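/- Theorem. Consider bounded-error quantum algorithms in the unit-cost word model: a classical random-access machine with words of $O(\log n)$ bits that controls a constant number of quantum words of $O(\log n)$ qubits; its unit-time steps are word operations (classical, or reversible on quantum words), Hadamard gates on any selected qubits of a quantum word, measurement of a quantum word, reading a cell of the classical memory (classically or in superposition), writing such a cell, and one query to the input (classically or in superposition). Let $G$ be an undirected bipartite graph with $n$ vertices, a given bipartition $(V_1,V_2)$ and $m\ge 1$ edges. The algorithm is given $n$ and may query the side of each vertex. In the *adjacency model* it may query the entries $A[v,w]$ of the adjacency matrix. In the *list model* it may query, for each vertex $v$, the length $d_v\le n$ and the entries of an array $N_v[1],\dots,N_v[d_v]$, each of which is a vertex or a hole, where the set of vertices occurring in $N_v$ is the set of neighbors of $v$ ($m$ is not given). 1. There are a quantum algorithm for the adjacency model and a constant $C$ such that on every such input the algorithm always halts within time $C\,n^2\log n$ and with probability at least $1-1/n$ outputs a matching of $G$ of maximum size. 2. There are a quantum algorithm for the list model and a constant $C$ such that on every such input the algorithm always halts within time $C\,n\sqrt{m+n}\,\log n$ and with probability at least $1-1/n$ outputs a matching of $G$ of maximum size. -/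

import Mathlib

open scoped Classical

/-!
Machine model: a word RAM that controls a constant number of quantum words, run at unit cost.
A word has `w` bits (later `w = O(log n)`).  The classical part has registers and a
random-access memory.  The quantum part is a pure state of `k` words of `w` qubits each.  The
input is a black box whose entries are read one at a time, classically or in superposition.
The classical memory may also be read (never written) in superposition.  Programs are built from
instructions by sequencing, branching and looping; every step costs one unit of time.
-/

/-- The word operations of the machine. -/
inductive WordOp where
  | add | sub | mul | div | mod | and | or | xor | shl | shr | eq | lt

/-- Words are read as unsigned integers; `add`, `sub` and `mul` are modulo `2 ^ w`; division by
zero gives `0`; `eq` and `lt` return `1` or `0`. -/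
def WordOp.eval {w : ℕ} : WordOp → BitVec w → BitVec w → BitVec w
  | .add, a, b => a + b
  | .sub, a, b => a - b
  | .mul, a, b => a * b
  | .div, a, b => a / b
  | .mod, a, b => a % b
  | .and, a, b => a &&& b
  | .or, a, b => a ||| b
  | .xor, a, b => a ^^^ b
  | .shl, a, b => a <<< b
  | .shr, a, b => a >>> b
  | .eq, a, b => if a = b then 1 else 0
  | .lt, a, b => if a.toNat < b.toNat then 1 else 0

/-- Instructions.  `ι` is the set of kinds of questions the black box answers, `k` is the number
of quantum words.  Natural numbers `t a b` name classical registers.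

Classical instructions:
`const t v` sets `t := v`;
`op o t a b` sets `t := o(a, b)`;
`load t a` sets `t := memory[a]`;
`store a b` sets `memory[a] := b`;
`query p t a b` sets `t` to the answer of the black box to the question `p(a, b)`.

Quantum instructions (the target differs from the arguments, so all but `measure` are unitary):
`qxor t a` maps `|t⟩` to `|t ⊕ a⟩` for the classical register `a`;
`qop o t a b` maps `|a, b, t⟩` to `|a, b, t ⊕ o(a, b)⟩`;
`qload t a` maps `|a, t⟩` to `|a, t ⊕ memory[a]⟩`;
`qquery p t a b` maps `|a, b, t⟩` to `|a, b, t ⊕ p(a, b)⟩`;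
`had q a` applies the Hadamard gate to those qubits of the word `q` at which the classical
register `a` has the bit `1`;
`measure t q` measures the word `q` in the computational basis and puts the outcome in the
classical register `t`. -/
inductive Instr (ι : Type) (k : ℕ) where
  | const (t : ℕ) (v : ℕ)
  | op (o : WordOp) (t a b : ℕ)
  | load (t a : ℕ)
  | store (a b : ℕ)
  | query (p : ι) (t a b : ℕ)
  | qxor (t : Fin k) (a : ℕ)
  | qop (o : WordOp) (t a b : Fin k) (ha : a ≠ t) (hb : b ≠ t)
  | qload (t a : Fin k) (ha : a ≠ t)
  | qquery (p : ι) (t a b : Fin k) (ha : a ≠ t) (hb : b ≠ t)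
  | had (q : Fin k) (a : ℕ)
  | measure (t : ℕ) (q : Fin k)

/-- Programs. `cond a P Q` runs `P` if register `a` is nonzero, else `Q`; `loop a P` repeats `P`
as long as register `a` is nonzero. -/
inductive Prog (ι : Type) (k : ℕ) where
  | instr (i : Instr ι k)
  | seq (P Q : Prog ι k)
  | cond (a : ℕ) (P Q : Prog ι k)
  | loop (a : ℕ) (P : Prog ι k)

/-- A (non-normalised) state of `k` quantum words of `w` qubits: the amplitudes of the
computational basis states. -/
abbrev QState (w k : ℕ) : Type := (Fin k → BitVec w) → ℂ

/-- The squared norm of a quantum state. -/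
noncomputable def QState.normSq {w k : ℕ} (ψ : QState w k) : ℝ := ∑ x, ‖ψ x‖ ^ 2

/-- The state `|0, …, 0⟩`. -/
noncomputable def QState.zero (w k : ℕ) : QState w k := fun x => if x = 0 then 1 else 0

/-- The unitary `|x⟩ ↦ |x with x_t replaced by x_t ⊕ g(x)⟩`, where `g` does not depend on the
word `t` (so that the map on basis states is an involution). -/
def QState.xorInto {w k : ℕ} (t : Fin k) (g : (Fin k → BitVec w) → BitVec w)
    (ψ : QState w k) : QState w k :=
  fun x => ψ (Function.update x t (x t ^^^ g x))

/-- The matrix entry at `(x, y)` of the tensor product over the `w` qubits of the Hadamard matrix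
at the positions where `mask` has a `1`, and of the identity matrix at the other positions. -/
noncomputable def hadEntry {w : ℕ} (mask x y : BitVec w) : ℂ :=
  ∏ i : Fin w,
    if mask.getLsbD i then
      (if x.getLsbD i && y.getLsbD i then -1 else 1) / (Real.sqrt 2 : ℂ)
    else if x.getLsbD i = y.getLsbD i then 1 else 0

/-- Hadamard gates on the qubits of the word `q` that are selected by `mask`. -/
noncomputable def QState.had {w k : ℕ} (q : Fin k) (mask : BitVec w) (ψ : QState w k) :
    QState w k :=
  fun x => ∑ y, hadEntry mask (x q) y * ψ (Function.update x q y)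

/-- The projection onto the basis states whose word `q` equals `y`. -/
noncomputable def QState.project {w k : ℕ} (q : Fin k) (y : BitVec w) (ψ : QState w k) :
    QState w k :=
  fun x => if x q = y then ψ x else 0

/-- The content of the classical registers and of the classical memory. -/
structure CState (w : ℕ) where
  reg : ℕ → BitVec w
  mem : BitVec w → BitVec w

/-- Assign a classical register. -/
def CState.set {w : ℕ} (s : CState w) (t : ℕ) (v : BitVec w) : CState w :=
  { s with reg := Function.update s.reg t v }

/-- A black box answers each question, which consists of a kind and two words, by a word. -/
abbrev BlackBox (ι : Type) (w : ℕ) : Type := ι → BitVec w → BitVec w → BitVec w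

/-- The effect of one instruction: the branches that may result, each with a quantum state whose
squared norm is weighted by the probability of the branch.  Only a measurement has several
branches. -/
noncomputable def Instr.exec {ι : Type} {w k : ℕ} (O : BlackBox ι w) :
    Instr ι k → CState w × QState w k → Multiset (CState w × QState w k)
  | .const t v, (s, ψ) => {(s.set t (BitVec.ofNat w v), ψ)}
  | .op o t a b, (s, ψ) => {(s.set t (o.eval (s.reg a) (s.reg b)), ψ)}
  | .load t a, (s, ψ) => {(s.set t (s.mem (s.reg a)), ψ)}
  | .store a b, (s, ψ) => {({ s with mem := Function.update s.mem (s.reg a) (s.reg b) }, ψ)}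
  | .query p t a b, (s, ψ) => {(s.set t (O p (s.reg a) (s.reg b)), ψ)}
  | .qxor t a, (s, ψ) => {(s, ψ.xorInto t fun _ => s.reg a)}
  | .qop o t a b _ _, (s, ψ) => {(s, ψ.xorInto t fun x => o.eval (x a) (x b))}
  | .qload t a _, (s, ψ) => {(s, ψ.xorInto t fun x => s.mem (x a))}
  | .qquery p t a b _ _, (s, ψ) => {(s, ψ.xorInto t fun x => O p (x a) (x b))}
  | .had q a, (s, ψ) => {(s, ψ.had q (s.reg a))}
  | .measure t q, (s, ψ) =>
      (Finset.univ : Finset (BitVec w)).val.map fun y => (s.set t y, ψ.project q y)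

/-- A configuration: the list of program pieces that are still to be run, the classical state and
the quantum state. -/
abbrev Conf (ι : Type) (w k : ℕ) : Type := List (Prog ι k) × CState w × QState w k

/-- One step of the machine, which takes one unit of time.  A configuration with nothing left to
run has halted and does not change. -/
noncomputable def Conf.step {ι : Type} {w k : ℕ} (O : BlackBox ι w) :
    Conf ι w k → Multiset (Conf ι w k)
  | ([], s) => {([], s)}
  | (.instr i :: K, s) => (i.exec O s).map fun s' => (K, s')
  | (.seq P Q :: K, s) => {(P :: Q :: K, s)}
  | (.cond a P Q :: K, s) => {((if s.1.reg a ≠ 0 then P else Q) :: K, s)}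
  | (.loop a P :: K, s) => {(if s.1.reg a ≠ 0 then P :: .loop a P :: K else K, s)}

/-- The probability that the run from a configuration, after `T` units of time, has halted in a
classical state that satisfies `S`.  (Quantum states are kept non-normalised: the squared norm of
the state at the end of a branch is the probability of this branch.) -/
noncomputable def Conf.haltProb {ι : Type} {w k : ℕ} (O : BlackBox ι w) (S : CState w → Prop) :
    ℕ → Conf ι w k → ℝ
  | 0, (K, s, ψ) => if K = [] ∧ S s then ψ.normSq else 0
  | T + 1, c => ((c.step O).map (Conf.haltProb O S T)).sum

/-- The initial configuration: register `0` holds `n`; all other registers, all memory cells and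
all quantum words hold `0`. -/
noncomputable def Conf.init {ι : Type} {k : ℕ} (w : ℕ) (P : Prog ι k) (n : ℕ) : Conf ι w k :=
  ([P], ⟨Function.update 0 0 (BitVec.ofNat w n), 0⟩, QState.zero w k)

/-- With black box `O` and input size `n`, the program `P` always halts within time `T`, and with
probability at least `p` it does so in a classical state that satisfies `S`. -/
def SolvesInTime {ι : Type} {w k : ℕ} (P : Prog ι k) (O : BlackBox ι w) (n T : ℕ) (p : ℝ)
    (S : CState w → Prop) : Prop :=
  Conf.haltProb O (fun _ => True) T (Conf.init w P n) = 1 ∧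
    p ≤ Conf.haltProb O S T (Conf.init w P n)

/-- A maximum matching: a matching with the largest possible number of edges. -/
def IsMaximumMatching {V : Type*} (G : SimpleGraph V) (M : G.Subgraph) : Prop :=
  M.IsMatching ∧ ∀ M' : G.Subgraph, M'.IsMatching → M'.edgeSet.ncard ≤ M.edgeSet.ncard

/-- The memory holds a maximum matching of `G`: cell `v` holds `0` if the vertex `v` is free, and
`u + 1` if `v` is matched with `u`. -/
def HoldsMaximumMatching {n w : ℕ} (G : SimpleGraph (Fin n)) (s : CState w) : Prop :=
  ∃ M : G.Subgraph, IsMaximumMatching G M ∧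
    (∀ v : Fin n, v ∉ M.verts → (s.mem (BitVec.ofNat w v)).toNat = 0) ∧
    ∀ v u : Fin n, M.Adj v u → (s.mem (BitVec.ofNat w v)).toNat = u + 1

/-- Extend a function on the vertices to all words by `0`. -/
def onVertex {n w : ℕ} (f : Fin n → BitVec w) (v : BitVec w) : BitVec w :=
  if h : v.toNat < n then f ⟨v.toNat, h⟩ else 0

/-- Questions in the adjacency model: on which side is the vertex `v`? (second word ignored); is
`(v, u)` an edge? -/
inductive AdjQuestion where
  | side | edge

/-- The adjacency matrix of a bipartite graph as a black box. -/
noncomputable def adjBlackBox {n : ℕ} (w : ℕ) (G : SimpleGraph (Fin n)) (side : G.Coloring Bool) :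
    BlackBox AdjQuestion w
  | .side, v, _ => onVertex (fun v' => if side v' then 1 else 0) v
  | .edge, v, u => onVertex (fun v' => onVertex (fun u' => if G.Adj v' u' then 1 else 0) u) v

/-- A list representation of `G`: for each vertex `v` an array of length at most `n`, each entry
of which is a vertex or a hole (`none`), such that the vertices that occur are the neighbors of
`v`. -/
structure NeighborLists {n : ℕ} (G : SimpleGraph (Fin n)) where
  len : Fin n → ℕ
  len_le : ∀ v, len v ≤ n
  entry : (v : Fin n) → Fin (len v) → Option (Fin n)
  entry_spec : ∀ v u, (∃ i, entry v i = some u) ↔ G.Adj v u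

/-- Questions in the list model: on which side is `v`? how long is the array of `v`? (second word
ignored); what is entry `i` of the array of `v`? -/
inductive ListQuestion where
  | side | length | entry

/-- The neighbor lists of a bipartite graph as a black box.  An entry is answered by `0` if it is a
hole and by `u + 1` if it is the vertex `u`. -/
noncomputable def listBlackBox {n : ℕ} (w : ℕ) (G : SimpleGraph (Fin n)) (side : G.Coloring Bool)
    (N : NeighborLists G) : BlackBox ListQuestion w
  | .side, v, _ => onVertex (fun v' => if side v' then 1 else 0) v
  | .length, v, _ => onVertex (fun v' => BitVec.ofNat w (N.len v')) v
  | .entry, v, i => onVertex (fun v' =>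
      if h : i.toNat < N.len v' then
        match N.entry v' ⟨i.toNat, h⟩ with
        | none => 0
        | some u => BitVec.ofNat w (u + 1)
      else 0) v

/-!
# Maximum bipartite matchings on a quantum word machine

**The algorithm.** Let `4 ^ s` be the least power of four above `n`, so that `L = 2 ^ s` is about
the square root of `n`.

* Read the graph into the classical memory (`learn`): each list of neighbors is searched for new
  neighbors, block by block, and each neighbor found is stored.  The length `4 ^ d` of the blocks
  starts at `4 ^ s` and shrinks as more edges are found, so that there are `O(m + n)` blocks and
  reading costs `O(n * sqrt (m + n))` steps of quantum search.
* Find a matching that lacks at most `L` edges by an auction with prices up to `L` (`auction`):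
  each free vertex on one side bids for a cheapest neighbor, and may throw out the partner of
  this neighbor.
* Remove the deficiency by at most `L` rounds of breadth-first search for an augmenting path
  (`bfsRounds`).

In the last two phases there are `O(n * L)` searches of blocks of the stored lists, of length
`4 ^ d` where `4 ^ d * n` is of the order of `m + n`; each costs `O(2 ^ d * log n)`.  As `L` is of
the order of `sqrt n`, the total is `O(n * sqrt (m + n) * log n)`.  In the adjacency model `i + 1`
times the entry `A[v, i]` of the adjacency matrix is entry `i` of a neighbor list of length `n`;
the bound then gives `O(n ^ 2 * log n)`.

**Optimality.** Both phases rest on weak duality for bipartite matchings (`mul_ncard_edgeSet_le`):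
if `π v + p u ≥ K` on edges, `π v + p u ≤ D` on matched pairs and free vertices have `π = 0` and
`p = 0`, then `K` times the size of any matching is at most `D` times the size of the present one.
After the auction this holds with `K = L` and `D = L + 1` for the prices `p`; after a
breadth-first search without success, with `K = D = 1` for the indicator functions of a vertex
cover.

**Quantum search.** `search` is Grover's algorithm with an unknown number of solutions: it tries
about `3 ^ i / 2` iterations for all `i` with `3 ^ i` up to the order of `2 ^ d`, each of them `R`
times, and verifies every measured candidate.  For one of the values of `i` a solution is seen
with probability at least `1 / 4`, so that a solution is missed with probability at most
`(3 / 4) ^ R`.  The time bound holds for all outcomes of the measurements, also if a search misses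
a solution.

**Verification.** Programs are written in a small structured language (`Exp`, `Blk`, `Prog.while`,
`Prog.ite`) on natural numbers that is compiled to the machine.  They are verified with triples
(`Triple`) that carry time credits: a loop terminates because every iteration uses up credits, and
the error probability is charged at the fixed rate `δ` per unit of time.  The same triples serve
twice.  With `δ = 0` and `β = False` nothing is claimed about searches that fail, and halting
within the time bound is certain; with `δ = (3 / 4) ^ R` and `β = True` a search that fails shows,
up to the error that is charged, that there is nothing to be found, which yields a maximum
matching with high probability.
-/

/-! ### Hadamard gates -/

lemma BitVec.card_eq (w : ℕ) : Fintype.card (BitVec w) = 2 ^ w := by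
  rw [← FinEnum.card_eq_fintypeCard]; rfl

/-- A word as the function that gives its bits. -/
noncomputable def bitsEquiv (w : ℕ) : BitVec w ≃ (Fin w → Bool) :=
  Equiv.ofBijective (fun x i => x.getLsbD i) <| by
    rw [Fintype.bijective_iff_injective_and_card]
    refine ⟨fun x y h => BitVec.eq_of_getLsbD_eq fun i hi => congrFun h ⟨i, hi⟩, ?_⟩
    simp [BitVec.card_eq]

lemma bitsEquiv_apply {w : ℕ} (x : BitVec w) (i : Fin w) : bitsEquiv w x i = x.getLsbD i := rfl

lemma sum_bits {w : ℕ} (F : Fin w → Bool → ℂ) :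
    ∑ y : BitVec w, ∏ i : Fin w, F i (y.getLsbD i) = ∏ i : Fin w, (F i false + F i true) := by
  have h := Equiv.sum_comp (bitsEquiv w) (fun g : Fin w → Bool => ∏ i, F i (g i))
  simp only [bitsEquiv_apply] at h
  rw [h]
  have h2 := Finset.prod_univ_sum (fun _ : Fin w => (Finset.univ : Finset Bool)) F
  rw [Fintype.piFinset_univ] at h2
  rw [← h2]
  exact Finset.prod_congr rfl fun i _ => by simp [add_comm]

lemma inv_sqrt_two_mul_self : (1 / (Real.sqrt 2 : ℂ)) * (1 / (Real.sqrt 2 : ℂ)) = 1 / 2 := by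
  rw [div_mul_div_comm, ← Complex.ofReal_mul, Real.mul_self_sqrt (by norm_num)]
  norm_num

/-- The matrix entry of the Hadamard gate (`m = true`) or of the identity (`m = false`) on one
qubit. -/
noncomputable def hadFactor (m a b : Bool) : ℂ :=
  if m then (if a && b then -1 else 1) / (Real.sqrt 2 : ℂ) else if a = b then 1 else 0

lemma hadEntry_eq {w : ℕ} (mask x y : BitVec w) : hadEntry mask x y =
    ∏ i : Fin w, hadFactor (mask.getLsbD i) (x.getLsbD i) (y.getLsbD i) := by
  refine Finset.prod_congr rfl fun i _ => ?_
  unfold hadFactor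
  congr

lemma hadFactor_mul (m c a b : Bool) (h : c = true → m = true) :
    hadFactor m a false * hadFactor m (false ^^ c) b +
      hadFactor m a true * hadFactor m (true ^^ c) b =
      if a = b then (if c && a then -1 else 1) else 0 := by
  have hs := inv_sqrt_two_mul_self
  rcases m <;> rcases c <;> rcases a <;> rcases b <;> simp_all [hadFactor, div_eq_mul_inv] <;>
    norm_num

/-- Conjugating the bit flips `c` by Hadamard gates gives phase flips: with `c = 0` this says that
Hadamard gates are involutive, and with `c = 1` that a Z gate is the conjugate of an X gate. -/
lemma sum_hadEntry_mul {w : ℕ} (mask c x z : BitVec w) (hc : c &&& mask = c) :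
    ∑ y, hadEntry mask x y * hadEntry mask (y ^^^ c) z =
      if x = z then ∏ i : Fin w, (if c.getLsbD i && x.getLsbD i then (-1 : ℂ) else 1) else 0 := by
  have hc' : ∀ i : Fin w, c.getLsbD i = true → mask.getLsbD i = true := by
    intro i hi
    have := congrArg (fun b : BitVec w => b.getLsbD i) hc
    simp only [BitVec.getLsbD_and, hi, Bool.true_and] at this
    exact this
  simp_rw [hadEntry_eq, ← Finset.prod_mul_distrib, BitVec.getLsbD_xor]
  rw [sum_bits fun i b => hadFactor (mask.getLsbD i) (x.getLsbD i) b *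
    hadFactor (mask.getLsbD i) (b ^^ c.getLsbD i) (z.getLsbD i)]
  have key := fun i : Fin w => hadFactor_mul _ _ (x.getLsbD i) (z.getLsbD i) (hc' i)
  rw [Finset.prod_congr rfl fun i _ => key i]
  split_ifs with h
  · subst h; simp
  · have : ∃ i : Fin w, x.getLsbD i ≠ z.getLsbD i := by
      by_contra hcon
      push Not at hcon
      exact h (BitVec.eq_of_getLsbD_eq fun i hi => hcon ⟨i, hi⟩)
    obtain ⟨i, hi⟩ := this
    exact Finset.prod_eq_zero (Finset.mem_univ i) (if_neg hi)

lemma hadEntry_comm {w : ℕ} (mask x y : BitVec w) : hadEntry mask x y = hadEntry mask y x := by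
  refine Finset.prod_congr rfl fun i _ => ?_
  simp only [Bool.and_comm, eq_comm]

lemma hadEntry_conj {w : ℕ} (mask x y : BitVec w) :
    (starRingEnd ℂ) (hadEntry mask x y) = hadEntry mask x y := by
  unfold hadEntry
  rw [map_prod]
  refine Finset.prod_congr rfl fun i _ => ?_
  split_ifs <;> simp

lemma sum_hadEntry_mul_self {w : ℕ} (mask x z : BitVec w) :
    ∑ y, hadEntry mask x y * hadEntry mask y z = if x = z then 1 else 0 := by
  have := sum_hadEntry_mul mask 0 x z (by simp)
  simpa using this

/-- Hadamard gates on the low `d` qubits map `|0⟩` to the uniform superposition of the words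
below `2 ^ d`. -/
lemma hadEntry_zero {w d : ℕ} (hd : d ≤ w) (mask x : BitVec w) (hm : mask.toNat = 2 ^ d - 1) :
    hadEntry mask x 0 = if x.toNat < 2 ^ d then (1 / (Real.sqrt 2 : ℂ)) ^ d else 0 := by
  have hmi : ∀ i : Fin w, mask.getLsbD i = decide (i.val < d) := by
    intro i
    rw [← BitVec.testBit_toNat, hm, Nat.testBit_two_pow_sub_one]
  have e : hadEntry mask x 0 = ∏ i : Fin w, if i.val < d then (1 / (Real.sqrt 2 : ℂ)) else
      if x.getLsbD i = false then 1 else 0 := by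
    rw [hadEntry_eq]
    refine Finset.prod_congr rfl fun i _ => ?_
    rw [hmi]; simp [hadFactor]
  rw [e]
  split_ifs with h
  · have : ∀ i : Fin w, (if i.val < d then (1 / (Real.sqrt 2 : ℂ)) else
      if x.getLsbD i = false then 1 else 0) = if i.val < d then (1 / (Real.sqrt 2 : ℂ)) else 1 := by
      intro i
      split_ifs with h1 h2 <;> try rfl
      exfalso; apply h2
      rw [← BitVec.testBit_toNat]
      exact Nat.testBit_lt_two_pow (lt_of_lt_of_le h (Nat.pow_le_pow_right (by norm_num)
        (by omega)))
    rw [Finset.prod_congr rfl fun i _ => this i, Finset.prod_ite, Finset.prod_const,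
      Finset.prod_const_one, mul_one]
    congr 1
    rw [Fin.card_filter_val_lt]; exact min_eq_right hd
  · obtain ⟨i, hi, hb⟩ := Nat.exists_ge_and_testBit_of_ge_two_pow (not_lt.mp h)
    have hiw : i < w := by
      by_contra hcon
      rw [BitVec.testBit_toNat, BitVec.getLsbD_of_ge _ _ (not_lt.mp hcon)] at hb
      exact absurd hb (by simp)
    refine Finset.prod_eq_zero (Finset.mem_univ ⟨i, hiw⟩) ?_
    rw [BitVec.testBit_toNat] at hb
    simp [hb, not_lt.mpr hi]

/-- A real symmetric involution preserves the squared norm. -/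
lemma sum_norm_sq_of_involutive {α : Type*} [Fintype α] (H : α → α → ℂ)
    (hconj : ∀ x y, (starRingEnd ℂ) (H x y) = H x y) (hsymm : ∀ x y, H x y = H y x)
    (hinv : ∀ x z, ∑ y, H x y * H y z = if x = z then 1 else 0) (φ : α → ℂ) :
    ∑ x, ‖∑ y, H x y * φ y‖ ^ 2 = ∑ y, ‖φ y‖ ^ 2 := by
  have e : ∀ z : ℂ, ((‖z‖ ^ 2 : ℝ) : ℂ) = (starRingEnd ℂ) z * z := by
    intro z; rw [Complex.conj_mul']; norm_num
  apply Complex.ofReal_injective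
  rw [Complex.ofReal_sum, Complex.ofReal_sum]
  simp_rw [e, map_sum, map_mul, hconj, Finset.sum_mul_sum]
  have : ∀ x y z : α, H x y * (starRingEnd ℂ) (φ y) * (H x z * φ z) =
      (H y x * H x z) * ((starRingEnd ℂ) (φ y) * φ z) := by
    intro x y z; rw [hsymm x y]; ring
  simp_rw [this]
  rw [Finset.sum_comm]
  refine Finset.sum_congr rfl fun y _ => ?_
  rw [Finset.sum_comm]
  simp_rw [← Finset.sum_mul, hinv]
  simp

namespace QState
variable {w k : ℕ}

lemma normSq_nonneg (ψ : QState w k) : 0 ≤ ψ.normSq := Finset.sum_nonneg fun _ _ => by positivity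

lemma normSq_smul (c : ℂ) (ψ : QState w k) : (c • ψ).normSq = ‖c‖ ^ 2 * ψ.normSq := by
  simp [normSq, mul_pow, Finset.mul_sum]

lemma normSq_zero : (QState.zero w k).normSq = 1 := by
  unfold normSq zero
  rw [Finset.sum_eq_single 0] <;> simp +contextual

/-- The map on basis states behind `xorInto`. -/
def xorMap (t : Fin k) (g : (Fin k → BitVec w) → BitVec w) (x : Fin k → BitVec w) :
    Fin k → BitVec w := Function.update x t (x t ^^^ g x)

lemma xorMap_involutive (t : Fin k) (g : (Fin k → BitVec w) → BitVec w)
    (hg : ∀ x v, g (Function.update x t v) = g x) : Function.Involutive (xorMap t g) := by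
  intro x
  simp [xorMap, hg]

lemma normSq_xorInto (t : Fin k) (g : (Fin k → BitVec w) → BitVec w)
    (hg : ∀ x v, g (Function.update x t v) = g x) (ψ : QState w k) :
    (ψ.xorInto t g).normSq = ψ.normSq :=
  Equiv.sum_comp (xorMap_involutive t g hg).toPerm fun x => ‖ψ x‖ ^ 2

lemma normSq_had (q : Fin k) (mask : BitVec w) (ψ : QState w k) :
    (ψ.had q mask).normSq = ψ.normSq := by
  unfold normSq had
  have e := fun f : (Fin k → BitVec w) → ℝ => (Equiv.sum_comp (Equiv.funSplitAt q
    (BitVec w)).symm f)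
  rw [← e, ← e, Fintype.sum_prod_type, Fintype.sum_prod_type, Finset.sum_comm]
  conv_rhs => rw [Finset.sum_comm]
  refine Finset.sum_congr rfl fun r _ => ?_
  have h1 : ∀ a : BitVec w, (Equiv.funSplitAt q (BitVec w)).symm (a, r) q = a := by
    intro a; simp
  have h2 : ∀ a b : BitVec w, Function.update ((Equiv.funSplitAt q (BitVec w)).symm (a, r)) q b =
      (Equiv.funSplitAt q (BitVec w)).symm (b, r) := by
    intro a b; funext j
    by_cases hj : j = q
    · subst hj; simp
    · simp [hj]
  simp_rw [h1, h2]
  exact sum_norm_sq_of_involutive (hadEntry mask) (hadEntry_conj mask) (hadEntry_comm mask)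
    (fun x z => by rw [sum_hadEntry_mul_self]; congr) _

lemma sum_normSq_project (q : Fin k) (ψ : QState w k) : ∑ y, (ψ.project q y).normSq = ψ.normSq := by
  unfold normSq project
  rw [Finset.sum_comm]
  refine Finset.sum_congr rfl fun x _ => ?_
  rw [Finset.sum_eq_single (x q)] <;> simp +contextual [eq_comm]

end QState

/-! ### Halting probabilities -/

section haltProb
variable {ι : Type} {w k : ℕ} (O : BlackBox ι w)

lemma Instr.sum_normSq_exec (i : Instr ι k) (s : CState w) (ψ : QState w k) :
    ((i.exec O (s, ψ)).map fun b => b.2.normSq).sum = ψ.normSq := by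
  cases i with
  | measure t q =>
    simp only [Instr.exec, Multiset.map_map, Function.comp_def]
    exact QState.sum_normSq_project q ψ
  | had q a => simp [Instr.exec, QState.normSq_had]
  | qxor t a => simp [Instr.exec]; exact QState.normSq_xorInto _ _ (by simp) _
  | qop o t a b ha hb => simp [Instr.exec]; exact QState.normSq_xorInto _ _ (by simp [ha, hb]) _
  | qload t a ha => simp [Instr.exec]; exact QState.normSq_xorInto _ _ (by simp [ha]) _
  | qquery p t a b ha hb =>
    simp [Instr.exec]; exact QState.normSq_xorInto _ _ (by simp [ha, hb]) _
  | _ => simp [Instr.exec]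

lemma Instr.exec_smul (i : Instr ι k) (s : CState w) (c : ℂ) (ψ : QState w k) :
    i.exec O (s, c • ψ) = (i.exec O (s, ψ)).map fun b => (b.1, c • b.2) := by
  cases i with
  | measure t q =>
    simp only [Instr.exec, Multiset.map_map, Function.comp_def]
    refine Multiset.map_congr rfl fun y _ => ?_
    congr 1; funext x; simp [QState.project]
  | had q a =>
    simp only [Instr.exec, Multiset.map_singleton]
    congr 2; funext x; simp only [QState.had, Pi.smul_apply, smul_eq_mul, Finset.mul_sum]
    exact Finset.sum_congr rfl fun y _ => by ring
  | _ => simp only [Instr.exec, Multiset.map_singleton] <;> rfl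

namespace Conf

lemma haltProb_zero (S : CState w → Prop) (K : List (Prog ι k)) (s : CState w) (ψ : QState w k) :
    haltProb O S 0 (K, s, ψ) = if K = [] ∧ S s then ψ.normSq else 0 := by
  rw [haltProb]

lemma haltProb_succ (S : CState w → Prop) (T : ℕ) (c : Conf ι w k) :
    haltProb O S (T + 1) c = ((c.step O).map (haltProb O S T)).sum := by
  rw [haltProb]

lemma haltProb_nonneg (S : CState w → Prop) (T : ℕ) (c : Conf ι w k) : 0 ≤ haltProb O S T c := by
  induction T generalizing c with
  | zero =>
    obtain ⟨K, s, ψ⟩ := c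
    rw [haltProb_zero]; split_ifs
    exacts [ψ.normSq_nonneg, le_rfl]
  | succ T ih =>
    rw [haltProb_succ]
    refine Multiset.sum_nonneg fun x hx => ?_
    obtain ⟨c', -, rfl⟩ := Multiset.mem_map.mp hx
    exact ih c'

lemma haltProb_nil (S : CState w → Prop) (T : ℕ) (s : CState w) (ψ : QState w k) :
    haltProb O S T ([], s, ψ) = if S s then ψ.normSq else 0 := by
  induction T with
  | zero => simp [haltProb_zero]
  | succ T ih => simp [haltProb_succ, step, ih]

lemma haltProb_le_succ (S : CState w → Prop) (T : ℕ) (c : Conf ι w k) :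
    haltProb O S T c ≤ haltProb O S (T + 1) c := by
  induction T generalizing c with
  | zero =>
    obtain ⟨K, s, ψ⟩ := c
    rcases K with _ | ⟨P, K⟩
    · simp [haltProb_nil]
    · rw [haltProb_zero]; simpa using haltProb_nonneg O S _ _
  | succ T ih =>
    rw [haltProb_succ, haltProb_succ O S (T + 1)]
    exact Multiset.sum_map_le_sum_map _ _ fun c' _ => ih c'

lemma haltProb_mono (S : CState w → Prop) (c : Conf ι w k) : Monotone fun T => haltProb O S T c :=
  monotone_nat_of_le_succ fun T => haltProb_le_succ O S T c

lemma haltProb_le_normSq (S : CState w → Prop) (T : ℕ) (K : List (Prog ι k)) (s : CState w)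
    (ψ : QState w k) : haltProb O S T (K, s, ψ) ≤ ψ.normSq := by
  induction T generalizing K s ψ with
  | zero =>
    rw [haltProb_zero]; split_ifs
    exacts [le_rfl, ψ.normSq_nonneg]
  | succ T ih =>
    rw [haltProb_succ]
    rcases K with _ | ⟨_ | _ | _ | _, K⟩
    · simpa [step] using ih _ _ _
    · simp only [step, Multiset.map_map]
      rw [← Instr.sum_normSq_exec O _ s ψ]
      exact Multiset.sum_map_le_sum_map _ _ fun c' _ => ih _ _ _
    all_goals simpa [step] using ih _ _ _

lemma haltProb_smul (S : CState w → Prop) (T : ℕ) (K : List (Prog ι k)) (s : CState w) (c : ℂ)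
    (ψ : QState w k) : haltProb O S T (K, s, c • ψ) = ‖c‖ ^ 2 * haltProb O S T (K, s, ψ) := by
  induction T generalizing K s ψ with
  | zero =>
    rw [haltProb_zero, haltProb_zero, QState.normSq_smul]; split_ifs <;> simp
  | succ T ih =>
    rw [haltProb_succ, haltProb_succ]
    rcases K with _ | ⟨_ | _ | _ | _, K⟩
    · simpa [step] using ih _ _ _
    · simp only [step, Multiset.map_map, Instr.exec_smul, Function.comp_def]
      simp_rw [ih]
      rw [Multiset.sum_map_mul_left]
    all_goals simpa [step] using ih _ _ _

end Conf

/-- From `(s, ψ)` the program `P` reaches `(s', ψ')` within time `t`, without branching. -/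
def Runs (P : Prog ι k) (t : ℕ) (s : CState w) (ψ : QState w k) (s' : CState w)
    (ψ' : QState w k) : Prop :=
  ∀ K S T, Conf.haltProb O S T (K, s', ψ') ≤ Conf.haltProb O S (T + t) (P :: K, s, ψ)

namespace Runs
variable {O} {P Q : Prog ι k} {t t₁ t₂ : ℕ} {s s' s'' : CState w} {ψ ψ' ψ'' : QState w k}

lemma mono (h : Runs O P t₁ s ψ s' ψ') (ht : t₁ ≤ t₂) : Runs O P t₂ s ψ s' ψ' := fun K S T =>
  (h K S T).trans (Conf.haltProb_mono O S _ (by omega))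

lemma instr (i : Instr ι k) (h : i.exec O (s, ψ) = {(s', ψ')}) :
    Runs O (.instr i) 1 s ψ s' ψ' := fun K S T => by
  rw [Conf.haltProb_succ]; simp [Conf.step, h]

lemma seq (h₁ : Runs O P t₁ s ψ s' ψ') (h₂ : Runs O Q t₂ s' ψ' s'' ψ'') :
    Runs O (.seq P Q) (t₁ + t₂ + 1) s ψ s'' ψ'' := fun K S T => by
  rw [← add_assoc, Conf.haltProb_succ]; simp only [Conf.step, Multiset.map_singleton,
    Multiset.sum_singleton]
  refine (h₂ K S T).trans ((h₁ _ S _).trans (le_of_eq ?_))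
  congr 1; omega

lemma cond_pos {a : ℕ} (ha : s.reg a ≠ 0) (h : Runs O P t s ψ s' ψ') :
    Runs O (.cond a P Q) (t + 1) s ψ s' ψ' := fun K S T => by
  rw [← add_assoc, Conf.haltProb_succ, Conf.step, if_pos ha, Multiset.map_singleton,
    Multiset.sum_singleton]
  exact h K S T

lemma cond_neg {a : ℕ} (ha : s.reg a = 0) (h : Runs O Q t s ψ s' ψ') :
    Runs O (.cond a P Q) (t + 1) s ψ s' ψ' := fun K S T => by
  rw [← add_assoc, Conf.haltProb_succ, Conf.step, if_neg (not_not.mpr ha), Multiset.map_singleton,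
    Multiset.sum_singleton]
  exact h K S T

lemma loop_done {a : ℕ} (ha : s.reg a = 0) : Runs O (.loop a P) 1 s ψ s ψ := fun K S T => by
  rw [Conf.haltProb_succ]; simp [Conf.step, ha]

lemma loop_more {a : ℕ} (ha : s.reg a ≠ 0) (h₁ : Runs O P t₁ s ψ s' ψ')
    (h₂ : Runs O (.loop a P) t₂ s' ψ' s'' ψ'') :
    Runs O (.loop a P) (t₁ + t₂ + 1) s ψ s'' ψ'' := fun K S T => by
  rw [← add_assoc, Conf.haltProb_succ]; simp only [Conf.step, ha, Multiset.map_singleton,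
    Multiset.sum_singleton, ne_eq, not_false_eq_true, if_true]
  refine (h₂ K S T).trans ((h₁ _ S _).trans (le_of_eq ?_))
  congr 1; omega

end Runs

end haltProb

/-! ### A structured language on top of the machine -/

/-- The content of registers and memory as natural numbers. -/
@[ext] structure St where
  v : ℕ → ℕ
  m : ℕ → ℕ

namespace St

/-- Assign a register. -/
def set (a : St) (x n : ℕ) : St := ⟨Function.update a.v x n, a.m⟩

/-- Write a memory cell. -/
def put (a : St) (i n : ℕ) : St := ⟨a.v, Function.update a.m i n⟩

@[simp] lemma set_v (a : St) (x n y : ℕ) : (a.set x n).v y = if y = x then n else a.v y := by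
  simp [set, Function.update_apply]
@[simp] lemma set_m (a : St) (x n : ℕ) : (a.set x n).m = a.m := rfl
@[simp] lemma put_v (a : St) (i n : ℕ) : (a.put i n).v = a.v := rfl
lemma put_m (a : St) (i n j : ℕ) : (a.put i n).m j = if j = i then n else a.m j := by
  simp [put, Function.update_apply]

/-- `a` describes the memory and the first `64` registers of the machine state `s`; the other
registers are scratch space for the evaluation of expressions. -/
def Rel {w : ℕ} (a : St) (s : CState w) : Prop :=
  (∀ x < 64, (s.reg x).toNat = a.v x) ∧ ∀ b, (s.mem b).toNat = a.m b.toNat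

end St

open St (Rel)

/-- The word operations on natural numbers, correct where no overflow occurs. -/
def WordOp.evalNat : WordOp → ℕ → ℕ → ℕ
  | .add, a, b => a + b
  | .sub, a, b => a - b
  | .mul, a, b => a * b
  | .div, a, b => a / b
  | .mod, a, b => a % b
  | .eq, a, b => if a = b then 1 else 0
  | .lt, a, b => if a < b then 1 else 0
  | _, _, _ => 0

/-- The operation does not overflow with words below `M`.  (Bit operations are not used.) -/
def WordOp.okNat (M : ℕ) : WordOp → ℕ → ℕ → Prop
  | .add, a, b => a + b < M
  | .sub, a, b => b ≤ a
  | .mul, a, b => a * b < M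
  | .div, _, _ | .mod, _, _ | .eq, _, _ | .lt, _, _ => True
  | _, _, _ => False

lemma BitVec.toNat_one_of_pos {w : ℕ} (hw : 0 < w) : (1 : BitVec w).toNat = 1 := by
  change (BitVec.ofNat w 1).toNat = 1
  rw [BitVec.toNat_ofNat]
  exact Nat.mod_eq_of_lt (Nat.one_lt_two_pow hw.ne')

lemma WordOp.toNat_eval {w : ℕ} (hw : 0 < w) (o : WordOp) (x y : BitVec w)
    (h : o.okNat (2 ^ w) x.toNat y.toNat) : (o.eval x y).toNat = o.evalNat x.toNat y.toNat := by
  cases o with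
  | add => simp only [eval, evalNat, BitVec.toNat_add]; exact Nat.mod_eq_of_lt h
  | sub =>
    simp only [okNat] at h
    simp only [eval, evalNat]
    exact BitVec.toNat_sub_of_le (BitVec.le_def.mpr h)
  | mul => simp only [eval, evalNat, BitVec.toNat_mul]; exact Nat.mod_eq_of_lt h
  | div => simp [eval, evalNat]
  | mod => simp [eval, evalNat]
  | eq =>
    simp only [eval, evalNat, BitVec.toNat_inj]
    split_ifs
    exacts [BitVec.toNat_one_of_pos hw, rfl]
  | lt =>
    simp only [eval, evalNat]
    split_ifs
    exacts [BitVec.toNat_one_of_pos hw, rfl]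
  | _ => exact h.elim

/-- Expressions over registers and memory. -/
inductive Exp where
  | v (x : ℕ)
  | c (n : ℕ)
  | op (o : WordOp) (e f : Exp)
  | ld (e : Exp)

namespace Exp

/-- The value of an expression. -/
def eval : Exp → St → ℕ
  | v x, a => a.v x
  | c n, _ => n
  | op o e f, a => o.evalNat (e.eval a) (f.eval a)
  | ld e, a => a.m (e.eval a)

/-- The evaluation of the expression does not overflow. -/
def ok (M : ℕ) : Exp → St → Prop
  | v x, _ => x < 64
  | c n, _ => n < M
  | op o e f, a => e.ok M a ∧ f.ok M a ∧ o.okNat M (e.eval a) (f.eval a)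
  | ld e, a => e.ok M a

/-- The code that evaluates an expression into register `t`, using higher registers as scratch
space. -/
def code {ι : Type} {k : ℕ} : Exp → ℕ → Prog ι k
  | v x, t => .instr (.op .or t x x)
  | c n, t => .instr (.const t n)
  | op o e f, t => .seq (e.code t) (.seq (f.code (t + 1)) (.instr (.op o t t (t + 1))))
  | ld e, t => .seq (e.code t) (.instr (.load t t))

/-- The running time of the code of an expression. -/
def cost : Exp → ℕ
  | v _ => 1
  | c _ => 1
  | op _ e f => e.cost + f.cost + 3
  | ld e => e.cost + 2

end Exp

section
variable {ι : Type} {w k : ℕ} (O : BlackBox ι w)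

lemma CState.set_reg {w : ℕ} (s : CState w) (t : ℕ) (x : BitVec w) (y : ℕ) :
    (s.set t x).reg y = if y = t then x else s.reg y := by
  simp [CState.set, Function.update_apply]

lemma St.Rel.set_scratch {w : ℕ} {a : St} {s : CState w} (h : Rel a s) {t : ℕ} (ht : 64 ≤ t)
    (x : BitVec w) : Rel a (s.set t x) :=
  ⟨fun y hy => by rw [CState.set_reg, if_neg (by omega)]; exact h.1 y hy, h.2⟩

lemma St.Rel.set {w : ℕ} {a : St} {s : CState w} (h : Rel a s) (t : ℕ)
    (x : BitVec w) : Rel (a.set t x.toNat) (s.set t x) :=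
  ⟨fun y hy => by
    rw [CState.set_reg, St.set_v]; split_ifs; exacts [rfl, h.1 y hy], h.2⟩

lemma Exp.runs_code (hw : 0 < w) (e : Exp) {a : St} {s : CState w} (h : Rel a s) {t : ℕ}
    (ht : 64 ≤ t) (he : e.ok (2 ^ w) a) : ∃ s', Rel a s' ∧ (s'.reg t).toNat = e.eval a ∧
      (∀ x < t, s'.reg x = s.reg x) ∧ ∀ ψ : QState w k, Runs O (e.code t) e.cost s ψ s' ψ := by
  induction e generalizing s t with
  | v x =>
    refine ⟨s.set t (s.reg x), h.set_scratch ht _, ?_, fun y hy => ?_, fun ψ => Runs.instr _ ?_⟩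
    · rw [CState.set_reg, if_pos rfl]; exact h.1 x he
    · rw [CState.set_reg, if_neg (by omega)]
    · simp [Instr.exec, WordOp.eval]
  | c n =>
    refine ⟨s.set t (BitVec.ofNat w n), h.set_scratch ht _, ?_, fun y hy => ?_,
      fun ψ => Runs.instr _ ?_⟩
    · rw [CState.set_reg, if_pos rfl, BitVec.toNat_ofNat]; exact Nat.mod_eq_of_lt he
    · rw [CState.set_reg, if_neg (by omega)]
    · simp [Instr.exec]
  | op o e f ihe ihf =>
    obtain ⟨he, hf, ho⟩ := he
    obtain ⟨s₁, h₁, hv₁, hr₁, hR₁⟩ := ihe h ht he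
    obtain ⟨s₂, h₂, hv₂, hr₂, hR₂⟩ := ihf h₁ (t := t + 1) (by omega) hf
    rw [← hr₂ t (by omega)] at hv₁
    refine ⟨s₂.set t (o.eval (s₂.reg t) (s₂.reg (t + 1))), h₂.set_scratch ht _, ?_,
      fun y hy => ?_, fun ψ => ((hR₁ ψ).seq ((hR₂ ψ).seq
        (Runs.instr (s' := s₂.set t (o.eval (s₂.reg t) (s₂.reg (t + 1)))) _ rfl))).mono ?_⟩
    · rw [CState.set_reg, if_pos rfl, WordOp.toNat_eval hw, hv₁, hv₂]
      · rfl
      · rwa [hv₁, hv₂]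
    · rw [CState.set_reg, if_neg (by omega), hr₂ y (by omega), hr₁ y hy]
    · simp only [cost]; omega
  | ld e ihe =>
    obtain ⟨s₁, h₁, hv₁, hr₁, hR₁⟩ := ihe h ht he
    refine ⟨s₁.set t (s₁.mem (s₁.reg t)), h₁.set_scratch ht _, ?_, fun y hy => ?_,
      fun ψ => ((hR₁ ψ).seq (Runs.instr (s' := s₁.set t (s₁.mem (s₁.reg t))) _ rfl)).mono ?_⟩
    · rw [CState.set_reg, if_pos rfl, h₁.2, hv₁]; rfl
    · rw [CState.set_reg, if_neg (by omega), hr₁ y hy]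
    · simp only [cost]; omega

end

/-- Loop-free programs. -/
inductive Blk (ι : Type) where
  | skip
  | asg (x : ℕ) (e : Exp)
  | sto (e f : Exp)
  | qry (x : ℕ) (p : ι) (e f : Exp)
  | seq (B C : Blk ι)
  | ite (e : Exp) (B C : Blk ι)

/-- The answers of a black box as natural numbers. -/
def BlackBox.nat {ι : Type} {w : ℕ} (O : BlackBox ι w) (p : ι) (i j : ℕ) : ℕ :=
  (O p (BitVec.ofNat w i) (BitVec.ofNat w j)).toNat

namespace Blk
variable {ι : Type} {w k : ℕ} (O : BlackBox ι w)

/-- The effect of a loop-free program. -/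
def exec : Blk ι → St → St
  | skip, a => a
  | asg x e, a => a.set x (e.eval a)
  | sto e f, a => a.put (e.eval a) (f.eval a)
  | qry x p e f, a => a.set x (O.nat p (e.eval a) (f.eval a))
  | seq B C, a => C.exec (B.exec a)
  | ite e B C, a => if e.eval a ≠ 0 then B.exec a else C.exec a

/-- The program does not overflow. -/
def ok : Blk ι → St → Prop
  | skip, _ => True
  | asg x e, a => x < 64 ∧ e.ok (2 ^ w) a
  | sto e f, a => e.ok (2 ^ w) a ∧ f.ok (2 ^ w) a
  | qry x _ e f, a => x < 64 ∧ e.ok (2 ^ w) a ∧ f.ok (2 ^ w) a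
  | seq B C, a => B.ok a ∧ C.ok (B.exec O a)
  | ite e B C, a => e.ok (2 ^ w) a ∧ (e.eval a ≠ 0 → B.ok a) ∧ (e.eval a = 0 → C.ok a)

/-- The machine program. -/
def prog : Blk ι → Prog ι k
  | skip => .instr (.const 64 0)
  | asg x e => .seq (e.code 64) (.instr (.op .or x 64 64))
  | sto e f => .seq (e.code 64) (.seq (f.code 65) (.instr (.store 64 65)))
  | qry x p e f => .seq (e.code 64) (.seq (f.code 65) (.instr (.query p x 64 65)))
  | seq B C => .seq B.prog C.prog
  | ite e B C => .seq (e.code 64) (.cond 64 B.prog C.prog)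

/-- A bound on the running time. -/
def cost : Blk ι → ℕ
  | skip => 1
  | asg _ e => e.cost + 2
  | sto e f => e.cost + f.cost + 3
  | qry _ _ e f => e.cost + f.cost + 3
  | seq B C => B.cost + C.cost + 1
  | ite e B C => e.cost + max B.cost C.cost + 2

lemma runs_prog (hw : 0 < w) (B : Blk ι) {a : St} {s : CState w} (h : Rel a s)
    (hB : B.ok O a) : ∃ s', Rel (B.exec O a) s' ∧
      ∀ ψ : QState w k, Runs O B.prog B.cost s ψ s' ψ := by
  induction B generalizing a s with
  | skip =>
    exact ⟨s.set 64 (BitVec.ofNat w 0), h.set_scratch le_rfl _, fun ψ => Runs.instr _ rfl⟩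
  | asg x e =>
    obtain ⟨s₁, h₁, hv₁, -, hR₁⟩ := e.runs_code (k := k) O hw h le_rfl hB.2
    refine ⟨s₁.set x (s₁.reg 64), ?_, fun ψ => ((hR₁ ψ).seq
      (Runs.instr (s' := s₁.set x (s₁.reg 64)) _ ?_)).mono ?_⟩
    · have := h₁.set x (s₁.reg 64); rwa [hv₁] at this
    · simp [Instr.exec, WordOp.eval]
    · simp only [cost]; omega
  | sto e f =>
    obtain ⟨s₁, h₁, hv₁, -, hR₁⟩ := e.runs_code (k := k) O hw h le_rfl hB.1
    obtain ⟨s₂, h₂, hv₂, hr₂, hR₂⟩ := f.runs_code (k := k) O hw h₁ (t := 65) (by omega) hB.2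
    rw [← hr₂ 64 (by omega)] at hv₁
    refine ⟨{ s₂ with mem := Function.update s₂.mem (s₂.reg 64) (s₂.reg 65) }, ⟨h₂.1, fun b => ?_⟩,
      fun ψ => ((hR₁ ψ).seq ((hR₂ ψ).seq (Runs.instr _ rfl))).mono ?_⟩
    · simp only [exec, St.put_m, Function.update_apply, ← hv₁, ← hv₂, BitVec.toNat_inj]
      split_ifs
      exacts [rfl, h₂.2 b]
    · simp only [cost]; omega
  | qry x p e f =>
    obtain ⟨s₁, h₁, hv₁, -, hR₁⟩ := e.runs_code (k := k) O hw h le_rfl hB.2.1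
    obtain ⟨s₂, h₂, hv₂, hr₂, hR₂⟩ := f.runs_code (k := k) O hw h₁ (t := 65) (by omega) hB.2.2
    rw [← hr₂ 64 (by omega)] at hv₁
    refine ⟨s₂.set x (O p (s₂.reg 64) (s₂.reg 65)), ?_,
      fun ψ => ((hR₁ ψ).seq ((hR₂ ψ).seq (Runs.instr _ rfl))).mono ?_⟩
    · have := h₂.set x (O p (s₂.reg 64) (s₂.reg 65))
      have e : (O p (s₂.reg 64) (s₂.reg 65)).toNat = O.nat p (e.eval a) (f.eval a) := by
        rw [← hv₁, ← hv₂, BlackBox.nat, BitVec.ofNat_toNat, BitVec.ofNat_toNat,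
          BitVec.setWidth_eq, BitVec.setWidth_eq]
      rwa [e] at this
    · simp only [cost]; omega
  | seq B C ihB ihC =>
    obtain ⟨s₁, h₁, hR₁⟩ := ihB h hB.1
    obtain ⟨s₂, h₂, hR₂⟩ := ihC h₁ hB.2
    exact ⟨s₂, h₂, fun ψ => (hR₁ ψ).seq (hR₂ ψ)⟩
  | ite e B C ihB ihC =>
    obtain ⟨s₁, h₁, hv₁, -, hR₁⟩ := e.runs_code (k := k) O hw h le_rfl hB.1
    by_cases he : e.eval a = 0
    · obtain ⟨s₂, h₂, hR₂⟩ := ihC h₁ (hB.2.2 he)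
      refine ⟨s₂, by simpa [exec, he] using h₂, fun ψ =>
        ((hR₁ ψ).seq (Runs.cond_neg ?_ (hR₂ ψ))).mono ?_⟩
      · rw [he] at hv₁; exact BitVec.eq_of_toNat_eq hv₁
      · simp only [cost]; omega
    · obtain ⟨s₂, h₂, hR₂⟩ := ihB h₁ (hB.2.1 he)
      refine ⟨s₂, by simpa [exec, he] using h₂, fun ψ =>
        ((hR₁ ψ).seq (Runs.cond_pos ?_ (hR₂ ψ))).mono ?_⟩
      · intro h0; rw [h0] at hv₁; exact he hv₁.symm
      · simp only [cost]; omega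

end Blk

/-- Iterate `P` while the value of `e` is nonzero. -/
def Prog.while {ι : Type} {k : ℕ} (e : Exp) (P : Prog ι k) : Prog ι k :=
  .seq (e.code 64) (.loop 64 (.seq P (e.code 64)))

/-- Run `P` if the value of `e` is nonzero, else `Q`. -/
def Prog.ite {ι : Type} {k : ℕ} (e : Exp) (P Q : Prog ι k) : Prog ι k :=
  .seq (e.code 64) (.cond 64 P Q)

/-! ### Triples with time credits -/

section
variable {ι : Type} {w k : ℕ} (O : BlackBox ι w)

/-- The halting probability from a state in which all quantum words are `0`. -/
noncomputable def clHaltProb (S : CState w → Prop) (τ : ℕ) (K : List (Prog ι k)) (s : CState w) :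
    ℝ := Conf.haltProb O S τ (K, s, QState.zero w k)

lemma clHaltProb_nonneg (S : CState w → Prop) (τ : ℕ) (K : List (Prog ι k)) (s : CState w) :
    0 ≤ clHaltProb O S τ K s := Conf.haltProb_nonneg O S _ _

/-- Starting in `a` with `τ` units of time left, the program reaches some state `a'` with `τ'`
units of time left such that `Q τ' a'`, except for an error probability that is charged at the
rate `δ` per unit of time.  The meaning is expressed through the halting probability of an
arbitrary continuation `K` for an arbitrary event `S`. -/
def Triple (δ : NNReal) (P : Prog ι k) (Q : ℕ → St → Prop) (τ : ℕ) (a : St) : Prop :=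
  ∀ s, Rel a s → ∀ (K : List (Prog ι k)) (S : CState w → Prop) (c : ℝ), c ≤ 1 →
    (∀ τ' ≤ τ, ∀ a' s', Q τ' a' → Rel a' s' → c - δ * τ' ≤ clHaltProb O S τ' K s') →
    c - δ * τ ≤ clHaltProb O S τ (P :: K) s

variable {O} {δ : NNReal} {P P' : Prog ι k} {Q Q' : ℕ → St → Prop} {τ : ℕ} {a : St}

lemma sub_mul_le_of_le {τ τ' : ℕ} (h : τ' ≤ τ) (c : ℝ) : c - δ * τ ≤ c - δ * τ' := by
  have : (τ' : ℝ) ≤ τ := by exact_mod_cast h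
  have := mul_le_mul_of_nonneg_left this δ.2
  linarith!

lemma clHaltProb_seq {S : CState w → Prop} {K : List (Prog ι k)} {s : CState w} :
    clHaltProb O S (τ + 1) (.seq P P' :: K) s = clHaltProb O S τ (P :: P' :: K) s := by
  simp [clHaltProb, Conf.haltProb_succ, Conf.step]

lemma clHaltProb_cond {S : CState w → Prop} {K : List (Prog ι k)} {s : CState w} {x : ℕ} :
    clHaltProb O S (τ + 1) (.cond x P P' :: K) s =
      clHaltProb O S τ ((if s.reg x ≠ 0 then P else P') :: K) s := by
  rw [clHaltProb, Conf.haltProb_succ, Conf.step, Multiset.map_singleton, Multiset.sum_singleton]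
  rfl

lemma clHaltProb_loop {S : CState w → Prop} {K : List (Prog ι k)} {s : CState w} {x : ℕ} :
    clHaltProb O S (τ + 1) (.loop x P :: K) s =
      clHaltProb O S τ (if s.reg x ≠ 0 then P :: .loop x P :: K else K) s := by
  rw [clHaltProb, Conf.haltProb_succ, Conf.step, Multiset.map_singleton, Multiset.sum_singleton]
  rfl

lemma clHaltProb_runs {S : CState w → Prop} {K : List (Prog ι k)} {t : ℕ}
    {s s' : CState w} (hr : Runs O P t s (QState.zero w k) s' (QState.zero w k)) :
    clHaltProb O S τ K s' ≤ clHaltProb O S (τ + t) (P :: K) s := hr K S τ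

namespace Triple

lemma seq (hτ : 1 ≤ τ) (h : Triple O δ P (Triple O δ P' Q) (τ - 1) a) :
    Triple O δ (.seq P P') Q τ a := fun s hs K S c hc hK => by
  refine (sub_mul_le_of_le (Nat.sub_le τ 1) c).trans ((h s hs (P' :: K) S c hc
    fun τ' hτ' a' s' h' hr => h' s' hr K S c hc fun τ'' h'' => hK τ'' (by omega)).trans ?_)
  obtain ⟨t, rfl⟩ := Nat.exists_eq_add_of_le' hτ
  exact clHaltProb_seq.ge

lemma blk (hw : 0 < w) (B : Blk ι) (hok : B.ok O a) (hτ : B.cost ≤ τ)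
    (h : Q (τ - B.cost) (B.exec O a)) : Triple O δ (B.prog : Prog ι k) Q τ a :=
  fun s hs K S c _ hK => by
    obtain ⟨s', h', hr⟩ := B.runs_prog (k := k) O hw hs hok
    obtain ⟨t, ht⟩ := Nat.exists_eq_add_of_le' hτ
    rw [ht, Nat.add_sub_cancel] at h
    rw [ht]
    exact (sub_mul_le_of_le (by omega) c).trans
      ((hK t (by omega) _ s' h h').trans (clHaltProb_runs (hr _)))

lemma ite (hw : 0 < w) (e : Exp) (hok : e.ok (2 ^ w) a) (hτ : e.cost + 2 ≤ τ)
    (h₁ : e.eval a ≠ 0 → Triple O δ P Q (τ - (e.cost + 2)) a)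
    (h₂ : e.eval a = 0 → Triple O δ P' Q (τ - (e.cost + 2)) a) :
    Triple O δ (.ite e P P') Q τ a := fun s hs K S c hc hK => by
  obtain ⟨s₁, h', hv₁, -, hr⟩ := e.runs_code (k := k) O hw hs le_rfl hok
  obtain ⟨t, rfl⟩ := Nat.exists_eq_add_of_le' hτ
  rw [Nat.add_sub_cancel] at h₁ h₂
  refine (sub_mul_le_of_le (τ' := t) (by omega) c).trans ?_
  rw [show t + (e.cost + 2) = t + 1 + e.cost + 1 by omega, Prog.ite, clHaltProb_seq]
  refine le_trans ?_ (clHaltProb_runs (hr _))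
  rw [clHaltProb_cond]
  by_cases he : e.eval a = 0
  · rw [if_neg (not_not.mpr (BitVec.eq_of_toNat_eq (by rw [hv₁, he]; rfl)))]
    exact h₂ he s₁ h' K S c hc fun τ' hτ' => hK τ' (by omega)
  · rw [if_pos (fun h0 => he (hv₁.symm.trans (by rw [h0]; rfl)))]
    exact h₁ he s₁ h' K S c hc fun τ' hτ' => hK τ' (by omega)

/-- The rule for loops.  The invariant speaks about the time that is left, so that termination
needs no separate argument. -/
lemma while_ (hw : 0 < w) (e : Exp) (I : ℕ → St → Prop)
    (hI : ∀ τ' ≤ τ, ∀ a, I τ' a → e.ok (2 ^ w) a ∧ e.cost + 3 ≤ τ' ∧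
      (e.eval a = 0 → Q (τ' - (e.cost + 3)) a) ∧
      (e.eval a ≠ 0 → Triple O δ P I (τ' - (e.cost + 3)) a)) (h : I τ a) :
    Triple O δ (.while e P) Q τ a := fun s hs K S c hc hK => by
  -- the claim about the loop, from the point where `e` is to be evaluated
  have key : ∀ τ₁, τ₁ + 1 ≤ τ → ∀ a s, I (τ₁ + 1) a → Rel a s → c - δ * (τ₁ + 1 : ℕ) ≤
      clHaltProb O S τ₁ (e.code 64 :: .loop 64 (.seq P (e.code 64)) :: K) s := by
    intro τ₁
    induction τ₁ using Nat.strong_induction_on with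
    | _ τ₁ ih =>
      intro hτ a s ha hs
      obtain ⟨hok, hc', hz, hnz⟩ := hI _ hτ a ha
      obtain ⟨s₁, h', hv₁, -, hr⟩ := e.runs_code (k := k) O hw hs le_rfl hok
      obtain ⟨t, rfl⟩ : ∃ t, τ₁ = t + 2 + e.cost := ⟨τ₁ - 2 - e.cost, by omega⟩
      rw [show t + 2 + e.cost + 1 - (e.cost + 3) = t by omega] at hz hnz
      refine (sub_mul_le_of_le (τ' := t) (by omega) c).trans (le_trans ?_
        (clHaltProb_runs (hr _)))
      rw [show t + 2 = t + 1 + 1 from rfl, clHaltProb_loop]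
      by_cases he : e.eval a = 0
      · rw [if_neg (not_not.mpr (BitVec.eq_of_toNat_eq (by rw [hv₁, he]; rfl)))]
        exact (hK t (by omega) a s₁ (hz he) h').trans (Conf.haltProb_mono O S _ (by omega))
      · rw [if_pos (fun h0 => he (hv₁.symm.trans (by rw [h0]; rfl))), clHaltProb_seq]
        refine hnz he s₁ h' _ S c hc fun τ' hτ' a' s' hi hr' => ?_
        rcases τ' with _ | τ'
        · exact absurd (hI 0 (by omega) a' hi).2.1 (by omega)
        · exact (ih τ' (by omega) (by omega) a' s' hi hr').trans
            (Conf.haltProb_mono O S _ (by omega))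
  have h1 := (hI τ le_rfl a h).2.1
  obtain ⟨t, rfl⟩ : ∃ t, τ = t + 1 := ⟨τ - 1, by omega⟩
  exact (key t (by omega) a s h hs).trans clHaltProb_seq.ge

end Triple
end

/-! ### Amplitude amplification -/

section amplitude
variable {α : Type*} [Fintype α]

/-- The amplitudes after `j` iterations of Grover's algorithm that starts in the state `u`, with
phase oracle `χ`.  (The reflection has the opposite of the usual sign.) -/
noncomputable def groverAmp (u χ : α → ℝ) : ℕ → α → ℝ
  | 0 => u
  | j + 1 => fun x => χ x * groverAmp u χ j x - 2 * u x * ∑ z, u z * (χ z * groverAmp u χ j z)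

lemma groverAmp_eq_zero {u χ : α → ℝ} {x : α} (hx : u x = 0) (j : ℕ) : groverAmp u χ j x = 0 := by
  induction j with
  | zero => exact hx
  | succ j ih => simp [groverAmp, ih, hx]

lemma sum_sq_groverAmp {u χ : α → ℝ} (hu : ∑ x, u x ^ 2 = 1) (hχ : ∀ x, χ x ^ 2 = 1) (j : ℕ) :
    ∑ x, groverAmp u χ j x ^ 2 = 1 := by
  induction j with
  | zero => exact hu
  | succ j ih =>
    set σ := ∑ z, u z * (χ z * groverAmp u χ j z) with hσ
    have : ∀ x, groverAmp u χ (j + 1) x ^ 2 = groverAmp u χ j x ^ 2 -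
        4 * σ * (u x * (χ x * groverAmp u χ j x)) + 4 * σ ^ 2 * u x ^ 2 := by
      intro x
      simp only [groverAmp, ← hσ]
      linear_combination groverAmp u χ j x ^ 2 * hχ x
    simp_rw [this]
    rw [Finset.sum_add_distrib, Finset.sum_sub_distrib, ← Finset.mul_sum, ← Finset.mul_sum, ih, hu,
      ← hσ]
    ring

/-- The amplitudes rotate by the angle `2 * θ` in each iteration, where `sin θ ^ 2` is the fraction
of marked elements. -/
lemma groverAmp_eq {u χ : α → ℝ} {P f : α → Prop} [DecidablePred P] [DecidablePred f] {r θ : ℝ}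
    (hr : r ≠ 0)
    (hu : ∀ x, u x = if P x then r else 0) (hχ : ∀ x, P x → χ x = if f x then -1 else 1)
    (ht : r ^ 2 * (Finset.univ.filter fun x => P x ∧ f x).card = Real.sin θ ^ 2)
    (ht' : r ^ 2 * (Finset.univ.filter fun x => P x ∧ ¬ f x).card = Real.cos θ ^ 2)
    (hs : Real.sin θ ≠ 0) (j : ℕ) (x : α) (hx : P x) :
    groverAmp u χ j x = (-1) ^ j * r * (if f x then Real.sin ((2 * j + 1) * θ) / Real.sin θ else
      Real.cos ((2 * j + 1) * θ) / Real.cos θ) := by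
  have hc : ∀ x, P x → ¬ f x → Real.cos θ ≠ 0 := by
    intro x hx hf h0
    rw [h0] at ht'
    have hcard : (0 : ℝ) < (Finset.univ.filter fun x => P x ∧ ¬ f x).card := by
      exact_mod_cast Finset.card_pos.mpr ⟨x, by simp [hx, hf]⟩
    have : 0 < r ^ 2 * ((Finset.univ.filter fun x => P x ∧ ¬ f x).card : ℝ) := by positivity
    rw [ht'] at this
    norm_num at this
  induction j generalizing x with
  | zero =>
    simp only [groverAmp, hu, hx, if_true]
    split_ifs with hf
    · simp [hs]
    · simp [hc x hx hf]
  | succ j ih =>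
    set S := Real.sin ((2 * j + 1) * θ) with hS
    set C := Real.cos ((2 * j + 1) * θ) with hC
    have hsum : ∑ z, u z * (χ z * groverAmp u χ j z) =
        (-1) ^ j * (-Real.sin θ * S + Real.cos θ * C) := by
      have e : ∀ z, u z * (χ z * groverAmp u χ j z) =
          (if P z ∧ f z then (-1) ^ j * r ^ 2 * (-(S / Real.sin θ)) else 0) +
          (if P z ∧ ¬ f z then (-1) ^ j * r ^ 2 * (C / Real.cos θ) else 0) := by
        intro z
        by_cases hz : P z
        · rw [ih z hz, hu, hχ z hz]
          by_cases hf : f z <;> simp [hz, hf] <;> ring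
        · simp [hu, hz]
      simp_rw [e]
      rw [Finset.sum_add_distrib, ← Finset.sum_filter, ← Finset.sum_filter, Finset.sum_const,
        Finset.sum_const, nsmul_eq_mul, nsmul_eq_mul]
      have e1 : ((Finset.univ.filter fun x => P x ∧ f x).card : ℝ) *
          ((-1) ^ j * r ^ 2 * (-(S / Real.sin θ))) = (-1) ^ j * (-Real.sin θ * S) := by
        calc _ = (-1) ^ j * (r ^ 2 * ((Finset.univ.filter fun x => P x ∧ f x).card : ℝ)) *
              (-(S / Real.sin θ)) := by ring
          _ = _ := by rw [ht]; field_simp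
      have e2 : ((Finset.univ.filter fun x => P x ∧ ¬ f x).card : ℝ) *
          ((-1) ^ j * r ^ 2 * (C / Real.cos θ)) = (-1) ^ j * (Real.cos θ * C) := by
        calc _ = (-1) ^ j * (r ^ 2 * ((Finset.univ.filter fun x => P x ∧ ¬ f x).card : ℝ)) *
              (C / Real.cos θ) := by ring
          _ = _ := by
            rw [ht']
            by_cases h0 : Real.cos θ = 0
            · simp [h0]
            · field_simp
      rw [e1, e2]; ring
    have a1 : (2 * ((j + 1 : ℕ) : ℝ) + 1) * θ = (2 * j + 1) * θ + 2 * θ := by push_cast; ring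
    have hsc := Real.sin_sq_add_cos_sq θ
    simp only [groverAmp]
    rw [hsum, ih x hx, hu, if_pos hx, hχ x hx, a1, Real.sin_add, Real.cos_add, ← hS, ← hC,
      Real.sin_two_mul, Real.cos_two_mul]
    split_ifs with hf
    · field_simp
      rw [pow_succ]
      linear_combination (2 * (-1) ^ j * S) * hsc
    · have := hc x hx hf
      field_simp
      rw [pow_succ]
      ring

/-- The probability that the measurement after `j` iterations yields a marked element. -/
lemma sum_sq_groverAmp_marked {u χ : α → ℝ} {P f : α → Prop} [DecidablePred P] [DecidablePred f]
    {r θ : ℝ} (hr : r ≠ 0)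
    (hu : ∀ x, u x = if P x then r else 0) (hχ : ∀ x, P x → χ x = if f x then -1 else 1)
    (ht : r ^ 2 * (Finset.univ.filter fun x => P x ∧ f x).card = Real.sin θ ^ 2)
    (ht' : r ^ 2 * (Finset.univ.filter fun x => P x ∧ ¬ f x).card = Real.cos θ ^ 2)
    (hs : Real.sin θ ≠ 0) (j : ℕ) :
    ∑ x ∈ Finset.univ.filter (fun x => P x ∧ f x), groverAmp u χ j x ^ 2 =
      Real.sin ((2 * j + 1) * θ) ^ 2 := by
  have e : ∀ x ∈ Finset.univ.filter (fun x => P x ∧ f x), groverAmp u χ j x ^ 2 =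
      r ^ 2 * (Real.sin ((2 * j + 1) * θ) / Real.sin θ) ^ 2 := by
    intro x hx
    rw [Finset.mem_filter] at hx
    rw [groverAmp_eq hr hu hχ ht ht' hs j x hx.2.1, if_pos hx.2.2, mul_pow, mul_pow, ← pow_mul,
      mul_comm j 2, pow_mul]
    norm_num
  rw [Finset.sum_congr rfl e, Finset.sum_const, nsmul_eq_mul, ← mul_assoc, mul_comm _ (r ^ 2), ht]
  field_simp

end amplitude

/-- Among the angles `3 ^ i * θ` one is between `π / 6` and `π / 2`.  Hence with one of the numbers
of iterations `(3 ^ i - 1) / 2` the success probability is at least `1 / 4`, and the first such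
number is at most of the order of the square root of the inverse fraction of marked elements. -/
lemma exists_pow_three_mul {θ : ℝ} (h0 : 0 < θ) (h1 : θ ≤ Real.pi / 2) :
    ∃ i : ℕ, 1 / 4 ≤ Real.sin (3 ^ i * θ) ^ 2 ∧ (3 : ℝ) ^ i * Real.sin θ ≤ 2 := by
  have hex : ∃ i : ℕ, Real.pi / 6 ≤ 3 ^ i * θ := by
    obtain ⟨i, hi⟩ := pow_unbounded_of_one_lt (Real.pi / 6 / θ) (by norm_num : (1 : ℝ) < 3)
    exact ⟨i, by rw [div_lt_iff₀ h0] at hi; exact hi.le⟩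
  have hmin : 3 ^ (Nat.find hex) * θ ≤ Real.pi / 2 := by
    rcases hi : Nat.find hex with _ | i
    · simpa using h1
    · have := Nat.find_min hex (m := i) (by omega)
      rw [not_le] at this
      rw [pow_succ]; linarith
  refine ⟨Nat.find hex, ?_, ?_⟩
  · have h2 : 1 / 2 ≤ Real.sin (3 ^ Nat.find hex * θ) := by
      rw [← Real.sin_pi_div_six]
      exact Real.sin_le_sin_of_le_of_le_pi_div_two (by linarith [Real.pi_pos]) hmin
        (Nat.find_spec hex)
    nlinarith
  · have h3 := Real.sin_le h0.le
    have h4 := Real.pi_le_four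
    have : (3 : ℝ) ^ Nat.find hex * Real.sin θ ≤ 3 ^ Nat.find hex * θ := by gcongr
    linarith

/-! ### Grover's algorithm on the machine -/

namespace Instr
variable {ι : Type} {w k : ℕ} (O : BlackBox ι w) (s : CState w)

/-- The action of the XOR instructions on basis states. -/
def basis : Instr ι k → (Fin k → BitVec w) → Fin k → BitVec w
  | qxor t a => QState.xorMap t fun _ => s.reg a
  | qop o t a b _ _ => QState.xorMap t fun x => o.eval (x a) (x b)
  | qload t a _ => QState.xorMap t fun x => s.mem (x a)
  | qquery p t a b _ _ => QState.xorMap t fun x => O p (x a) (x b)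
  | _ => id

/-- The instruction permutes the basis states. -/
def IsGate : Instr ι k → Prop
  | qxor _ _ | qop _ _ _ _ _ _ | qload _ _ _ | qquery _ _ _ _ _ _ => True
  | _ => False

lemma exec_gate {i : Instr ι k} (hi : i.IsGate) (ψ : QState w k) :
    i.exec O (s, ψ) = {(s, fun x => ψ (i.basis O s x))} := by
  cases i <;> first | exact hi.elim | rfl

lemma basis_basis {i : Instr ι k} (hi : i.IsGate) (x : Fin k → BitVec w) :
    i.basis O s (i.basis O s x) = x := by
  cases i with
  | qxor t a => exact QState.xorMap_involutive _ _ (by simp) x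
  | qop o t a b ha hb => exact QState.xorMap_involutive _ _ (by simp [ha, hb]) x
  | qload t a ha => exact QState.xorMap_involutive _ _ (by simp [ha]) x
  | qquery p t a b ha hb => exact QState.xorMap_involutive _ _ (by simp [ha, hb]) x
  | _ => exact hi.elim

/-- The action of a list of XOR instructions on basis states. -/
def basisList : List (Instr ι k) → (Fin k → BitVec w) → Fin k → BitVec w
  | [], x => x
  | g :: L, x => basisList L (g.basis O s x)

end Instr

/-- Compute, run `P`, uncompute. -/
def Prog.sandwich {ι : Type} {k : ℕ} : List (Instr ι k) → Prog ι k → Prog ι k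
  | [], P => P
  | g :: L, P => .seq (.instr g) (.seq (sandwich L P) (.instr g))

lemma Runs.sandwich {ι : Type} {w k : ℕ} {O : BlackBox ι w} {s : CState w} {P : Prog ι k} {t : ℕ}
    {χ : (Fin k → BitVec w) → ℂ} (hP : ∀ ψ : QState w k, Runs O P t s ψ s fun x => χ x * ψ x)
    (L : List (Instr ι k)) (hL : ∀ g ∈ L, g.IsGate) (ψ : QState w k) :
    Runs O (Prog.sandwich L P) (t + 4 * L.length) s ψ s
      fun x => χ (Instr.basisList O s L x) * ψ x := by
  induction L generalizing ψ with
  | nil => exact hP ψ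
  | cons g L ih =>
    have hg := hL g (by simp)
    have ih' := ih (fun g' h' => hL g' (by simp [h']))
    refine ((Runs.instr g (Instr.exec_gate O s hg ψ)).seq
      ((ih' _).seq (Runs.instr (s' := s) g ?_))).mono (by simp; omega)
    rw [Instr.exec_gate O s hg]
    simp only [Instr.basis_basis O s hg, Instr.basisList]

/-- A Z gate on the lowest qubit of the word `q`, where register `o` holds `1`. -/
def Prog.zGate {ι : Type} {k : ℕ} (q : Fin k) (o : ℕ) : Prog ι k :=
  .seq (.instr (.had q o)) (.seq (.instr (.qxor q o)) (.instr (.had q o)))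

/-- The phase of a Z gate on the lowest qubit. -/
def zPhase {w : ℕ} (x : BitVec w) : ℝ := if x.getLsbD 0 then -1 else 1

lemma zPhase_of_toNat {w : ℕ} (x : BitVec w) (p : Prop) [Decidable p]
    (h : x.toNat = if p then 1 else 0) :
    zPhase x = if p then -1 else 1 := by
  unfold zPhase
  rw [← BitVec.testBit_toNat, h]
  split_ifs <;> simp_all

lemma Runs.zGate {ι : Type} {w k : ℕ} (hw : 0 < w) {O : BlackBox ι w} {s : CState w} (q : Fin k)
    {o : ℕ} (ho : (s.reg o).toNat = 1) (ψ : QState w k) :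
    Runs O (Prog.zGate q o) 5 s ψ s fun x => (zPhase (x q) : ℂ) * ψ x := by
  have h : Runs O (Prog.zGate q o) 5 s ψ s (((ψ.had q (s.reg o)).xorInto q
      fun _ => s.reg o).had q (s.reg o)) :=
    (Runs.instr _ rfl).seq ((Runs.instr _ rfl).seq (Runs.instr _ rfl))
  convert h using 1
  funext x
  have h1 : s.reg o = 1 := BitVec.eq_of_toNat_eq (by rw [ho, BitVec.toNat_one_of_pos hw])
  have hsign : ∀ a : BitVec w, (∏ i : Fin w,
      (if (1 : BitVec w).getLsbD i && a.getLsbD i then (-1 : ℂ) else 1)) = (zPhase a : ℂ) := by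
    intro a
    rw [Finset.prod_eq_single (⟨0, hw⟩ : Fin w)]
    · have : (1 : BitVec w).getLsbD 0 = true := by
        rw [← BitVec.testBit_toNat, BitVec.toNat_one_of_pos hw]; rfl
      simp only [this, Bool.true_and, zPhase]
      split_ifs <;> simp
    · intro i _ hi
      have : (1 : BitVec w).getLsbD i = false := by
        rw [← BitVec.testBit_toNat, BitVec.toNat_one_of_pos hw]
        have : i.val ≠ 0 := fun h => hi (Fin.ext h)
        obtain ⟨j, hj⟩ := Nat.exists_eq_succ_of_ne_zero this
        rw [hj, Nat.testBit_succ]; simp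
      simp only [this, Bool.false_and]; simp
    · simp
  simp only [QState.had, QState.xorInto, h1, Function.update_self, Function.update_idem]
  simp_rw [Finset.mul_sum]
  rw [Finset.sum_comm]
  simp_rw [← mul_assoc, ← Finset.sum_mul]
  have := fun z => sum_hadEntry_mul (1 : BitVec w) 1 (x q) z (BitVec.and_self)
  simp_rw [this, hsign]
  simp

/-- The state in which word `0` has the amplitudes `φ` and the other words are `0`. -/
noncomputable def QState.onWord {w : ℕ} (φ : BitVec w → ℂ) : QState w 14 :=
  fun x => if ∀ i, i ≠ 0 → x i = 0 then φ (x 0) else 0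

/-- The basis state in which word `0` holds `y` and the other words are `0`. -/
def basisWord {w : ℕ} (y : BitVec w) : Fin 14 → BitVec w := fun i => if i = 0 then y else 0

namespace QState
variable {w : ℕ}

lemma eq_basisWord {x : Fin 14 → BitVec w} (h : ∀ i, i ≠ 0 → x i = 0) : x = basisWord (x 0) := by
  funext i
  by_cases hi : i = 0
  · subst hi; simp [basisWord]
  · simp [basisWord, hi, h i hi]

lemma zero_eq_onWord : QState.zero w 14 = onWord fun y => if y = 0 then 1 else 0 := by
  funext x
  simp only [QState.zero, onWord]
  by_cases h : ∀ i, i ≠ 0 → x i = 0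
  · rw [if_pos h]
    by_cases h0 : x 0 = 0
    · rw [if_pos h0, if_pos]
      funext i
      by_cases hi : i = 0
      · subst hi; exact h0
      · exact h i hi
    · rw [if_neg h0, if_neg]
      exact fun hx => h0 (congrFun hx 0)
  · rw [if_neg h, if_neg]
    exact fun hx => h fun i _ => congrFun hx i

lemma had_onWord (mask : BitVec w) (φ : BitVec w → ℂ) :
    (onWord φ).had 0 mask = onWord fun y => ∑ z, hadEntry mask y z * φ z := by
  funext x
  have : ∀ y, (∀ i, i ≠ 0 → Function.update x 0 y i = 0) ↔ ∀ i, i ≠ 0 → x i = 0 := by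
    intro y
    refine forall_congr' fun i => forall_congr' fun hi => ?_
    rw [Function.update_of_ne hi]
  simp only [had, onWord, this, Function.update_self]
  split_ifs <;> simp

lemma mul_onWord (χ : (Fin 14 → BitVec w) → ℂ) (φ : BitVec w → ℂ) :
    (fun x => χ x * onWord φ x) = onWord fun y => χ (basisWord y) * φ y := by
  funext x
  simp only [onWord]
  split_ifs with h
  · rw [← eq_basisWord h]
  · simp

lemma project_onWord (y : BitVec w) (φ : BitVec w → ℂ) :
    ((onWord φ).project 0 y).xorInto 0 (fun _ => y) = φ y • QState.zero w 14 := by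
  funext x
  have : ∀ b, (∀ i, i ≠ 0 → Function.update x 0 b i = 0) ↔ ∀ i, i ≠ 0 → x i = 0 := by
    intro y
    refine forall_congr' fun i => forall_congr' fun hi => ?_
    rw [Function.update_of_ne hi]
  have h2 : x 0 ^^^ y = y ↔ x 0 = 0 := by
    constructor
    · intro h
      have := congrArg (· ^^^ y) h
      simpa [BitVec.xor_assoc] using this
    · intro h; rw [h]; exact BitVec.zero_xor
  rw [zero_eq_onWord]
  simp only [xorInto, project, onWord, this, Function.update_self, h2, Pi.smul_apply, smul_eq_mul]
  by_cases h0 : x 0 = 0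
  · simp only [h0, if_true]
    split_ifs
    · rw [show (0 : BitVec w) ^^^ y = y from BitVec.zero_xor, mul_one]
    · simp
  · simp only [if_neg h0, mul_zero, ite_self]

end QState

/-- The XOR instruction that tests whether word `0` is zero. -/
def zeroTest {ι : Type} : Instr ι 14 := .qop .eq 1 0 2 (by decide) (by decide)

/-- One iteration of Grover's algorithm: a phase flip where the XOR instructions in `gates` set
the word `1` to an odd value, and the reflection about the uniform superposition.  Register `46`
holds the mask of the search space and register `47` the number `1`. -/
def groverStep {ι : Type} (gates : List (Instr ι 14)) : Prog ι 14 :=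
  .seq (.sandwich gates (.zGate 1 47)) (.seq (.instr (.had 0 46))
    (.seq (.sandwich [zeroTest] (.zGate 1 47)) (.instr (.had 0 46))))

/-- Run as many iterations as register `43` says and measure the result into register `42`. -/
def grover {ι : Type} (gates : List (Instr ι 14)) : Prog ι 14 :=
  .seq (.instr (.had 0 46)) (.seq (.while (.v 43) (.seq (groverStep gates)
    (Blk.asg 43 (.op .sub (.v 43) (.c 1))).prog))
    (.seq (.instr (.measure 42 0)) (.instr (.qxor 0 42))))

/-- The uniform superposition of the words below `4 ^ d`. -/
noncomputable def unifAmp (w d : ℕ) (x : BitVec w) : ℝ :=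
  if x.toNat < 4 ^ d then (1 / 2) ^ d else 0

lemma hadEntry_zero_eq_unifAmp {w d : ℕ} (hd : 2 * d ≤ w) {mask : BitVec w}
    (hm : mask.toNat = 4 ^ d - 1) (x : BitVec w) : hadEntry mask x 0 = (unifAmp w d x : ℂ) := by
  have h4 : (4 : ℕ) ^ d = 2 ^ (2 * d) := by rw [pow_mul]; norm_num
  rw [hadEntry_zero hd mask x (by rw [hm, h4]), unifAmp, h4, pow_mul (1 / (Real.sqrt 2 : ℂ)),
    pow_two (1 / (Real.sqrt 2 : ℂ)), inv_sqrt_two_mul_self]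
  split_ifs <;> simp

lemma sum_unifAmp_sq {w d : ℕ} (hd : 2 * d ≤ w) : ∑ x, unifAmp w d x ^ 2 = 1 := by
  have hlt : 4 ^ d - 1 < 2 ^ w := by
    have : (4 : ℕ) ^ d ≤ 2 ^ w := by
      rw [show (4 : ℕ) = 2 ^ 2 from rfl, ← pow_mul]; exact Nat.pow_le_pow_right (by norm_num) hd
    have : 0 < (4 : ℕ) ^ d := by positivity
    omega
  have hm : (BitVec.ofNat w (4 ^ d - 1)).toNat = 4 ^ d - 1 := by
    rw [BitVec.toNat_ofNat, Nat.mod_eq_of_lt hlt]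
  have h := sum_hadEntry_mul_self (BitVec.ofNat w (4 ^ d - 1)) 0 0
  simp_rw [hadEntry_comm _ 0, hadEntry_zero_eq_unifAmp hd hm] at h
  simp only [if_true] at h
  have h' : (∑ x, unifAmp w d x * unifAmp w d x) = 1 := by exact_mod_cast h
  simpa [pow_two] using h'

section
variable {ι : Type} {w : ℕ} {O : BlackBox ι w} {s : CState w}

lemma Runs.groverStep (hw : 0 < w) {d : ℕ} (hd : 2 * d ≤ w) {gates : List (Instr ι 14)}
    (hg : ∀ g ∈ gates, g.IsGate) (h46 : (s.reg 46).toNat = 4 ^ d - 1) (h47 : (s.reg 47).toNat = 1)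
    {χ : BitVec w → ℝ} {φ : BitVec w → ℝ}
    (hχ : ∀ y, χ y * φ y = zPhase (Instr.basisList O s gates (basisWord y) 1) * φ y) :
    Runs O (groverStep gates) (4 * gates.length + 19) s (QState.onWord fun y => (φ y : ℂ)) s
      (QState.onWord fun x => ((χ x * φ x - 2 * unifAmp w d x *
        ∑ z, unifAmp w d z * (χ z * φ z) : ℝ) : ℂ)) := by
  have h1 := Runs.sandwich (P := Prog.zGate 1 47) (χ := fun x => (zPhase (x 1) : ℂ))
    (Runs.zGate (O := O) hw 1 h47) gates hg (QState.onWord fun y => (φ y : ℂ))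
  have h2 := fun ψ => Runs.sandwich (P := Prog.zGate 1 47) (χ := fun x => (zPhase (x 1) : ℂ))
    (Runs.zGate (O := O) hw 1 h47) [zeroTest]
    (by simp [Instr.IsGate, zeroTest]) ψ
  rw [QState.mul_onWord] at h1
  have h3 := h1.seq ((Runs.instr (s' := s) (.had 0 46) rfl).seq
    ((h2 _).seq (Runs.instr (s' := s) (.had 0 46) rfl)))
  have h : Runs O (_root_.groverStep gates) (4 * gates.length + 19) s _ s _ :=
    Runs.mono h3 (by simp only [List.length_singleton]; omega)
  convert h using 1
  symm
  have e1 : ∀ y, ((zPhase (Instr.basisList O s gates (basisWord y) 1) : ℝ) : ℂ) * (φ y : ℂ) =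
      ((χ y * φ y : ℝ) : ℂ) := by
    intro y; rw [hχ]; push_cast; rfl
  simp_rw [e1]
  rw [QState.had_onWord, QState.mul_onWord, QState.had_onWord]
  congr 1
  funext x
  have e2 : ∀ y : BitVec w, ((zPhase (Instr.basisList O s
      [(zeroTest : Instr ι 14)] (basisWord y) 1) : ℝ) : ℂ) =
      1 - 2 * (if y = 0 then 1 else 0) := by
    intro y
    rw [zPhase_of_toNat _ (y = 0)]
    · split_ifs <;> norm_num
    · have : Instr.basisList O s
        [(zeroTest : Instr ι 14)] (basisWord y) 1 =
        if y = 0 then 1 else 0 := by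
        simp only [Instr.basisList, zeroTest, Instr.basis, QState.xorMap, Function.update_self,
          basisWord,
          WordOp.eval]
        simp
      rw [this]
      split_ifs
      exacts [BitVec.toNat_one_of_pos hw, rfl]
  simp_rw [e2]
  have e3 : ∀ (F : BitVec w → ℂ), ∑ y, hadEntry (s.reg 46)
    x y * ((1 - 2 * (if y = 0 then 1 else 0)) *
      ∑ z, hadEntry (s.reg 46) y z * F z) =
      F x - 2 * (hadEntry (s.reg 46) x 0 * ∑ z, hadEntry (s.reg 46) z 0 * F z) := by
    intro F
    have : ∀ y, hadEntry (s.reg 46) x y * ((1 - 2 * (if y = 0 then 1 else 0)) *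
      ∑ z, hadEntry (s.reg 46) y z * F z) = ∑ z, hadEntry (s.reg 46) x y * hadEntry (s.reg 46) y z *
        F z - (if y = 0 then 2 * (hadEntry (s.reg 46) x y *
          ∑ z, hadEntry (s.reg 46) y z * F z) else 0) := by
      intro y
      simp_rw [mul_assoc]
      rw [← Finset.mul_sum]
      split_ifs <;> ring
    simp_rw [this]
    rw [Finset.sum_sub_distrib, Finset.sum_ite_eq' Finset.univ (0 : BitVec w),
      if_pos (Finset.mem_univ _), Finset.sum_comm]
    simp_rw [← Finset.sum_mul, sum_hadEntry_mul_self, hadEntry_comm _ 0]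
    simp
  rw [e3 fun z => ((χ z * φ z : ℝ) : ℂ)]
  simp_rw [hadEntry_zero_eq_unifAmp hd h46]
  push_cast
  ring


/-- The loop of Grover's algorithm.  The phase oracle matters only where `unifAmp` is nonzero. -/
lemma Runs.groverLoop (hw : 0 < w) {d : ℕ} (hd : 2 * d ≤ w) {gates : List (Instr ι 14)}
    (hg : ∀ g ∈ gates, g.IsGate) {a : St} (h46 : a.v 46 = 4 ^ d - 1) (h47 : a.v 47 = 1)
    {χ : BitVec w → ℝ}
    (hχ : ∀ i s, Rel (a.set 43 i) s → ∀ y : BitVec w, y.toNat < 4 ^ d →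
      χ y = zPhase (Instr.basisList O s gates (basisWord y) 1))
    (j : ℕ) (i : ℕ) (s : CState w) (hs : Rel (a.set 43 j) s) (hj : (s.reg 64).toNat = j) :
    ∃ s', Rel (a.set 43 0) s' ∧ Runs O (.loop 64 (.seq (.seq (_root_.groverStep gates)
      (Blk.asg 43 (.op .sub (.v 43) (.c 1))).prog) (Exp.code (.v 43) 64)))
      (j * (4 * gates.length + 30) + 1) s
      (QState.onWord fun y => (groverAmp (unifAmp w d) χ i y : ℂ)) s'
      (QState.onWord fun y => (groverAmp (unifAmp w d) χ (i + j) y : ℂ)) := by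
  induction j generalizing i s with
  | zero =>
    exact ⟨s, hs, (Runs.loop_done (BitVec.eq_of_toNat_eq (by rw [hj]; rfl))).mono (by omega)⟩
  | succ j ih =>
    have hG := Runs.groverStep (O := O) hw hd hg (by rw [hs.1 46 (by omega)]; simpa using h46)
      (by rw [hs.1 47 (by omega)]; simpa using h47) (χ := χ)
      (φ := groverAmp (unifAmp w d) χ i) (by
        intro y
        by_cases hy : y.toNat < 4 ^ d
        · rw [hχ _ s hs y hy]
        · rw [groverAmp_eq_zero (by simp [unifAmp, hy]), mul_zero, mul_zero])
    obtain ⟨s₁, h₁, hR₁⟩ := Blk.runs_prog (k := 14) O hw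
      (Blk.asg 43 (.op .sub (.v 43) (.c 1))) hs (by
        simp [Blk.ok, Exp.ok, WordOp.okNat, Exp.eval, Nat.one_lt_two_pow hw.ne'])
    have e : Blk.exec O (Blk.asg 43 (.op .sub (.v 43) (.c 1))) (a.set 43 (j + 1)) = a.set 43 j := by
      simp [Blk.exec, Exp.eval, WordOp.evalNat, St.set]
    rw [e] at h₁
    obtain ⟨s₂, h₂, hv₂, -, hR₂⟩ := Exp.runs_code (k := 14) O hw (.v 43) h₁ (t := 64) le_rfl
      (by simp [Exp.ok])
    obtain ⟨s₃, h₃, hR₃⟩ := ih (i + 1) s₂ h₂ (by rw [hv₂]; simp [Exp.eval])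
    refine ⟨s₃, h₃, ?_⟩
    have hR := Runs.loop_more (a := 64) (s := s) (by
      intro h0; rw [h0] at hj; exact absurd hj (by simp)) ((hG.seq (hR₁ _)).seq (hR₂ _)) hR₃
    rw [show i + (j + 1) = i + 1 + j by ring]
    refine hR.mono ?_
    simp only [Blk.cost, Exp.cost]
    ring_nf; omega

lemma Conf.haltProb_seq {k : ℕ} {S : CState w → Prop} {T : ℕ} {P Q : Prog ι k}
    {K : List (Prog ι k)} {ψ : QState w k} : Conf.haltProb O S (T + 1) (.seq P Q :: K, s, ψ) =
      Conf.haltProb O S T (P :: Q :: K, s, ψ) := by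
  rw [Conf.haltProb_succ, Conf.step, Multiset.map_singleton, Multiset.sum_singleton]

/-- Grover's algorithm up to the measurement. -/
lemma Runs.grover_unitary (hw : 0 < w) {d : ℕ} (hd : 2 * d ≤ w) {gates : List (Instr ι 14)}
    (hg : ∀ g ∈ gates, g.IsGate) {a : St} (h46 : a.v 46 = 4 ^ d - 1) (h47 : a.v 47 = 1)
    {χ : BitVec w → ℝ}
    (hχ : ∀ i s, Rel (a.set 43 i) s → ∀ y : BitVec w, y.toNat < 4 ^ d →
      χ y = zPhase (Instr.basisList O s gates (basisWord y) 1))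
    (s : CState w) (hs : Rel a s) :
    ∃ s₁, Rel (a.set 43 0) s₁ ∧ ∀ K S T, Conf.haltProb O S T
      (.instr (.measure 42 0) :: .instr (.qxor 0 42) :: K, s₁,
        QState.onWord fun y => (groverAmp (unifAmp w d) χ (a.v 43) y : ℂ)) ≤
      clHaltProb O S (T + (a.v 43 * (4 * gates.length + 30) + 8)) (_root_.grover gates :: K) s := by
  have ha : a.set 43 (a.v 43) = a := by simp [St.set]
  obtain ⟨s₂, h₂, hv₂, -, hR₂⟩ := Exp.runs_code (k := 14) O hw (.v 43) hs (t := 64) le_rfl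
      (by simp [Exp.ok])
  obtain ⟨s₃, h₃, hR₃⟩ := Runs.groverLoop (O := O) hw hd hg h46 h47 hχ (a.v 43) 0 s₂
    (by rwa [ha]) hv₂
  have h0 : Runs O (.instr (.had 0 46)) 1 s (QState.zero w 14) s
      (QState.onWord fun y => (groverAmp (unifAmp w d) χ 0 y : ℂ)) := by
    refine Runs.instr _ ?_
    simp only [Instr.exec]
    congr 2
    rw [QState.zero_eq_onWord, QState.had_onWord]
    congr 1
    funext y
    rw [groverAmp, ← hadEntry_zero_eq_unifAmp hd (hs.1 46 (by omega) |>.trans h46)]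
    simp
  have hRW := (hR₂ (QState.onWord fun y => (groverAmp (unifAmp w d) χ 0 y : ℂ))).seq hR₃
  rw [zero_add] at hRW
  refine ⟨s₃, h₃, fun K S T => ?_⟩
  rw [← Conf.haltProb_seq]
  refine (hRW _ S _).trans ?_
  generalize hX : (Exp.v 43).cost + (a.v 43 * (4 * gates.length + 30) + 1) + 1 = X
  have hX' : T + (a.v 43 * (4 * gates.length + 30) + 8) = T + 1 + X + 1 + 1 + 1 + 1 := by
    simp only [Exp.cost] at hX; omega
  rw [hX', _root_.grover, clHaltProb_seq, clHaltProb]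
  refine le_trans ?_ (Conf.haltProb_le_succ O S _ _)
  refine le_trans ?_ (h0 _ S _)
  rw [Conf.haltProb_seq]
  exact le_rfl

/-- Grover's algorithm as a whole: up to the probabilities with which it is reached, the state after
the measurement with outcome `y` is classical. -/
lemma le_clHaltProb_grover (hw : 0 < w) {d : ℕ} (hd : 2 * d ≤ w) {gates : List (Instr ι 14)}
    (hg : ∀ g ∈ gates, g.IsGate) {a : St} (h46 : a.v 46 = 4 ^ d - 1) (h47 : a.v 47 = 1)
    {χ : BitVec w → ℝ}
    (hχ : ∀ i s, Rel (a.set 43 i) s → ∀ y : BitVec w, y.toNat < 4 ^ d →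
      χ y = zPhase (Instr.basisList O s gates (basisWord y) 1))
    (s : CState w) (hs : Rel a s) :
    ∃ s' : BitVec w → CState w, (∀ y, Rel ((a.set 43 0).set 42 y.toNat) (s' y)) ∧
      ∀ K S τ, ∑ y, groverAmp (unifAmp w d) χ (a.v 43) y ^ 2 * clHaltProb O S τ K (s' y) ≤
        clHaltProb O S (τ + (a.v 43 * (4 * gates.length + 30) + 10)) (grover gates :: K) s := by
  obtain ⟨s₃, h₃, hR⟩ := Runs.grover_unitary hw hd hg h46 h47 hχ s hs
  refine ⟨fun y => s₃.set 42 y, fun y => h₃.set 42 y, fun K S τ => ?_⟩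
  refine le_trans (le_of_eq ?_) ((hR K S (τ + 2)).trans (Conf.haltProb_mono O S _ (by omega)))
  generalize (a.v 43) = j
  rw [Conf.haltProb_succ, Conf.step, Multiset.map_map, Instr.exec, Multiset.map_map]
  refine Finset.sum_congr rfl fun y _ => ?_
  simp only [Function.comp_apply]
  rw [Conf.haltProb_succ, Conf.step, Instr.exec, Multiset.map_singleton, Multiset.map_singleton,
    Multiset.sum_singleton, show (s₃.set 42 y).reg 42 = y by simp [CState.set_reg],
    QState.project_onWord, Conf.haltProb_smul, clHaltProb]
  congr 1
  rw [Complex.norm_real, Real.norm_eq_abs, sq_abs]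

end

/-! ### Quantum search in a block of a table -/

/-- The states agree up to the registers from `40` on. -/
def St.Agree (a b : St) : Prop := b.m = a.m ∧ ∀ x < 40, b.v x = a.v x

namespace St.Agree
variable {a b c : St}

lemma refl (a : St) : a.Agree a := ⟨rfl, fun _ _ => rfl⟩

lemma set (h : a.Agree b) {x : ℕ} (hx : 40 ≤ x) (n : ℕ) : a.Agree (b.set x n) :=
  ⟨h.1, fun y hy => by rw [St.set_v, if_neg (by omega)]; exact h.2 y hy⟩

end St.Agree

section
variable {ι : Type}

/-- Given the word `3`, the index of a table entry, compute into the word `1` whether the entry at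
this index of the table at address (register) `10` is less than (register) `9`. -/
def testGates : List (Instr ι 14) :=
  [.qxor 4 10, .qop .add 5 4 3 (by decide) (by decide), .qload 6 5 (by decide), .qxor 7 9,
    .qop .lt 1 6 7 (by decide) (by decide)]

/-- Check the measurement outcome. -/
def checkBlk (ent : Blk ι) : Blk ι :=
  .seq (.asg 45 (.op .sub (.v 45) (.c 1))) (.ite (.op .lt (.v 42) (.op .mul (.v 4) (.v 4)))
    (.seq ent (.ite (.op .lt (.ld (.op .add (.v 10) (.v 41))) (.v 9))
      (.seq (.asg 40 (.c 1)) (.asg 45 (.c 0))) .skip)) .skip)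

/-- Run Grover's algorithm with the same number of iterations until a marked element is found, at
most as often as register `45` says. -/
def searchStage (gates : List (Instr ι 14)) (ent : Blk ι) : Prog ι 14 :=
  .while (.v 45) (.seq (Blk.asg 43 (.op .div (.op .sub (.v 44) (.c 1)) (.c 2))).prog
    (.seq (grover (gates ++ testGates)) (checkBlk ent).prog))

/-- Search for an `x` below the square of register `4` such that the table at address `10` contains
at the index `ent x` a number less than register `9`.  If one is found, register `40` becomes `1`
and register `41` becomes `ent x`, else register `40` becomes `0`. -/
def search (gates : List (Instr ι 14)) (ent : Blk ι) : Prog ι 14 :=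
  .seq (Blk.prog (.seq (.asg 40 (.c 0)) (.seq (.asg 44 (.c 1)) (.seq (.asg 47 (.c 1))
      (.asg 46 (.op .sub (.op .mul (.v 4) (.v 4)) (.c 1)))))))
    (.while (.op .mul (.op .eq (.v 40) (.c 0)) (.op .lt (.v 44)
        (.op .add (.op .mul (.c 2) (.v 4)) (.c 1))))
      (.seq (Blk.asg 45 (.v 3)).prog
        (.seq (searchStage gates ent) (Blk.asg 44 (.op .mul (.c 3) (.v 44))).prog)))

variable {w : ℕ} (O : BlackBox ι w)

/-- In the state `a`, the XOR instructions `gates` and the program `blk` compute the function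
`ent` below `4 ^ d`, where `2 ^ d` is in register `4`. -/
structure SearchInput (gates : List (Instr ι 14)) (blk : Blk ι) (ent : ℕ → ℕ) (d : ℕ) (a : St) :
    Prop where
  width : 2 * d ≤ w
  size : a.v 4 = 2 ^ d
  small : 6 * 4 ^ d < 2 ^ w
  isGate : ∀ g ∈ gates, g.IsGate
  add_ent : ∀ x < 4 ^ d, a.v 10 + ent x < 2 ^ w
  circuit : ∀ b s, a.Agree b → Rel b s → ∀ x : BitVec w, x.toNat < 4 ^ d →
    (Instr.basisList O s gates (basisWord x) 3).toNat = ent x.toNat ∧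
    ∀ i : Fin 14, i = 1 ∨ i = 4 ∨ i = 5 ∨ i = 6 ∨ i = 7 →
      Instr.basisList O s gates (basisWord x) i = 0
  block : ∀ b, a.Agree b → b.v 42 < 4 ^ d →
    blk.ok O b ∧ blk.exec O b = b.set 41 (ent (b.v 42))

variable {O} {gates : List (Instr ι 14)} {blk : Blk ι} {ent : ℕ → ℕ} {d : ℕ} {a : St}

lemma Instr.basisList_append {k : ℕ} (s : CState w) (L L' : List (Instr ι k))
    (x : Fin k → BitVec w) : basisList O s (L ++ L') x = basisList O s L' (basisList O s L x) := by
  induction L generalizing x with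
  | nil => rfl
  | cons g L ih => exact ih _

lemma SearchInput.zPhase_eq (hw : 0 < w) (h : SearchInput O gates blk ent d a) {b : St}
    {s : CState w} (hb : a.Agree b) (hs : Rel b s) (x : BitVec w) (hx : x.toNat < 4 ^ d) :
    zPhase (Instr.basisList O s (gates ++ testGates) (basisWord x) 1) =
      if a.m (a.v 10 + ent x.toNat) < a.v 9 then -1 else 1 := by
  apply zPhase_of_toNat
  obtain ⟨h3, h0⟩ := h.circuit b s hb hs x hx
  rw [Instr.basisList_append]
  generalize Instr.basisList O s gates (basisWord x) = y at h3 h0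
  have e : Instr.basisList O s testGates y 1 =
      WordOp.lt.eval (s.mem (s.reg 10 + y 3)) (s.reg 9) := by
    simp only [testGates, Instr.basisList, Instr.basis, QState.xorMap]
    simp [h0, WordOp.eval]
  have h10 : (s.reg 10).toNat = a.v 10 := by rw [hs.1 10 (by omega), hb.2 10 (by omega)]
  have h9 : (s.reg 9).toNat = a.v 9 := by rw [hs.1 9 (by omega), hb.2 9 (by omega)]
  have hadd : (s.reg 10 + y 3).toNat = a.v 10 + ent x.toNat := by
    rw [BitVec.toNat_add, h10, h3, Nat.mod_eq_of_lt (h.add_ent _ hx)]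
  rw [e, WordOp.toNat_eval hw .lt _ _ trivial, hs.2, hadd, h9, hb.1]
  rfl

/-- With one of the numbers of iterations that the search tries, the success probability is at least
`1 / 4`. -/
lemma exists_groverAmp_success (hd : 2 * d ≤ w) {f : BitVec w → Prop} [DecidablePred f]
    {χ : BitVec w → ℝ}
    (hχ : ∀ x : BitVec w, x.toNat < 4 ^ d → χ x = if f x then -1 else 1)
    (hf : ∃ x : BitVec w, x.toNat < 4 ^ d ∧ f x) :
    ∃ i : ℕ, 3 ^ i ≤ 2 * 2 ^ d ∧ 1 / 4 ≤ ∑ x ∈ Finset.univ.filter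
      (fun x : BitVec w => x.toNat < 4 ^ d ∧ f x), groverAmp (unifAmp w d) χ ((3 ^ i - 1) / 2)
        x ^ 2 := by
  set t := (Finset.univ.filter fun x : BitVec w => x.toNat < 4 ^ d ∧ f x).card with ht
  set t' := (Finset.univ.filter fun x : BitVec w => x.toNat < 4 ^ d ∧ ¬ f x).card with ht'
  have hr : ((1 / 2 : ℝ) ^ d) ≠ 0 := by positivity
  have hsum : ((1 / 2 : ℝ) ^ d) ^ 2 * t + ((1 / 2 : ℝ) ^ d) ^ 2 * t' = 1 := by
    refine Eq.trans ?_ (sum_unifAmp_sq hd)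
    have : ∀ x : BitVec w, unifAmp w d x ^ 2 =
        (if x.toNat < 4 ^ d ∧ f x then ((1 / 2 : ℝ) ^ d) ^ 2 else 0) +
        (if x.toNat < 4 ^ d ∧ ¬ f x then ((1 / 2 : ℝ) ^ d) ^ 2 else 0) := by
      intro x
      unfold unifAmp
      by_cases h1 : x.toNat < 4 ^ d <;> by_cases h2 : f x <;> simp [h1, h2]
    simp_rw [this]
    rw [Finset.sum_add_distrib, ← Finset.sum_filter, ← Finset.sum_filter, Finset.sum_const,
      Finset.sum_const, nsmul_eq_mul, nsmul_eq_mul]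
    ring
  have htpos : 1 ≤ t := by
    obtain ⟨x, hx⟩ := hf
    exact Finset.card_pos.mpr ⟨x, by simpa using hx⟩
  have htr : (1 : ℝ) ≤ t := by exact_mod_cast htpos
  set q := (1 / 2 : ℝ) ^ d * Real.sqrt t with hq
  have hq2 : q ^ 2 = ((1 / 2 : ℝ) ^ d) ^ 2 * t := by
    rw [hq, mul_pow, Real.sq_sqrt (by positivity)]
  have hq0 : 0 < q := by positivity
  have hq1 : q ≤ 1 := by
    have : 0 ≤ ((1 / 2 : ℝ) ^ d) ^ 2 * t' := by positivity
    nlinarith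
  have hsin : Real.sin (Real.arcsin q) = q := Real.sin_arcsin (by linarith) hq1
  obtain ⟨i, hi, hi'⟩ := exists_pow_three_mul (θ := Real.arcsin q) (Real.arcsin_pos.mpr hq0)
    (Real.arcsin_le_pi_div_two q)
  have hodd : 2 * ((3 ^ i - 1) / 2) + 1 = 3 ^ i := by
    have h1 : (3 ^ i) % 2 = 1 := by rw [Nat.pow_mod]; simp
    generalize 3 ^ i = m at h1
    omega
  refine ⟨i, ?_, ?_⟩
  · rw [hsin] at hi'
    have h2 : (1 / 2 : ℝ) ^ d ≤ q := by
      rw [hq]; exact le_mul_of_one_le_right (by positivity) (Real.one_le_sqrt.mpr htr)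
    have h3 : (3 : ℝ) ^ i * (1 / 2 : ℝ) ^ d ≤ 2 := (by gcongr : _ ≤ (3 : ℝ) ^ i * q).trans hi'
    rw [one_div, inv_pow, ← div_eq_mul_inv, div_le_iff₀ (by positivity)] at h3
    exact_mod_cast h3
  · rw [sum_sq_groverAmp_marked (u := unifAmp w d) (r := (1 / 2) ^ d)
      (P := fun x : BitVec w => x.toNat < 4 ^ d) (f := f) (θ := Real.arcsin q)
      hr (fun x => rfl) hχ (by rw [hsin, hq2, ht]) ?_ (by rw [hsin]; exact hq0.ne')]
    · have : (2 * (((3 ^ i - 1) / 2 : ℕ) : ℝ) + 1) = 3 ^ i := by exact_mod_cast hodd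
      rwa [this]
    · rw [Real.cos_sq', hsin, hq2]
      linarith

/-- The result of a search in the state `a` that found a marked element. -/
def Found (ent : ℕ → ℕ) (d : ℕ) (a b : St) : Prop :=
  b.v 40 = 1 ∧ ∃ x < 4 ^ d, a.m (a.v 10 + ent x) < a.v 9 ∧ b.v 41 = ent x

/-- A stage of the search: if with this number of iterations the success probability is at least
`1 / 4` (as `β` says), then the failure probability after `r` repetitions is at most
`(3 / 4) ^ r`. -/
lemma le_clHaltProb_searchStage (hw : 0 < w) (h : SearchInput O gates blk ent d a) {i : ℕ}
    {χ : BitVec w → ℝ}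
    (hχ : ∀ x : BitVec w, χ x = if a.m (a.v 10 + ent x.toNat) < a.v 9 then -1 else 1)
    {β : Prop} (hβ : β → 1 / 4 ≤ ∑ x ∈ Finset.univ.filter
      (fun x : BitVec w => x.toNat < 4 ^ d ∧ a.m (a.v 10 + ent x.toNat) < a.v 9),
        groverAmp (unifAmp w d) χ ((3 ^ i - 1) / 2) x ^ 2)
    {A : ℝ} (hA : A ≤ 1) {τ : ℕ} {K : List (Prog ι 14)} {S : CState w → Prop}
    (hK : ∀ b s, a.Agree b → b.v 46 = 4 ^ d - 1 → b.v 47 = 1 → b.v 44 = 3 ^ i →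
      Found ent d a b ∨ (b.v 40 = 0 ∧ ¬ β) → Rel b s → A ≤ clHaltProb O S τ K s)
    (r : ℕ) (b : St) (hb : a.Agree b) (h46 : b.v 46 = 4 ^ d - 1) (h47 : b.v 47 = 1)
    (h44 : b.v 44 = 3 ^ i) (h40 : b.v 40 = 0) (h45 : b.v 45 = r) (s : CState w) (hs : Rel b s) :
    A - (if β then (3 / 4) ^ r else 0) ≤ clHaltProb O S
      (τ + 2 + r * ((3 ^ i - 1) / 2 * (4 * gates.length + 50) + blk.cost + 100))
      (Exp.code (.v 45) 64 :: .loop 64 (.seq (.seq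
        (Blk.asg 43 (.op .div (.op .sub (.v 44) (.c 1)) (.c 2))).prog
        (.seq (grover (gates ++ testGates)) (checkBlk blk).prog)) (Exp.code (.v 45) 64)) :: K)
          s := by
  induction r generalizing b s with
  | zero =>
    obtain ⟨s₁, h₁, hv₁, -, hr⟩ := Exp.runs_code (k := 14) O hw (.v 45) hs (t := 64) le_rfl
      (by simp [Exp.ok])
    by_cases hb' : β
    · simp only [hb', if_true, pow_zero]
      have := clHaltProb_nonneg (k := 14) O S
      exact le_trans (by linarith) (this _ _ _)
    · simp only [hb', if_false, sub_zero, zero_mul, add_zero]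
      refine le_trans ?_ (clHaltProb_runs (τ := τ + 1) (hr _))
      rw [clHaltProb_loop, if_neg]
      · exact hK b s₁ hb h46 h47 h44 (Or.inr ⟨h40, hb'⟩) h₁
      · rw [not_not]
        exact BitVec.eq_of_toNat_eq (by rw [hv₁]; simp [Exp.eval, h45])
  | succ r ih =>
    obtain ⟨s₁, h₁, hv₁, -, hr⟩ := Exp.runs_code (k := 14) O hw (.v 45) hs (t := 64) le_rfl
      (by simp [Exp.ok])
    have hone : 1 < 2 ^ w := Nat.one_lt_two_pow hw.ne'
    have htwo : 2 < 2 ^ w := by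
      have := h.small; have : 0 < 4 ^ d := by positivity
      omega
    have h3 : 1 ≤ 3 ^ i := Nat.one_le_pow _ _ (by norm_num)
    obtain ⟨s₂, h₂, hr₂⟩ := Blk.runs_prog (k := 14) O hw
      (Blk.asg 43 (.op .div (.op .sub (.v 44) (.c 1)) (.c 2))) h₁ (by
        simp [Blk.ok, Exp.ok, WordOp.okNat, Exp.eval, hone, htwo, h44, h3])
    have e₂ : Blk.exec O (Blk.asg 43 (.op .div (.op .sub (.v 44) (.c 1)) (.c 2))) b =
        b.set 43 ((3 ^ i - 1) / 2) := by
      simp [Blk.exec, Exp.eval, WordOp.evalNat, h44]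
    rw [e₂] at h₂
    set b₂ := b.set 43 ((3 ^ i - 1) / 2) with hb₂
    have hab₂ : a.Agree b₂ := hb.set (by omega) _
    obtain ⟨s₃, h₃, hr₃⟩ := le_clHaltProb_grover (O := O) hw h.width (gates := gates ++ testGates)
      (by
        intro g hg
        rcases List.mem_append.mp hg with hg | hg
        · exact h.isGate g hg
        · simp only [testGates, List.mem_cons, List.not_mem_nil, or_false] at hg
          rcases hg with rfl | rfl | rfl | rfl | rfl <;> trivial) (a := b₂) (χ := χ)
      (by simpa [hb₂] using h46) (by simpa [hb₂] using h47) (by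
        intro j s hs x hx
        rw [hχ, h.zPhase_eq hw (hab₂.set (by omega) j) hs x hx]) s₂ h₂
    have h43 : b₂.v 43 = (3 ^ i - 1) / 2 := by simp [hb₂]
    rw [h43] at hr₃
    set C := (3 ^ i - 1) / 2 * (4 * gates.length + 50) + blk.cost + 100 with hC
    set p := fun y => groverAmp (unifAmp w d) χ ((3 ^ i - 1) / 2) y ^ 2 with hp
    set W := Prog.loop 64 (.seq (.seq
        (Blk.asg 43 (.op .div (.op .sub (.v 44) (.c 1)) (.c 2))).prog
        (.seq (grover (gates ++ testGates)) (checkBlk blk).prog)) (Exp.code (.v 45) 64)) with hW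
    -- the value of each measurement outcome
    have hval : ∀ y : BitVec w,
        A - (if y.toNat < 4 ^ d ∧ a.m (a.v 10 + ent y.toNat) < a.v 9 then 0 else
          (if β then (3 / 4) ^ r else 0)) ≤
        clHaltProb O S (τ + 2 + r * C + (checkBlk blk).cost)
          ((checkBlk blk).prog :: Exp.code (.v 45) 64 :: W :: K) (s₃ y) := by
      intro y
      set b₃ := (b₂.set 43 0).set 42 y.toNat with hb₃
      have hab₃ : a.Agree b₃ := (hab₂.set (by omega) _).set (by omega) _
      set b₄ := b₃.set 45 r with hb₄
      have hab₄ : a.Agree b₄ := hab₃.set (by omega) _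
      have h454 : b₃.v 45 = r + 1 := by simp [hb₃, hb₂, h45]
      have h42 : b₄.v 42 = y.toNat := by simp [hb₄, hb₃]
      have h4 : b₄.v 4 = 2 ^ d := by rw [hab₄.2 4 (by omega), h.size]
      have h44' : (2 : ℕ) ^ d * 2 ^ d = 4 ^ d := by rw [← mul_pow]; norm_num
      have hlt4 : 4 ^ d < 2 ^ w := by have := h.small; omega
      have h10 : b₄.v 10 = a.v 10 := hab₄.2 10 (by omega)
      have h9 : b₄.v 9 = a.v 9 := hab₄.2 9 (by omega)
      have ex1 : Blk.exec O (Blk.asg 45 (.op .sub (.v 45) (.c 1))) b₃ = b₄ := by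
        simp [Blk.exec, Exp.eval, WordOp.evalNat, h454, hb₄]
      have ok1 : Blk.ok O (Blk.asg 45 (.op .sub (.v 45) (.c 1))) b₃ := by
        simp [Blk.ok, Exp.ok, WordOp.okNat, Exp.eval, h454, hone]
      have hpost40 : b₄.v 40 = 0 := by simp [hb₄, hb₃, hb₂, h40]
      have hpost44 : b₄.v 44 = 3 ^ i := by simp [hb₄, hb₃, hb₂, h44]
      have hpost46 : b₄.v 46 = 4 ^ d - 1 := by simp [hb₄, hb₃, hb₂, h46]
      have hpost47 : b₄.v 47 = 1 := by simp [hb₄, hb₃, hb₂, h47]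
      have hpost45 : b₄.v 45 = r := by simp [hb₄]
      by_cases hy : y.toNat < 4 ^ d
      · obtain ⟨hok, hex⟩ := h.block b₄ hab₄ (by rw [h42]; exact hy)
        rw [h42] at hex
        have hadd := h.add_ent _ hy
        by_cases hm : a.m (a.v 10 + ent y.toNat) < a.v 9
        · simp only [hy, hm, and_self, if_true, sub_zero]
          have ex : (checkBlk blk).exec O b₃ =
              ((b₄.set 41 (ent y.toNat)).set 40 1).set 45 0 := by
            rw [checkBlk, Blk.exec, ex1]
            simp [Blk.exec, Exp.eval, WordOp.evalNat, h42, h4, h44', hy, hex, h10, h9, hm, hab₄.1]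
          have ok : (checkBlk blk).ok O b₃ := by
            rw [checkBlk, Blk.ok, ex1]
            refine ⟨ok1, ?_⟩
            simp [Blk.ok, Exp.ok, Exp.eval, WordOp.evalNat, WordOp.okNat, h42, h4, h44', hy,
              hlt4, hok, hex, h10, hadd, hone]
          obtain ⟨s₄, h₄, hr₄⟩ := Blk.runs_prog (k := 14) O hw (checkBlk blk) (h₃ y) ok
          rw [ex] at h₄
          refine le_trans ?_ (clHaltProb_runs (hr₄ _))
          obtain ⟨s₅, h₅, hv₅, -, hr₅⟩ := Exp.runs_code (k := 14) O hw (.v 45) h₄ (t := 64) le_rfl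
            (by simp [Exp.ok])
          refine le_trans ?_ (Conf.haltProb_mono O S _ (by simp only [Exp.cost]; omega :
            τ + 1 + (Exp.v 45).cost ≤ τ + 2 + r * C))
          refine le_trans ?_ (clHaltProb_runs (τ := τ + 1) (hr₅ _))
          rw [hW, clHaltProb_loop, if_neg]
          · refine hK _ s₅ (((hab₄.set (by omega) _).set (by omega) _).set (by omega) _)
              (by simpa using hpost46) (by simpa using hpost47) (by simpa using hpost44)
              (Or.inl ⟨by simp, y.toNat, hy, hm, by simp⟩) h₅
          · rw [not_not]
            exact BitVec.eq_of_toNat_eq (by rw [hv₅]; simp [Exp.eval])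
        · simp only [hy, hm, and_false, if_false]
          have ex : (checkBlk blk).exec O b₃ = b₄.set 41 (ent y.toNat) := by
            rw [checkBlk, Blk.exec, ex1]
            simp [Blk.exec, Exp.eval, WordOp.evalNat, h42, h4, h44', hy, hex, h10, h9, hm, hab₄.1]
          have ok : (checkBlk blk).ok O b₃ := by
            rw [checkBlk, Blk.ok, ex1]
            refine ⟨ok1, ?_⟩
            simp [Blk.ok, Exp.ok, Exp.eval, WordOp.evalNat, WordOp.okNat, h42, h4, h44', hy,
              hlt4, hok, hex, h10, hadd, hone]
          obtain ⟨s₄, h₄, hr₄⟩ := Blk.runs_prog (k := 14) O hw (checkBlk blk) (h₃ y) ok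
          rw [ex] at h₄
          refine le_trans ?_ (clHaltProb_runs (hr₄ _))
          exact ih _ (hab₄.set (by omega) _) (by simpa using hpost46) (by simpa using hpost47)
            (by simpa using hpost44) (by simpa using hpost40) (by simpa using hpost45) s₄ h₄
      · simp only [hy, false_and, if_false]
        have ex : (checkBlk blk).exec O b₃ = b₄ := by
          rw [checkBlk, Blk.exec, ex1]
          simp [Blk.exec, Exp.eval, WordOp.evalNat, h42, h4, h44', hy]
        have ok : (checkBlk blk).ok O b₃ := by
          rw [checkBlk, Blk.ok, ex1]
          refine ⟨ok1, ?_⟩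
          simp [Blk.ok, Exp.ok, Exp.eval, WordOp.evalNat, WordOp.okNat, h42, h4, h44', hy, hlt4]
        obtain ⟨s₄, h₄, hr₄⟩ := Blk.runs_prog (k := 14) O hw (checkBlk blk) (h₃ y) ok
        rw [ex] at h₄
        refine le_trans ?_ (clHaltProb_runs (hr₄ _))
        exact ih _ hab₄ hpost46 hpost47 hpost44 hpost40 hpost45 s₄ h₄
    have hsum : ∑ y, p y = 1 := sum_sq_groverAmp (sum_unifAmp_sq h.width)
      (fun x => by rw [hχ]; split_ifs <;> norm_num) _
    have hp0 : ∀ y, 0 ≤ p y := fun y => sq_nonneg _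
    have havg : A - (if β then (3 / 4) ^ (r + 1) else 0) ≤
        ∑ y, p y * clHaltProb O S (τ + 2 + r * C + (checkBlk blk).cost)
          ((checkBlk blk).prog :: Exp.code (.v 45) 64 :: W :: K) (s₃ y) := by
      refine le_trans ?_ (Finset.sum_le_sum fun y _ => mul_le_mul_of_nonneg_left (hval y) (hp0 y))
      by_cases hb' : β
      · have hs4 := hβ hb'
        simp only [hb', if_true]
        have : ∀ y : BitVec w, p y * (A - (if y.toNat < 4 ^ d ∧ a.m (a.v 10 + ent y.toNat) < a.v 9
            then 0 else (3 / 4) ^ r)) = p y * (A - (3 / 4) ^ r) +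
            (if y.toNat < 4 ^ d ∧ a.m (a.v 10 + ent y.toNat) < a.v 9 then p y else 0) *
              (3 / 4) ^ r := by
          intro y; split_ifs <;> ring
        simp_rw [this]
        rw [Finset.sum_add_distrib, ← Finset.sum_mul, ← Finset.sum_mul, hsum, ← Finset.sum_filter,
          pow_succ]
        have h34 : (0 : ℝ) ≤ (3 / 4) ^ r := by positivity
        have := mul_le_mul_of_nonneg_right hs4 h34
        simp only [hp]
        linarith
      · simp only [hb', if_false, ite_self, sub_zero]
        rw [← Finset.sum_mul, hsum, one_mul]
    refine havg.trans ((hr₃ _ S _).trans ?_)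
    have hT : τ + 2 + (r + 1) * C = τ + 2 + r * C + (checkBlk blk).cost +
        ((3 ^ i - 1) / 2 * (4 * (gates ++ testGates).length + 30) + 10) + 1 +
        (Blk.asg 43 (.op .div (.op .sub (.v 44) (.c 1)) (.c 2)) : Blk ι).cost + 1 + 1 + 1 +
        (Exp.v 45).cost + (C - ((checkBlk blk).cost +
        ((3 ^ i - 1) / 2 * (4 * (gates ++ testGates).length + 30) + 10) + 1 +
        (Blk.asg 43 (.op .div (.op .sub (.v 44) (.c 1)) (.c 2)) : Blk ι).cost + 1 + 1 + 1 +
        (Exp.v 45).cost)) := by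
      have : ((checkBlk blk).cost +
        ((3 ^ i - 1) / 2 * (4 * (gates ++ testGates).length + 30) + 10) + 1 +
        (Blk.asg 43 (.op .div (.op .sub (.v 44) (.c 1)) (.c 2)) : Blk ι).cost + 1 + 1 + 1 +
        (Exp.v 45).cost) ≤ C := by
        rw [hC]
        simp only [checkBlk, testGates, Blk.cost, Exp.cost, List.length_append, List.length_cons,
          List.length_nil]
        have e1 : (3 ^ i - 1) / 2 * (4 * (gates.length + (0 + 1 + 1 + 1 + 1 + 1)) + 30) =
          (3 ^ i - 1) / 2 * (4 * gates.length + 50) := by congr 1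
        rw [e1]
        omega
      have e2 : (r + 1) * C = r * C + C := by ring
      rw [e2]
      omega
    rw [hT]
    refine le_trans ?_ (Conf.haltProb_mono O S _ (Nat.le_add_right _ _))
    refine le_trans ?_ (clHaltProb_runs (hr _))
    rw [hW, clHaltProb_loop, if_pos, clHaltProb_seq, clHaltProb_seq]
    · refine le_trans ?_ (clHaltProb_runs (hr₂ _))
      rw [clHaltProb_seq]
    · intro h0
      rw [h0] at hv₁
      simp [Exp.eval, h45] at hv₁


/-- The rule for a stage of the search. -/
lemma Triple.searchStage (hw : 0 < w) (h : SearchInput O gates blk ent d a) {i : ℕ}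
    {β : Prop} {δ : NNReal} {r : ℕ} (hδ : β → (3 / 4) ^ r ≤ (δ : ℝ))
    (hβ : β → 1 / 4 ≤ ∑ x ∈ Finset.univ.filter
      (fun x : BitVec w => x.toNat < 4 ^ d ∧ a.m (a.v 10 + ent x.toNat) < a.v 9),
        groverAmp (unifAmp w d) (fun x => if a.m (a.v 10 + ent x.toNat) < a.v 9 then -1 else 1)
          ((3 ^ i - 1) / 2) x ^ 2) {Q : ℕ → St → Prop} {τ : ℕ}
    {b : St} (hb : a.Agree b) (h46 : b.v 46 = 4 ^ d - 1) (h47 : b.v 47 = 1)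
    (h44 : b.v 44 = 3 ^ i) (h40 : b.v 40 = 0) (h45 : b.v 45 = r)
    (hτ : r * ((3 ^ i - 1) / 2 * (4 * gates.length + 50) + blk.cost + 100) + 3 ≤ τ)
    (hQ : ∀ c, a.Agree c → c.v 46 = 4 ^ d - 1 → c.v 47 = 1 → c.v 44 = 3 ^ i →
      Found ent d a c ∨ (c.v 40 = 0 ∧ ¬ β) →
      Q (τ - (r * ((3 ^ i - 1) / 2 * (4 * gates.length + 50) + blk.cost + 100) + 3)) c) :
    Triple O δ (searchStage gates blk) Q τ b := fun s hs K S c hc hK => by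
  obtain ⟨t, rfl⟩ := Nat.exists_eq_add_of_le' hτ
  rw [Nat.add_sub_cancel] at hQ
  set C := r * ((3 ^ i - 1) / 2 * (4 * gates.length + 50) + blk.cost + 100) with hC
  have hδ0 : (0 : ℝ) ≤ δ * t := mul_nonneg δ.2 (Nat.cast_nonneg _)
  have := le_clHaltProb_searchStage hw h (i := i) (fun x => rfl) hβ (A := c - δ * t)
    (by linarith) (τ := t) (K := K) (S := S) (fun c' s' h1 h2 h3 h4 h5 h6 =>
      hK t (by omega) c' s' (hQ c' h1 h2 h3 h4 h5) h6) r b hb h46 h47 h44 h40 h45 s hs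
  rw [← hC] at this
  rw [_root_.searchStage, Prog.while, show t + (C + 3) = t + 2 + C + 1 by omega, clHaltProb_seq]
  refine le_trans ?_ this
  have h1 : (δ : ℝ) * ((t + 2 + C + 1 : ℕ) : ℝ) = δ * t + δ + δ * (2 + C) := by push_cast; ring
  have h2 : (0 : ℝ) ≤ δ * (2 + C) := mul_nonneg δ.2 (by positivity)
  rw [h1]
  split_ifs with hb'
  · have := hδ hb'
    linarith
  · have := δ.2
    linarith!

/-- The running time of the search. -/
def searchCost (gates : List (Instr ι 14)) (blk : Blk ι) (d R : ℕ) : ℕ :=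
  6 * 2 ^ d * (R * (4 * gates.length + blk.cost + 150) + 100) + 100

/-- The rule for the search.  An element that is reported is always marked; if `β` holds, then up to
the error probability that is charged, a marked element is found if there is one. -/
lemma Triple.search (hw : 0 < w) (h : SearchInput O gates blk ent d a)
    {β : Prop} {δ : NNReal} (hδ : β → (3 / 4) ^ (a.v 3) ≤ (δ : ℝ)) {Q : ℕ → St → Prop} {τ : ℕ}
    (hτ : searchCost gates blk d (a.v 3) ≤ τ)
    (hQ : ∀ τ' b, τ - searchCost gates blk d (a.v 3) ≤ τ' → τ' ≤ τ → a.Agree b →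
      Found ent d a b ∨ (b.v 40 = 0 ∧ (β → ∀ x < 4 ^ d, ¬ a.m (a.v 10 + ent x) < a.v 9)) →
      Q τ' b) :
    Triple O δ (search gates blk) Q τ a := by
  set R := a.v 3 with hR
  set U := R * (4 * gates.length + blk.cost + 150) + 100 with hU
  have hcost : searchCost gates blk d R = 6 * 2 ^ d * U + 100 := rfl
  rw [hcost] at hτ hQ
  have h44' : (2 : ℕ) ^ d * 2 ^ d = 4 ^ d := by rw [← mul_pow]; norm_num
  have h2d : 1 ≤ 2 ^ d := Nat.one_le_two_pow
  have h24 : 2 ^ d ≤ 4 ^ d := Nat.pow_le_pow_left (by norm_num) d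
  have h4d : 1 ≤ 4 ^ d := h2d.trans h24
  have hsmall := h.small
  have hsize := h.size
  have hlt4 : 4 ^ d < 2 ^ w := by omega
  have hone : 1 < 2 ^ w := Nat.one_lt_two_pow hw.ne'
  refine Triple.seq (by omega) (Triple.blk hw _ ?_ (by simp [Blk.cost, Exp.cost]; omega) ?_)
  · simp [Blk.ok, Blk.exec, Exp.ok, Exp.eval, WordOp.okNat, WordOp.evalNat, hsize, h44', hone, hlt4]
    omega
  -- a stage that succeeds if there is a marked element
  obtain ⟨i₀, hi₀⟩ : ∃ i₀, 3 ^ i₀ ≤ 2 * 2 ^ d ∧ ((∃ x < 4 ^ d, a.m (a.v 10 + ent x) < a.v 9) →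
      1 / 4 ≤ ∑ x ∈ Finset.univ.filter
      (fun x : BitVec w => x.toNat < 4 ^ d ∧ a.m (a.v 10 + ent x.toNat) < a.v 9),
        groverAmp (unifAmp w d) (fun x => if a.m (a.v 10 + ent x.toNat) < a.v 9 then -1 else 1)
          ((3 ^ i₀ - 1) / 2) x ^ 2) := by
    by_cases hex : ∃ x < 4 ^ d, a.m (a.v 10 + ent x) < a.v 9
    · obtain ⟨x, hx, hm⟩ := hex
      have hxw : (BitVec.ofNat w x).toNat = x := by
        rw [BitVec.toNat_ofNat]; exact Nat.mod_eq_of_lt (by omega)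
      obtain ⟨i₀, h1, h2⟩ := exists_groverAmp_success (w := w) h.width
        (f := fun x => a.m (a.v 10 + ent x.toNat) < a.v 9)
        (χ := fun x => if a.m (a.v 10 + ent x.toNat) < a.v 9 then -1 else 1) (fun x _ => rfl)
        ⟨BitVec.ofNat w x, by rwa [hxw], by rwa [hxw]⟩
      exact ⟨i₀, h1, fun _ => h2⟩
    · exact ⟨0, by simpa using (by omega : 1 ≤ 2 * 2 ^ d), fun h => (hex h).elim⟩
  obtain ⟨hi₁, hi₂⟩ := hi₀
  set τe := τ - (6 * 2 ^ d * U + 100) with hτe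
  refine Triple.while_ hw _ (fun τ' b => a.Agree b ∧ b.v 46 = 4 ^ d - 1 ∧ b.v 47 = 1 ∧
    ∃ i, b.v 44 = 3 ^ i ∧ 3 ^ i ≤ 6 * 2 ^ d ∧ ((Found ent d a b ∧ τe + 40 ≤ τ') ∨
      (b.v 40 = 0 ∧ τe + 40 + (6 * 2 ^ d - 3 ^ i) * U ≤ τ' ∧
        (β → (∃ x < 4 ^ d, a.m (a.v 10 + ent x) < a.v 9) → i ≤ i₀)))) ?_ ?_
  · rintro τ' hτ' b ⟨hb, h46, h47, i, h44, hi, hcase⟩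
    have hb4 : b.v 4 = 2 ^ d := by rw [hb.2 4 (by omega), hsize]
    have hb3 : b.v 3 = R := hb.2 3 (by omega)
    have hτ40 : τe + 40 ≤ τ' := by
      rcases hcase with h | h
      · exact h.2
      · omega
    refine ⟨?_, by simp only [Exp.cost]; omega, fun he => ?_, fun he => ?_⟩
    · simp only [Exp.ok, Exp.eval, WordOp.okNat, WordOp.evalNat, hb4]
      refine ⟨⟨by norm_num, by omega, trivial⟩, ⟨by norm_num, ⟨⟨by omega, by norm_num, by omega⟩,
        by omega, by omega⟩, trivial⟩, ?_⟩
      refine lt_of_le_of_lt ?_ hone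
      by_cases h1 : b.v 40 = 0 <;> by_cases h2 : b.v 44 < 2 * 2 ^ d + 1 <;>
        simp only [h1, h2, if_true, if_false] <;> norm_num
    · refine hQ _ b (by simp only [Exp.cost]; omega) (by omega) hb ?_
      rcases hcase with h | ⟨h40, -, hi'⟩
      · exact Or.inl h.1
      · refine Or.inr ⟨h40, fun hβ x hx hm => ?_⟩
        have h1 := hi' hβ ⟨x, hx, hm⟩
        have h2 : 3 ^ i ≤ 3 ^ i₀ := Nat.pow_le_pow_right (by norm_num) h1
        simp only [Exp.eval, WordOp.evalNat, h40, hb4, h44] at he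
        simp only [if_true, one_mul] at he
        rw [if_pos (by omega)] at he
        exact absurd he (by norm_num)
    · rcases hcase with ⟨⟨h40, -⟩, -⟩ | ⟨h40, hτi, hi'⟩
      · simp [Exp.eval, WordOp.evalNat, h40] at he
      have hJ : 3 ^ i ≤ 2 * 2 ^ d := by
        by_contra hcon
        simp only [Exp.eval, WordOp.evalNat, h40, hb4, h44] at he
        rw [if_neg (by omega : ¬ (3 ^ i < 2 * 2 ^ d + 1))] at he
        simp at he
      have h3 : 1 ≤ 3 ^ i := Nat.one_le_pow _ _ (by norm_num)
      have hmul : (6 * 2 ^ d - 3 ^ i) * U = (6 * 2 ^ d - 3 ^ (i + 1)) * U + 2 * (3 ^ i * U) := by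
        have : 6 * 2 ^ d - 3 ^ i = 6 * 2 ^ d - 3 ^ (i + 1) + 2 * 3 ^ i := by rw [pow_succ]; omega
        rw [this]; ring
      have hstage : R * ((3 ^ i - 1) / 2 * (4 * gates.length + 50) + blk.cost + 100) + 100 ≤
          3 ^ i * U := by
        have e1 : (3 ^ i - 1) / 2 * (4 * gates.length + 50) + blk.cost + 100 ≤
            3 ^ i * (4 * gates.length + blk.cost + 150) := by
          calc _ ≤ 3 ^ i * (4 * gates.length + 50) + 3 ^ i * blk.cost + 3 ^ i * 100 := by
                gcongr
                · omega
                · exact Nat.le_mul_of_pos_left _ h3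
                · omega
            _ = _ := by ring
        calc _ ≤ R * (3 ^ i * (4 * gates.length + blk.cost + 150)) + 3 ^ i * 100 := by
              gcongr
              omega
          _ = _ := by rw [hU]; ring
      set b₁ := b.set 45 R with hb₁
      have ex1 : Blk.exec O (Blk.asg 45 (.v 3)) b = b₁ := by simp [Blk.exec, Exp.eval, hb3, hb₁]
      refine Triple.seq (by simp only [Exp.cost]; omega) (Triple.blk hw _ (by simp [Blk.ok, Exp.ok])
        (by simp only [Exp.cost, Blk.cost]; omega) ?_)
      rw [ex1]
      refine Triple.seq (by simp only [Exp.cost, Blk.cost]; omega) ?_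
      refine Triple.searchStage hw h (i := i) (r := R)
        (β := β ∧ (∃ x < 4 ^ d, a.m (a.v 10 + ent x) < a.v 9) ∧ i = i₀) (fun hβ => hδ hβ.1)
        (fun hβ => by rw [hβ.2.2]; exact hi₂ hβ.2.1) (hb.set (by omega) _)
          (by simpa [hb₁] using h46)
        (by simpa [hb₁] using h47) (by simpa [hb₁] using h44) (by simpa [hb₁] using h40)
        (by simp [hb₁]) (by simp only [Exp.cost, Blk.cost]; omega) ?_
      intro c hc h46 h47 h44 hcase
      have ex2 : Blk.exec O (Blk.asg 44 (.op .mul (.c 3) (.v 44))) c = c.set 44 (3 ^ (i + 1)) := by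
        simp [Blk.exec, Exp.eval, WordOp.evalNat, h44, pow_succ, mul_comm]
      refine Triple.blk hw _ ?_ (by simp only [Exp.cost, Blk.cost]; omega) ?_
      · simp only [Blk.ok, Exp.ok, Exp.eval, WordOp.okNat, h44]
        exact ⟨by norm_num, by omega, by norm_num, by omega⟩
      rw [ex2]
      refine ⟨hc.set (by omega) _, by simpa using h46, by simpa using h47, i + 1, by simp,
        by rw [pow_succ]; omega, ?_⟩
      rcases hcase with hf | ⟨h40, hn⟩
      · refine Or.inl ⟨?_, by simp only [Exp.cost, Blk.cost]; omega⟩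
        obtain ⟨hf1, x, hx, hm, he⟩ := hf
        exact ⟨by simpa using hf1, x, hx, hm, by simpa using he⟩
      · refine Or.inr ⟨by simpa using h40, by simp only [Exp.cost, Blk.cost]; omega, ?_⟩
        intro hβ hex
        have h1 := hi' hβ hex
        rcases h1.lt_or_eq with h2 | h2
        · omega
        · exact (hn ⟨hβ, hex, h2⟩).elim
  · refine ⟨?_, ?_, ?_, 0, ?_, ?_, Or.inr ⟨?_, ?_, ?_⟩⟩
    · simp only [Blk.exec]
      exact (((St.Agree.refl a).set (by omega) _).set (by omega) _).set (by omega) _ |>.set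
        (by omega) _
    · simp [Blk.exec, Exp.eval, WordOp.evalNat, hsize, h44']
    · simp [Blk.exec, Exp.eval]
    · simp [Blk.exec, Exp.eval]
    · rw [pow_zero]; omega
    · simp [Blk.exec, Exp.eval]
    · have : (6 * 2 ^ d - 3 ^ 0) * U + U = 6 * 2 ^ d * U := by
        rw [Nat.sub_mul, pow_zero, one_mul]
        exact Nat.sub_add_cancel (Nat.le_mul_of_pos_left _ (by omega))
      simp only [Blk.cost, Exp.cost]
      omega
    · intro _ _; omega

end

/-! ### Bipartite matchings -/

section matching
variable {n : ℕ} {G : SimpleGraph (Fin n)} {side : G.Coloring Bool}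

/-- The array `mate` describes a matching of `G`: it holds `0` for free vertices and `u + 1` for
vertices matched with `u`. -/
def IsMate (G : SimpleGraph (Fin n)) (mate : ℕ → ℕ) : Prop :=
  ∀ v : Fin n, mate v ≠ 0 → ∃ u : Fin n, mate v = u + 1 ∧ mate u = v + 1 ∧ G.Adj v u

/-- The number of edges of the matching, counted by their endpoints on the side `true`. -/
noncomputable def mateSize (side : G.Coloring Bool) (mate : ℕ → ℕ) : ℕ :=
  (Finset.univ.filter fun v : Fin n => side v = true ∧ mate v ≠ 0).card

/-- Every matching of `G` has at most `k` edges more than `mate`. -/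
def Deficiency (side : G.Coloring Bool) (mate : ℕ → ℕ) (k : ℕ) : Prop :=
  ∀ M : G.Subgraph, M.IsMatching → M.edgeSet.ncard ≤ mateSize side mate + k

lemma side_of_adj (side : G.Coloring Bool) {v u : Fin n} (h : G.Adj v u) : side v = !side u := by
  have := side.valid h
  cases hv : side v <;> cases hu : side u <;> simp_all

/-- Approximate linear programming duality: potentials `π`, `p` that cover each edge at least `K`
times, vanish on free vertices and cover each edge of `mate` at most `D` times. -/
lemma mul_ncard_edgeSet_le {mate : ℕ → ℕ} (hm : IsMate G mate) {K D : ℕ} {π p : ℕ → ℕ}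
    (hK : ∀ v u : Fin n, side v = true → G.Adj v u → K ≤ π v + p u)
    (hD : ∀ v u : Fin n, side v = true → mate v = u + 1 → π v + p u ≤ D)
    (hπ : ∀ v : Fin n, side v = true → mate v = 0 → π v = 0)
    (hp : ∀ u : Fin n, side u = false → mate u = 0 → p u = 0)
    {M : G.Subgraph} (hM : M.IsMatching) : K * M.edgeSet.ncard ≤ D * mateSize side mate := by
  choose! f hf using fun v (hv : v ∈ M.verts) => (hM hv).exists
  have huniq : ∀ {v u u'}, M.Adj v u → M.Adj v u' → u = u' := fun h h' =>
    (hM h.fst_mem).unique h h'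
  set S := Finset.univ.filter fun v : Fin n => side v = true ∧ v ∈ M.verts with hS
  have hfS : ∀ v ∈ S, M.Adj v (f v) := fun v hv => hf v (by simp [hS] at hv; exact hv.2)
  have hinj : Set.InjOn f S := by
    intro v hv v' hv' h
    have h1 := hfS v hv
    have h2 := hfS v' hv'
    rw [← h] at h2
    exact huniq h1.symm h2.symm
  have hcard : M.edgeSet.ncard ≤ S.card := by
    have : M.edgeSet ⊆ ((S.image fun v => s(v, f v) : Finset (Sym2 (Fin n))) : Set _) := by
      intro e
      induction e with
      | _ a b =>
        intro he
        rw [SimpleGraph.Subgraph.mem_edgeSet] at he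
        have hab := side_of_adj side he.adj_sub
        rw [Finset.coe_image]
        cases ha : side a with
        | true =>
          refine ⟨a, by simp [hS, ha, he.fst_mem], ?_⟩
          simp only [huniq (hf a he.fst_mem) he]
        | false =>
          have hb : side b = true := by rw [ha] at hab; simpa using hab.symm
          refine ⟨b, by simp [hS, hb, he.snd_mem], ?_⟩
          simp only [huniq (hf b he.snd_mem) he.symm, Sym2.eq_swap]
    calc _ ≤ ((S.image fun v => s(v, f v) : Finset (Sym2 (Fin n))) : Set _).ncard :=
          Set.ncard_le_ncard this (Finset.finite_toSet _)
      _ ≤ _ := by rw [Set.ncard_coe_finset]; exact Finset.card_image_le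
  set Lm := Finset.univ.filter fun v : Fin n => side v = true ∧ mate v ≠ 0 with hLm
  choose! g hg using hm
  have h1 : K * S.card ≤ ∑ v ∈ S, (π v + p (f v)) := by
    rw [mul_comm, ← smul_eq_mul]
    refine Finset.card_nsmul_le_sum _ _ _ fun v hv => hK v (f v) ?_ (hfS v hv).adj_sub
    simp [hS] at hv; exact hv.1
  have h2 : ∑ v ∈ S, π v ≤ ∑ v ∈ Lm, π v := by
    refine Finset.sum_le_sum_of_ne_zero fun v hv h0 => ?_
    simp only [hS, Finset.mem_filter, Finset.mem_univ, true_and] at hv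
    simp only [hLm, Finset.mem_filter, Finset.mem_univ, true_and]
    exact ⟨hv.1, fun h => h0 (hπ v hv.1 h)⟩
  have h3 : ∑ v ∈ S, p (f v) ≤ ∑ v ∈ Lm, p (g v) := by
    have e : ∑ v ∈ S, p (f v) = ∑ u ∈ S.image f, p u := (Finset.sum_image (f := fun u : Fin n =>
      p u) hinj).symm
    have hginj : Set.InjOn g Lm := by
      intro v hv v' hv' h
      simp only [hLm, Finset.coe_filter, Finset.mem_univ, true_and, Set.mem_ofPred_eq] at hv hv'
      have h4 := (hg v hv.2).2.1
      have h5 := (hg v' hv'.2).2.1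
      rw [h, h5] at h4
      exact Fin.ext (by omega)
    have e' : ∑ v ∈ Lm, p (g v) = ∑ u ∈ Lm.image g, p u := (Finset.sum_image (f := fun u : Fin n =>
      p u) hginj).symm
    rw [e, e']
    refine Finset.sum_le_sum_of_ne_zero fun u hu h0 => ?_
    obtain ⟨v, hv, rfl⟩ := Finset.mem_image.mp hu
    have hadj := (hfS v hv).adj_sub
    have hsv : side v = true := by simp [hS] at hv; exact hv.1
    have hside : side (f v) = false := by
      have := side_of_adj side hadj; rw [hsv] at this; simpa using this.symm
    have hm0 : mate (f v) ≠ 0 := fun h => h0 (hp _ hside h)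
    obtain ⟨h4, h5, h6⟩ := hg _ hm0
    have hside' := side_of_adj side h6
    rw [hside] at hside'
    have h7 : mate (g (f v)) ≠ 0 := by omega
    refine Finset.mem_image.mpr ⟨g (f v), ?_, ?_⟩
    · simp only [hLm, Finset.mem_filter, Finset.mem_univ, true_and]
      exact ⟨by simpa using hside'.symm, h7⟩
    · have := (hg _ h7).1
      exact Fin.ext (by omega)
  have h4 : ∑ v ∈ Lm, (π v + p (g v)) ≤ Lm.card * D := by
    rw [← smul_eq_mul]
    refine Finset.sum_le_card_nsmul _ _ _ fun v hv => ?_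
    simp only [hLm, Finset.mem_filter, Finset.mem_univ, true_and] at hv
    exact hD v _ hv.1 (hg v hv.2).1
  rw [Finset.sum_add_distrib] at h1 h4
  calc K * M.edgeSet.ncard ≤ K * S.card := Nat.mul_le_mul_left _ hcard
    _ ≤ Lm.card * D := by omega
    _ = _ := by rw [mul_comm]; rfl

/-- A matching array without deficiency in the memory. -/
lemma holdsMaximumMatching_of_isMate {w : ℕ} {s : CState w} {mate : ℕ → ℕ}
    (hs : ∀ v : Fin n, (s.mem (BitVec.ofNat w v)).toNat = mate v) (hm : IsMate G mate)
    (hd : Deficiency side mate 0) : HoldsMaximumMatching G s := by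
  let M : G.Subgraph :=
    { verts := {v | mate v ≠ 0}
      Adj := fun v u => mate v = u + 1
      adj_sub := by
        intro v u h
        obtain ⟨u', h1, -, h3⟩ := hm v (by omega)
        rwa [Fin.ext (by omega : u.val = u'.val)]
      edge_vert := fun {v u} h => by simp only [Set.mem_ofPred_eq]; omega
      symm := by
        constructor
        intro v u h
        obtain ⟨u', h1, h2, -⟩ := hm v (by omega)
        rwa [Fin.ext (by omega : u.val = u'.val)] }
  have hM : M.IsMatching := by
    intro v hv
    obtain ⟨u, h1, h2, h3⟩ := hm v hv
    exact ⟨u, h1, fun u' h' => Fin.ext (by simp only [M] at h'; omega)⟩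
  refine ⟨M, ⟨hM, fun M' hM' => (hd M' hM').trans ?_⟩, ?_, ?_⟩
  · have hm' := hm
    choose! g hg using hm'
    rw [add_zero, mateSize, ← Set.ncard_coe_finset]
    refine Set.ncard_le_ncard_of_injOn (fun v => s(v, g v)) ?_ ?_ (Set.toFinite _)
    · intro v hv
      simp only [Finset.coe_filter, Finset.mem_univ, true_and, Set.mem_ofPred_eq] at hv
      rw [SimpleGraph.Subgraph.mem_edgeSet]
      exact (hg v hv.2).1
    · intro v hv v' hv' h
      simp only [Finset.coe_filter, Finset.mem_univ, true_and, Set.mem_ofPred_eq] at hv hv'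
      simp only [Sym2.eq_iff] at h
      rcases h with h | h
      · exact h.1
      · have := side_of_adj side (hg v' hv'.2).2.2
        rw [← h.1, hv.1, hv'.1] at this
        simp at this
  · intro v hv
    rw [hs]
    simpa [M] using hv
  · intro v u h
    rw [hs]
    exact h

end matching

/-! ### The memory as a table -/

infixl:65 " +ₑ " => Exp.op WordOp.add
infixl:65 " -ₑ " => Exp.op WordOp.sub
infixl:70 " *ₑ " => Exp.op WordOp.mul
infix:50 " <ₑ " => Exp.op WordOp.lt

/-- The memory that consists of rows of length `Z`. -/
def flat (Z : ℕ) (C : ℕ → ℕ → ℕ) : ℕ → ℕ := fun b => C (b / Z) (b % Z)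

/-- Change one cell of a table. -/
def upd (C : ℕ → ℕ → ℕ) (r i x : ℕ) : ℕ → ℕ → ℕ := Function.update C r (Function.update (C r) i x)

lemma upd_apply (C : ℕ → ℕ → ℕ) (r i x r' j : ℕ) :
    upd C r i x r' j = if r' = r ∧ j = i then x else C r' j := by
  unfold upd
  by_cases hr : r' = r
  · subst hr
    by_cases hj : j = i <;> simp [hj]
  · simp [hr]

lemma upd_of_ne (C : ℕ → ℕ → ℕ) {r r' : ℕ} (h : r' ≠ r) (i x : ℕ) : upd C r i x r' = C r' := by
  simp [upd, h]

lemma flat_read {Z i : ℕ} (C : ℕ → ℕ → ℕ) (r : ℕ) (hi : i < Z) : flat Z C (r * Z + i) = C r i := by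
  have hZ : 0 < Z := by omega
  unfold flat
  rw [add_comm, Nat.add_mul_div_right _ _ hZ, Nat.add_mul_mod_self_right, Nat.mod_eq_of_lt hi,
    Nat.div_eq_of_lt hi, zero_add]

lemma flat_write {Z i : ℕ} (C : ℕ → ℕ → ℕ) (r x : ℕ) (hi : i < Z) :
    Function.update (flat Z C) (r * Z + i) x = flat Z (upd C r i x) := by
  have hZ : 0 < Z := by omega
  funext b
  by_cases hb : b = r * Z + i
  · subst hb
    rw [Function.update_self, flat_read _ _ hi, upd_apply, if_pos ⟨rfl, rfl⟩]
  · rw [Function.update_of_ne hb, flat, flat, upd_apply, if_neg]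
    rintro ⟨h1, h2⟩
    apply hb
    rw [← h1, ← h2, mul_comm, Nat.div_add_mod]

/-- The address of a cell, where register `1` holds the length of the rows. -/
def cellE (r e : Exp) : Exp := (r *ₑ .v 1) +ₑ e

/-- The memory of `a` is the table `C` with rows of length `Z`; words are below `M`. -/
structure Tab (M Z : ℕ) (C : ℕ → ℕ → ℕ) (a : St) : Prop where
  mem : a.m = flat Z C
  reg : a.v 1 = Z
  pos : 0 < Z
  big : 64 * (Z * Z) ≤ M

/-- The expression `e` does not overflow and has the value `x`. -/
def Val (M : ℕ) (a : St) (e : Exp) (x : ℕ) : Prop := e.ok M a ∧ e.eval a = x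

namespace Val
variable {M Z : ℕ} {C : ℕ → ℕ → ℕ} {a : St} {e f r : Exp} {x y i ρ : ℕ}

lemma reg (y : ℕ) (h : a.v y = x) (hy : y < 64 := by norm_num) : Val M a (.v y) x := ⟨hy, h⟩

lemma const (h : x < M) : Val M a (.c x) x := ⟨h, rfl⟩

lemma add (he : Val M a e x) (hf : Val M a f y) (h : x + y < M) : Val M a (e +ₑ f) (x + y) := by
  obtain ⟨h1, rfl⟩ := he; obtain ⟨h2, rfl⟩ := hf; exact ⟨⟨h1, h2, h⟩, rfl⟩

lemma sub (he : Val M a e x) (hf : Val M a f y) (h : y ≤ x) : Val M a (e -ₑ f) (x - y) := by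
  obtain ⟨h1, rfl⟩ := he; obtain ⟨h2, rfl⟩ := hf; exact ⟨⟨h1, h2, h⟩, rfl⟩

lemma mul (he : Val M a e x) (hf : Val M a f y) (h : x * y < M) : Val M a (e *ₑ f) (x * y) := by
  obtain ⟨h1, rfl⟩ := he; obtain ⟨h2, rfl⟩ := hf; exact ⟨⟨h1, h2, h⟩, rfl⟩

lemma div (he : Val M a e x) (hf : Val M a f y) : Val M a (.op .div e f) (x / y) := by
  obtain ⟨h1, rfl⟩ := he; obtain ⟨h2, rfl⟩ := hf; exact ⟨⟨h1, h2, trivial⟩, rfl⟩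

lemma lt (he : Val M a e x) (hf : Val M a f y) : Val M a (e <ₑ f) (if x < y then 1 else 0) := by
  obtain ⟨h1, rfl⟩ := he; obtain ⟨h2, rfl⟩ := hf; exact ⟨⟨h1, h2, trivial⟩, rfl⟩

lemma addr (hT : Tab M Z C a) (hr : Val M a r ρ) (he : Val M a e i) (hρ : ρ < 16 + Z)
    (hi : i < Z) : Val M a (cellE r e) (ρ * Z + i) := by
  have hZ := hT.pos
  have hM := hT.big
  have h1 : (ρ + 1) * Z ≤ 32 * Z * Z := Nat.mul_le_mul_right _ (by omega)
  have h2 : 0 < Z * Z := Nat.mul_pos hZ hZ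
  have h3 : (ρ + 1) * Z = ρ * Z + Z := by ring
  have h4 : 32 * Z * Z = 32 * (Z * Z) := by ring
  exact (hr.mul (.reg 1 hT.reg) (by omega)).add he (by omega)

/-- Reading a cell. -/
lemma cell (hT : Tab M Z C a) (hr : Val M a r ρ) (he : Val M a e i) (hi : i < Z)
    (hρ : ρ < 16 + Z) : Val M a (.ld (cellE r e)) (C ρ i) := by
  obtain ⟨h1, h2⟩ := addr hT hr he hρ hi
  refine ⟨h1, ?_⟩
  rw [Exp.eval, h2, hT.mem, flat_read _ _ hi]

end Val

lemma Tab.set {M Z : ℕ} {C : ℕ → ℕ → ℕ} {a : St} (h : Tab M Z C a) (x n : ℕ)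
    (hx : x ≠ 1 := by norm_num) : Tab M Z C (a.set x n) :=
  ⟨h.mem, by rw [St.set_v, if_neg hx.symm, h.reg], h.pos, h.big⟩

/-- The program does not overflow and leads from `a` to a state with property `P`. -/
def Blk.Sat {ι : Type} {w : ℕ} (O : BlackBox ι w) (B : Blk ι) (a : St) (P : St → Prop) : Prop :=
  B.ok O a ∧ P (B.exec O a)

namespace Blk.Sat
variable {ι : Type} {w : ℕ} {O : BlackBox ι w} {B B' : Blk ι} {a : St} {P : St → Prop} {Z : ℕ}
  {C : ℕ → ℕ → ℕ} {e f r : Exp} {x y i ρ : ℕ}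

lemma skip (h : P a) : Blk.Sat O .skip a P := ⟨trivial, h⟩

lemma seq (h : B.Sat O a fun b => B'.Sat O b P) : (B.seq B').Sat O a P := ⟨⟨h.1, h.2.1⟩, h.2.2⟩

lemma asg (y : ℕ) (he : Val (2 ^ w) a e x) (h : P (a.set y x)) (hy : y < 64 := by norm_num) :
    (Blk.asg y e).Sat O a P := by
  obtain ⟨h1, rfl⟩ := he; exact ⟨⟨hy, h1⟩, h⟩

lemma qry (y : ℕ) {p : ι} (he : Val (2 ^ w) a e x) (hf : Val (2 ^ w) a f i)
    (h : P (a.set y (O.nat p x i))) (hy : y < 64 := by norm_num) :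
    (Blk.qry y p e f).Sat O a P := by
  obtain ⟨h1, rfl⟩ := he; obtain ⟨h2, rfl⟩ := hf; exact ⟨⟨hy, h1, h2⟩, h⟩

/-- Writing a cell. -/
lemma sto (hT : Tab (2 ^ w) Z C a) (hr : Val (2 ^ w) a r ρ) (he : Val (2 ^ w) a e i)
    (hf : Val (2 ^ w) a f x) (hi : i < Z) (hρ : ρ < 16 + Z)
    (h : ∀ b : St, b.v = a.v → Tab (2 ^ w) Z (upd C ρ i x) b → P b) :
    (Blk.sto (cellE r e) f).Sat O a P := by
  obtain ⟨h1, h2⟩ := Val.addr hT hr he hρ hi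
  refine ⟨⟨h1, hf.1⟩, h _ rfl ⟨?_, hT.reg, hT.pos, hT.big⟩⟩
  rw [← flat_write C ρ x hi, ← hT.mem, ← h2, ← hf.2]
  rfl

lemma ite (he : Val (2 ^ w) a e x) (h₁ : x ≠ 0 → B.Sat O a P) (h₂ : x = 0 → B'.Sat O a P) :
    (Blk.ite e B B').Sat O a P := by
  obtain ⟨h1, rfl⟩ := he
  refine ⟨⟨h1, fun h => (h₁ h).1, fun h => (h₂ h).1⟩, ?_⟩
  simp only [Blk.exec]
  split_ifs with h
  exacts [(h₁ h).2, (h₂ (not_not.mp h)).2]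

/-- A comparison. -/
lemma ite_lt (he : Val (2 ^ w) a e x) (hf : Val (2 ^ w) a f y) (h₁ : x < y → B.Sat O a P)
    (h₂ : ¬ x < y → B'.Sat O a P) : (Blk.ite (e <ₑ f) B B').Sat O a P := by
  refine ite (he.lt hf) (fun h => h₁ ?_) (fun h => h₂ ?_)
  · by_contra h'; simp [h'] at h
  · intro h'; simp [h'] at h

end Blk.Sat

lemma Triple.sat {ι : Type} {w k : ℕ} {O : BlackBox ι w} {δ : NNReal} {Q : ℕ → St → Prop}
    {τ : ℕ} {a : St} (hw : 0 < w) {B : Blk ι} (hτ : B.cost ≤ τ)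
    (h : B.Sat O a fun b => Q (τ - B.cost) b) : Triple O δ (B.prog : Prog ι k) Q τ a :=
  Triple.blk hw B h.1 hτ h.2

/-! ### The graph in the black box -/

section
variable {ι : Type} {w n : ℕ}

/-- How the black box gives access to the graph: `sd` asks for the side of a vertex; the XOR
instructions `eg` and the program `eb` compute the entry `ent v (off + x)` of the neighbor list of
`v`, where register `8` holds `v`, register `5` holds `off` and `x` is the word `0` or register
`42`. -/
structure Access (O : BlackBox ι w) (G : SimpleGraph (Fin n)) (side : G.Coloring Bool) (sd : ι)
    (eg : List (Instr ι 14)) (eb : Blk ι) (ent : ℕ → ℕ → ℕ) : Prop where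
  side_eq : ∀ v : Fin n, O.nat sd v 0 = if side v = true then 1 else 0
  isGate : ∀ g ∈ eg, g.IsGate
  adj_of_ent : ∀ (v : Fin n) i, ent v i ≠ 0 → ∃ u : Fin n, ent v i = u + 1 ∧ G.Adj v u
  ent_of_adj : ∀ v u : Fin n, G.Adj v u → ∃ i < n, ent v i = u + 1
  circuit : ∀ s : CState w, (s.reg 8).toNat < n → (s.reg 12).toNat = 1 → ∀ x : BitVec w,
    (s.reg 5).toNat + x.toNat + 1 < 2 ^ w →
    (Instr.basisList O s eg (basisWord x) 3).toNat = ent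
      (s.reg 8).toNat ((s.reg 5).toNat + x.toNat) ∧
    ∀ i : Fin 14, i = 1 ∨ i = 4 ∨ i = 5 ∨ i = 6 ∨ i = 7 →
      Instr.basisList O s eg (basisWord x) i = 0
  block : ∀ b, b.v 8 < n → b.v 12 = 1 → b.v 5 + b.v 42 + 1 < 2 ^ w →
    eb.ok O b ∧ eb.exec O b = b.set 41 (ent (b.v 8) (b.v 5 + b.v 42))

/-- The registers that stay fixed: the number `n` of vertices, the length `4 ^ s > n` of the rows
of the memory, its square root and the number `R` of repetitions of each quantum search. -/
structure Base (n s R : ℕ) (a : St) : Prop where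
  h0 : a.v 0 = n
  h1 : a.v 1 = 4 ^ s
  h2 : a.v 2 = 2 ^ s
  h3 : a.v 3 = R
  h12 : a.v 12 = 1

/-- Words are long enough for the numbers that occur. -/
structure Large (w n s R : ℕ) : Prop where
  two_le : 2 ≤ n
  lt : n < 4 ^ s
  le : 4 ^ s ≤ 4 * n
  mem : 64 * (4 ^ s * 4 ^ s) ≤ 2 ^ w
  rep : R < 2 ^ w
  width : 2 * s ≤ w
  pos : 0 < w

end

/-! ### Reading the graph -/

section
variable {ι : Type}

/-- An edge was found: mark it, append it to the neighbor list of its vertex, count it, and make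
the blocks smaller if the number of edges calls for it. -/
def learnFound : Blk ι :=
  .seq (.sto (cellE (.c 1) (.v 41)) (.v 8 +ₑ .c 1))
  (.seq (.sto (cellE (.c 16 +ₑ .v 8) (.ld (cellE (.c 6) (.v 8)))) (.v 41))
  (.seq (.sto (cellE (.c 6) (.v 8)) (.ld (cellE (.c 6) (.v 8)) +ₑ .c 1))
  (.seq (.asg 6 (.v 6 +ₑ .c 1))
  (.ite (.v 6 <ₑ .v 7) .skip
    (.seq (.asg 4 (.op .div (.v 4) (.c 2))) (.asg 7 (.c 4 *ₑ .v 7)))))))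

/-- No further edge in this block. -/
def learnMiss : Blk ι :=
  .seq (.asg 5 (.v 5 +ₑ (.v 4 *ₑ .v 4)))
  (.ite (.v 5 <ₑ .v 1) .skip (.seq (.asg 8 (.v 8 +ₑ .c 1)) (.asg 5 (.c 0))))

/-- Read the neighbor lists of the vertices `v` (register `8`) on the side `true` block by block.
The size of the blocks is the square of register `4`, register `5` is the position in the list,
register `6` counts the edges; row `1` of the memory marks the known neighbors of `v`, row `6` holds
the numbers of known neighbors and row `16 + v` the known neighbors of `v`. -/
def learn (sd : ι) (eg : List (Instr ι 14)) (eb : Blk ι) : Prog ι 14 :=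
  .while (.v 8 <ₑ .v 0)
    (.seq (Blk.qry 15 sd (.v 8) (.c 0)).prog
    (.ite (.v 15)
      (.seq (Blk.prog (.seq (.asg 9 (.v 8 +ₑ .c 1)) (.asg 10 (.v 1))))
      (.seq (search eg eb) (Blk.ite (.v 40) learnFound learnMiss).prog))
      (Blk.seq (.asg 8 (.v 8 +ₑ .c 1)) (.asg 5 (.c 0))).prog))

variable {w n : ℕ} {O : BlackBox ι w} {G : SimpleGraph (Fin n)} {side : G.Coloring Bool}

/-- The lists in the rows from `16` on consist of `C 6 v` distinct neighbors of `v`, for vertices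
`v` on the side `true`. -/
structure Sound (side : G.Coloring Bool) (C : ℕ → ℕ → ℕ) : Prop where
  adj : ∀ v : Fin n, ∀ i < C 6 v, side v = true ∧ ∃ u : Fin n, C (16 + v) i = u + 1 ∧ G.Adj v u
  inj : ∀ v : Fin n, ∀ i < C 6 v, ∀ j < C 6 v, C (16 + v) i = C (16 + v) j → i = j
  zero : ∀ v : Fin n, ∀ i, C 6 v ≤ i → C (16 + v) i = 0

lemma Sound.deg_le {C : ℕ → ℕ → ℕ} (h : Sound side C) (v : Fin n) : C 6 v ≤ n := by
  have h1 := fun i : Fin (C 6 v) => (h.adj v i i.2).2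
  choose f hf using h1
  have hinj : Function.Injective f := by
    intro i j hij
    have h2 := (hf i).1
    have h3 := (hf j).1
    rw [← hij, ← h2] at h3
    exact Fin.ext (h.inj v i i.2 j j.2 h3.symm)
  simpa using Fintype.card_le_of_injective f hinj

lemma Sound.sum_deg_le {C : ℕ → ℕ → ℕ} (h : Sound side C) :
    ∑ v : Fin n, C 6 v ≤ G.edgeSet.ncard := by
  have h1 := fun p : Σ v : Fin n, Fin (C 6 v) => h.adj p.1 p.2 p.2.2
  choose hs f hf using h1
  have hcard : ∑ v : Fin n, C 6 v = Fintype.card (Σ v : Fin n, Fin (C 6 v)) := by simp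
  rw [hcard, ← Nat.card_eq_fintype_card, ← Nat.card_coe_set_eq]
  refine Nat.card_le_card_of_injective
    (fun p : Σ v : Fin n, Fin (C 6 v) => (⟨s(p.1, f p), (hf p).2⟩ : G.edgeSet)) ?_
  intro p q hpq
  replace hpq := Sym2.eq_iff.mp (congrArg Subtype.val hpq)
  rcases hpq with ⟨h1, h2⟩ | ⟨h1, h2⟩
  · obtain ⟨v, i⟩ := p
    obtain ⟨v', j⟩ := q
    simp only at h1
    subst h1
    have h3 := (hf ⟨v, i⟩).1
    have h4 := (hf ⟨v, j⟩).1
    rw [← h2, ← h3] at h4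
    rw [Fin.ext (h.inj v i i.2 j j.2 h4.symm)]
  · have := side_of_adj side (hf q).2
    rw [hs q, ← h1, hs p] at this
    simp at this

/-- The lists contain all neighbors of `v`. -/
def CompleteAt (G : SimpleGraph (Fin n)) (C : ℕ → ℕ → ℕ) (v : Fin n) : Prop :=
  ∀ u, G.Adj v u → ∃ i < C 6 v, C (16 + v) i = u + 1

variable {s R : ℕ}

end

/-- A bound on the running time per unit of block length of a search and of the work around it. -/
def unit {ι : Type} (gates : List (Instr ι 14)) (blk : Blk ι) (R : ℕ) : ℕ :=
  6 * (R * (4 * gates.length + blk.cost + 150) + 100) + 1100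

lemma searchCost_le {ι : Type} (gates : List (Instr ι 14)) (blk : Blk ι) (d R : ℕ) :
    searchCost gates blk d R + 1000 ≤ 2 ^ d * unit gates blk R := by
  have h : 1 ≤ 2 ^ d := Nat.one_le_two_pow
  unfold searchCost unit
  calc _ = 2 ^ d * (6 * (R * (4 * gates.length + blk.cost + 150) + 100)) + 1 * 1100 := by ring
    _ ≤ 2 ^ d * (6 * (R * (4 * gates.length + blk.cost + 150) + 100)) + 2 ^ d * 1100 := by gcongr
    _ = _ := by ring

section
variable {ι : Type} {w n s R : ℕ} {O : BlackBox ι w} {G : SimpleGraph (Fin n)}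
  {side : G.Coloring Bool} {ent : ℕ → ℕ → ℕ} {β : Prop} {sd : ι} {eg : List (Instr ι 14)}
  {eb : Blk ι} {C₀ C : ℕ → ℕ → ℕ} {a b : St} {d q : ℕ}

/-- The invariant of `learn`.  The position in the lists is `q` times the length `4 ^ d` of the
blocks, and register `7` is the number of edges at which the blocks get smaller.  If `β` holds, no
search has failed. -/
structure LearnInv (w s R : ℕ) (G : SimpleGraph (Fin n)) (side : G.Coloring Bool)
    (ent : ℕ → ℕ → ℕ) (β : Prop) (C₀ C : ℕ → ℕ → ℕ) (d q : ℕ) (a : St) : Prop where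
  base : Base n s R a
  tab : Tab (2 ^ w) (4 ^ s) C a
  vertex : a.v 8 ≤ n
  off : a.v 5 < 4 ^ s
  size : a.v 4 = 2 ^ d
  le : d ≤ s
  pos : a.v 8 * 4 ^ s + a.v 5 = q * 4 ^ d
  thr : a.v 7 * 4 ^ d = 4 ^ s * 4 ^ s
  cnt : a.v 6 = ∑ v : Fin n, C 6 v
  cnt_lt : a.v 6 < a.v 7
  thr_le : d = s ∨ a.v 7 ≤ 4 * a.v 6
  sound : Sound side C
  stamp_zero : C 1 0 = 4 ^ s * 4 ^ s
  stamp_le : ∀ e ≠ 0, e ≤ n → C 1 e ≤ a.v 8 + 1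
  stamp : ∀ e ≠ 0, e ≤ n → (C 1 e = a.v 8 + 1 ↔ ∃ i < C 6 (a.v 8), C (16 + a.v 8) i = e)
  later : ∀ v, a.v 8 < v → C 6 v = 0
  rows : ∀ r < 16, r ≠ 1 → r ≠ 6 → C r = C₀ r
  done : β → ∀ v : Fin n, v < a.v 8 → side v = true → CompleteAt G C v
  part : β → ∀ i < a.v 5, ent (a.v 8) i ≠ 0 → ∃ j < C 6 (a.v 8), C (16 + a.v 8) j = ent (a.v 8) i

namespace LearnInv

lemma congr (h : LearnInv w s R G side ent β C₀ C d q a) (hm : b.m = a.m)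
    (hv : ∀ x < 9, b.v x = a.v x) (h12 : b.v 12 = a.v 12) :
    LearnInv w s R G side ent β C₀ C d q b := by
  have h0 := hv 0 (by omega)
  have h1 := hv 1 (by omega)
  have h2 := hv 2 (by omega)
  have h3 := hv 3 (by omega)
  have h4 := hv 4 (by omega)
  have h5 := hv 5 (by omega)
  have h6 := hv 6 (by omega)
  have h7 := hv 7 (by omega)
  have h8 := hv 8 (by omega)
  obtain ⟨⟨_, _, _, _, _⟩, ⟨_, _, _, _⟩, _, _, _, _, _, _, _, _, _, _, _, _, _, _, _, _, _⟩ := h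
  constructor
  · constructor <;> simp only [*]
  · constructor <;> simp only [*]
  all_goals ((try simp only [h4, h5, h6, h7, h8]); assumption)

lemma lt_thr (h : LearnInv w s R G side ent β C₀ C d q a) (hL : Large w n s R) :
    q < a.v 7 := by
  have h1 := h.pos
  have h2 := h.thr
  have h3 := h.off
  have h4 := hL.lt
  have h5 : a.v 8 * 4 ^ s + 4 ^ s ≤ 4 ^ s * 4 ^ s := by
    calc _ = (a.v 8 + 1) * 4 ^ s := by ring
      _ ≤ _ := Nat.mul_le_mul_right _ (by have := h.vertex; omega)
  have : q * 4 ^ d < a.v 7 * 4 ^ d := by omega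
  exact lt_of_mul_lt_mul_right this (by positivity)

/-- The next block lies in the same row. -/
lemma off_add_le (h : LearnInv w s R G side ent β C₀ C d q a) : a.v 5 + 4 ^ d ≤ 4 ^ s := by
  have h1 : (4 : ℕ) ^ d ∣ 4 ^ s := pow_dvd_pow _ h.le
  have h2 : 4 ^ d ∣ a.v 5 := by
    have : 4 ^ d ∣ a.v 8 * 4 ^ s + a.v 5 := ⟨q, by rw [h.pos, mul_comm]⟩
    exact (Nat.dvd_add_right (h1.mul_left _)).mp this
  obtain ⟨x, hx⟩ := h1
  obtain ⟨y, hy⟩ := h2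
  have h3 := h.off
  rw [hx, hy] at h3 ⊢
  have h4 : y < x := lt_of_mul_lt_mul_left h3 (by positivity)
  calc _ = 4 ^ d * (y + 1) := by ring
    _ ≤ _ := Nat.mul_le_mul_left _ h4

/-- The amortised cost so far, in units, together with the cost of the next search. -/
lemma spent_le (h : LearnInv w s R G side ent β C₀ C d q a) (hL : Large w n s R)
    {Y : ℕ} (hY : G.edgeSet.ncard ≤ Y * Y) :
    (q + a.v 7 + a.v 6) * 2 ^ d + 2 ^ d ≤ 3 * (4 ^ s * 2 ^ s + 2 * 4 ^ s * Y) := by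
  have h1 := h.lt_thr hL
  have h2 := h.cnt_lt
  have h3 : a.v 7 * 2 ^ d ≤ 4 ^ s * 2 ^ s + 2 * 4 ^ s * Y := by
    have hth := h.thr
    have h44 : (2 : ℕ) ^ d * 2 ^ d = 4 ^ d := by rw [← mul_pow]; norm_num
    rcases h.thr_le with rfl | h4
    · have : a.v 7 = 4 ^ d := Nat.eq_of_mul_eq_mul_right (by positivity) hth
      rw [this]; omega
    · have h5 : a.v 6 ≤ Y * Y := by rw [h.cnt]; exact h.sound.sum_deg_le.trans hY
      have : (a.v 7 * 2 ^ d) * (a.v 7 * 2 ^ d) ≤ (2 * 4 ^ s * Y) * (2 * 4 ^ s * Y) := by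
        calc _ = a.v 7 * (a.v 7 * (2 ^ d * 2 ^ d)) := by ring
          _ = a.v 7 * (4 ^ s * 4 ^ s) := by rw [h44, hth]
          _ ≤ (4 * (Y * Y)) * (4 ^ s * 4 ^ s) := Nat.mul_le_mul_right _ (by omega)
          _ = _ := by ring
      have := Nat.mul_self_le_mul_self_iff.mp this
      omega
  calc _ = (q + a.v 7 + a.v 6 + 1) * 2 ^ d := by ring
    _ ≤ (3 * a.v 7) * 2 ^ d := Nat.mul_le_mul_right _ (by omega)
    _ = 3 * (a.v 7 * 2 ^ d) := by ring
    _ ≤ _ := Nat.mul_le_mul_left _ h3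

/-- All entries of the list of `v` have been seen. -/
lemma completeAt {sd : ι} (h : LearnInv w s R G side ent β C₀ C d q a)
    (acc : Access O G side sd eg eb ent) (hL : Large w n s R) (hβ : β) (v : Fin n)
    (hv : v.val = a.v 8) {x : ℕ} (hx : 4 ^ s ≤ a.v 5 + x)
    (hblk : ∀ y < x, ¬ C 1 (ent v (a.v 5 + y)) < v + 1) : CompleteAt G C v := by
  intro u hu
  obtain ⟨i, hi, hiu⟩ := acc.ent_of_adj v u hu
  have hlt := hL.lt
  rw [← hiu, hv]
  by_cases h1 : i < a.v 5
  · exact h.part hβ i h1 (by rw [← hv, hiu]; omega)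
  · have h2 := hblk (i - a.v 5) (by omega)
    rw [show a.v 5 + (i - a.v 5) = i by omega, hiu, hv] at h2
    have h3 := h.stamp_le (u + 1) (by omega) (by omega)
    rw [← hv, hiu, hv]
    exact (h.stamp (u + 1) (by omega) (by omega)).mp (by omega)

end LearnInv

/-- A state with the invariant after an amortised cost of at least `D` units. -/
def LearnNext (w s R : ℕ) (G : SimpleGraph (Fin n)) (side : G.Coloring Bool)
    (ent : ℕ → ℕ → ℕ) (β : Prop) (C₀ : ℕ → ℕ → ℕ) (D : ℕ) (a : St) : Prop :=
  ∃ C d q, LearnInv w s R G side ent β C₀ C d q a ∧ D ≤ (q + a.v 7 + a.v 6) * 2 ^ d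

lemma LearnInv.next_vertex (h : LearnInv w s R G side ent β C₀ C d q a)
    (hv : a.v 8 < n)
    (hdone : β → ∀ v : Fin n, v.val = a.v 8 → side v = true → CompleteAt G C v)
    (hm : b.m = a.m) (hb : ∀ x < 8, x ≠ 5 → b.v x = a.v x) (h12 : b.v 12 = a.v 12)
    (h8 : b.v 8 = a.v 8 + 1) (h5 : b.v 5 = 0) :
    LearnNext w s R G side ent β C₀ ((q + a.v 7 + a.v 6) * 2 ^ d + 2 ^ d) b := by
  have h0 := hb 0 (by omega) (by omega)
  have h1 := hb 1 (by omega) (by omega)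
  have h2 := hb 2 (by omega) (by omega)
  have h3 := hb 3 (by omega) (by omega)
  have h4 := hb 4 (by omega) (by omega)
  have h6 := hb 6 (by omega) (by omega)
  have h7 := hb 7 (by omega) (by omega)
  obtain ⟨e, he⟩ : (4 : ℕ) ^ d ∣ 4 ^ s := pow_dvd_pow _ h.le
  have hoff := h.off
  have hpos := h.pos
  have hq : q < (a.v 8 + 1) * e := by
    have : q * 4 ^ d < ((a.v 8 + 1) * e) * 4 ^ d := by
      calc q * 4 ^ d < a.v 8 * 4 ^ s + 4 ^ s := by omega
        _ = _ := by rw [he]; ring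
    exact lt_of_mul_lt_mul_right this (by positivity)
  refine ⟨C, d, (a.v 8 + 1) * e, ⟨⟨?_, ?_, ?_, ?_, ?_⟩, ⟨?_, ?_, ?_, ?_⟩, ?_, ?_, ?_, h.le,
    ?_, ?_, ?_,
    ?_, ?_, h.sound, h.stamp_zero, ?_, ?_, ?_, h.rows, ?_, ?_⟩, ?_⟩
  · rw [h0, h.base.h0]
  · rw [h1, h.base.h1]
  · rw [h2, h.base.h2]
  · rw [h3, h.base.h3]
  · rw [h12, h.base.h12]
  · rw [hm, h.tab.mem]
  · rw [h1, h.tab.reg]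
  · exact h.tab.pos
  · exact h.tab.big
  · omega
  · rw [h5]; exact h.tab.pos
  · rw [h4, h.size]
  · rw [h8, h5, he]; ring
  · rw [h7, h.thr]
  · rw [h6, h.cnt]
  · rw [h6, h7]; exact h.cnt_lt
  · rw [h6, h7]; exact h.thr_le
  · intro e' he' hn
    have := h.stamp_le e' he' hn
    omega
  · intro e' he' hn
    have h9 := h.stamp_le e' he' hn
    rw [h8, h.later _ (Nat.lt_succ_self _)]
    exact ⟨fun h => by omega, fun ⟨i, hi, _⟩ => by omega⟩
  · intro v hv'
    exact h.later v (by omega)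
  · intro hβ v hv' hs
    rw [h8] at hv'
    rcases Nat.lt_succ_iff_lt_or_eq.mp hv' with h9 | h9
    · exact h.done hβ v h9 hs
    · exact hdone hβ v h9 hs
  · intro hβ i hi; omega
  · rw [h6, h7]
    calc _ = (q + 1 + a.v 7 + a.v 6) * 2 ^ d := by ring
      _ ≤ _ := Nat.mul_le_mul_right _ (by omega)

lemma LearnInv.sat_learnMiss {sd : ι} (h : LearnInv w s R G side ent β C₀ C d q a)
    (acc : Access O G side sd eg eb ent) (hL : Large w n s R) (v : Fin n) (hv : v.val = a.v 8)
    (hblk : β → ∀ y < 4 ^ d, ¬ C 1 (ent v (a.v 5 + y)) < v + 1) :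
    learnMiss.Sat O a
      (LearnNext w s R G side ent β C₀ ((q + a.v 7 + a.v 6) * 2 ^ d + 2 ^ d)) := by
  have hoff := h.off_add_le
  have hM := hL.mem
  have h44 : (2 : ℕ) ^ d * 2 ^ d = 4 ^ d := by rw [← mul_pow]; norm_num
  have hZ : 4 ^ s ≤ 4 ^ s * 4 ^ s := Nat.le_mul_of_pos_left _ h.tab.pos
  have h4d : 0 < 4 ^ d := by positivity
  have hn := hL.lt
  refine .seq (.asg 5 ((Val.reg 5 rfl).add ((Val.reg 4 h.size).mul (.reg 4 h.size) ?_) ?_) ?_)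
  · omega
  · omega
  rw [h44]
  refine .ite_lt (x := a.v 5 + 4 ^ d) (y := 4 ^ s) (.reg 5 (by simp)) (.reg 1 (by simp [h.base.h1]))
    ?_ ?_
  · intro hlt
    refine .skip ⟨C, d, q + 1, ⟨⟨?_, ?_, ?_, ?_, ?_⟩, h.tab.set _ _, ?_, ?_, ?_, h.le, ?_, ?_, ?_,
      ?_, ?_, h.sound, h.stamp_zero, ?_, ?_, ?_, h.rows, ?_, ?_⟩, ?_⟩
    · simp [h.base.h0]
    · simp [h.base.h1]
    · simp [h.base.h2]
    · simp [h.base.h3]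
    · simp [h.base.h12]
    · simpa using h.vertex
    · simpa using hlt
    · simp [h.size]
    · simp only [St.set_v]
      norm_num
      have := h.pos
      rw [add_mul, ← this]
      ring
    · simpa using h.thr
    · simpa using h.cnt
    · simpa using h.cnt_lt
    · simpa using h.thr_le
    · simpa using h.stamp_le
    · simpa using h.stamp
    · simpa using h.later
    · simpa using h.done
    · intro hβ i hi
      simp only [St.set_v, if_true] at hi
      norm_num at hi ⊢
      intro h0
      by_cases h1 : i < a.v 5
      · exact h.part hβ i h1 h0
      · have h2 := hblk hβ (i - a.v 5) (by omega)
        rw [show a.v 5 + (i - a.v 5) = i by omega, hv] at h2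
        obtain ⟨u, hu, -⟩ := acc.adj_of_ent v i (by rwa [hv])
        rw [hv] at hu
        rw [hu] at h2 ⊢
        have h3 := h.stamp_le (u + 1) (by omega) (by omega)
        exact (h.stamp (u + 1) (by omega) (by omega)).mp (by omega)
    · simp only [St.set_v]
      norm_num
      apply le_of_eq
      ring
  · intro hlt
    refine .seq (.asg 8 (x := a.v 8 + 1) ((Val.reg 8 (by simp)).add (.const ?_) ?_) ?_)
    · omega
    · omega
    refine .asg 5 (x := 0) (.const (by omega)) ?_
    refine h.next_vertex (by omega) (fun hβ v' hv' _ => ?_) rfl ?_ (by simp) (by simp) (by simp)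
    · obtain rfl : v' = v := Fin.ext (by omega)
      exact h.completeAt acc hL hβ v' hv (by omega) (hblk hβ)
    · intro x hx h5
      simp [h5]
      intro h8; omega

lemma LearnInv.sat_learnFound {sd : ι} (h : LearnInv w s R G side ent β C₀ C d q a)
    (acc : Access O G side sd eg eb ent) (hL : Large w n s R) (v : Fin n) (hv : v.val = a.v 8)
    (hs : side v = true) {y : ℕ} (hy : C 1 (ent v y) < v + 1) (h41 : a.v 41 = ent v y) :
    learnFound.Sat O a
      (LearnNext w s R G side ent β C₀ ((q + a.v 7 + a.v 6) * 2 ^ d + 2 ^ d)) := by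
  have hM := hL.mem
  have hn := hL.lt
  have hZpos := h.tab.pos
  have hZ : 4 ^ s ≤ 4 ^ s * 4 ^ s := Nat.le_mul_of_pos_left _ hZpos
  have hvn := v.2
  have h0 : ent v y ≠ 0 := by
    intro h0
    rw [h0, h.stamp_zero] at hy
    omega
  obtain ⟨u, hu, hadj⟩ := acc.adj_of_ent v y h0
  have hun := u.2
  rw [hu] at hy h41
  -- the vertex `u` is not yet in the list
  have hnew : ¬ ∃ i < C 6 v, C (16 + v) i = u + 1 := by
    rw [hv, ← h.stamp (u + 1) (by omega) (by omega)]
    omega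
  have hdeg : C 6 v < 4 ^ s := (h.sound.deg_le v).trans_lt hn
  set C' := upd (upd (upd C 1 (u + 1) (v + 1)) (16 + v) (C 6 v) (u + 1)) 6 v (C 6 v + 1) with hC'
  have hC'6 : ∀ x, C' 6 x = if x = v.val then C 6 v + 1 else C 6 x := by
    intro x
    simp only [hC', upd_apply, true_and]
    split_ifs <;> first | rfl | omega
  have hC'1 : ∀ x, C' 1 x = if x = u + 1 then v.val + 1 else C 1 x := by
    intro x
    simp only [hC', upd_apply, true_and]
    split_ifs <;> first | rfl | omega
  have hC'l : ∀ x i, C' (16 + x) i = if x = v.val ∧ i = C 6 v then u.val + 1 else C (16 + x) i := by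
    intro x i
    simp only [hC', upd_apply]
    split_ifs <;> first | rfl | omega
  have hC'r : ∀ r < 16, r ≠ 1 → r ≠ 6 → C' r = C₀ r := by
    intro r hr h1 h6
    rw [← h.rows r hr h1 h6, hC', upd_of_ne _ h6, upd_of_ne _ (by omega), upd_of_ne _ h1]
  have hsum : ∑ x : Fin n, C' 6 x = a.v 6 + 1 := by
    rw [h.cnt]
    have : ∀ x : Fin n, C' 6 x = C 6 x + if x = v then 1 else 0 := by
      intro x
      rw [hC'6]
      by_cases hx : x = v
      · simp [hx]
      · rw [if_neg (fun h => hx (Fin.ext h)), if_neg hx]; rfl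
    simp [this, Finset.sum_add_distrib]
  have hsound : Sound side C' := by
    constructor
    · intro x i hi
      rw [hC'6] at hi
      rw [hC'l]
      by_cases hx : x.val = v.val
      · obtain rfl : x = v := Fin.ext hx
        rw [if_pos rfl] at hi
        by_cases hi' : i = C 6 x
        · exact ⟨hs, u, by simp [hi'], hadj⟩
        · rw [if_neg (by omega)]
          exact h.sound.adj x i (by omega)
      · rw [if_neg hx] at hi
        rw [if_neg (by omega)]
        exact h.sound.adj x i hi
    · intro x i hi j hj
      rw [hC'6] at hi hj
      rw [hC'l, hC'l]
      by_cases hx : x.val = v.val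
      · obtain rfl : x = v := Fin.ext hx
        rw [if_pos rfl] at hi hj
        by_cases hi' : i = C 6 x <;> by_cases hj' : j = C 6 x
        · intro _; omega
        · rw [if_pos ⟨rfl, hi'⟩, if_neg (by omega)]
          intro he
          exact (hnew ⟨j, by omega, he.symm⟩).elim
        · rw [if_neg (by omega), if_pos ⟨rfl, hj'⟩]
          intro he
          exact (hnew ⟨i, by omega, he⟩).elim
        · rw [if_neg (by omega), if_neg (by omega)]
          exact h.sound.inj x i (by omega) j (by omega)
      · rw [if_neg hx] at hi hj
        rw [if_neg (by omega), if_neg (by omega)]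
        exact h.sound.inj x i hi j hj
    · intro x i hi
      rw [hC'6] at hi
      rw [hC'l]
      by_cases hx : x.val = v.val
      · obtain rfl : x = v := Fin.ext hx
        rw [if_pos rfl] at hi
        rw [if_neg (by omega)]
        exact h.sound.zero x i (by omega)
      · rw [if_neg hx] at hi
        rw [if_neg (by omega)]
        exact h.sound.zero x i hi
  have hmono : ∀ x i, i < C 6 x → i < C' 6 x ∧ C' (16 + x) i = C (16 + x) i := by
    intro x i hi
    rw [hC'6, hC'l]
    by_cases hx : x = v.val
    · rw [hx] at hi
      rw [if_pos hx, if_neg (by omega)]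
      exact ⟨by omega, rfl⟩
    · rw [if_neg hx, if_neg (by omega)]
      exact ⟨hi, rfl⟩
  have hcntn : a.v 6 + 1 < 4 ^ s * 4 ^ s := by
    have : ∑ x : Fin n, C' 6 x ≤ ∑ x : Fin n, n := Finset.sum_le_sum fun x _ => hsound.deg_le x
    rw [hsum] at this
    simp only [Finset.sum_const, Finset.card_univ, Fintype.card_fin, smul_eq_mul] at this
    have h2 : n * n < 4 ^ s * 4 ^ s := Nat.mul_lt_mul'' hn hn
    omega
  have hthr7 : a.v 7 ≤ 4 ^ s * 4 ^ s := by
    rw [← h.thr]; exact Nat.le_mul_of_pos_right _ (by positivity)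
  -- the invariant, for both choices of the new block length
  have key : ∀ (c : St) (d' q' : ℕ), Tab (2 ^ w) (4 ^ s) C' c → (∀ x < 6, x ≠ 4 → c.v x = a.v x) →
      c.v 12 = a.v 12 → c.v 8 = a.v 8 → c.v 6 = a.v 6 + 1 → c.v 4 = 2 ^ d' → d' ≤ s →
      q' * 4 ^ d' = q * 4 ^ d → c.v 7 * 4 ^ d' = a.v 7 * 4 ^ d → a.v 6 + 1 < c.v 7 →
      (d' = s ∨ c.v 7 ≤ 4 * (a.v 6 + 1)) → LearnInv w s R G side ent β C₀ C' d' q' c := by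
    intro c d' q' hT hc h12 h8 h6 h4 hd' hq' h7 hlt hle
    have h0 := hc 0 (by omega) (by omega)
    have h2 := hc 2 (by omega) (by omega)
    have h3 := hc 3 (by omega) (by omega)
    have h5 := hc 5 (by omega) (by omega)
    refine ⟨⟨?_, ?_, ?_, ?_, ?_⟩, hT, ?_, ?_, h4, hd', ?_, ?_, ?_,
      ?_, ?_, hsound, ?_, ?_, ?_, ?_, hC'r, ?_, ?_⟩
    · rw [h0, h.base.h0]
    · rw [hT.reg]
    · rw [h2, h.base.h2]
    · rw [h3, h.base.h3]
    · rw [h12, h.base.h12]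
    · rw [h8]; exact h.vertex
    · rw [h5]; exact h.off
    · rw [h8, h5, h.pos, hq']
    · rw [h7, h.thr]
    · rw [h6, hsum]
    · rw [h6]; exact hlt
    · rw [h6]; exact hle
    · rw [hC'1, if_neg (by omega), h.stamp_zero]
    · intro e he hen
      rw [hC'1, h8]
      split_ifs
      · omega
      · exact h.stamp_le e he hen
    · intro e he hen
      rw [hC'1, h8, ← hv, hC'6, if_pos rfl]
      constructor
      · intro he'
        split_ifs at he' with h9
        · exact ⟨C 6 v, by omega, by rw [hC'l, if_pos ⟨rfl, rfl⟩, h9]⟩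
        · rw [hv, h.stamp e he hen, ← hv] at he'
          obtain ⟨i, hi, hi'⟩ := he'
          exact ⟨i, by omega, by rw [(hmono v i hi).2, hi']⟩
      · rintro ⟨i, hi, hi'⟩
        rw [hC'l] at hi'
        by_cases h9 : i = C 6 v
        · rw [if_pos ⟨rfl, h9⟩] at hi'
          rw [if_pos hi'.symm]
        · rw [if_neg (by omega)] at hi'
          split_ifs
          · rfl
          · rw [hv, h.stamp e he hen, ← hv]
            exact ⟨i, by omega, hi'⟩
    · intro x hx
      rw [h8] at hx
      rw [hC'6, if_neg (by omega)]
      exact h.later x hx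
    · intro hβ x hx hsx u' hu'
      rw [h8] at hx
      obtain ⟨i, hi, hi'⟩ := h.done hβ x hx hsx u' hu'
      exact ⟨i, (hmono x i hi).1, by rw [(hmono x i hi).2, hi']⟩
    · intro hβ i hi hent
      rw [h5] at hi
      rw [h8] at hent ⊢
      obtain ⟨j, hj, hj'⟩ := h.part hβ i hi hent
      exact ⟨j, (hmono _ j hj).1, by rw [(hmono _ j hj).2, hj']⟩
  have hT := h.tab
  refine .seq (.sto hT (.const (x := 1) (by omega)) (.reg 41 h41) (x := v + 1)
    (by rw [hv]; exact (Val.reg 8 rfl).add (.const (by omega)) (by omega)) (by omega) (by omega) ?_)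
  intro b₁ hb₁ hT₁
  have r6 : C 6 v = upd C 1 (u + 1) (v + 1) 6 v := by rw [upd_of_ne _ (by omega)]
  have c6 : Val (2 ^ w) b₁ (.ld (cellE (.c 6) (.v 8))) (C 6 v) := by
    rw [r6]
    exact Val.cell hT₁ (.const (by omega)) (.reg 8 (by rw [hb₁, hv])) (by omega) (by omega)
  refine .seq (.sto hT₁ (ρ := 16 + v) (i := C 6 v)
    ((Val.const (by omega)).add (.reg 8 (by rw [hb₁, hv])) (by omega))
    c6 (.reg 41 (by rw [hb₁, h41])) hdeg (by omega) ?_)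
  intro b₂ hb₂ hT₂
  have r6' : C 6 v = upd (upd C 1 (u + 1) (v + 1)) (16 + v) (C 6 v) (u + 1) 6 v := by
    rw [upd_of_ne _ (by omega), upd_of_ne _ (by omega)]
  have c6' : Val (2 ^ w) b₂ (.ld (cellE (.c 6) (.v 8))) (C 6 v) := by
    rw [r6']
    exact Val.cell hT₂ (.const (by omega)) (.reg 8 (by rw [hb₂, hb₁, hv])) (by omega) (by omega)
  refine .seq (.sto hT₂ (ρ := 6) (i := v) (.const (by omega)) (.reg 8 (by rw [hb₂, hb₁, hv]))
    (c6'.add (.const (by omega)) (by omega)) (by omega) (by omega) ?_)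
  intro b₃ hb₃ hT₃
  rw [← hC'] at hT₃
  have hbv : b₃.v = a.v := by rw [hb₃, hb₂, hb₁]
  refine .seq (.asg 6 ((Val.reg 6 (by rw [hbv])).add (.const (by omega)) (by omega)) ?_)
  refine .ite_lt (x := a.v 6 + 1) (y := a.v 7) (.reg 6 (by simp)) (.reg 7 (by simp [hbv])) ?_ ?_
  · intro hlt
    refine .skip ⟨C', d, q, key _ d q (hT₃.set _ _) ?_ ?_ ?_ ?_ ?_ h.le rfl ?_ ?_ ?_, ?_⟩
    · intro x hx _
      simp [hbv]
      intro; omega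
    · simp [hbv]
    · simp [hbv]
    · simp
    · simp [hbv, h.size]
    · simp [hbv]
    · simpa [hbv] using hlt
    · simp only [St.set_v, hbv]
      norm_num
      exact h.thr_le.imp_right fun h9 => by omega
    · simp only [St.set_v, hbv]
      norm_num
      apply le_of_eq
      ring
  · intro hlt
    have hcnt : a.v 6 + 1 = a.v 7 := by have := h.cnt_lt; omega
    -- the blocks cannot have length one, since there are less than `4 ^ s * 4 ^ s` edges
    obtain ⟨d', rfl⟩ : ∃ d', d = d' + 1 := by
      refine ⟨d - 1, ?_⟩
      rcases Nat.eq_zero_or_pos d with h9 | h9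
      · have := h.thr
        rw [h9, pow_zero, mul_one] at this
        omega
      · omega
    refine .seq (.asg 4 (x := 2 ^ d') ?_ ?_)
    · have := (Val.reg (M := 2 ^ w) (a := b₃.set 6 (a.v 6 + 1)) (x := 2 ^ (d' + 1)) 4
        (by simp [hbv, h.size])).div (.const (x := 2) (by omega))
      rwa [pow_succ, Nat.mul_div_cancel _ (by norm_num)] at this
    refine .asg 7 (x := 4 * a.v 7) ((Val.const (by omega)).mul (.reg 7 (by simp [hbv])) (by omega))
      ?_
    refine ⟨C', d', 4 * q, key _ d' (4 * q) (((hT₃.set _ _).set _ _).set _ _) ?_ ?_ ?_ ?_ ?_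
      (by have := h.le; omega) ?_ ?_ ?_ ?_, ?_⟩
    · intro x hx h4
      simp [hbv, h4]
      rw [if_neg (by omega), if_neg (by omega)]
    · simp [hbv]
    · simp [hbv]
    · simp
    · simp
    · rw [pow_succ]; ring
    · simp only [St.set_v]; norm_num; rw [pow_succ]; ring
    · simp; omega
    · simp; omega
    · simp only [St.set_v]
      norm_num
      rw [pow_succ, hcnt]
      have : a.v 6 + 1 = a.v 7 := hcnt
      have h9 : a.v 6 ≤ a.v 7 := by omega
      calc (q + a.v 7 + a.v 6) * (2 ^ d' * 2) + 2 ^ d' * 2 =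
          (2 * q + 2 * a.v 7 + 2 * (a.v 6 + 1)) * 2 ^ d' := by ring
        _ = (2 * q + 2 * a.v 7 + 2 * a.v 7) * 2 ^ d' := by rw [hcnt]
        _ ≤ _ := Nat.mul_le_mul_right _ (by omega)

/-- The input of a search in the neighbor list of `v`. -/
lemma Access.searchInput (acc : Access O G side sd eg eb ent) (hL : Large w n s R) (v : Fin n)
    (hb : Base n s R a) (hv : a.v 8 = v) (hoff : a.v 5 + 4 ^ d ≤ 4 ^ s) (hd : d ≤ s)
    (hX : a.v 4 = 2 ^ d) (h10 : a.v 10 ≤ 4 ^ s) :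
    SearchInput O eg eb (fun x => ent v (a.v 5 + x)) d a := by
  have hM := hL.mem
  have hn := hL.lt
  have hZ : 4 ^ s ≤ 4 ^ s * 4 ^ s := Nat.le_mul_of_pos_left _ (by positivity)
  have hw := hL.width
  refine ⟨by omega, hX, by omega, acc.isGate, fun x _ => ?_, fun b t hab hr x hx => ?_,
    fun b hab hx => ?_⟩
  · by_cases h0 : ent v (a.v 5 + x) = 0
    · omega
    · obtain ⟨u, hu, -⟩ := acc.adj_of_ent v _ h0
      omega
  · have e8 : (t.reg 8).toNat = v := by rw [hr.1 8 (by omega), hab.2 8 (by omega), hv]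
    have e5 : (t.reg 5).toNat = a.v 5 := by rw [hr.1 5 (by omega), hab.2 5 (by omega)]
    have e12 : (t.reg 12).toNat = 1 := by rw [hr.1 12 (by omega), hab.2 12 (by omega), hb.h12]
    have := acc.circuit t (by rw [e8]; exact v.2) e12 x (by omega)
    rwa [e8, e5] at this
  · have e8 : b.v 8 = v := by rw [hab.2 8 (by omega), hv]
    have e5 : b.v 5 = a.v 5 := hab.2 5 (by omega)
    have := acc.block b (by rw [e8]; exact v.2) (by rw [hab.2 12 (by omega), hb.h12]) (by omega)
    rwa [e8, e5] at this

/-- Reading the graph.  The number of searches with blocks of length `4 ^ d` is of the order of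
`4 ^ s * 4 ^ s / 4 ^ d`, and such blocks occur only if this is at most of the order of the number of
edges, or if `d = s`; each search costs `2 ^ d` units.  Hence the geometric sum over `d` is dominated
by its last term. -/
lemma Triple.learn (hL : Large w n s R) (acc : Access O G side sd eg eb ent) {δ : NNReal}
    (hδ : β → (3 / 4) ^ R ≤ (δ : ℝ)) (h : LearnInv w s R G side ent β C₀ C d q a) {Y : ℕ}
    (hY : G.edgeSet.ncard ≤ Y * Y) {τ τe : ℕ}
    (hτ : τe + unit eg eb R * (3 * (4 ^ s * 2 ^ s + 2 * 4 ^ s * Y)) + 20 ≤ τ)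
    {Q : ℕ → St → Prop} (hQ : ∀ τ' ≤ τ, ∀ b C d q, τe ≤ τ' →
      LearnInv w s R G side ent β C₀ C d q b → b.v 8 = n → Q τ' b) :
    Triple O δ (learn sd eg eb) Q τ a := by
  have hw := hL.pos
  have hM := hL.mem
  have hn := hL.lt
  set U := unit eg eb R with hU
  set B := 3 * (4 ^ s * 2 ^ s + 2 * 4 ^ s * Y) with hB
  have hZ : 4 ^ s ≤ 4 ^ s * 4 ^ s := Nat.le_mul_of_pos_left _ (by positivity)
  have hZpos : 0 < 4 ^ s := by positivity
  refine Triple.while_ hw _ (fun τ' a => ∃ C d q, LearnInv w s R G side ent β C₀ C d q a ∧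
    τe + U * B + 20 ≤ τ' + U * ((q + a.v 7 + a.v 6) * 2 ^ d)) ?_ ⟨C, d, q, h, by omega⟩
  rintro τ' hτ' a ⟨C, d, q, h, hcred⟩
  set D := (q + a.v 7 + a.v 6) * 2 ^ d with hD
  have hsp : D + 2 ^ d ≤ B := h.spent_le hL hY
  have hmul : U * D + U * 2 ^ d ≤ U * B := by rw [← mul_add]; exact Nat.mul_le_mul_left _ hsp
  have hcond := (Val.reg (M := 2 ^ w) (a := a) 8 rfl).lt (Val.reg 0 h.base.h0)
  have hSC := searchCost_le eg eb d R
  rw [← hU, mul_comm] at hSC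
  refine ⟨hcond.1, by simp only [Exp.cost]; omega, fun he => ?_, fun he => ?_⟩
  · rw [hcond.2] at he
    refine hQ _ (by omega) a C d q (by simp only [Exp.cost]; omega) h ?_
    have := h.vertex
    by_contra hne
    rw [if_pos (by omega)] at he
    omega
  rw [hcond.2] at he
  have hv : a.v 8 < n := by by_contra h'; rw [if_neg h'] at he; exact he rfl
  have hfin : ∀ τ'' b, LearnNext w s R G side ent β C₀ (D + 2 ^ d) b →
      τ' ≤ τ'' + U * 2 ^ d → ∃ C d q, LearnInv w s R G side ent β C₀ C d q b ∧
    τe + U * B + 20 ≤ τ'' + U * ((q + b.v 7 + b.v 6) * 2 ^ d) := by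
    rintro τ'' b ⟨C', d', q', h', hD'⟩ hτ''
    refine ⟨C', d', q', h', ?_⟩
    have : U * D + U * 2 ^ d ≤ U * ((q' + b.v 7 + b.v 6) * 2 ^ d') := by
      rw [← mul_add]; exact Nat.mul_le_mul_left _ hD'
    omega
  set v : Fin n := ⟨a.v 8, hv⟩ with hvdef
  refine Triple.seq (by simp only [Exp.cost]; omega) (Triple.sat hw
    (by simp only [Exp.cost, Blk.cost]; omega) ?_)
  refine .qry 15 (.reg 8 rfl) (.const (x := 0) (by omega)) ?_
  have hside : O.nat sd (a.v 8) 0 = if side v = true then 1 else 0 := acc.side_eq v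
  refine Triple.ite hw _ (by simp [Exp.ok]) (by simp only [Exp.cost, Blk.cost]; omega)
    (fun h15 => ?_) (fun h15 => ?_)
  · have hs : side v = true := by
      simp only [Exp.eval, St.set_v, if_true, hside] at h15
      by_contra h'
      rw [if_neg h'] at h15
      exact h15 rfl
    refine Triple.seq (by simp only [Exp.cost, Blk.cost]; omega) (Triple.sat hw
      (by simp only [Exp.cost, Blk.cost]; omega) ?_)
    refine .seq (.asg 9 ((Val.reg 8 (x := v) (by simp [hvdef])).add (.const (x := 1) (by omega))
      (by omega)) ?_)
    refine .asg 10 (.reg 1 (x := 4 ^ s) (by simp [h.base.h1])) ?_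
    set a₁ := ((a.set 15 (O.nat sd (a.v 8) 0)).set 9 (v + 1)).set 10 (4 ^ s) with ha₁
    have hb₁ : Base n s R a₁ := by
      constructor <;> simp [ha₁, h.base.h0, h.base.h1, h.base.h2, h.base.h3, h.base.h12]
    have hv₁ : ∀ x < 40, x ≠ 9 → x ≠ 10 → x ≠ 15 → a₁.v x = a.v x := by
      intro x hx h1 h2 h3
      simp [ha₁, h1, h2, h3]
    have h5 := hv₁ 5 (by omega) (by omega) (by omega) (by omega)
    have hm : ∀ x, a₁.m (a₁.v 10 + ent v (a₁.v 5 + x)) = C 1 (ent v (a.v 5 + x)) := by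
      intro x
      rw [h5]
      have hlt : ent v (a.v 5 + x) < 4 ^ s := by
        by_cases h0 : ent v (a.v 5 + x) = 0
        · omega
        · obtain ⟨u, hu, -⟩ := acc.adj_of_ent v _ h0
          omega
      have : a₁.m = flat (4 ^ s) C := h.tab.mem
      have e10 : a₁.v 10 = 1 * 4 ^ s := by simp [ha₁]
      rw [this, e10, flat_read _ _ hlt]
    have e9 : a₁.v 9 = v + 1 := by simp [ha₁]
    refine Triple.seq (by simp only [Exp.cost, Blk.cost]; omega) (Triple.search hw
      (acc.searchInput hL v hb₁ (hv₁ 8 (by omega) (by omega) (by omega) (by omega))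
        (by rw [h5]; exact h.off_add_le) h.le
        (by rw [hv₁ 4 (by omega) (by omega) (by omega) (by omega), h.size]) (by simp [ha₁]))
      (β := β) (by rwa [hb₁.h3]) (by rw [hb₁.h3]; simp only [Exp.cost, Blk.cost]; omega) ?_)
    rw [hb₁.h3]
    intro τ₂ b hτ₂ hτ₂' hab hfound
    simp only [Exp.cost, Blk.cost] at hτ₂
    have hb : LearnInv w s R G side ent β C₀ C d q b := h.congr (by rw [hab.1]; rfl)
      (fun x hx => by rw [hab.2 x (by omega), hv₁ x (by omega) (by omega) (by omega) (by omega)])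
      (by rw [hab.2 12 (by omega), hv₁ 12 (by omega) (by omega) (by omega) (by omega)])
    have hv8 : b.v 8 = v := by
      rw [hab.2 8 (by omega), hv₁ 8 (by omega) (by omega) (by omega) (by omega)]
    have hD' : (q + b.v 7 + b.v 6) * 2 ^ d = D := by
      rw [hab.2 7 (by omega), hv₁ 7 (by omega) (by omega) (by omega) (by omega),
        hab.2 6 (by omega), hv₁ 6 (by omega) (by omega) (by omega) (by omega)]
    have hv5 : b.v 5 = a.v 5 := by rw [hab.2 5 (by omega), h5]
    refine Triple.sat hw (by simp only [learnFound, learnMiss, cellE, Exp.cost, Blk.cost]; omega) ?_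
    have hcost : τ' ≤ τ₂ - (Blk.ite (.v 40) learnFound learnMiss : Blk ι).cost + U * 2 ^ d := by
      simp only [learnFound, learnMiss, cellE, Exp.cost, Blk.cost]
      omega
    rw [← hD'] at hfin
    refine .ite (.reg 40 rfl) (fun h40 => ?_) (fun h40 => ?_)
    · rcases hfound with ⟨-, x, hx, hmark, h41⟩ | ⟨h0, -⟩
      · rw [hm, e9] at hmark
        rw [h5] at h41
        have := hb.sat_learnFound acc hL v hv8.symm hs hmark h41
        exact ⟨this.1, hfin _ _ this.2 hcost⟩
      · exact (h40 h0).elim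
    · rcases hfound with ⟨h1, -⟩ | ⟨-, hno⟩
      · omega
      · have := hb.sat_learnMiss acc hL v hv8.symm (fun hβ y hy => by
          have := hno hβ y hy
          rwa [hm, e9, ← hv5] at this)
        exact ⟨this.1, hfin _ _ this.2 hcost⟩
  · have hs : ¬ side v = true := by
      intro h'
      simp [Exp.eval, St.set_v, hside, h'] at h15
    refine Triple.sat hw (by simp only [Exp.cost, Blk.cost]; omega) ?_
    refine .seq (.asg 8 ((Val.reg 8 (x := v) (by simp [hvdef])).add (.const (x := 1) (by omega))
      (by omega)) ?_)
    refine .asg 5 (x := 0) (.const (by omega)) (hfin _ _ ?_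
      (by simp only [Exp.cost, Blk.cost]; omega))
    refine h.next_vertex (b := _) hv (fun hβ v' hv' hs' => ?_) rfl ?_ (by simp) (by simp [hvdef])
      (by simp)
    · obtain rfl : v' = v := Fin.ext hv'
      exact absurd hs' hs
    · intro x hx h5
      simp [h5]
      rw [if_neg (by omega), if_neg (by omega)]

end

/-! ### Searching the stored lists -/

section
variable {ι : Type} {w n s R : ℕ} {O : BlackBox ι w} {G : SimpleGraph (Fin n)}
  {side : G.Coloring Bool} {β : Prop} {C C' : ℕ → ℕ → ℕ} {a b : St} {d : ℕ}

lemma Sound.congr (h : Sound side C) (h6 : C' 6 = C 6) (h16 : ∀ v, C' (16 + v) = C (16 + v)) :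
    Sound side C' :=
  ⟨fun v i hi => by rw [h16]; rw [h6] at hi; exact h.adj v i hi,
    fun v => by rw [h6, h16]; exact h.inj v, fun v => by rw [h6, h16]; exact h.zero v⟩

/-- The memory holds neighbor lists of the graph, complete if `β` holds, which decompose into
`O(n)` blocks of length `4 ^ d`. -/
structure NbrLists (w s R : ℕ) (G : SimpleGraph (Fin n)) (side : G.Coloring Bool) (β : Prop) (d : ℕ)
    (C : ℕ → ℕ → ℕ) (a : St) : Prop where
  base : Base n s R a
  tab : Tab (2 ^ w) (4 ^ s) C a
  size : a.v 4 = 2 ^ d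
  le : d ≤ s
  sound : Sound side C
  complete : β → ∀ v : Fin n, side v = true → CompleteAt G C v
  sum_le : ∑ v : Fin n, C 6 v ≤ 4 ^ d * n

namespace NbrLists

/-- Changes of registers and of other rows of the table do not affect the lists. -/
lemma congr (h : NbrLists w s R G side β d C a) (hT : Tab (2 ^ w) (4 ^ s) C' b) (h6 : C' 6 = C 6)
    (h16 : ∀ v, C' (16 + v) = C (16 + v)) (hv : ∀ x < 5, b.v x = a.v x) (h12 : b.v 12 = a.v 12) :
    NbrLists w s R G side β d C' b := by
  refine ⟨⟨?_, ?_, ?_, ?_, ?_⟩, hT, ?_, h.le, h.sound.congr h6 h16, fun hβ v hs u hu => ?_, ?_⟩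
  · rw [hv 0 (by omega), h.base.h0]
  · rw [hv 1 (by omega), h.base.h1]
  · rw [hv 2 (by omega), h.base.h2]
  · rw [hv 3 (by omega), h.base.h3]
  · rw [h12, h.base.h12]
  · rw [hv 4 (by omega), h.size]
  · rw [h6, h16]; exact h.complete hβ v hs u hu
  · rw [h6]; exact h.sum_le

/-- The number of blocks of the lists, and one more for each vertex. -/
lemma sum_blocks_le (h : NbrLists w s R G side β d C a) :
    ∑ v : Fin n, (C 6 v / 4 ^ d + 2) ≤ 3 * n := by
  have h1 : (∑ v : Fin n, C 6 v / 4 ^ d) * 4 ^ d ≤ n * 4 ^ d := by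
    rw [Finset.sum_mul, mul_comm n]
    exact (Finset.sum_le_sum fun v _ => Nat.div_mul_le_self _ _).trans h.sum_le
  have h2 := le_of_mul_le_mul_right h1 (by positivity)
  rw [Finset.sum_add_distrib]
  simp only [Finset.sum_const, Finset.card_univ, Fintype.card_fin, smul_eq_mul]
  omega

lemma entry (h : NbrLists w s R G side β d C a) (v : Fin n) (i : ℕ) (h0 : C (16 + v) i ≠ 0) :
    ∃ u : Fin n, C (16 + v) i = u + 1 ∧ G.Adj v u := by
  by_cases hi : i < C 6 v
  · exact (h.sound.adj v i hi).2
  · exact (h0 (h.sound.zero v i (by omega))).elim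

end NbrLists

/-- The XOR instructions that read the memory at the address in register `11` plus word `0`. -/
def listGates : List (Instr ι 14) :=
  [.qxor 8 11, .qop .add 9 8 0 (by decide) (by decide), .qload 3 9 (by decide)]

/-- The classical counterpart of `listGates`. -/
def listBlk : Blk ι := .asg 41 (.ld (.v 11 +ₑ .v 42))

/-- Search a block, from the position in register `5` on, of the list of the vertex in register `8`
for a neighbor `u` such that the entry `u + 1` of row `ρ` is smaller than register `9`. -/
def listSearch (ρ : ℕ) : Prog ι 14 :=
  .seq (Blk.prog (.seq (.asg 10 (.c ρ *ₑ .v 1)) (.asg 11 (cellE (.c 16 +ₑ .v 8) (.v 5)))))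
    (search listGates listBlk)

/-- The unit of running time for searches in the lists. -/
def listUnit (R : ℕ) : ℕ := unit (ι := Empty) listGates listBlk R

/-- The search for a neighbor in a block of a stored list.  Holes, which are entries `0`, are never
found because of the sentinel `C ρ 0`. -/
lemma Triple.listSearch (hL : Large w n s R) {δ : NNReal}
    (hδ : β → (3 / 4) ^ R ≤ (δ : ℝ)) (h : NbrLists w s R G side β d C a) {ρ : ℕ} (hρ : ρ < 16)
    (v : Fin n) (hv : a.v 8 = v) (hoff : a.v 5 + 4 ^ d ≤ 4 ^ s) (h9 : a.v 9 ≤ C ρ 0) {τ : ℕ}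
    (hτ : 2 ^ d * listUnit R ≤ τ + 900)
    {Q : ℕ → St → Prop} (hQ : ∀ τ' b, τ + 900 ≤ τ' + 2 ^ d * listUnit R → τ' ≤ τ → b.m = a.m →
      (∀ x < 40, x ≠ 10 → x ≠ 11 → b.v x = a.v x) →
      ((b.v 40 = 1 ∧ ∃ u : Fin n, b.v 41 = u.val + 1 ∧ G.Adj v u ∧ C ρ (u + 1) < a.v 9) ∨
        (b.v 40 = 0 ∧ (β → ∀ i < 4 ^ d, ∀ u : Fin n, C (16 + v) (a.v 5 + i) = u + 1 →
          a.v 9 ≤ C ρ (u + 1)))) → Q τ' b) :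
    Triple O δ (listSearch ρ) Q τ a := by
  have hw := hL.pos
  have hM := hL.mem
  have hn := hL.lt
  have hvn := v.2
  have hZpos : 0 < 4 ^ s := by positivity
  have h4d : 0 < 4 ^ d := by positivity
  have hZ : 4 ^ s ≤ 4 ^ s * 4 ^ s := Nat.le_mul_of_pos_left _ hZpos
  have hρZ : ρ * 4 ^ s ≤ 15 * (4 ^ s * 4 ^ s) := Nat.mul_le_mul (by omega) hZ
  have hSC := searchCost_le (ι := Empty) listGates listBlk d R
  have e : searchCost (ι := Empty) listGates listBlk d R = searchCost (ι := ι)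
    listGates listBlk d R := rfl
  rw [e] at hSC
  change _ ≤ 2 ^ d * listUnit R at hSC
  refine Triple.seq (by omega) (Triple.sat hw (by simp only [cellE, Exp.cost, Blk.cost]; omega) ?_)
  refine .seq (.asg 10 (x := ρ * 4 ^ s) ((Val.const (by omega)).mul (.reg 1 h.base.h1) (by omega))
    ?_)
  refine .asg 11 (x := (16 + v) * 4 ^ s + a.v 5) (Val.addr (h.tab.set _ _)
    ((Val.const (by omega)).add (.reg 8 (by simp [hv])) (by omega)) (.reg 5 (by simp)) (by omega)
      (by omega)) ?_
  set a₁ := (a.set 10 (ρ * 4 ^ s)).set 11 ((16 + v) * 4 ^ s + a.v 5) with ha₁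
  have hv₁ : ∀ x, x ≠ 10 → x ≠ 11 → a₁.v x = a.v x := by
    intro x h1 h2; simp [ha₁, h1, h2]
  have h10 : a₁.v 10 = ρ * 4 ^ s := by simp [ha₁]
  have h11 : a₁.v 11 = (16 + v) * 4 ^ s + a.v 5 := by simp [ha₁]
  have hm₁ : a₁.m = flat (4 ^ s) C := h.tab.mem
  have hrow : (16 + v.val) * 4 ^ s + 4 ^ s ≤ 32 * (4 ^ s * 4 ^ s) := by
    calc _ = (17 + v.val) * 4 ^ s := by ring
      _ ≤ (32 * 4 ^ s) * 4 ^ s := Nat.mul_le_mul_right _ (by omega)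
      _ = _ := by ring
  have hent : ∀ x < 4 ^ d, flat (4 ^ s) C ((16 + v) * 4 ^ s + a.v 5 + x) = C (16 + v)
    (a.v 5 + x) := by
    intro x hx
    rw [add_assoc, flat_read _ _ (by omega)]
  have hle : ∀ i, C (16 + v) i < 4 ^ s := by
    intro i
    by_cases h0 : C (16 + v) i = 0
    · omega
    · obtain ⟨u, hu, -⟩ := h.entry v i h0
      omega
  have hin : SearchInput O (listGates : List (Instr ι 14)) listBlk
      (fun x => flat (4 ^ s) C ((16 + v) * 4 ^ s + a.v 5 + x)) d a₁ := by
    refine ⟨by have := hL.width; have := h.le; omega, by rw [hv₁ 4 (by omega) (by omega), h.size],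
      by omega, ?_, ?_, ?_, ?_⟩
    · simp [listGates, Instr.IsGate]
    · intro x hx
      simp only [hent x hx, h10]
      have := hle (a.v 5 + x)
      omega
    · intro b t hab hr x hx
      have e11 : (t.reg 11).toNat = (16 + v) * 4 ^ s + a.v 5 := by
        rw [hr.1 11 (by omega), hab.2 11 (by omega), h11]
      have eadd : (t.reg 11 + x).toNat = (16 + v) * 4 ^ s + a.v 5 + x.toNat := by
        rw [BitVec.toNat_add, e11, Nat.mod_eq_of_lt (by omega)]
      constructor
      · have : Instr.basisList O t listGates (basisWord x) 3 = t.mem (t.reg 11 + x) := by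
          simp [listGates, Instr.basisList, Instr.basis, QState.xorMap, basisWord, WordOp.eval]
        rw [this, hr.2, hab.1, hm₁, eadd]
      · intro i hi
        rcases hi with rfl | rfl | rfl | rfl | rfl <;>
        simp [listGates, Instr.basisList, Instr.basis, QState.xorMap, basisWord]
    · intro b hab hb
      have e11 : b.v 11 = (16 + v) * 4 ^ s + a.v 5 := by rw [hab.2 11 (by omega), h11]
      refine ⟨⟨by norm_num, by simp [Exp.ok], by simp [Exp.ok], ?_⟩, ?_⟩
      · simp only [Exp.eval, WordOp.okNat, e11]
        omega
      · simp [listBlk, Blk.exec, Exp.eval, WordOp.evalNat, e11, hab.1, hm₁]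
  have h3 : a₁.v 3 = R := by rw [hv₁ 3 (by omega) (by omega), h.base.h3]
  refine Triple.search hw hin (β := β) (by rwa [h3])
    (by rw [h3]; simp only [cellE, Exp.cost, Blk.cost]; omega) ?_
  rw [h3]
  intro τ' b hτ' hτ'' hab hf
  have hmark : ∀ x < 4 ^ d, a₁.m (a₁.v 10 + flat (4 ^ s) C ((16 + v) * 4 ^ s + a.v 5 + x)) =
      C ρ (C (16 + v) (a.v 5 + x)) := by
    intro x hx
    rw [hent x hx, hm₁, h10, flat_read _ _ (hle _)]
  have e9 : a₁.v 9 = a.v 9 := hv₁ 9 (by omega) (by omega)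
  simp only [cellE, Exp.cost, Blk.cost] at hτ' hτ''
  refine hQ τ' b (by omega) (by omega) (by rw [hab.1]; rfl)
    (fun x hx h1 h2 => by rw [hab.2 x hx, hv₁ x h1 h2]) ?_
  rcases hf with ⟨h40, x, hx, hlt, h41⟩ | ⟨h40, hno⟩
  · refine Or.inl ⟨h40, ?_⟩
    rw [hmark x hx, e9] at hlt
    replace h41 := h41.trans (hent x hx)
    obtain ⟨u, hu, hadj⟩ := h.entry v (a.v 5 + x) (fun h0 => by rw [h0] at hlt; omega)
    exact ⟨u, by rw [h41, hu], hadj, by rwa [hu] at hlt⟩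
  · refine Or.inr ⟨h40, fun hβ i hi u hu => ?_⟩
    have := hno hβ i hi
    rw [hmark i hi, e9, hu] at this
    omega

/-- Choose the length of the blocks: the square of register `4` is the least power of `4` such that
blocks of this length suffice on average for the lists. -/
def choose : Prog ι 14 :=
  .seq (Blk.asg 4 (.c 1)).prog
    (.while (((.v 4 *ₑ .v 4) *ₑ .v 0) <ₑ .v 6) (Blk.asg 4 (.c 2 *ₑ .v 4)).prog)

/-- The chosen block length is at most of the order of the average length of the lists. -/
lemma Triple.choose (hL : Large w n s R) {δ : NNReal} (hb : Base n s R a)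
    (hT : Tab (2 ^ w) (4 ^ s) C a) (hs : Sound side C)
    (hc : β → ∀ v : Fin n, side v = true → CompleteAt G C v) (h6 : a.v 6 = ∑ v : Fin n, C 6 v)
    {τ τe : ℕ} (hτ : τe + 40 * (s + 2) ≤ τ) {Q : ℕ → St → Prop}
    (hQ : ∀ τ' ≤ τ, ∀ b d, τe ≤ τ' → NbrLists w s R G side β d C b →
      4 ^ d * n ≤ 4 * (∑ v : Fin n, C 6 v) + n → Q τ' b) : Triple O δ choose Q τ a := by
  have hw := hL.pos
  have hM := hL.mem
  have hn := hL.lt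
  have hZpos : 0 < 4 ^ s := by positivity
  have hZ : 4 ^ s ≤ 4 ^ s * 4 ^ s := Nat.le_mul_of_pos_left _ hZpos
  have hsum : ∑ v : Fin n, C 6 v ≤ n * n := by
    refine (Finset.sum_le_sum fun v _ => hs.deg_le v).trans ?_
    simp
  refine Triple.seq (by omega) (Triple.sat hw (by simp only [Exp.cost, Blk.cost]; omega) ?_)
  refine .asg 4 (.const (x := 1) (by omega)) ?_
  refine Triple.while_ hw _ (fun τ' b => Tab (2 ^ w) (4 ^ s) C b ∧ Base n s R b ∧
    b.v 6 = ∑ v : Fin n, C 6 v ∧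
    ∃ d ≤ s, b.v 4 = 2 ^ d ∧ 4 ^ d * n ≤ 4 * (∑ v : Fin n, C 6 v) + n ∧
    τe + 40 * (s + 1) ≤ τ' + 40 * d) ?_ ?_
  · rintro τ' hτ' b ⟨hT, hb, h6, d, hd, h4, hle, hcr⟩
    have h44 : (2 : ℕ) ^ d * 2 ^ d = 4 ^ d := by rw [← mul_pow]; norm_num
    have h4s : 4 ^ d ≤ 4 ^ s := Nat.pow_le_pow_right (by norm_num) hd
    have h24 : 2 ^ d ≤ 4 ^ d := Nat.pow_le_pow_left (by norm_num) d
    have h5 : 4 ^ d * n ≤ 4 ^ s * 4 ^ s := Nat.mul_le_mul h4s hn.le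
    have hcond := (((Val.reg (M := 2 ^ w) 4 h4).mul (.reg 4 h4) (by omega)).mul (.reg 0 hb.h0)
      (by rw [h44]; omega)).lt (.reg 6 h6)
    rw [h44] at hcond
    refine ⟨hcond.1, by simp only [Exp.cost]; omega, fun he => ?_, fun he => ?_⟩
    · rw [hcond.2] at he
      refine hQ _ (by omega) b d (by simp only [Exp.cost]; omega) ⟨hb, hT, h4, hd, hs, hc, ?_⟩ hle
      by_contra h'
      rw [if_pos (by omega)] at he
      omega
    · rw [hcond.2] at he
      have hlt : 4 ^ d * n < ∑ v : Fin n, C 6 v := by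
        by_contra h'; rw [if_neg h'] at he; exact he rfl
      have hds : d < s := by
        have h1 : 4 ^ d * n < n * n := by omega
        have h2 : 4 ^ d < 4 ^ s := (lt_of_mul_lt_mul_right h1 (by omega)).trans hn
        exact (Nat.pow_lt_pow_iff_right (by norm_num)).mp h2
      refine Triple.sat hw (by simp only [Exp.cost, Blk.cost]; omega) ?_
      refine .asg 4 (x := 2 * 2 ^ d) ((Val.const (by omega)).mul (.reg 4 h4) (by omega)) ?_
      refine ⟨hT.set _ _,
        ⟨?_, ?_, ?_, ?_, ?_⟩, by simpa using h6, d + 1, hds, by simp [pow_succ, mul_comm],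
        by rw [show 4 ^ (d + 1) * n = 4 * (4 ^ d * n) by ring]; omega, by simp only [Exp.cost, Blk.cost]; omega⟩
      all_goals simp [hb.h0, hb.h1, hb.h2, hb.h3, hb.h12]
  · refine ⟨hT.set _ _, ⟨?_, ?_, ?_, ?_, ?_⟩, by simpa using h6, 0, by omega, by simp,
      by rw [pow_zero]; omega, by simp only [Exp.cost, Blk.cost]; omega⟩
    all_goals simp [hb.h0, hb.h1, hb.h2, hb.h3, hb.h12]

end

/-! ### The auction -/

section
variable {n : ℕ} {G : SimpleGraph (Fin n)}

/-- The vertex `v` gets matched with `u`, which loses its former partner. -/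
lemma IsMate.kick {mate mate' : ℕ → ℕ} (hm : IsMate G mate) {v u : Fin n} (hv : mate v = 0)
    (hadj : G.Adj v u)
      (h : ∀ x : Fin n, mate' x = if x = v then u.val + 1 else if x = u then v.val + 1
      else if mate u = x + 1 then 0 else mate x) : IsMate G mate' := by
  have hne : u ≠ v := hadj.ne'
  intro x hx
  by_cases hxv : x = v
  · subst hxv
    exact ⟨u, by rw [h, if_pos rfl], by rw [h, if_neg hne, if_pos rfl], hadj⟩
  by_cases hxu : x = u
  · subst hxu
    exact ⟨v, by rw [h, if_neg hxv, if_pos rfl], by rw [h, if_pos rfl], hadj.symm⟩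
  rw [h, if_neg hxv, if_neg hxu] at hx
  have hx' : mate u ≠ x + 1 := fun h' => hx (if_pos h')
  rw [if_neg hx'] at hx
  obtain ⟨y, h1, h2, h3⟩ := hm x hx
  refine ⟨y, by rw [h, if_neg hxv, if_neg hxu, if_neg hx', h1], ?_, h3⟩
  rw [h, if_neg, if_neg, if_neg, h2]
  · intro h4
    obtain ⟨z, h5, h6, -⟩ := hm u (by omega)
    obtain rfl : z = y := Fin.ext (by omega)
    exact hxu (Fin.ext (by omega))
  · rintro rfl; exact hx' h2
  · rintro rfl; omega

lemma sum_add_one_le {f g : Fin n → ℕ} (h : ∀ x, f x ≤ g x) (v : Fin n) (hv : f v + 1 ≤ g v) :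
    ∑ x, f x + 1 ≤ ∑ x, g x :=
  Finset.sum_lt_sum (fun x _ => h x) ⟨v, Finset.mem_univ _, hv⟩

lemma add_pow_le_of_dvd {d s x : ℕ} (hd : d ≤ s) (hx : 4 ^ d ∣ x) (hlt : x < 4 ^ s) :
    x + 4 ^ d ≤ 4 ^ s := by
  obtain ⟨y, hy⟩ : (4 : ℕ) ^ d ∣ 4 ^ s := pow_dvd_pow _ hd
  obtain ⟨z, rfl⟩ := hx
  rw [hy] at hlt ⊢
  have h4 : z < y := lt_of_mul_lt_mul_left hlt (by positivity)
  calc _ = 4 ^ d * (z + 1) := by ring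
    _ ≤ _ := Nat.mul_le_mul_left _ h4

end

section
variable {ι : Type}

/-- Proceed to the next vertex. -/
def auctionNext : Blk ι := .seq (.asg 13 (.v 13 +ₑ .c 1)) (.asg 8 (.v 13))

/-- A neighbor at a suitable price was found: take it, raise its price and go on with its former
partner, if there is one. -/
def auctionFound : Blk ι :=
  .seq (.asg 14 (.ld (cellE (.c 0) (.v 41 -ₑ .c 1))))
  (.seq (.sto (cellE (.c 0) (.v 41 -ₑ .c 1)) (.v 8 +ₑ .c 1))
  (.seq (.sto (cellE (.c 0) (.v 8)) (.v 41))
  (.seq (.sto (cellE (.c 2) (.v 41)) (.ld (cellE (.c 2) (.v 41)) +ₑ .c 1))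
  (.ite (.v 14)
    (.seq (.sto (cellE (.c 0) (.v 14 -ₑ .c 1)) (.c 0)) (.asg 8 (.v 14 -ₑ .c 1)))
    auctionNext))))

/-- Proceed to the next block. -/
def auctionMiss : Blk ι := .sto (cellE (.c 5) (.v 8)) (.v 5 +ₑ (.v 4 *ₑ .v 4))

/-- The list has been scanned: raise the level of the vertex, or give it up if the level is
`2 ^ s`. -/
def auctionEnd : Blk ι :=
  .seq (.sto (cellE (.c 5) (.v 8)) (.c 0))
  (.seq (.sto (cellE (.c 4) (.v 8)) (.ld (cellE (.c 4) (.v 8)) +ₑ .c 1))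
  (.ite (.ld (cellE (.c 4) (.v 8)) <ₑ .v 2) .skip auctionNext))

/-- The auction.  Register `8` is the vertex `v` that is to be matched, register `13` the next
vertex that has not been considered; row `0` is the matching, row `2` holds the prices, row `4`
the levels and row `5` the positions in the lists.  A vertex accepts a neighbor whose price is at
most its level. -/
def auction (sd : ι) : Prog ι 14 :=
  .while (.v 13 <ₑ .v 0)
    (.seq (Blk.qry 15 sd (.v 8) (.c 0)).prog
    (.ite (.v 15)
      (.ite (.ld (cellE (.c 5) (.v 8)) <ₑ .ld (cellE (.c 6) (.v 8)))
        (.seq (Blk.seq (.asg 9 (.ld (cellE (.c 4) (.v 8)) +ₑ .c 1))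
            (.asg 5 (.ld (cellE (.c 5) (.v 8))))).prog
          (.seq (listSearch 2) (Blk.ite (.v 40) auctionFound auctionMiss).prog))
        auctionEnd.prog)
      auctionNext.prog))

end

section
variable {ι : Type} {w n s R : ℕ} {O : BlackBox ι w} {G : SimpleGraph (Fin n)}
  {side : G.Coloring Bool} {β : Prop} {C₀ C C' : ℕ → ℕ → ℕ} {a b : St} {d : ℕ} {P : St → Prop}

/-- The invariant of the auction, up to the properties of the current vertex.  If `β` holds, no
search has failed. -/
structure AuctionInv (w s R : ℕ) (G : SimpleGraph (Fin n)) (side : G.Coloring Bool) (β : Prop)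
    (d : ℕ) (C₀ C : ℕ → ℕ → ℕ) (a : St) : Prop where
  lists : NbrLists w s R G side β d C a
  rows : ∀ r, r ≠ 0 → r ≠ 2 → r ≠ 4 → r ≠ 5 → C r = C₀ r
  mate : IsMate G (C 0)
  vertex : a.v 13 ≤ n
  before : ∀ v : Fin n, side v = true → v ≤ a.v 13 →
    C 0 v ≠ 0 ∨ 2 ^ s ≤ C 4 v ∨ v.val = a.v 8
  after : ∀ v : Fin n, side v = true → a.v 13 < v → C 0 v = 0 ∧ C 4 v = 0
  price_zero : 2 ^ s < C 2 0
  price_le : ∀ u : Fin n, C 2 (u + 1) ≤ 2 ^ s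
  lev_le : ∀ v : Fin n, C 4 v ≤ 2 ^ s
  ptr_dvd : ∀ v : Fin n, 4 ^ d ∣ C 5 v
  ptr_lt : ∀ v : Fin n, C 5 v < C 6 v + 4 ^ d
  scanned : β → ∀ v : Fin n, ∀ i < C 5 v, ∀ u : Fin n, C (16 + v) i = u + 1 →
    C 4 v + 1 ≤ C 2 (u + 1)
  lev_price : β → ∀ v u : Fin n, side v = true → G.Adj v u → C 4 v ≤ C 2 (u + 1)
  matched : ∀ v u : Fin n, side v = true → C 0 v = u + 1 → C 2 (u + 1) ≤ C 4 v + 1 ∧ C 4 v < 2 ^ s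
  priced : ∀ u : Fin n, side u = false → C 0 u = 0 → C 2 (u + 1) = 0

/-- The current vertex. -/
def AuctionCur (n s : ℕ) {G : SimpleGraph (Fin n)} (side : G.Coloring Bool) (C : ℕ → ℕ → ℕ)
    (a : St) : Prop :=
  (a.v 13 < n → ∃ v : Fin n, a.v 8 = v ∧ v ≤ a.v 13 ∧
    (side v = true → C 0 v = 0 ∧ C 4 v < 2 ^ s)) ∧ (n ≤ a.v 13 → n ≤ a.v 8)

/-- The amortised cost so far: each step of the auction raises it. -/
def auctionSpent (n d : ℕ) (C : ℕ → ℕ → ℕ) (x : ℕ) : ℕ :=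
  x + ∑ v : Fin n, (C 4 v * (C 6 v / 4 ^ d + 2) + C 5 v / 4 ^ d) + ∑ u : Fin n, C 2 (u + 1)

/-- The state after a step of the auction. -/
def AuctionStep (w s R : ℕ) (G : SimpleGraph (Fin n)) (side : G.Coloring Bool) (β : Prop)
    (d : ℕ) (C₀ : ℕ → ℕ → ℕ) (D : ℕ) (a : St) : Prop :=
  ∃ C, AuctionInv w s R G side β d C₀ C a ∧ AuctionCur n s side C a ∧
    D < auctionSpent n d C (a.v 13)

namespace AuctionInv

lemma congr (h : AuctionInv w s R G side β d C₀ C a) (hm : b.m = a.m) (hv : ∀ x < 5, b.v x = a.v x)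
    (h8 : b.v 8 = a.v 8) (h12 : b.v 12 = a.v 12) (h13 : b.v 13 = a.v 13) :
    AuctionInv w s R G side β d C₀ C b where
  lists := h.lists.congr ⟨by rw [hm, h.lists.tab.mem], by rw [hv 1 (by omega), h.lists.tab.reg],
    h.lists.tab.pos, h.lists.tab.big⟩ rfl (fun _ => rfl) hv h12
  rows := h.rows
  mate := h.mate
  vertex := by rw [h13]; exact h.vertex
  before := by rw [h13, h8]; exact h.before
  after := by rw [h13]; exact h.after
  price_zero := h.price_zero
  price_le := h.price_le
  lev_le := h.lev_le
  ptr_dvd := h.ptr_dvd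
  ptr_lt := h.ptr_lt
  scanned := h.scanned
  lev_price := h.lev_price
  matched := h.matched
  priced := h.priced

lemma spent_le (h : AuctionInv w s R G side β d C₀ C a) :
    auctionSpent n d C (a.v 13) + (n - a.v 13) ≤ 4 * n * (2 ^ s + 1) := by
  have h1 : ∑ v : Fin n, (C 4 v * (C 6 v / 4 ^ d + 2) + C 5 v / 4 ^ d) ≤ (2 ^ s + 1) * (3 * n) := by
    refine le_trans ?_ (Nat.mul_le_mul_left _ h.lists.sum_blocks_le)
    rw [Finset.mul_sum]
    refine Finset.sum_le_sum fun v _ => ?_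
    have h2 : C 5 v / 4 ^ d ≤ C 6 v / 4 ^ d + 1 := by
      rw [← Nat.add_div_right _ (by positivity)]
      exact Nat.div_le_div_right (h.ptr_lt v).le
    have h3 := Nat.mul_le_mul_right (C 6 v / 4 ^ d + 2) (h.lev_le v)
    rw [add_mul, one_mul]
    omega
  have h2 : ∑ u : Fin n, C 2 (u + 1) ≤ n * 2 ^ s := by
    refine (Finset.sum_le_sum fun u _ => h.price_le u).trans ?_
    simp
  have h3 := h.vertex
  unfold auctionSpent
  have e1 : (2 ^ s + 1) * (3 * n) = 3 * (n * 2 ^ s) + 3 * n := by ring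
  have e2 : 4 * n * (2 ^ s + 1) = 4 * (n * 2 ^ s) + 4 * n := by ring
  omega

lemma sat_next (h : AuctionInv w s R G side β d C₀ C a) (hL : Large w n s R) (hlt : a.v 13 < n)
    (hset : ∀ v : Fin n, v.val = a.v 8 → side v = true → C 0 v ≠ 0 ∨ 2 ^ s ≤ C 4 v)
    {D : ℕ} (hD : D ≤ auctionSpent n d C (a.v 13)) :
    auctionNext.Sat O a (AuctionStep w s R G side β d C₀ D) := by
  have hM := hL.mem
  have hn := hL.lt
  have hZ : 4 ^ s ≤ 4 ^ s * 4 ^ s := Nat.le_mul_of_pos_left _ h.lists.tab.pos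
  refine .seq (.asg 13 ((Val.reg 13 rfl).add (.const (x := 1) (by omega)) (by omega)) ?_)
  refine .asg 8 (.reg 13 (x := a.v 13 + 1) (by simp)) ?_
  have hlists := h.lists.congr ((h.lists.tab.set 13 (a.v 13 + 1)).set 8 (a.v 13 + 1))
    rfl (fun _ => rfl)
    (fun x hx => by
      simp only [St.set_v]; rw [if_neg (by omega), if_neg (by omega)]) (by simp)
  refine ⟨C, { h with lists := hlists, vertex := ?_, before := ?_, after := ?_ }, ?_, ?_⟩
  · simp; omega
  · intro v hs hv
    simp only [St.set_v] at hv ⊢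
    norm_num at hv ⊢
    rcases Nat.lt_or_ge (a.v 13) v with h1 | h1
    · omega
    · rcases h.before v hs h1 with h2 | h2 | h2
      · exact Or.inl h2
      · exact Or.inr (Or.inl h2)
      · rcases hset v h2 hs with h3 | h3
        exacts [Or.inl h3, Or.inr (Or.inl h3)]
  · intro v hs hv
    refine h.after v hs ?_
    simp only [St.set_v] at hv
    norm_num at hv
    omega
  · refine ⟨fun hlt' => ?_, by simp⟩
    simp only [St.set_v] at hlt'
    norm_num at hlt'
    refine ⟨⟨a.v 13 + 1, hlt'⟩, by simp, by simp, fun hs => ?_⟩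
    obtain ⟨h1, h2⟩ := h.after ⟨a.v 13 + 1, hlt'⟩ hs (Nat.lt_succ_self _)
    exact ⟨h1, by rw [h2]; positivity⟩
  · simp only [St.set_v]
    norm_num
    unfold auctionSpent at hD ⊢
    omega

lemma sat_miss (h : AuctionInv w s R G side β d C₀ C a) (hL : Large w n s R)
    (hcur : AuctionCur n s side C a) (v : Fin n) (hv : a.v 8 = v) (h5 : a.v 5 = C 5 v)
    (hlt : C 5 v < C 6 v)
    (hno : β → ∀ i < 4 ^ d, ∀ u : Fin n, C (16 + v) (C 5 v + i) = u + 1 → C 4 v + 1 ≤ C 2 (u + 1)) :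
    auctionMiss.Sat O a (AuctionStep w s R G side β d C₀ (auctionSpent n d C (a.v 13))) := by
  have hM := hL.mem
  have hn := hL.lt
  have hvn := v.2
  have hZ : 4 ^ s ≤ 4 ^ s * 4 ^ s := Nat.le_mul_of_pos_left _ h.lists.tab.pos
  have h44 : (2 : ℕ) ^ d * 2 ^ d = 4 ^ d := by rw [← mul_pow]; norm_num
  have h4d : 0 < 4 ^ d := by positivity
  have hdeg := h.lists.sound.deg_le v
  have hoff := add_pow_le_of_dvd h.lists.le (h.ptr_dvd v) (by omega)
  refine .sto h.lists.tab (ρ := 5) (i := v) (x := C 5 v + 4 ^ d) (.const (by omega)) (.reg 8 hv)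
    (by rw [← h44]; exact (Val.reg 5 h5).add ((Val.reg 4 h.lists.size).mul (.reg 4 h.lists.size)
      (by omega)) (by omega)) (by omega) (by omega) ?_
  intro b hb hT
  set C' := upd C 5 v (C 5 v + 4 ^ d) with hC'
  have hr : ∀ r, r ≠ 5 → C' r = C r := fun r hr => upd_of_ne _ hr _ _
  have hr5 : ∀ x : ℕ, C' 5 x = if x = v.val then C 5 v + 4 ^ d else C 5 x := by
    intro x; simp [hC', upd_apply]
  refine ⟨C', { lists := ?_, rows := ?_, mate := ?_, vertex := ?_, before := ?_, after := ?_,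
                price_zero := ?_, price_le := ?_, lev_le := ?_, ptr_dvd := ?_, ptr_lt := ?_,
                scanned := ?_, lev_price := ?_, matched := ?_, priced := ?_ }, ?_, ?_⟩
  · exact h.lists.congr hT (hr _ (by omega)) (fun x => hr _ (by omega)) (fun x _ => by rw [hb])
      (by rw [hb])
  · intro r h0 h2 h4 h5; rw [hr r h5, h.rows r h0 h2 h4 h5]
  · rw [hr 0 (by omega)]; exact h.mate
  · rw [hb]; exact h.vertex
  · rw [hb, hr 0 (by omega), hr 4 (by omega)]; exact h.before
  · rw [hb, hr 0 (by omega), hr 4 (by omega)]; exact h.after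
  · rw [hr 2 (by omega)]; exact h.price_zero
  · rw [hr 2 (by omega)]; exact h.price_le
  · rw [hr 4 (by omega)]; exact h.lev_le
  · intro x
    rw [hr5]
    split_ifs
    · exact Nat.dvd_add (h.ptr_dvd v) dvd_rfl
    · exact h.ptr_dvd x
  · intro x
    rw [hr5, hr 6 (by omega)]
    split_ifs with hx
    · rw [hx]; omega
    · exact h.ptr_lt x
  · intro hβ x i hi u hu
    rw [hr5] at hi
    rw [hr _ (by omega)] at hu
    rw [hr 4 (by omega), hr 2 (by omega)]
    split_ifs at hi with hx
    · obtain rfl : x = v := Fin.ext hx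
      by_cases hi' : i < C 5 x
      · exact h.scanned hβ x i hi' u hu
      · refine hno hβ (i - C 5 x) (by omega) u ?_
        rwa [show C 5 x + (i - C 5 x) = i by omega]
    · exact h.scanned hβ x i hi u hu
  · rw [hr 4 (by omega), hr 2 (by omega)]; exact h.lev_price
  · rw [hr 4 (by omega), hr 2 (by omega), hr 0 (by omega)]; exact h.matched
  · rw [hr 2 (by omega), hr 0 (by omega)]; exact h.priced
  · unfold AuctionCur
    rw [hb, hr 4 (by omega), hr 0 (by omega)]; exact hcur
  · unfold auctionSpent
    rw [hb, hr 4 (by omega), hr 2 (by omega), hr 6 (by omega)]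
    have := sum_add_one_le (f := fun v : Fin n => C 4 v * (C 6 v / 4 ^ d + 2) + C 5 v / 4 ^ d)
      (g := fun v : Fin n => C 4 v * (C 6 v / 4 ^ d + 2) + C' 5 v / 4 ^ d) (fun x => by
        rw [hr5]
        split_ifs with hx
        · rw [hx]; gcongr; omega
        · rfl) v (by rw [hr5, if_pos rfl, Nat.add_div_right _ h4d]; rfl)
    omega

lemma sat_end (h : AuctionInv w s R G side β d C₀ C a) (hL : Large w n s R) (hlt : a.v 13 < n)
    (v : Fin n) (hv : a.v 8 = v) (hs : side v = true) (hv0 : v ≤ a.v 13) (hm : C 0 v = 0)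
    (hlev : C 4 v < 2 ^ s) (hptr : C 6 v ≤ C 5 v) :
    auctionEnd.Sat O a (AuctionStep w s R G side β d C₀ (auctionSpent n d C (a.v 13))) := by
  have hM := hL.mem
  have hn := hL.lt
  have hvn := v.2
  have hZ : 4 ^ s ≤ 4 ^ s * 4 ^ s := Nat.le_mul_of_pos_left _ h.lists.tab.pos
  have h24 : 2 ^ s ≤ 4 ^ s := Nat.pow_le_pow_left (by norm_num) s
  have h4d : 0 < 4 ^ d := by positivity
  refine .seq (.sto h.lists.tab (ρ := 5) (i := v) (x := 0) (.const (by omega)) (.reg 8 hv)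
    (.const (by omega)) (by omega) (by omega) ?_)
  intro b₁ hb₁ hT₁
  have c4 : Val (2 ^ w) b₁ (.ld (cellE (.c 4) (.v 8))) (C 4 v) := by
    have := Val.cell hT₁ (.const (x := 4) (by omega)) (.reg 8 (x := v) (by rw [hb₁, hv])) (by omega)
      (by omega)
    rwa [upd_of_ne _ (by omega)] at this
  refine .seq (.sto hT₁ (ρ := 4) (i := v) (x := C 4 v + 1) (.const (by omega))
    (.reg 8 (by rw [hb₁, hv]))
    (c4.add (.const (by omega)) (by omega)) (by omega) (by omega) ?_)
  intro b₂ hb₂ hT₂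
  set C' := upd (upd C 5 v 0) 4 v (C 4 v + 1) with hC'
  have hb : b₂.v = a.v := by rw [hb₂, hb₁]
  have hr : ∀ r, r ≠ 5 → r ≠ 4 → C' r = C r := fun r h5 h4 => by
    rw [hC', upd_of_ne _ h4, upd_of_ne _ h5]
  have hr5 : ∀ x : ℕ, C' 5 x = if x = v.val then 0 else C 5 x := by
    intro x; simp [hC', upd_apply]
  have hr4 : ∀ x : ℕ, C' 4 x = if x = v.val then C 4 v + 1 else C 4 x := by
    intro x; simp [hC', upd_apply]
  have h4le : ∀ x : ℕ, C 4 x ≤ C' 4 x := by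
    intro x; rw [hr4]; split_ifs with hx
    · rw [hx]; omega
    · rfl
  have hinv : AuctionInv w s R G side β d C₀ C' b₂ := by
    refine { lists := ?_, rows := ?_, mate := ?_, vertex := ?_, before := ?_, after := ?_,
             price_zero := ?_, price_le := ?_, lev_le := ?_, ptr_dvd := ?_, ptr_lt := ?_,
             scanned := ?_, lev_price := ?_, matched := ?_, priced := ?_ }
    · exact h.lists.congr hT₂ (hr _ (by omega) (by omega)) (fun x => hr _ (by omega) (by omega))
        (fun x _ => by rw [hb]) (by rw [hb])
    · intro r h0 h2 h4 h5; rw [hr r h5 h4, h.rows r h0 h2 h4 h5]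
    · rw [hr 0 (by omega) (by omega)]; exact h.mate
    · rw [hb]; exact h.vertex
    · intro x hsx hx
      rw [hb] at hx ⊢
      rw [hr 0 (by omega) (by omega)]
      rcases h.before x hsx hx with h1 | h1 | h1
      · exact Or.inl h1
      · exact Or.inr (Or.inl (h1.trans (h4le _)))
      · exact Or.inr (Or.inr h1)
    · intro x hsx hx
      rw [hb] at hx
      rw [hr 0 (by omega) (by omega), hr4, if_neg (by omega)]
      exact h.after x hsx hx
    · rw [hr 2 (by omega) (by omega)]; exact h.price_zero
    · rw [hr 2 (by omega) (by omega)]; exact h.price_le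
    · intro x
      rw [hr4]
      split_ifs
      · omega
      · exact h.lev_le x
    · intro x
      rw [hr5]
      split_ifs
      · exact dvd_zero _
      · exact h.ptr_dvd x
    · intro x
      rw [hr5, hr 6 (by omega) (by omega)]
      split_ifs with hx
      · omega
      · exact h.ptr_lt x
    · intro hβ x i hi u hu
      rw [hr5] at hi
      rw [hr _ (by omega) (by omega)] at hu
      split_ifs at hi with hx
      · omega
      · rw [hr4, if_neg hx, hr 2 (by omega) (by omega)]
        exact h.scanned hβ x i hi u hu
    · intro hβ x u hsx hadj
      rw [hr4, hr 2 (by omega) (by omega)]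
      split_ifs with hx
      · obtain rfl : x = v := Fin.ext hx
        obtain ⟨i, hi, hiu⟩ := h.lists.complete hβ x hsx u hadj
        exact h.scanned hβ x i (by omega) u hiu
      · exact h.lev_price hβ x u hsx hadj
    · intro x u hsx hx
      rw [hr 0 (by omega) (by omega)] at hx
      rw [hr4, hr 2 (by omega) (by omega), if_neg]
      · exact h.matched x u hsx hx
      · intro h'; rw [h', hm] at hx; omega
    · rw [hr 2 (by omega) (by omega), hr 0 (by omega) (by omega)]; exact h.priced
  have hspent : auctionSpent n d C (a.v 13) < auctionSpent n d C' (b₂.v 13) := by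
    unfold auctionSpent
    rw [hb, hr 2 (by omega) (by omega), hr 6 (by omega) (by omega)]
    have := sum_add_one_le (f := fun v : Fin n => C 4 v * (C 6 v / 4 ^ d + 2) + C 5 v / 4 ^ d)
      (g := fun v : Fin n => C' 4 v * (C 6 v / 4 ^ d + 2) + C' 5 v / 4 ^ d) (fun x => by
        by_cases hx : x.val = v
        · obtain rfl : x = v := Fin.ext hx
          have h2 : C 5 x / 4 ^ d ≤ C 6 x / 4 ^ d + 1 := by
            rw [← Nat.add_div_right _ h4d]
            exact Nat.div_le_div_right (h.ptr_lt x).le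
          rw [hr4, hr5, if_pos rfl, if_pos rfl, Nat.zero_div, add_mul]
          omega
        · rw [hr4, hr5, if_neg hx, if_neg hx]) v (by
          have h2 : C 5 v / 4 ^ d ≤ C 6 v / 4 ^ d + 1 := by
            rw [← Nat.add_div_right _ h4d]
            exact Nat.div_le_div_right (h.ptr_lt v).le
          rw [hr4, hr5, if_pos rfl, if_pos rfl, Nat.zero_div, add_mul]
          omega)
    omega
  refine .ite_lt (x := C 4 v + 1) (y := 2 ^ s) ?_ (.reg 2 hinv.lists.base.h2) (fun hl => ?_)
    (fun hl => ?_)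
  · have := Val.cell hT₂ (.const (x := 4) (by omega)) (.reg 8 (x := v) (by rw [hb, hv])) (by omega)
      (by omega)
    rwa [hr4, if_pos rfl] at this
  · refine .skip ⟨C', hinv, ⟨fun _ => ⟨v, by rw [hb, hv], by rw [hb]; exact hv0, fun _ => ⟨?_, ?_⟩⟩,
      fun h' => by rw [hb] at h'; omega⟩, hspent⟩
    · rw [hr 0 (by omega) (by omega), hm]
    · rw [hr4, if_pos rfl]; exact hl
  · refine hinv.sat_next hL (by rw [hb]; exact hlt) (fun x hx _ => ?_) hspent.le
    rw [hb, hv] at hx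
    rw [hr4, if_pos hx]
    exact Or.inr (by omega)

lemma sat_found (h : AuctionInv w s R G side β d C₀ C a) (hL : Large w n s R) (hlt : a.v 13 < n)
    (v : Fin n) (hv : a.v 8 = v) (hs : side v = true) (hv0 : v ≤ a.v 13) (hm : C 0 v = 0)
    (hlev : C 4 v < 2 ^ s) (u : Fin n) (hadj : G.Adj v u) (hu : a.v 41 = u + 1)
    (hprice : C 2 (u + 1) < C 4 v + 1) :
    auctionFound.Sat O a (AuctionStep w s R G side β d C₀ (auctionSpent n d C (a.v 13))) := by
  have hM := hL.mem
  have hn := hL.lt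
  have hvn := v.2
  have hun := u.2
  have hZ : 4 ^ s ≤ 4 ^ s * 4 ^ s := Nat.le_mul_of_pos_left _ h.lists.tab.pos
  have h24 : 2 ^ s ≤ 4 ^ s := Nat.pow_le_pow_left (by norm_num) s
  have hsu : side u = false := by have := side_of_adj side hadj; rw [hs] at this; simpa using this.symm
  have hne : u ≠ v := hadj.ne'
  have hne' : u.val ≠ v.val := fun h' => hne (Fin.ext h')
  have hT := h.lists.tab
  -- the former partner of `u`
  have hk : ∀ k : ℕ, C 0 u = k + 1 → ∃ hk : k < n, C 0 k = u + 1 ∧ side ⟨k, hk⟩ = true := by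
    intro k hk
    obtain ⟨x, h1, h2, h3⟩ := h.mate u (by omega)
    obtain rfl : k = x := by omega
    refine ⟨x.2, h2, ?_⟩
    have := side_of_adj side h3; rw [hsu] at this; simpa using this.symm
  -- the invariant after the exchange
  have key : ∀ (c : St) (C' : ℕ → ℕ → ℕ), Tab (2 ^ w) (4 ^ s) C' c →
      (∀ r, r ≠ 0 → r ≠ 2 → C' r = C r) →
      (∀ x : Fin n, C' 0 x = if x = v then u.val + 1 else if x = u then v.val + 1
        else if C 0 u = x + 1 then 0 else C 0 x) →
      (∀ x, C' 2 x = if x = u.val + 1 then C 2 (u + 1) + 1 else C 2 x) →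
      (∀ x < 5, c.v x = a.v x) → c.v 12 = a.v 12 → c.v 13 = a.v 13 →
      (∀ k, C 0 u = k + 1 → c.v 8 = k) → AuctionInv w s R G side β d C₀ C' c ∧
      auctionSpent n d C (a.v 13) < auctionSpent n d C' (c.v 13) := by
    intro c C' hT hr hr0 hr2 hc h12 h13 h8
    have h2le : ∀ x, C 2 x ≤ C' 2 x := by
      intro x; rw [hr2]; split_ifs with hx
      · rw [hx]; omega
      · rfl
    refine ⟨{ lists := ?_, rows := ?_, mate := h.mate.kick hm hadj hr0, vertex := ?_, before := ?_,
              after := ?_, price_zero := ?_, price_le := ?_, lev_le := ?_, ptr_dvd := ?_,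
              ptr_lt := ?_, scanned := ?_, lev_price := ?_, matched := ?_, priced := ?_ }, ?_⟩
    · exact h.lists.congr hT (hr _ (by omega) (by omega)) (fun x => hr _ (by omega) (by omega))
        hc h12
    · intro r h0 h2 h4 h5; rw [hr r h0 h2, h.rows r h0 h2 h4 h5]
    · rw [h13]; exact h.vertex
    · intro x hsx hx
      rw [h13] at hx
      rw [hr 4 (by omega) (by omega), hr0]
      by_cases hxv : x = v
      · rw [if_pos hxv]; exact Or.inl (by omega)
      rw [if_neg hxv, if_neg (by rintro rfl; rw [hsu] at hsx; exact absurd hsx (by simp))]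
      by_cases hxk : C 0 u = x + 1
      · exact Or.inr (Or.inr (h8 x hxk).symm)
      rw [if_neg hxk]
      rcases h.before x hsx hx with h1 | h1 | h1
      · exact Or.inl h1
      · exact Or.inr (Or.inl h1)
      · exact (hxv (Fin.ext (by omega))).elim
    · intro x hsx hx
      rw [h13] at hx
      obtain ⟨h1, h2⟩ := h.after x hsx hx
      rw [hr 4 (by omega) (by omega), hr0, if_neg (by rintro rfl; omega),
        if_neg (by rintro rfl; rw [hsu] at hsx; exact absurd hsx (by simp))]
      exact ⟨by split_ifs <;> omega, h2⟩
    · rw [hr2, if_neg (by omega)]; exact h.price_zero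
    · intro x
      rw [hr2]
      split_ifs
      · omega
      · exact h.price_le x
    · rw [hr 4 (by omega) (by omega)]; exact h.lev_le
    · rw [hr 5 (by omega) (by omega)]; exact h.ptr_dvd
    · rw [hr 5 (by omega) (by omega), hr 6 (by omega) (by omega)]; exact h.ptr_lt
    · intro hβ x i hi y hy
      rw [hr 5 (by omega) (by omega)] at hi
      rw [hr _ (by omega) (by omega)] at hy
      rw [hr 4 (by omega) (by omega)]
      exact (h.scanned hβ x i hi y hy).trans (h2le _)
    · intro hβ x y hsx hxy
      rw [hr 4 (by omega) (by omega)]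
      exact (h.lev_price hβ x y hsx hxy).trans (h2le _)
    · intro x y hsx hxy
      rw [hr 4 (by omega) (by omega), hr2]
      rw [hr0] at hxy
      by_cases hxv : x = v
      · rw [if_pos hxv] at hxy
        subst hxv
        rw [if_pos (by omega)]
        exact ⟨by omega, hlev⟩
      rw [if_neg hxv, if_neg (by rintro rfl; rw [hsu] at hsx; exact absurd hsx (by simp))] at hxy
      by_cases hxk : C 0 u = x + 1
      · rw [if_pos hxk] at hxy; omega
      rw [if_neg hxk] at hxy
      rw [if_neg]
      · exact h.matched x y hsx hxy
      · intro h'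
        obtain ⟨z, h1, h2, -⟩ := h.mate x (by omega)
        obtain rfl : z = u := Fin.ext (by omega)
        exact hxk h2
    · intro x hsx hx
      rw [hr0] at hx
      have hxv : x ≠ v := by rintro rfl; rw [hs] at hsx; exact absurd hsx (by simp)
      rw [if_neg hxv] at hx
      have hxu : x ≠ u := by rintro rfl; rw [if_pos rfl] at hx; omega
      rw [if_neg hxu] at hx
      rw [hr2, if_neg (fun h' => hxu (Fin.ext (by omega)))]
      refine h.priced x hsx ?_
      by_cases hxk : C 0 u = x + 1
      · obtain ⟨h1, -, h2⟩ := hk x hxk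
        rw [show (⟨x.val, h1⟩ : Fin n) = x from rfl, hsx] at h2
        exact absurd h2 (by simp)
      · rwa [if_neg hxk] at hx
    · unfold auctionSpent
      rw [h13, hr 4 (by omega) (by omega), hr 5 (by omega) (by omega), hr 6 (by omega) (by omega)]
      have := sum_add_one_le (f := fun x : Fin n => C 2 (x + 1))
        (g := fun x : Fin n => C' 2 (x + 1))
        (fun x => h2le _) u (by rw [hr2, if_pos rfl])
      omega
  have c41 : ∀ b : St, b.v 41 = a.v 41 → Val (2 ^ w) b (.v 41 -ₑ .c 1) u := fun b hb => by
    have := (Val.reg (M := 2 ^ w) (a := b) (x := u + 1) 41 (by rw [hb, hu])).sub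
      (.const (x := 1) (by omega)) (by omega)
    simpa using this
  refine .seq (.asg 14 (.cell hT (.const (x := 0) (by omega)) (c41 a rfl) (by omega) (by omega)) ?_)
  refine .seq (.sto (hT.set _ _) (ρ := 0) (i := u) (x := v + 1) (.const (by omega))
    (c41 _ (by simp))
    ((Val.reg 8 (by simp [hv])).add (.const (by omega)) (by omega)) (by omega) (by omega) ?_)
  intro b₁ hb₁ hT₁
  refine .seq (.sto hT₁ (ρ := 0) (i := v) (x := u + 1) (.const (by omega))
    (.reg 8 (by simp [hb₁, hv])) (.reg 41 (by simp [hb₁, hu])) (by omega) (by omega) ?_)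
  intro b₂ hb₂ hT₂
  have c2 : Val (2 ^ w) b₂ (.ld (cellE (.c 2) (.v 41))) (C 2 (u + 1)) := by
    have := Val.cell hT₂ (.const (x := 2) (by omega)) (.reg 41 (x := u + 1)
      (by simp [hb₂, hb₁, hu]))
      (by omega) (by omega)
    rwa [upd_of_ne _ (by omega), upd_of_ne _ (by omega)] at this
  refine .seq (.sto hT₂ (ρ := 2) (i := u + 1) (x := C 2 (u + 1) + 1) (.const (by omega))
    (.reg 41 (by simp [hb₂, hb₁, hu])) (c2.add (.const (by omega)) (by omega)) (by omega)
      (by omega) ?_)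
  intro b₃ hb₃ hT₃
  set C₁ := upd (upd (upd C 0 u (v + 1)) 0 v (u + 1)) 2 (u + 1) (C 2 (u + 1) + 1) with hC₁
  have hr0 : ∀ x : ℕ, C₁ 0 x =
      if x = v.val then u.val + 1 else if x = u.val then v.val + 1 else C 0 x := by
    intro x; simp [hC₁, upd_apply]
  have hr2 : ∀ x : ℕ, C₁ 2 x = if x = u.val + 1 then C 2 (u + 1) + 1 else C 2 x := by
    intro x; simp [hC₁, upd_apply]
  have hr : ∀ r, r ≠ 0 → r ≠ 2 → C₁ r = C r := fun r h0 h2 => by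
    rw [hC₁, upd_of_ne _ h2, upd_of_ne _ h0, upd_of_ne _ h0]
  have hb : ∀ x, x ≠ 14 → b₃.v x = a.v x := by
    intro x hx
    rw [hb₃, hb₂, hb₁]
    simp [hx]
  have h14 : b₃.v 14 = C 0 u := by simp [hb₃, hb₂, hb₁]
  refine .ite (.reg 14 h14) (fun h0 => ?_) (fun h0 => ?_)
  · obtain ⟨k, hk'⟩ : ∃ k, C 0 u = k + 1 := ⟨C 0 u - 1, by omega⟩
    obtain ⟨hkn, hku, hks⟩ := hk k hk'
    have hkv : k ≠ v.val := by rintro rfl; omega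
    have hku' : k ≠ u.val := by
      intro h'
      rw [show (⟨k, hkn⟩ : Fin n) = u from Fin.ext h', hsu] at hks
      exact absurd hks (by simp)
    have c14 : ∀ b : St, b.v 14 = b₃.v 14 → Val (2 ^ w) b (.v 14 -ₑ .c 1) k := fun b hb => by
      have := (Val.reg (M := 2 ^ w) (a := b) (x := k + 1) 14 (by rw [hb, h14, hk'])).sub
        (.const (x := 1) (by omega)) (by omega)
      simpa using this
    refine .seq (.sto hT₃ (ρ := 0) (i := k) (x := 0) (.const (by omega)) (c14 _ rfl)
      (.const (by omega))
      (by omega) (by omega) ?_)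
    intro b₄ hb₄ hT₄
    refine .asg 8 (c14 _ (by rw [hb₄])) ?_
    have hC0 : ∀ x : Fin n, upd C₁ 0 k 0 0 x = if x = v then u.val + 1 else if x = u then v.val + 1
        else if C 0 u = x + 1 then 0 else C 0 x := by
      intro x
      rw [upd_apply, hr0]
      simp only [Fin.ext_iff, true_and]
      split_ifs <;> omega
    obtain ⟨h1, h2⟩ := key (b₄.set 8 k) (upd C₁ 0 k 0) (hT₄.set _ _)
      (fun r h0 h2 => by rw [upd_of_ne _ h0, hr r h0 h2]) hC0
      (fun x => by rw [upd_of_ne _ (by omega), hr2])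
      (fun x hx => by rw [St.set_v, if_neg (by omega), hb₄, hb x (by omega)])
      (by simp [hb₄, hb]) (by simp [hb₄, hb]) (fun k' hk'' => by simp; omega)
    refine ⟨_, h1, ⟨fun _ => ⟨⟨k, hkn⟩, by simp, ?_, fun _ => ⟨?_, ?_⟩⟩, fun h' => ?_⟩, h2⟩
    · simp only [St.set_v, hb₄]
      norm_num
      rw [hb 13 (by omega)]
      by_contra hcon
      have := (h.after ⟨k, hkn⟩ hks (by simpa using hcon)).1
      simp only at this
      omega
    · simp [upd_apply]
    · rw [upd_of_ne _ (by omega), hr 4 (by omega) (by omega)]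
      exact (h.matched ⟨k, hkn⟩ u hks hku).2
    · simp only [St.set_v, hb₄] at h'
      norm_num at h'
      rw [hb 13 (by omega)] at h'
      omega
  · obtain ⟨h1, h2⟩ := key b₃ C₁ hT₃ hr (fun x => by
      rw [hr0]
      simp only [Fin.ext_iff]
      split_ifs <;> omega) hr2 (fun x hx => hb x (by omega)) (hb _ (by omega)) (hb _ (by omega))
      (fun k hk => by omega)
    refine h1.sat_next hL (by rw [hb 13 (by omega)]; exact hlt) (fun x hx _ => ?_) h2.le
    rw [hb 8 (by omega), hv] at hx
    rw [hr0, if_pos hx]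
    exact Or.inl (by omega)

/-- The auction ends with a matching that is maximum up to `2 ^ s` edges. -/
lemma deficiency (h : AuctionInv w s R G side β d C₀ C a) (hL : Large w n s R) (ha : a.v 13 = n)
    (h8 : n ≤ a.v 8) (hβ : β) : Deficiency side (C 0) (2 ^ s) := by
  intro M hM
  have hpos : 0 < 2 ^ s := by positivity
  have h1 := mul_ncard_edgeSet_le (side := side) h.mate (K := 2 ^ s) (D := 2 ^ s + 1)
    (π := fun v => 2 ^ s - C 4 v) (p := fun u => C 2 (u + 1)) (fun v u hs hadj => by
      have := h.lev_price hβ v u hs hadj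
      omega) (fun v u hs hm => by
      have := h.matched v u hs hm
      omega) (fun v hs hm => by
      rcases h.before v hs (by omega) with h2 | h2 | h2
      · omega
      · omega
      · omega) h.priced hM
  have h2 : mateSize side (C 0) ≤ n := by
    unfold mateSize
    exact (Finset.card_le_univ _).trans (by simp)
  have h44 : (2 : ℕ) ^ s * 2 ^ s = 4 ^ s := by rw [← mul_pow]; norm_num
  have h3 := hL.lt
  have h4 : 2 ^ s * M.edgeSet.ncard ≤ 2 ^ s * (mateSize side (C 0) + 2 ^ s) := by
    rw [add_mul, one_mul] at h1
    rw [mul_add, h44]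
    omega
  exact le_of_mul_le_mul_left h4 hpos

end AuctionInv

/-- The auction scans each list at most once for each level of its vertex, which bounds the number of
searches by `O(n * 2 ^ s)`. -/
lemma Triple.auction (hL : Large w n s R) {sd : ι}
    (hsd : ∀ v : Fin n, O.nat sd v 0 = if side v = true then 1 else 0) {δ : NNReal}
    (hδ : β → (3 / 4) ^ R ≤ (δ : ℝ)) (h : AuctionInv w s R G side β d C₀ C a)
    (hcur : AuctionCur n s side C a) {τ τe : ℕ}
    (hτ : τe + 2 ^ d * listUnit R * (4 * n * (2 ^ s + 1)) + 20 ≤ τ)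
    {Q : ℕ → St → Prop} (hQ : ∀ τ' ≤ τ, ∀ b C, τe ≤ τ' → AuctionInv w s R G side β d C₀ C b →
      (β → Deficiency side (C 0) (2 ^ s)) → Q τ' b) : Triple O δ (auction sd) Q τ a := by
  have hw := hL.pos
  have hM := hL.mem
  have hn := hL.lt
  have hZ : 4 ^ s ≤ 4 ^ s * 4 ^ s := Nat.le_mul_of_pos_left _ (by positivity)
  have h24 : 2 ^ s ≤ 4 ^ s := Nat.pow_le_pow_left (by norm_num) s
  have hU : 1000 ≤ 2 ^ d * listUnit R :=
    le_trans (Nat.le_add_left _ _) (searchCost_le (ι := Empty) listGates listBlk d R)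
  set U := 2 ^ d * listUnit R with hUdef
  set B := 4 * n * (2 ^ s + 1) with hB
  refine Triple.while_ hw _ (fun τ' a => ∃ C, AuctionInv w s R G side β d C₀ C a ∧
    AuctionCur n s side C a ∧ τe + U * B + 20 ≤ τ' + U * auctionSpent n d C (a.v 13)) ?_
    ⟨C, h, hcur, by omega⟩
  rintro τ' hτ' a ⟨C, h, hcur, hcred⟩
  set D := auctionSpent n d C (a.v 13) with hD
  have hsp' : D + (n - a.v 13) ≤ B := h.spent_le
  have hsp : D ≤ B := by omega
  have hmul : U * D ≤ U * B := Nat.mul_le_mul_left _ hsp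
  have hcond := (Val.reg (M := 2 ^ w) (a := a) 13 rfl).lt (Val.reg 0 h.lists.base.h0)
  refine ⟨hcond.1, by simp only [Exp.cost]; omega, fun he => ?_, fun he => ?_⟩
  · rw [hcond.2] at he
    have hge : n ≤ a.v 13 := by by_contra h'; rw [if_pos (by omega)] at he; omega
    exact hQ _ (by omega) a C (by simp only [Exp.cost]; omega) h
      (h.deficiency hL (le_antisymm h.vertex hge) (hcur.2 hge))
  rw [hcond.2] at he
  have h13 : a.v 13 < n := by by_contra h'; rw [if_neg h'] at he; exact he rfl
  obtain ⟨v, hv, hv0, hfree⟩ := hcur.1 h13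
  have hvn := v.2
  -- each step raises the amortised cost, which is bounded
  have hfin : ∀ τ'' b, AuctionStep w s R G side β d C₀ D b → τ' ≤ τ'' + U → ∃ C,
      AuctionInv w s R G side β d C₀ C b ∧ AuctionCur n s side C b ∧
      τe + U * B + 20 ≤ τ'' + U * auctionSpent n d C (b.v 13) := by
    rintro τ'' b ⟨C', h', hc', hD'⟩ hτ''
    refine ⟨C', h', hc', ?_⟩
    have : U * (D + 1) ≤ U * auctionSpent n d C' (b.v 13) := Nat.mul_le_mul_left _ hD'
    rw [mul_add, mul_one] at this
    omega
  have hcr : τe + U + 20 ≤ τ' := by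
    have : U * (D + 1) ≤ U * B := Nat.mul_le_mul_left _ (by omega)
    rw [mul_add, mul_one] at this
    omega
  refine Triple.seq (by simp only [Exp.cost]; omega) (Triple.sat hw
    (by simp only [Exp.cost, Blk.cost]; omega) ?_)
  refine .qry 15 (.reg 8 rfl) (.const (x := 0) (by omega)) ?_
  rw [hv, hsd v]
  set a₁ := a.set 15 (if side v = true then 1 else 0) with ha₁
  have hv₁ : ∀ x, x ≠ 15 → a₁.v x = a.v x := fun x hx => by simp [ha₁, hx]
  have h₁ : AuctionInv w s R G side β d C₀ C a₁ := h.congr rfl (fun x hx => hv₁ x (by omega))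
    (hv₁ _ (by omega)) (hv₁ _ (by omega)) (hv₁ _ (by omega))
  have e13 : a₁.v 13 = a.v 13 := hv₁ _ (by omega)
  refine Triple.ite hw _ (by simp [Exp.ok]) (by simp only [Exp.cost, Blk.cost]; omega)
    (fun h15 => ?_) (fun h15 => ?_)
  · have hs : side v = true := by
      simp only [Exp.eval, ha₁, St.set_v, if_true] at h15
      by_contra h'
      rw [if_neg h'] at h15
      exact h15 rfl
    obtain ⟨hm, hlev⟩ := hfree hs
    have hcond := (Val.cell h₁.lists.tab (.const (x := 5) (by omega))
      (.reg 8 (x := v) (by rw [hv₁ 8 (by omega), hv])) (by omega) (by omega)).lt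
      (Val.cell h₁.lists.tab (.const (x := 6) (by omega))
      (.reg 8 (x := v) (by rw [hv₁ 8 (by omega), hv])) (by omega) (by omega))
    refine Triple.ite hw _ hcond.1 (by simp only [cellE, Exp.cost, Blk.cost]; omega)
      (fun hlt => ?_) (fun hlt => ?_)
    · rw [hcond.2] at hlt
      have hptr : C 5 v < C 6 v := by by_contra h'; rw [if_neg h'] at hlt; exact hlt rfl
      have hdeg := h.lists.sound.deg_le v
      have hoff := add_pow_le_of_dvd h.lists.le (h.ptr_dvd v) (by omega)
      refine Triple.seq (by simp only [cellE, Exp.cost, Blk.cost]; omega) (Triple.sat hw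
        (by simp only [cellE, Exp.cost, Blk.cost]; omega) ?_)
      refine .seq (.asg 9 (x := C 4 v + 1) ((Val.cell h₁.lists.tab (.const (by omega))
        (.reg 8 (by rw [hv₁ 8 (by omega), hv])) (by omega) (by omega)).add (.const (by omega))
          (by omega)) ?_)
      refine .asg 5 (x := C 5 v) (Val.cell (h₁.lists.tab.set _ _) (.const (by omega))
        (.reg 8 (by simp [hv₁, hv])) (by omega) (by omega)) ?_
      set a₂ := (a₁.set 9 (C 4 v + 1)).set 5 (C 5 v) with ha₂
      have hv₂ : ∀ x, x ≠ 5 → x ≠ 9 → x ≠ 15 → a₂.v x = a.v x := fun x h5 h9 h15 => by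
        simp [ha₂, h5, h9, hv₁ x h15]
      have e5 : a₂.v 5 = C 5 v := by simp [ha₂]
      have e9 : a₂.v 9 = C 4 v + 1 := by simp [ha₂]
      have hT₂ : Tab (2 ^ w) (4 ^ s) C a₂ := (h₁.lists.tab.set _ _).set _ _
      have h₂ : NbrLists w s R G side β d C a₂ := h.lists.congr hT₂ rfl (fun _ => rfl)
        (fun x hx => hv₂ x (by omega) (by omega) (by omega)) (hv₂ _ (by omega) (by omega)
          (by omega))
      have hp0 := h.price_zero
      refine Triple.seq (by simp only [cellE, Exp.cost, Blk.cost]; omega)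
        (Triple.listSearch hL hδ h₂
        (by omega) v (by rw [hv₂ 8 (by omega) (by omega) (by omega), hv]) (by rw [e5]; exact hoff)
        (by rw [e9]; omega) (by simp only [cellE, Exp.cost, Blk.cost]; omega) ?_)
      intro τ₃ b hτ₃ hτ₃' hbm hbv hfound
      simp only [cellE, Exp.cost, Blk.cost] at hτ₃
      have hv₃ : ∀ x < 40, x ≠ 5 → x ≠ 9 → x ≠ 10 → x ≠ 11 → x ≠ 15 → b.v x = a.v x :=
        fun x hx h5 h9 h10 h11 h15 => by rw [hbv x hx h10 h11, hv₂ x h5 h9 h15]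
      have h₃ : AuctionInv w s R G side β d C₀ C b := h.congr hbm
        (fun x hx => hv₃ x (by omega) (by omega) (by omega) (by omega) (by omega) (by omega))
        (hv₃ _ (by omega) (by omega) (by omega) (by omega) (by omega) (by omega))
        (hv₃ _ (by omega) (by omega) (by omega) (by omega) (by omega) (by omega))
        (hv₃ _ (by omega) (by omega) (by omega) (by omega) (by omega) (by omega))
      have f13 : b.v 13 = a.v 13 :=
        hv₃ _ (by omega) (by omega) (by omega) (by omega) (by omega) (by omega)
      have f8 : b.v 8 = v := by
        rw [hv₃ _ (by omega) (by omega) (by omega) (by omega) (by omega) (by omega), hv]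
      have f5 : b.v 5 = C 5 v := by rw [hbv 5 (by omega) (by omega) (by omega), e5]
      have hDb : auctionSpent n d C (b.v 13) = D := by rw [f13]
      have hcost : τ' ≤ τ₃ - (Blk.ite (.v 40) auctionFound auctionMiss : Blk ι).cost + U := by
        simp only [auctionFound, auctionMiss, auctionNext, cellE, Exp.cost, Blk.cost]
        omega
      rw [e9, e5] at hfound
      rw [← hDb] at hfin
      refine Triple.sat hw
        (by simp only [auctionFound, auctionMiss, auctionNext, cellE, Exp.cost, Blk.cost]; omega) ?_
      refine .ite (.reg 40 rfl) (fun h40 => ?_) (fun h40 => ?_)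
      · rcases hfound with ⟨-, u, hu, hadj, hprice⟩ | ⟨h0, -⟩
        · have := h₃.sat_found (O := O) hL (by omega) v f8 hs (by omega) hm hlev u hadj hu hprice
          exact ⟨this.1, hfin _ _ this.2 hcost⟩
        · exact (h40 h0).elim
      · rcases hfound with ⟨h1, -⟩ | ⟨-, hno⟩
        · omega
        · have := h₃.sat_miss (O := O) hL (by unfold AuctionCur; rw [f13, f8, ← hv]; exact hcur) v f8 f5 hptr hno
          exact ⟨this.1, hfin _ _ this.2 hcost⟩
    · rw [hcond.2] at hlt
      have hptr : C 6 v ≤ C 5 v := by by_contra h'; rw [if_pos (by omega)] at hlt; omega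
      refine Triple.sat hw (by simp only [auctionEnd, auctionNext, cellE, Exp.cost, Blk.cost]; omega) ?_
      have := h₁.sat_end (O := O) hL (by omega) v (by rw [hv₁ 8 (by omega), hv]) hs (by omega)
        hm hlev hptr
      rw [e13] at this
      exact ⟨this.1, hfin _ _ this.2
        (by simp only [auctionEnd, auctionNext, cellE, Exp.cost, Blk.cost]; omega)⟩
  · have hs : ¬ side v = true := by
      intro h'
      simp [Exp.eval, ha₁, h'] at h15
    refine Triple.sat hw (by simp only [auctionNext, Exp.cost, Blk.cost]; omega) ?_
    have := h₁.sat_next (O := O) hL (by omega) (fun x hx hsx => by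
      rw [hv₁ 8 (by omega), hv] at hx
      rw [Fin.ext hx] at hsx
      exact absurd hsx hs) (D := D) (by rw [e13])
    exact ⟨this.1, hfin _ _ this.2 (by simp only [auctionNext, Exp.cost, Blk.cost]; omega)⟩

end

/-! ### Augmenting paths by breadth-first search -/

section
variable {ι : Type}

/-- Append the vertex to the queue if it lies on the side `true` and is free. -/
def bfsCollect (sd : ι) : Blk ι :=
  .seq (.qry 15 sd (.v 8) (.c 0))
  (.seq (.ite (.v 15)
    (.ite (.ld (cellE (.c 0) (.v 8))) .skip
      (.seq (.sto (cellE (.c 7) (.v 17)) (.v 8)) (.asg 17 (.v 17 +ₑ .c 1)))) .skip)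
  (.asg 8 (.v 8 +ₑ .c 1)))

/-- Visit the neighbor that was found and look up its partner. -/
def bfsVisit : Blk ι :=
  .seq (.sto (cellE (.c 3) (.v 41)) (.v 9))
  (.seq (.sto (cellE (.c 8) (.v 41)) (.v 8 +ₑ .c 1))
  (.asg 14 (.ld (cellE (.c 0) (.v 41 -ₑ .c 1)))))

/-- Append the partner to the queue. -/
def bfsPush : Blk ι := .seq (.sto (cellE (.c 7) (.v 17)) (.v 14 -ₑ .c 1)) (.asg 17 (.v 17 +ₑ .c 1))

/-- Match the vertex in register `19` with its parent and continue with the parent's former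
partner. -/
def augmentStep : Blk ι :=
  .seq (.asg 8 (.ld (cellE (.c 8) (.v 19)) -ₑ .c 1))
  (.seq (.asg 14 (.ld (cellE (.c 0) (.v 8))))
  (.seq (.sto (cellE (.c 0) (.v 8)) (.v 19))
  (.seq (.sto (cellE (.c 0) (.v 19 -ₑ .c 1)) (.v 8 +ₑ .c 1))
  (.asg 19 (.v 14)))))

/-- Augment the matching along the path that ends in the free vertex that was found, and stop the
search. -/
def augment : Prog ι 14 :=
  .seq (Blk.asg 19 (.v 41)).prog
    (.seq (.while (.v 19) augmentStep.prog) (Blk.asg 16 (.v 17)).prog)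

/-- A breadth-first search for an augmenting path.  Row `7` is the queue, registers `16` and `17`
are its ends, row `3` marks the visited vertices by the number of the round (register `18`, plus
one), and row `8` holds the parents. -/
def bfs (sd : ι) : Prog ι 14 :=
  .seq (Blk.seq (.asg 16 (.c 0)) (.seq (.asg 17 (.c 0)) (.seq (.asg 8 (.c 0)) (.seq (.asg 5 (.c 0))
    (.asg 9 (.v 18 +ₑ .c 1)))))).prog
  (.seq (.while (.v 8 <ₑ .v 0) (bfsCollect sd).prog)
  (.while (.v 16 <ₑ .v 17)
    (.seq (Blk.asg 8 (.ld (cellE (.c 7) (.v 16)))).prog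
    (.ite (.v 5 <ₑ .ld (cellE (.c 6) (.v 8)))
      (.seq (listSearch 3)
        (.ite (.v 40) (.seq bfsVisit.prog (.ite (.v 14) bfsPush.prog augment))
          (Blk.asg 5 (.v 5 +ₑ (.v 4 *ₑ .v 4))).prog))
      (Blk.seq (.asg 16 (.v 16 +ₑ .c 1)) (.asg 5 (.c 0))).prog))))

/-- As many searches as register `2` says. -/
def bfsRounds (sd : ι) : Prog ι 14 :=
  .while (.v 18 <ₑ .v 2) (.seq (bfs sd) (Blk.asg 18 (.v 18 +ₑ .c 1)).prog)

end

section
variable {ι : Type} {w n s R : ℕ} {O : BlackBox ι w} {G : SimpleGraph (Fin n)}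
  {side : G.Coloring Bool} {β : Prop} {C C' : ℕ → ℕ → ℕ} {a b : St} {d : ℕ} {P : St → Prop}

lemma mateSize_congr {m m' : ℕ → ℕ}
    (h : ∀ x : Fin n, side x = true → (m' x ≠ 0 ↔ m x ≠ 0)) :
      mateSize side m' = mateSize side m := by
  unfold mateSize
  congr 1
  ext x
  simp only [Finset.mem_filter, Finset.mem_univ, true_and]
  constructor
  · rintro ⟨h1, h2⟩; exact ⟨h1, (h x h1).mp h2⟩
  · rintro ⟨h1, h2⟩; exact ⟨h1, (h x h1).mpr h2⟩

lemma mateSize_succ {m m' : ℕ → ℕ} {v : Fin n} (hs : side v = true) (hv : m v = 0) (hv' : m' v ≠ 0)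
    (h : ∀ x : Fin n, side x = true → x ≠ v → (m' x ≠ 0 ↔ m x ≠ 0)) :
    mateSize side m' = mateSize side m + 1 := by
  unfold mateSize
  rw [← Finset.card_insert_of_notMem (a := v) (by simp [hv])]
  congr 1
  ext x
  simp only [Finset.mem_filter, Finset.mem_univ, true_and, Finset.mem_insert]
  by_cases hx : x = v
  · subst hx; simp [hs, hv']
  · simp only [hx, false_or]
    constructor
    · rintro ⟨h1, h2⟩; exact ⟨h1, (h x h1 hx).mp h2⟩
    · rintro ⟨h1, h2⟩; exact ⟨h1, (h x h1 hx).mpr h2⟩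

/-- The situation between two searches: every matching has at most `k` edges more, and `r` bounds
the marks of visited vertices. -/
structure RoundInv (w s R : ℕ) (G : SimpleGraph (Fin n)) (side : G.Coloring Bool) (β : Prop)
    (d r k : ℕ) (C : ℕ → ℕ → ℕ) (a : St) : Prop where
  lists : NbrLists w s R G side β d C a
  mate : IsMate G (C 0)
  vis_zero : 2 ^ s ≤ C 3 0
  vis_le : ∀ u : Fin n, C 3 (u + 1) ≤ r
  deficiency : β → Deficiency side (C 0) k

/-- The invariant of the breadth-first search: the queue consists of all free vertices on the side
`true` and of partners of visited vertices, and the parent of a visited vertex precedes its partner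
in the queue.  If `β` holds, no search in a list has failed. -/
structure BfsInv (w s R : ℕ) (G : SimpleGraph (Fin n)) (side : G.Coloring Bool) (β : Prop)
    (d : ℕ) (C : ℕ → ℕ → ℕ) (a : St) : Prop where
  inv : RoundInv w s R G side β d (a.v 9) (2 ^ s - a.v 18) C a
  round : a.v 9 = a.v 18 + 1
  lt : a.v 18 < 2 ^ s
  head_le : a.v 16 ≤ a.v 17
  queue : ∀ i < a.v 17, ∃ v : Fin n, C 7 i = v ∧ side v = true
  inj : ∀ i < a.v 17, ∀ j < a.v 17, C 7 i = C 7 j → i = j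
  free : ∀ v : Fin n, side v = true → C 0 v = 0 → ∃ i < a.v 17, C 7 i = v
  tree : ∀ i < a.v 17, ∀ u : Fin n, C 0 (C 7 i) = u + 1 → C 3 (u + 1) = a.v 9 ∧
    ∃ j < i, ∃ v : Fin n, C 7 j = v ∧ C 8 (u + 1) = v + 1 ∧ G.Adj v u
  visited : ∀ u : Fin n, C 3 (u + 1) = a.v 9 → ∃ i < a.v 17, C 0 u = C 7 i + 1
  off_dvd : 4 ^ d ∣ a.v 5
  off_lt : a.v 5 = 0 ∨ a.v 16 < a.v 17 ∧ a.v 5 < C 6 (C 7 (a.v 16)) + 4 ^ d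
  expanded : β → ∀ i < a.v 16, ∀ v u : Fin n, C 7 i = v → G.Adj v u → C 3 (u + 1) = a.v 9
  part : β → ∀ i < a.v 5, ∀ v u : Fin n, C 7 (a.v 16) = v → C (16 + v) i = u + 1 →
    C 3 (u + 1) = a.v 9

/-- The amortised cost of the search so far. -/
def bfsSpent (d : ℕ) (C : ℕ → ℕ → ℕ) (a : St) : ℕ :=
  a.v 17 + ∑ i ∈ Finset.range (a.v 16), (C 6 (C 7 i) / 4 ^ d + 2) + a.v 5 / 4 ^ d

namespace BfsInv

lemma sum_queue_le (h : BfsInv w s R G side β d C a) (f : ℕ → ℕ) {t : ℕ} (ht : t ≤ a.v 17) :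
    ∑ i ∈ Finset.range t, f (C 7 i) ≤ ∑ v : Fin n, f v := by
  have h1 := fun i : Fin t => h.queue i (by omega)
  choose g hg using h1
  have hinj : Function.Injective g := fun i j hij =>
    Fin.ext (h.inj i (by omega) j (by omega) (by rw [(hg i).1, (hg j).1, hij]))
  calc ∑ i ∈ Finset.range t, f (C 7 i) = ∑ i : Fin t, f (C 7 i) := (Fin.sum_univ_eq_sum_range
    (fun i => f (C 7 i)) t).symm
    _ = ∑ i : Fin t, f (g i) := by simp_rw [(hg _).1]
    _ = ∑ v ∈ Finset.univ.map ⟨g, hinj⟩, f v := by simp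
    _ ≤ _ := Finset.sum_le_sum_of_subset (Finset.subset_univ _)

lemma tail_le (h : BfsInv w s R G side β d C a) : a.v 17 ≤ n := by
  simpa using h.sum_queue_le (fun _ => 1) le_rfl

lemma off_div_le (h : BfsInv w s R G side β d C a) :
    a.v 5 / 4 ^ d ≤ C 6 (C 7 (a.v 16)) / 4 ^ d + 1 := by
  rcases h.off_lt with h1 | ⟨-, h1⟩
  · simp [h1]
  · rw [← Nat.add_div_right _ (by positivity)]
    exact Nat.div_le_div_right h1.le

lemma spent_lt (h : BfsInv w s R G side β d C a) (hlt : a.v 16 < a.v 17) :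
    bfsSpent d C a < 4 * n := by
  have h1 := h.sum_queue_le (fun x => C 6 x / 4 ^ d + 2) (t := a.v 16 + 1) hlt
  have h2 := h.inv.lists.sum_blocks_le
  have h3 := h.off_div_le
  have h4 := h.tail_le
  rw [Finset.sum_range_succ] at h1
  unfold bfsSpent
  omega

lemma spent_le (h : BfsInv w s R G side β d C a) : bfsSpent d C a ≤ 4 * n := by
  rcases h.head_le.lt_or_eq with h1 | h1
  · exact (h.spent_lt h1).le
  · have h5 : a.v 5 = 0 := by
      rcases h.off_lt with h5 | h5
      · exact h5
      · omega
    have h1 := h.sum_queue_le (fun x => C 6 x / 4 ^ d + 2) (t := a.v 16) h.head_le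
    have h2 := h.inv.lists.sum_blocks_le
    have h4 := h.tail_le
    unfold bfsSpent
    rw [h5, Nat.zero_div]
    omega

/-- If the search ends without an augmenting path, the matching is maximum. -/
lemma deficiency_zero (h : BfsInv w s R G side β d C a) (hend : a.v 16 = a.v 17) (hβ : β) :
    Deficiency side (C 0) 0 := by
  intro M hM
  have h1 := mul_ncard_edgeSet_le (side := side) h.inv.mate (K := 1) (D := 1)
    (π := fun v => if ∃ i < a.v 17, C 7 i = v then 0 else 1)
    (p := fun u => if C 3 (u + 1) = a.v 9 then 1 else 0) (fun v u hs hadj => ?_)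
    (fun v u hs hm => ?_) (fun v hs hm => ?_) (fun u hs hm => ?_) hM
  · simpa using h1
  · by_cases hv : ∃ i < a.v 17, C 7 i = v
    · obtain ⟨i, hi, hiv⟩ := hv
      rw [if_pos (h.expanded hβ i (by omega) v u hiv hadj)]
      omega
    · rw [if_neg hv]; omega
  · by_cases hu : C 3 (u + 1) = a.v 9
    · obtain ⟨i, hi, hiu⟩ := h.visited u hu
      obtain ⟨u', h2, h3, -⟩ := h.inv.mate v (by omega)
      obtain rfl : u' = u := Fin.ext (by omega)
      rw [if_pos ⟨i, hi, by omega⟩]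
      split_ifs
      omega
    · rw [if_neg hu]
      split_ifs <;> omega
  · rw [if_pos (h.free v hs hm)]
  · rw [if_neg]
    intro hu
    obtain ⟨i, hi, hiu⟩ := h.visited u hu
    omega

end BfsInv

/-- What holds after a search. -/
def RoundPost (w s R : ℕ) (G : SimpleGraph (Fin n)) (side : G.Coloring Bool) (β : Prop)
    (d r : ℕ) (a : St) : Prop :=
  a.v 18 = r ∧ ∃ C, RoundInv w s R G side β d (r + 1) (2 ^ s - (r + 1)) C a

/-- What holds after a step of the search that has cost at least `D` so far. -/
def BfsStep (w s R : ℕ) (G : SimpleGraph (Fin n)) (side : G.Coloring Bool) (β : Prop)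
    (d r D : ℕ) (a : St) : Prop :=
  a.v 18 = r ∧ ∃ C, BfsInv w s R G side β d C a ∧ D < bfsSpent d C a

lemma RoundInv.congr {r k : ℕ} (h : RoundInv w s R G side β d r k C a) (hm : b.m = a.m)
    (hv : ∀ x < 5, b.v x = a.v x) (h12 : b.v 12 = a.v 12) : RoundInv w s R G side β d r k C b :=
  { h with lists := h.lists.congr ⟨by rw [hm, h.lists.tab.mem], by
      rw [hv 1 (by omega), h.lists.tab.reg], h.lists.tab.pos, h.lists.tab.big⟩ rfl (fun _ => rfl) hv h12 }

namespace BfsInv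

lemma congr (h : BfsInv w s R G side β d C a) (hm : b.m = a.m) (hv : ∀ x < 5, b.v x = a.v x)
    (h12 : b.v 12 = a.v 12) (h5 : b.v 5 = a.v 5) (h9 : b.v 9 = a.v 9) (h16 : b.v 16 = a.v 16)
    (h17 : b.v 17 = a.v 17) (h18 : b.v 18 = a.v 18) : BfsInv w s R G side β d C b where
  inv := by rw [h9, h18]; exact h.inv.congr hm hv h12
  round := by rw [h9, h18]; exact h.round
  lt := by rw [h18]; exact h.lt
  head_le := by rw [h16, h17]; exact h.head_le
  queue := by rw [h17]; exact h.queue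
  inj := by rw [h17]; exact h.inj
  free := by rw [h17]; exact h.free
  tree := by rw [h17, h9]; exact h.tree
  visited := by rw [h17, h9]; exact h.visited
  off_dvd := by rw [h5]; exact h.off_dvd
  off_lt := by rw [h5, h16, h17]; exact h.off_lt
  expanded := by rw [h16, h9]; exact h.expanded
  part := by rw [h5, h16, h9]; exact h.part

/-- The next block of the list. -/
lemma sat_miss (h : BfsInv w s R G side β d C a) (hL : Large w n s R) (hlt : a.v 16 < a.v 17)
    (v : Fin n) (hv : C 7 (a.v 16) = v) (h5 : a.v 5 < C 6 v)
    (hno : β → ∀ i < 4 ^ d, ∀ u : Fin n, C (16 + v) (a.v 5 + i) = u + 1 → a.v 9 ≤ C 3 (u + 1)) :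
    (Blk.asg 5 (.v 5 +ₑ (.v 4 *ₑ .v 4))).Sat O a
      (BfsStep w s R G side β d (a.v 18) (bfsSpent d C a)) := by
  have hM := hL.mem
  have hn := hL.lt
  have hZ : 4 ^ s ≤ 4 ^ s * 4 ^ s := Nat.le_mul_of_pos_left _ h.inv.lists.tab.pos
  have h44 : (2 : ℕ) ^ d * 2 ^ d = 4 ^ d := by rw [← mul_pow]; norm_num
  have h4d : 0 < 4 ^ d := by positivity
  have hdeg := h.inv.lists.sound.deg_le v
  have hoff := add_pow_le_of_dvd h.inv.lists.le h.off_dvd (by omega)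
  have hsize := h.inv.lists.size
  refine .asg 5 (x := a.v 5 + 4 ^ d) (by
    rw [← h44]; exact (Val.reg 5 rfl).add ((Val.reg 4 hsize).mul (.reg 4 hsize)
      (by omega)) (by omega)) ⟨by simp, C, ⟨?_, ?_, ?_, ?_, ?_, ?_, ?_, ?_, ?_, ?_, ?_, ?_, ?_⟩, ?_⟩
  · refine (h.inv.congr (b := a.set 5 _) rfl (fun x hx => ?_) ?_)
    · rw [St.set_v, if_neg (by omega)]
    · simp
  · simpa using h.round
  · simpa using h.lt
  · simpa using h.head_le
  · simpa using h.queue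
  · simpa using h.inj
  · simpa using h.free
  · simpa using h.tree
  · simpa using h.visited
  · simpa using h.off_dvd
  · right
    simp only [St.set_v]
    norm_num
    rw [hv]
    exact ⟨hlt, h5⟩
  · simpa using h.expanded
  · intro hβ i hi v' u hv' hu
    simp only [St.set_v] at hi hv' ⊢
    norm_num at hi hv' ⊢
    obtain rfl : v' = v := Fin.ext (by omega)
    by_cases hi' : i < a.v 5
    · exact h.part hβ i hi' v' u hv hu
    · refine le_antisymm (h.inv.vis_le u) (hno hβ (i - a.v 5) (by omega) u ?_)
      rwa [show a.v 5 + (i - a.v 5) = i by omega]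
  · unfold bfsSpent
    simp only [St.set_v]
    norm_num

/-- The next vertex in the queue. -/
lemma sat_next (h : BfsInv w s R G side β d C a) (hL : Large w n s R) (hlt : a.v 16 < a.v 17)
    (v : Fin n) (hv : C 7 (a.v 16) = v) (h5 : C 6 v ≤ a.v 5) :
    (Blk.seq (.asg 16 (.v 16 +ₑ .c 1)) (.asg 5 (.c 0))).Sat O a
      (BfsStep w s R G side β d (a.v 18) (bfsSpent d C a)) := by
  have hM := hL.mem
  have hn := hL.lt
  have htail := h.tail_le
  have hZ : 4 ^ s ≤ 4 ^ s * 4 ^ s := Nat.le_mul_of_pos_left _ h.inv.lists.tab.pos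
  refine .seq (.asg 16 ((Val.reg 16 rfl).add (.const (x := 1) (by omega)) (by omega)) ?_)
  refine .asg 5 (.const (x := 0) (by omega)) ⟨by simp, C, ⟨?_, ?_, ?_, ?_, ?_, ?_, ?_, ?_, ?_, ?_,
    ?_, ?_, ?_⟩, ?_⟩
  · refine (h.inv.congr (b := (a.set 16 _).set 5 _) rfl (fun x hx => ?_) ?_)
    · rw [St.set_v, if_neg (by omega), St.set_v, if_neg (by omega)]
    · simp
  · simpa using h.round
  · simpa using h.lt
  · simpa using hlt
  · simpa using h.queue
  · simpa using h.inj
  · simpa using h.free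
  · simpa using h.tree
  · simpa using h.visited
  · simp
  · simp
  · intro hβ i hi v' u hv' hadj
    simp only [St.set_v] at hi ⊢
    norm_num at hi ⊢
    rcases hi.lt_or_eq with h1 | rfl
    · exact h.expanded hβ i h1 v' u hv' hadj
    · obtain rfl : v' = v := Fin.ext (by omega)
      obtain ⟨y, hy, hys⟩ := h.queue (a.v 16) hlt
      obtain rfl : v' = y := Fin.ext (by omega)
      obtain ⟨j, hj, hju⟩ := h.inv.lists.complete hβ v' hys u hadj
      exact h.part hβ j (by omega) v' u hv hju
  · simp
  · have h3 := h.off_div_le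
    unfold bfsSpent
    simp only [St.set_v]
    norm_num
    rw [Finset.sum_range_succ]
    omega

/-- Visit a neighbor, and go on with its partner. -/
lemma sat_push (h : BfsInv w s R G side β d C a) (hL : Large w n s R) (hlt : a.v 16 < a.v 17)
    (v u : Fin n) (hv : C 7 (a.v 16) = v) (hadj : G.Adj v u) (hu : C 3 (u + 1) < a.v 9)
    {k : Fin n} (hk : C 0 u = k + 1) (hT : Tab (2 ^ w) (4 ^ s) (upd (upd C 3 (u + 1) (a.v 9))
      8 (u + 1) (v + 1)) b)
    (hb : ∀ x < 40, x ≠ 8 → x ≠ 14 → b.v x = a.v x) (h14 : b.v 14 = k + 1) :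
    bfsPush.Sat O b (BfsStep w s R G side β d (a.v 18) (bfsSpent d C a)) := by
  have hM := hL.mem
  have hn := hL.lt
  have htail := h.tail_le
  have hkn := k.2
  have hZ : 4 ^ s ≤ 4 ^ s * 4 ^ s := Nat.le_mul_of_pos_left _ h.inv.lists.tab.pos
  have e17 : b.v 17 = a.v 17 := hb _ (by omega) (by omega) (by omega)
  -- the partner of `u`
  obtain ⟨k', hk', hku, hkadj⟩ := h.inv.mate u (by omega)
  obtain rfl : k' = k := Fin.ext (by omega)
  have hsv : side v = true := by
    obtain ⟨v', hv', hs⟩ := h.queue _ hlt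
    obtain rfl : v' = v := Fin.ext (by omega)
    exact hs
  have hsk : side k' = true := by
    have h1 := side_of_adj side hadj
    have h2 := side_of_adj side hkadj
    rw [hsv] at h1
    rw [h2] at h1
    simpa using h1.symm
  have hnew : ∀ i < a.v 17, C 7 i ≠ k' := by
    intro i hi hik
    have := (h.tree i hi u (by rw [hik, hku])).1
    omega
  have ck : Val (2 ^ w) b (.v 14 -ₑ .c 1) k' := by
    have := (Val.reg (M := 2 ^ w) (a := b) 14 h14).sub (.const (x := 1) (by omega)) (by omega)
    simpa using this
  refine .seq (.sto hT (ρ := 7) (i := a.v 17) (x := k') (.const (by omega)) (.reg 17 e17)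
    ck (by omega)
    (by omega) ?_)
  intro c hc hT'
  refine .asg 17 (x := a.v 17 + 1) ((Val.reg 17 (by rw [hc, e17])).add (.const (by omega))
    (by omega)) ?_
  set C' := upd (upd (upd C 3 (u + 1) (a.v 9)) 8 (u + 1) (v + 1)) 7 (a.v 17) k' with hC'
  have hr : ∀ r, r ≠ 3 → r ≠ 7 → r ≠ 8 → C' r = C r := fun r h3 h7 h8 => by
    rw [hC', upd_of_ne _ h7, upd_of_ne _ h8, upd_of_ne _ h3]
  have hr3 : ∀ x, C' 3 x = if x = u.val + 1 then a.v 9 else C 3 x := by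
    intro x; simp [hC', upd_apply]
  have hr7 : ∀ x, C' 7 x = if x = a.v 17 then k'.val else C 7 x := by
    intro x; simp [hC', upd_apply]
  have hr7' : ∀ x < a.v 17, C' 7 x = C 7 x := fun x hx => by rw [hr7, if_neg (by omega)]
  have hr8 : ∀ x, C' 8 x = if x = u.val + 1 then v.val + 1 else C 8 x := by
    intro x; simp [hC', upd_apply]
  have h3mono : ∀ x : Fin n, C 3 (x + 1) = a.v 9 → C' 3 (x + 1) = a.v 9 := by
    intro x hx; rw [hr3]; split_ifs; exacts [rfl, hx]
  have hc' : ∀ x < 40, x ≠ 8 → x ≠ 14 → x ≠ 17 → (c.set 17 (a.v 17 + 1)).v x = a.v x := by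
    intro x hx h8 h14 h17
    rw [St.set_v, if_neg h17, hc, hb x hx h8 h14]
  have f5 := hc' 5 (by omega) (by omega) (by omega) (by omega)
  have f9 := hc' 9 (by omega) (by omega) (by omega) (by omega)
  have f16 := hc' 16 (by omega) (by omega) (by omega) (by omega)
  have f18 := hc' 18 (by omega) (by omega) (by omega) (by omega)
  have f17 : (c.set 17 (a.v 17 + 1)).v 17 = a.v 17 + 1 := by simp
  refine ⟨f18, C', ⟨?_, ?_, ?_, ?_, ?_, ?_, ?_, ?_, ?_, ?_, ?_, ?_, ?_⟩, ?_⟩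
  · rw [f9, f18]
    refine ⟨h.inv.lists.congr (hT'.set _ _) (hr _ (by omega) (by omega) (by omega))
      (fun x => hr _ (by omega) (by omega) (by omega))
      (fun x hx => hc' x (by omega) (by omega) (by omega) (by omega))
      (hc' _ (by omega) (by omega) (by omega) (by omega)), ?_, ?_, fun x => ?_, ?_⟩
    · rw [hr 0 (by omega) (by omega) (by omega)]; exact h.inv.mate
    · rw [hr3, if_neg (by omega)]; exact h.inv.vis_zero
    · rw [hr3]; split_ifs
      · rfl
      · exact h.inv.vis_le x
    · rw [hr 0 (by omega) (by omega) (by omega)]; exact h.inv.deficiency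
  · rw [f9, f18]; exact h.round
  · rw [f18]; exact h.lt
  · rw [f16, f17]; omega
  · rw [f17]
    intro i hi
    rcases Nat.lt_succ_iff_lt_or_eq.mp hi with h1 | rfl
    · rw [hr7' i h1]; exact h.queue i h1
    · exact ⟨k', by rw [hr7, if_pos rfl], hsk⟩
  · rw [f17]
    intro i hi j hj hij
    rcases Nat.lt_succ_iff_lt_or_eq.mp hi with h1 | h1 <;>
      rcases Nat.lt_succ_iff_lt_or_eq.mp hj with h2 | h2
    · rw [hr7' i h1, hr7' j h2] at hij
      exact h.inj i h1 j h2 hij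
    · rw [hr7' i h1, hr7 j, if_pos h2] at hij
      exact (hnew i h1 hij).elim
    · rw [hr7' j h2, hr7 i, if_pos h1] at hij
      exact (hnew j h2 hij.symm).elim
    · omega
  · rw [f17, hr 0 (by omega) (by omega) (by omega)]
    intro x hsx hx
    obtain ⟨i, hi, hix⟩ := h.free x hsx hx
    exact ⟨i, by omega, by rw [hr7' i hi, hix]⟩
  · rw [f17, f9, hr 0 (by omega) (by omega) (by omega)]
    intro i hi x hx
    rcases Nat.lt_succ_iff_lt_or_eq.mp hi with h1 | rfl
    · rw [hr7' i h1] at hx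
      obtain ⟨h2, j, hj, y, hy, hy8, hyadj⟩ := h.tree i h1 x hx
      refine ⟨h3mono x h2, j, hj, y, by rw [hr7' j (by omega), hy], ?_, hyadj⟩
      rw [hr8, if_neg (by intro h'; rw [h'] at h2; omega), hy8]
    · rw [hr7, if_pos rfl, hku] at hx
      obtain rfl : u = x := Fin.ext (by omega)
      exact ⟨by rw [hr3, if_pos rfl], a.v 16, hlt, v, by rw [hr7' _ hlt, hv],
        by rw [hr8, if_pos rfl], hadj⟩
  · rw [f17, f9, hr 0 (by omega) (by omega) (by omega)]
    intro x hx
    by_cases hxu : x = u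
    · subst hxu
      exact ⟨a.v 17, by omega, by rw [hr7, if_pos rfl, hk]⟩
    · rw [hr3, if_neg (fun h' => hxu (Fin.ext (by omega)))] at hx
      obtain ⟨i, hi, hix⟩ := h.visited x hx
      exact ⟨i, by omega, by rw [hr7' i hi, hix]⟩
  · rw [f5]; exact h.off_dvd
  · rw [f5, f16, f17, hr 6 (by omega) (by omega) (by omega), hr7' _ hlt]
    rcases h.off_lt with h1 | h1
    · exact Or.inl h1
    · exact Or.inr ⟨by omega, h1.2⟩
  · rw [f16, f9]
    intro hβ i hi x y hx hxy
    rw [hr7' i (by omega)] at hx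
    exact h3mono y (h.expanded hβ i hi x y hx hxy)
  · rw [f5, f16, f9]
    intro hβ i hi x y hx hxy
    rw [hr7' _ hlt] at hx
    rw [hr _ (by omega) (by omega) (by omega)] at hxy
    exact h3mono y (h.part hβ i hi x y hx hxy)
  · unfold bfsSpent
    rw [f17, f16, f5, hr 6 (by omega) (by omega) (by omega)]
    have : ∑ i ∈ Finset.range (a.v 16), (C 6 (C' 7 i) / 4 ^ d + 2) =
        ∑ i ∈ Finset.range (a.v 16), (C 6 (C 7 i) / 4 ^ d + 2) :=
      Finset.sum_congr rfl fun i hi => by rw [hr7' i (by rw [Finset.mem_range] at hi; omega)]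
    rw [this]
    omega

/-- The matching during the augmentation: the vertex of register `19` still has to be matched, and
its parent precedes position `i` of the queue, where the matching has not been changed. -/
def Augmenting (side : G.Coloring Bool) (t : ℕ) (C D : ℕ → ℕ → ℕ) (i e : ℕ) : Prop :=
  (e = 0 ∧ IsMate G (D 0) ∧ mateSize side (D 0) = mateSize side (C 0) + 1) ∨
  ∃ u : Fin n, e = u + 1 ∧ side u = false ∧ IsMate G (Function.update (D 0) u 0) ∧
    mateSize side (D 0) = mateSize side (C 0) ∧ ∃ j < i, j < t ∧ ∃ v : Fin n, C 7 j = v ∧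
    D 8 (u + 1) = v + 1 ∧ G.Adj v u ∧ ∀ j' ≤ j, D 0 (C 7 j') = C 0 (C 7 j')

/-- A step of the augmentation. -/
lemma sat_augmentStep (h : BfsInv w s R G side β d C a) (hL : Large w n s R)
    {D : ℕ → ℕ → ℕ} (hT : Tab (2 ^ w) (4 ^ s) D b) {i : ℕ} {u v : Fin n} (hu : b.v 19 = u + 1)
    (hsu : side u = false) (hm : IsMate G (Function.update (D 0) u 0))
    (hsize : mateSize side (D 0) = mateSize side (C 0)) (hi : i < a.v 17) (hv : C 7 i = v)
    (h8 : D 8 (u + 1) = v + 1) (hadj : G.Adj v u) (hD : ∀ j ≤ i, D 0 (C 7 j) = C 0 (C 7 j))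
    (hpar : ∀ x : Fin n, C 3 (x + 1) = a.v 9 → D 8 (x + 1) = C 8 (x + 1)) :
    augmentStep.Sat O b fun c => (∀ x, x ≠ 8 → x ≠ 14 → x ≠ 19 → c.v x = b.v x) ∧
      ∃ D', Tab (2 ^ w) (4 ^ s) D' c ∧ (∀ r ≠ 0, D' r = D r) ∧
      Augmenting side (a.v 17) C D' i (c.v 19) := by
  have hM := hL.mem
  have hn := hL.lt
  have hvn := v.2
  have hun := u.2
  have hZ : 4 ^ s ≤ 4 ^ s * 4 ^ s := Nat.le_mul_of_pos_left _ hT.pos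
  have hsv : side v = true := by have := side_of_adj side hadj; rw [hsu] at this; simpa using this
  have hne : u ≠ v := hadj.ne'
  have hne' : u.val ≠ v.val := fun h' => hne (Fin.ext h')
  have c8 := Val.cell hT (.const (x := 8) (by omega)) (.reg 19 hu) (by omega) (by omega)
  rw [h8] at c8
  have c8' := c8.sub (.const (x := 1) (by omega)) (by omega)
  rw [Nat.add_sub_cancel] at c8'
  refine .seq (.asg 8 c8' ?_)
  refine .seq (.asg 14 (x := D 0 v) (Val.cell (hT.set _ _) (.const (by omega)) (.reg 8 (by simp))
    (by omega) (by omega)) ?_)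
  refine .seq (.sto ((hT.set _ _).set _ _) (ρ := 0) (i := v) (x := u + 1) (.const (by omega))
    (.reg 8 (by simp)) (.reg 19 (by simp [hu])) (by omega) (by omega) ?_)
  intro b₁ hb₁ hT₁
  have c19 := (Val.reg (M := 2 ^ w) (a := b₁) (x := u + 1) 19 (by simp [hb₁, hu])).sub
    (.const (x := 1) (by omega)) (by omega)
  rw [Nat.add_sub_cancel] at c19
  refine .seq (.sto hT₁ (ρ := 0) (i := u) (x := v + 1) (.const (by omega))
    c19 ((Val.reg 8 (by simp [hb₁])).add (.const (by omega)) (by omega)) (by omega) (by omega) ?_)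
  intro b₂ hb₂ hT₂
  refine .asg 19 (x := D 0 v) (.reg 14 (by simp [hb₂, hb₁])) ?_
  set D' := upd (upd D 0 v (u + 1)) 0 u (v + 1) with hD'
  have hr : ∀ r, r ≠ 0 → D' r = D r := fun r hr => by rw [hD', upd_of_ne _ hr, upd_of_ne _ hr]
  have hr0 : ∀ x : ℕ, D' 0 x =
      if x = u.val then v.val + 1 else if x = v.val then u.val + 1 else D 0 x := by
    intro x; simp [hD', upd_apply]
  refine ⟨fun x h8 h14 h19 => by simp [hb₂, hb₁, h8, h14, h19], D', hT₂.set _ _, hr, ?_⟩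
  simp only [St.set_v, if_true]
  have hmv : Function.update (D 0) u.val 0 v = D 0 v := by
    rw [Function.update_of_ne hne'.symm]
  rcases Nat.eq_zero_or_pos (D 0 v) with h0 | h0
  · left
    refine ⟨h0, ?_, ?_⟩
    · refine hm.kick (v := u) (u := v) (by simp) hadj.symm (fun x => ?_)
      rw [hr0, hmv]
      simp only [Fin.ext_iff]
      split_ifs with h1 h2 h3
      · rfl
      · rfl
      · omega
      · rw [Function.update_of_ne h1]
    · rw [← hsize]
      refine mateSize_succ hsv h0 (by rw [hr0, if_neg hne'.symm, if_pos rfl]; omega)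
        (fun x hsx hx => ?_)
      rw [hr0, if_neg, if_neg (fun h' => hx (Fin.ext h'))]
      intro h'
      rw [Fin.ext h', hsu] at hsx
      exact absurd hsx (by simp)
  · right
    obtain ⟨y, hy, hy', hyadj⟩ := hm v (by rw [hmv]; omega)
    rw [hmv] at hy
    have hyu : y.val ≠ u.val := by
      intro h'
      rw [h', Function.update_self] at hy'
      omega
    have hsy : side y = false := by
      have := side_of_adj side hyadj; rw [hsv] at this; simpa using this.symm
    have hyC : C 0 (C 7 i) = y + 1 := by rw [← hD i le_rfl, hv, hy]
    obtain ⟨h3, j, hj, z, hz, hz8, hzadj⟩ := h.tree i hi y hyC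
    refine ⟨y, hy, hsy, ?_, ?_, j,
      hj, by omega, z, hz, by rw [hr 8 (by omega), hpar y h3, hz8], hzadj, ?_⟩
    · refine hm.kick (v := u) (u := v) (by simp) hadj.symm (fun x => ?_)
      rw [hmv, hy, Function.update_apply, hr0]
      have hyv : y.val ≠ v.val := fun h' => hyadj.ne' (Fin.ext h')
      simp only [Fin.ext_iff]
      by_cases h1 : x.val = y.val
      · rw [if_pos h1, if_neg (by omega), if_neg (by omega), if_pos (by omega)]
      rw [if_neg h1]
      by_cases h2 : x.val = u.val
      · rw [if_pos h2, if_pos h2]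
      rw [if_neg h2, if_neg h2]
      by_cases h4 : x.val = v.val
      · rw [if_pos h4, if_pos h4]
      rw [if_neg h4, if_neg h4, if_neg (by omega), Function.update_of_ne h2]
    · rw [← hsize]
      refine mateSize_congr (fun x hsx => ?_)
      rw [hr0, if_neg]
      · split_ifs with h1
        · rw [h1]; omega
        · rfl
      · intro h'
        rw [Fin.ext h', hsu] at hsx
        exact absurd hsx (by simp)
    · intro j' hj'
      rw [← hD j' (by omega), hr0, if_neg, if_neg]
      · intro h'
        have := h.inj j' (by omega) i hi (by rw [h', hv])
        omega
      · intro h'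
        obtain ⟨x, hx, hsx⟩ := h.queue j' (by omega)
        rw [Fin.ext (hx.symm.trans h'), hsu] at hsx
        exact absurd hsx (by simp)

/-- The augmentation takes linear time. -/
lemma triple_augment (h : BfsInv w s R G side β d C a) (hL : Large w n s R) (hlt : a.v 16 < a.v 17)
    (v u : Fin n) (hv : C 7 (a.v 16) = v) (hadj : G.Adj v u) (hu : C 3 (u + 1) < a.v 9)
    (hk : C 0 u = 0) (hT : Tab (2 ^ w) (4 ^ s) (upd (upd C 3 (u + 1) (a.v 9)) 8 (u + 1) (v + 1)) b)
    (hb : ∀ x < 40, x ≠ 8 → x ≠ 14 → b.v x = a.v x) (h41 : b.v 41 = u + 1) {δ : NNReal} {τ τe : ℕ}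
    (hτ : τe + 100 * n + 100 ≤ τ) {Q : ℕ → St → Prop}
    (hQ : ∀ τ' ≤ τ, ∀ c, τe ≤ τ' → c.v 16 = c.v 17 →
      RoundPost w s R G side β d (a.v 18) c → Q τ' c) : Triple O δ augment Q τ b := by
  have hw := hL.pos
  have htail := h.tail_le
  have hun := u.2
  have hn := hL.lt
  have hM := hL.mem
  have hZ : 4 ^ s ≤ 4 ^ s * 4 ^ s := Nat.le_mul_of_pos_left _ hT.pos
  set C₁ := upd (upd C 3 (u + 1) (a.v 9)) 8 (u + 1) (v + 1) with hC₁
  have hr : ∀ r, r ≠ 3 → r ≠ 8 → C₁ r = C r := fun r h3 h8 => by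
    rw [hC₁, upd_of_ne _ h8, upd_of_ne _ h3]
  have hr3 : ∀ x, C₁ 3 x = if x = u.val + 1 then a.v 9 else C 3 x := by
    intro x; simp [hC₁, upd_apply]
  have hr8 : ∀ x, C₁ 8 x = if x = u.val + 1 then v.val + 1 else C 8 x := by
    intro x; simp [hC₁, upd_apply]
  have hsv : side v = true := by
    obtain ⟨v', hv', hs⟩ := h.queue _ hlt
    obtain rfl : v' = v := Fin.ext (by omega)
    exact hs
  have hsu : side u = false := by
    have := side_of_adj side hadj; rw [hsv] at this; simpa using this.symm
  refine Triple.seq (by omega) (Triple.sat hw (by simp only [Exp.cost, Blk.cost]; omega) ?_)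
  refine .asg 19 (.reg 41 h41) ?_
  refine Triple.seq (by simp only [Exp.cost, Blk.cost]; omega) ?_
  refine Triple.while_ hw _ (fun τ' c => (∀ x < 40, x ≠ 8 → x ≠ 14 → x ≠ 19 → c.v x = a.v x) ∧
    ∃ D, Tab (2 ^ w) (4 ^ s) D c ∧ (∀ r ≠ 0, D r = C₁ r) ∧ ∃ i ≤ n,
    Augmenting side (a.v 17) C D i (c.v 19) ∧ τe + 100 * i + 40 ≤ τ') ?_ ?_
  · rintro τ' hτ' c ⟨hc, D, hTD, hD, i, hi, haug, hcr⟩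
    have hcond := Val.reg (M := 2 ^ w) (a := c) 19 rfl
    refine ⟨hcond.1, by simp only [Exp.cost]; omega, fun he => ?_, fun he => ?_⟩
    · rw [hcond.2] at he
      rcases haug with ⟨-, hm, hsz⟩ | ⟨x, hx, -⟩
      swap
      · omega
      refine Triple.sat hw (by simp only [Exp.cost, Blk.cost]; omega) ?_
      have f17 := hc 17 (by omega) (by omega) (by omega) (by omega)
      have f18 := hc 18 (by omega) (by omega) (by omega) (by omega)
      refine .asg 16 (.reg 17 rfl) (hQ _ (by omega) _ (by simp only [Exp.cost, Blk.cost]; omega)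
        (by simp) ⟨by simpa using f18, D, ?_, hm, ?_, fun x => ?_, fun hβ M hM => ?_⟩)
      · refine h.inv.lists.congr (hTD.set _ _) ?_ (fun x => ?_) (fun x hx => ?_) ?_
        · rw [hD 6 (by omega), hr 6 (by omega) (by omega)]
        · rw [hD _ (by omega), hr _ (by omega) (by omega)]
        · rw [St.set_v, if_neg (by omega), hc x (by omega) (by omega) (by omega) (by omega)]
        · simpa using hc 12 (by omega) (by omega) (by omega) (by omega)
      · rw [hD 3 (by omega), hr3, if_neg (by omega)]
        exact h.inv.vis_zero
      · rw [hD 3 (by omega), hr3, ← h.round]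
        split_ifs
        · rfl
        · exact h.inv.vis_le x
      · have h1 := h.inv.deficiency hβ M hM
        have h2 := h.lt
        rw [hsz]
        omega
    · rw [hcond.2] at he
      rcases haug with ⟨h0, -⟩ | ⟨x, hx, hsx, hm, hsz, j, hj, hjt, y, hy, hy8, hxy, hj'⟩
      · exact (he h0).elim
      have hsat := h.sat_augmentStep (O := O) hL hTD hx hsx hm hsz hjt hy hy8 hxy hj'
        (fun z hz => by
        rw [hD 8 (by omega), hr8, if_neg]
        intro h'
        rw [h'] at hz
        omega)
      refine Triple.sat hw (by simp only [augmentStep, cellE, Exp.cost, Blk.cost]; omega)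
        ⟨hsat.1, ?_⟩
      obtain ⟨h1, D', hT', hD', haug'⟩ := hsat.2
      refine ⟨fun x h2 h3 h4 h5 => by rw [h1 x h3 h4 h5, hc x h2 h3 h4 h5], D', hT',
        fun r hr => by rw [hD' r hr, hD r hr], j, by omega, haug', ?_⟩
      simp only [augmentStep, cellE, Exp.cost, Blk.cost]
      omega
  · refine ⟨fun x h2 h3 h4 h5 => by rw [St.set_v, if_neg h5, hb x h2 h3 h4], C₁, hT.set _ _,
      fun _ _ => rfl, n, le_rfl,
        Or.inr ⟨u, by simp, hsu, ?_, ?_, a.v 16, by omega, hlt, v, hv, ?_, hadj, ?_⟩,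
      by simp only [Exp.cost, Blk.cost]; omega⟩
    · rw [hr 0 (by omega) (by omega), Function.update_eq_self_iff.mpr hk.symm]
      exact h.inv.mate
    · rw [hr 0 (by omega) (by omega)]
    · rw [hr8, if_pos rfl]
    · intro j _
      rw [hr 0 (by omega) (by omega)]

end BfsInv

/-- The invariant of the loop that fills the queue; the first `x` vertices have been considered. -/
structure CollectInv (side : G.Coloring Bool) (mate Q : ℕ → ℕ) (t x : ℕ) : Prop where
  tail_le : t ≤ x
  le : x ≤ n
  queue : ∀ i < t, ∃ v : Fin n, Q i = v ∧ side v = true ∧ mate v = 0 ∧ v < x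
  inj : ∀ i < t, ∀ j < t, Q i = Q j → i = j
  free : ∀ v : Fin n, v < x → side v = true → mate v = 0 → ∃ i < t, Q i = v

lemma CollectInv.skip {mate Q : ℕ → ℕ} {t : ℕ} {v : Fin n} (h : CollectInv side mate Q t v)
    (hv : side v = true → mate v ≠ 0) : CollectInv side mate Q t (v + 1) := by
  refine ⟨h.tail_le.trans (Nat.le_succ _), v.2, fun i hi => ?_, h.inj, fun x hx hs hm => ?_⟩
  · obtain ⟨x, h1, h2, h3, h4⟩ := h.queue i hi
    exact ⟨x, h1, h2, h3, by omega⟩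
  · rcases Nat.lt_succ_iff_lt_or_eq.mp hx with h1 | h1
    · exact h.free x h1 hs hm
    · obtain rfl : x = v := Fin.ext h1
      exact (hv hs hm).elim

lemma CollectInv.push {mate Q Q' : ℕ → ℕ} {t : ℕ} {v : Fin n} (h : CollectInv side mate Q t v)
    (hs : side v = true) (hm : mate v = 0) (hQ : ∀ i, Q' i = if i = t then v.val else Q i) :
    CollectInv side mate Q' (t + 1) (v + 1) := by
  have hQ' : ∀ i < t, Q' i = Q i := fun i hi => by rw [hQ, if_neg (by omega)]
  have hQt : Q' t = v := by rw [hQ, if_pos rfl]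
  refine ⟨Nat.succ_le_succ h.tail_le, v.2, fun i hi => ?_, fun i hi j hj hij => ?_,
    fun x hx hs' hm' => ?_⟩
  · rcases Nat.lt_succ_iff_lt_or_eq.mp hi with h1 | rfl
    · obtain ⟨x, h2, h3, h4, h5⟩ := h.queue i h1
      exact ⟨x, by rw [hQ' i h1, h2], h3, h4, by omega⟩
    · exact ⟨v, hQt, hs, hm, Nat.lt_succ_self _⟩
  · rcases Nat.lt_succ_iff_lt_or_eq.mp hi with h1 | rfl <;>
      rcases Nat.lt_succ_iff_lt_or_eq.mp hj with h2 | rfl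
    · rw [hQ' i h1, hQ' j h2] at hij
      exact h.inj i h1 j h2 hij
    · rw [hQ' i h1, hQt] at hij
      obtain ⟨x, h3, -, -, h4⟩ := h.queue i h1
      omega
    · rw [hQ' j h2, hQt] at hij
      obtain ⟨x, h3, -, -, h4⟩ := h.queue j h2
      omega
    · rfl
  · rcases Nat.lt_succ_iff_lt_or_eq.mp hx with h1 | h1
    · obtain ⟨i, hi, hix⟩ := h.free x h1 hs' hm'
      exact ⟨i, by omega, by rw [hQ' i hi, hix]⟩
    · exact ⟨t, by omega, by rw [hQt, h1]⟩

lemma sat_bfsCollect (hL : Large w n s R) {sd : ι}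
    (hsd : ∀ v : Fin n, O.nat sd v 0 = if side v = true then 1 else 0)
    (hT : Tab (2 ^ w) (4 ^ s) C a) {v : Fin n} (hv : a.v 8 = v)
    (h : CollectInv side (C 0) (C 7) (a.v 17) v) :
    (bfsCollect sd).Sat O a fun b => (∀ x, x ≠ 8 → x ≠ 15 → x ≠ 17 → b.v x = a.v x) ∧
      b.v 8 = v + 1 ∧ ∃ C', Tab (2 ^ w) (4 ^ s) C' b ∧ (∀ r ≠ 7, C' r = C r) ∧
      CollectInv side (C 0) (C' 7) (b.v 17) (v + 1) := by
  have hM := hL.mem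
  have hn := hL.lt
  have hvn := v.2
  have htail := h.tail_le
  have hZ : 4 ^ s ≤ 4 ^ s * 4 ^ s := Nat.le_mul_of_pos_left _ hT.pos
  refine .seq (.qry 15 (.reg 8 hv) (.const (x := 0) (by omega)) ?_)
  rw [hsd v]
  set a₁ := a.set 15 (if side v = true then 1 else 0) with ha₁
  have hT₁ : Tab (2 ^ w) (4 ^ s) C a₁ := hT.set _ _
  have e8 : a₁.v 8 = v := by simp [ha₁, hv]
  have hend : ∀ b : St, (∀ x, x ≠ 15 → x ≠ 17 → b.v x = a.v x) → (∃ C', Tab (2 ^ w) (4 ^ s) C' b ∧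
      (∀ r ≠ 7, C' r = C r) ∧ CollectInv side (C 0) (C' 7) (b.v 17) (v + 1)) →
      (Blk.asg 8 (.v 8 +ₑ .c 1)).Sat O b fun b => (∀ x, x ≠ 8 → x ≠ 15 → x ≠ 17 → b.v x = a.v x) ∧
      b.v 8 = v + 1 ∧ ∃ C', Tab (2 ^ w) (4 ^ s) C' b ∧ (∀ r ≠ 7, C' r = C r) ∧
      CollectInv side (C 0) (C' 7) (b.v 17) (v + 1) := by
    rintro b hb ⟨C', h1, h2, h3⟩
    refine .asg 8 (x := v + 1) ((Val.reg 8 (by rw [hb 8 (by omega) (by omega), hv])).add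
      (.const (by omega)) (by omega))
        ⟨fun x h8 h15 h17 => ?_, by simp, C', h1.set _ _, h2, by simpa using h3⟩
    rw [St.set_v, if_neg h8, hb x h15 h17]
  have hskip : (side v = true → C 0 v ≠ 0) → (Blk.skip : Blk ι).Sat O a₁ fun b =>
      (Blk.asg 8 (.v 8 +ₑ .c 1)).Sat O b fun b => (∀ x, x ≠ 8 → x ≠ 15 → x ≠ 17 → b.v x = a.v x) ∧
      b.v 8 = v + 1 ∧ ∃ C', Tab (2 ^ w) (4 ^ s) C' b ∧ (∀ r ≠ 7, C' r = C r) ∧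
      CollectInv side (C 0) (C' 7) (b.v 17) (v + 1) := fun hs =>
    .skip (hend a₁ (fun x h15 _ => by simp [ha₁, h15]) ⟨C, hT₁, fun _ _ => rfl, by
      simpa [ha₁] using h.skip hs⟩)
  refine .seq (.ite (x := if side v = true then 1 else 0) (.reg 15 (by simp [ha₁])) (fun hs => ?_)
    (fun hs => hskip ?_))
  · have hs : side v = true := by by_contra h'; rw [if_neg h'] at hs; exact hs rfl
    refine .ite (x := C 0 v) (.cell hT₁ (.const (by omega)) (.reg 8 e8) (by omega) (by omega))
      (fun hm => hskip fun _ => hm) (fun hm => ?_)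
    refine .seq (.sto hT₁ (ρ := 7) (i := a.v 17) (x := v) (.const (by omega))
      (.reg 17 (by simp [ha₁]))
      (.reg 8 e8) (by omega) (by omega) ?_)
    intro b hb hTb
    refine .asg 17 (x := a.v 17 + 1) ((Val.reg 17 (by rw [hb]; simp [ha₁])).add (.const (by omega))
      (by omega))
      (hend _ (fun x h15 h17 => by rw [St.set_v, if_neg h17, hb]; simp [ha₁, h15])
        ⟨_, hTb.set _ _, fun r hr => upd_of_ne _ hr _ _, ?_⟩)
    simp only [St.set_v, if_true]
    exact h.push hs hm fun i => by simp [upd_apply]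
  · intro h'; rw [if_pos h'] at hs; omega

/-- A round of breadth-first search scans each list at most once, with `O(n)` searches of blocks. -/
lemma Triple.bfs (hL : Large w n s R) {sd : ι}
    (hsd : ∀ v : Fin n, O.nat sd v 0 = if side v = true then 1 else 0) {δ : NNReal}
    (hδ : β → (3 / 4) ^ R ≤ (δ : ℝ))
    (h : RoundInv w s R G side β d (a.v 18) (2 ^ s - a.v 18) C a) (hlt : a.v 18 < 2 ^ s) {τ τe : ℕ}
    (hτ : τe + 2 ^ d * listUnit R * (6 * n) ≤ τ) {Q : ℕ → St → Prop}
    (hQ : ∀ τ' ≤ τ, ∀ b, τe ≤ τ' → RoundPost w s R G side β d (a.v 18) b → Q τ' b) :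
    Triple O δ (bfs sd) Q τ a := by
  have hw := hL.pos
  have hM := hL.mem
  have hn := hL.lt
  have h2n := hL.two_le
  have hZ : 4 ^ s ≤ 4 ^ s * 4 ^ s := Nat.le_mul_of_pos_left _ (by positivity)
  have h24 : 2 ^ s ≤ 4 ^ s := Nat.pow_le_pow_left (by norm_num) s
  have hU : 1000 ≤ 2 ^ d * listUnit R :=
    le_trans (Nat.le_add_left _ _) (searchCost_le (ι := Empty) listGates listBlk d R)
  set U := 2 ^ d * listUnit R with hUdef
  have hbud : U * (4 * n) + 200 * n + 500 ≤ U * (6 * n) := by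
    have : 1000 * (2 * n) ≤ U * (2 * n) := Nat.mul_le_mul_right _ hU
    have e : U * (6 * n) = U * (4 * n) + U * (2 * n) := by ring
    omega
  set r := a.v 18 with hr
  refine Triple.seq (by omega) (Triple.sat hw (by simp only [Exp.cost, Blk.cost]; omega) ?_)
  refine .seq (.asg 16 (.const (x := 0) (by omega)) ?_)
  refine .seq (.asg 17 (.const (x := 0) (by omega)) ?_)
  refine .seq (.asg 8 (.const (x := 0) (by omega)) ?_)
  refine .seq (.asg 5 (.const (x := 0) (by omega)) ?_)
  refine .asg 9 (x := r + 1) ((Val.reg 18 (by simp [hr])).add (.const (by omega)) (by omega)) ?_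
  set a₁ := (((((a.set 16 0).set 17 0).set 8 0).set 5 0).set 9 (r + 1)) with ha₁
  have hv₁ : ∀ x, x ≠ 5 → x ≠ 8 → x ≠ 9 → x ≠ 16 → x ≠ 17 → a₁.v x = a.v x :=
    fun x h5 h8 h9 h16 h17 => by simp [ha₁, h5, h8, h9, h16, h17]
  have hT₁ : Tab (2 ^ w) (4 ^ s) C a₁ :=
    ((((h.lists.tab.set _ _).set _ _).set _ _).set _ _).set _ _
  refine Triple.seq (by simp only [Exp.cost, Blk.cost]; omega) ?_
  refine Triple.while_ hw _ (fun τ' b => (∀ x, x ≠ 8 → x ≠ 15 → x ≠ 17 → b.v x = a₁.v x) ∧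
    ∃ D, Tab (2 ^ w) (4 ^ s) D b ∧ (∀ r ≠ 7, D r = C r) ∧
    CollectInv side (C 0) (D 7) (b.v 17) (b.v 8) ∧
    τe + U * (4 * n) + 200 * n + 400 ≤ τ' + 100 * b.v 8) ?_ ?_
  swap
  · refine ⟨fun _ _ _ _ => rfl, C, hT₁, fun _ _ => rfl,
      ?_, by simp only [Exp.cost, Blk.cost]; omega⟩
    have e17 : a₁.v 17 = 0 := by simp [ha₁]
    have e8 : a₁.v 8 = 0 := by simp [ha₁]
    rw [e17, e8]
    exact ⟨le_rfl, Nat.zero_le _, fun i hi => by omega, fun i hi => by omega, fun v hv => by omega⟩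
  rintro τ' hτ' b ⟨hb, D, hTD, hD, hcol, hcr⟩
  have hle := hcol.le
  have hbv : ∀ x, x ≠ 5 → x ≠ 8 → x ≠ 9 → x ≠ 15 → x ≠ 16 → x ≠ 17 → b.v x = a.v x :=
    fun x h5 h8 h9 h15 h16 h17 => by rw [hb x h8 h15 h17, hv₁ x h5 h8 h9 h16 h17]
  have hlists : NbrLists w s R G side β d D b := h.lists.congr hTD (hD _ (by omega))
    (fun x => hD _ (by omega)) (fun x hx => hbv x (by omega) (by omega) (by omega) (by omega)
      (by omega) (by omega))
    (hbv _ (by omega) (by omega) (by omega) (by omega) (by omega) (by omega))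
  have hcond := (Val.reg (M := 2 ^ w) (a := b) 8 rfl).lt (Val.reg 0 hlists.base.h0)
  refine ⟨hcond.1, by simp only [Exp.cost]; omega, fun he => ?_, fun he => ?_⟩
  swap
  · rw [hcond.2] at he
    have hlt : b.v 8 < n := by by_contra h'; rw [if_neg h'] at he; exact he rfl
    have hsat := sat_bfsCollect (O := O) hL hsd hTD (v := ⟨b.v 8, hlt⟩)
      rfl (by rw [hD 0 (by omega)]; exact hcol)
    refine Triple.sat hw (by simp only [bfsCollect, cellE, Exp.cost, Blk.cost]; omega) ⟨hsat.1, ?_⟩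
    obtain ⟨h1, h2, D', h3, h4, h5⟩ := hsat.2
    rw [hD 0 (by omega)] at h5
    refine ⟨fun x h8 h15 h17 => by rw [h1 x h8 h15 h17, hb x h8 h15 h17], D', h3,
      fun r hr => by rw [h4 r hr, hD r hr], by rw [h2]; exact h5, ?_⟩
    rw [h2]
    simp only [bfsCollect, cellE, Exp.cost, Blk.cost]
    omega
  -- the queue is filled
  rw [hcond.2] at he
  have hbn : b.v 8 = n := by by_contra h'; rw [if_pos (by omega)] at he; omega
  rw [hbn] at hcol
  have f5 : b.v 5 = 0 := by rw [hb _ (by omega) (by omega) (by omega)]; simp [ha₁]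
  have f9 : b.v 9 = r + 1 := by rw [hb _ (by omega) (by omega) (by omega)]; simp [ha₁]
  have f16 : b.v 16 = 0 := by rw [hb _ (by omega) (by omega) (by omega)]; simp [ha₁]
  have f18 : b.v 18 = r := hbv _ (by omega) (by omega) (by omega) (by omega) (by omega) (by omega)
  have hinv : BfsInv w s R G side β d D b := by
    refine ⟨⟨hlists, ?_, ?_, fun u => ?_, ?_⟩, ?_, ?_, ?_, fun i hi => ?_, hcol.inj,
      fun v hs hm => ?_,
      fun i hi u hu => ?_, fun u hu => ?_, ?_, Or.inl f5, fun _ i hi => ?_, fun _ i hi => ?_⟩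
    · rw [hD 0 (by omega)]; exact h.mate
    · rw [hD 3 (by omega)]; exact h.vis_zero
    · rw [hD 3 (by omega), f9]; exact (h.vis_le u).trans (Nat.le_succ _)
    · rw [hD 0 (by omega), f18]; exact h.deficiency
    · rw [f9, f18]
    · rw [f18]; exact hlt
    · rw [f16]; exact Nat.zero_le _
    · obtain ⟨v, h1, h2, -⟩ := hcol.queue i hi
      exact ⟨v, h1, h2⟩
    · rw [hD 0 (by omega)] at hm
      exact hcol.free v v.2 hs hm
    · obtain ⟨v, h1, -, h2, -⟩ := hcol.queue i hi
      rw [hD 0 (by omega), h1, h2] at hu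
      omega
    · rw [hD 3 (by omega), f9] at hu
      have := h.vis_le u
      omega
    · rw [f5]; exact dvd_zero _
    · omega
    · omega
  refine Triple.while_ hw _ (fun τ' b => (b.v 18 = r ∧ ∃ C, BfsInv w s R G side β d C b ∧
      τe + U * (4 * n) + 100 * n + 200 ≤ τ' + U * bfsSpent d C b) ∨
    (b.v 16 = b.v 17 ∧ RoundPost w s R G side β d r b ∧ τe + 20 ≤ τ')) ?_
    (Or.inl ⟨f18, D, hinv, by simp only [Exp.cost]; omega⟩)
  clear! b D a₁
  clear_value r
  clear h hlt hr
  rintro τ₁ hτ₁ a hcase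
  have hcond := (Val.reg (M := 2 ^ w) (a := a) 16 rfl).lt (Val.reg 17 rfl)
  rcases hcase with ⟨h18, C, h, hcr⟩ | ⟨hend, hpost, hcr⟩
  swap
  · refine ⟨hcond.1, by simp only [Exp.cost]; omega, fun he => ?_, fun he => ?_⟩
    · exact hQ _ (by simp only [Exp.cost] at hτ₁ ⊢; omega) a (by simp only [Exp.cost]; omega) hpost
    · rw [hcond.2, if_neg (by omega)] at he
      exact (he rfl).elim
  have hsp := h.spent_le
  have hmul : U * bfsSpent d C a ≤ U * (4 * n) := Nat.mul_le_mul_left _ hsp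
  have hround := h.round
  refine ⟨hcond.1, by simp only [Exp.cost]; omega, fun he => ?_, fun he => ?_⟩
  · have hend : a.v 16 = a.v 17 := by
      rw [hcond.2] at he
      have := h.head_le
      by_contra h'
      rw [if_pos (by omega)] at he
      omega
    refine hQ _ (by simp only [Exp.cost] at hτ₁ ⊢; omega) a (by simp only [Exp.cost]; omega)
      ⟨h18, C, h.inv.lists, h.inv.mate, h.inv.vis_zero, fun u => ?_, fun hβ M hM => ?_⟩
    · rw [← h18, ← hround]; exact h.inv.vis_le u
    · have := h.deficiency_zero hend hβ M hM
      omega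
  have hht : a.v 16 < a.v 17 := by
    rw [hcond.2] at he; by_contra h'; rw [if_neg h'] at he; exact he rfl
  have htail := h.tail_le
  have hcredit : τe + 100 * n + 200 + U ≤ τ₁ := by
    have : U * (bfsSpent d C a + 1) ≤ U * (4 * n) := Nat.mul_le_mul_left _ (h.spent_lt hht)
    rw [mul_add, mul_one] at this
    omega
  have hfin : ∀ τ'' b, BfsStep w s R G side β d r (bfsSpent d C a) b → τ₁ ≤ τ'' + U →
      (b.v 18 = r ∧ ∃ C, BfsInv w s R G side β d C b ∧
      τe + U * (4 * n) + 100 * n + 200 ≤ τ'' + U * bfsSpent d C b) ∨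
    (b.v 16 = b.v 17 ∧ RoundPost w s R G side β d r b ∧ τe + 20 ≤ τ'') := by
    rintro τ'' b ⟨h18, C', h', hD'⟩ hτ''
    refine Or.inl ⟨h18, C', h', ?_⟩
    have : U * (bfsSpent d C a + 1) ≤ U * bfsSpent d C' b := Nat.mul_le_mul_left _ hD'
    rw [mul_add, mul_one] at this
    omega
  obtain ⟨v, hv, hs⟩ := h.queue _ hht
  have hvn := v.2
  have hT := h.inv.lists.tab
  have h92 : a.v 9 ≤ 2 ^ s := by have := h.lt; omega
  have hdeg := h.inv.lists.sound.deg_le v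
  refine Triple.seq (by simp only [Exp.cost]; omega) (Triple.sat hw
    (by simp only [cellE, Exp.cost, Blk.cost]; omega) ?_)
  have c8 := Val.cell hT (.const (x := 7) (by omega)) (.reg 16 rfl) (by omega) (by omega)
  rw [hv] at c8
  refine .asg 8 c8 ?_
  set a₂ := a.set 8 v.val with ha₂
  have hv₂ : ∀ x, x ≠ 8 → a₂.v x = a.v x := fun x hx => by simp [ha₂, hx]
  have h₂ : BfsInv w s R G side β d C a₂ := h.congr rfl (fun x hx => hv₂ x (by omega))
    (hv₂ _ (by omega)) (hv₂ _ (by omega)) (hv₂ _ (by omega)) (hv₂ _ (by omega)) (hv₂ _ (by omega))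
    (hv₂ _ (by omega))
  have e8 : a₂.v 8 = v := by simp [ha₂]
  have e5 : a₂.v 5 = a.v 5 := hv₂ _ (by omega)
  have e9 : a₂.v 9 = a.v 9 := hv₂ _ (by omega)
  have hcond := (Val.reg (M := 2 ^ w) (a := a₂) 5 rfl).lt (Val.cell h₂.inv.lists.tab
    (.const (x := 6) (by omega)) (.reg 8 e8) (by omega) (by omega))
  rw [e5] at hcond
  -- a state with the invariant in which the same amount has been spent
  have hsame : ∀ b : St, b.m = a.m → (∀ x < 40, x ≠ 8 → x ≠ 10 → x ≠ 11 → b.v x = a.v x) →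
      BfsInv w s R G side β d C b ∧ b.v 18 = r ∧ bfsSpent d C b = bfsSpent d C a := by
    intro b hm hb
    refine ⟨h.congr hm (fun x hx => hb x (by omega) (by omega) (by omega) (by omega))
      (hb _ (by omega) (by omega) (by omega) (by omega)) (hb _ (by omega) (by omega) (by omega)
        (by omega))
      (hb _ (by omega) (by omega) (by omega) (by omega)) (hb _ (by omega) (by omega) (by omega)
        (by omega))
      (hb _ (by omega) (by omega) (by omega) (by omega)) (hb _ (by omega) (by omega) (by omega)
        (by omega)),
      (hb _ (by omega) (by omega) (by omega) (by omega)).trans h18, ?_⟩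
    unfold bfsSpent
    rw [hb 17 (by omega) (by omega) (by omega) (by omega), hb 16 (by omega) (by omega) (by omega)
      (by omega),
      hb 5 (by omega) (by omega) (by omega) (by omega)]
  refine Triple.ite hw _ hcond.1 (by simp only [cellE, Exp.cost, Blk.cost]; omega)
    (fun hlt => ?_) (fun hlt => ?_)
  swap
  · rw [hcond.2] at hlt
    have h5 : C 6 v ≤ a.v 5 := by by_contra h'; rw [if_pos (by omega)] at hlt; omega
    obtain ⟨-, f18, fD⟩ := hsame a₂ rfl (fun x _ hx _ _ => hv₂ x hx)
    have := h₂.sat_next (O := O) hL (by rw [hv₂ 16 (by omega), hv₂ 17 (by omega)]; exact hht) v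
      (by rw [hv₂ 16 (by omega), hv]) (by rw [e5]; exact h5)
    rw [f18, fD] at this
    refine Triple.sat hw (by simp only [cellE, Exp.cost, Blk.cost]; omega)
      ⟨this.1, hfin _ _ this.2 ?_⟩
    simp only [cellE, Exp.cost, Blk.cost]
    omega
  rw [hcond.2] at hlt
  have h5 : a.v 5 < C 6 v := by by_contra h'; rw [if_neg h'] at hlt; exact hlt rfl
  have hoff := add_pow_le_of_dvd h.inv.lists.le h.off_dvd (by omega)
  have hvis := h.inv.vis_zero
  refine Triple.seq (by simp only [cellE, Exp.cost, Blk.cost]; omega)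
    (Triple.listSearch hL hδ h₂.inv.lists
    (by omega) v e8 (by rw [e5]; exact hoff) (by rw [e9]; omega)
    (by simp only [cellE, Exp.cost, Blk.cost]; omega) ?_)
  intro τ₃ b hτ₃ hτ₃' hbm hbv hfound
  simp only [cellE, Exp.cost, Blk.cost] at hτ₃
  rw [e9, e5] at hfound
  have hv₃ : ∀ x < 40, x ≠ 8 → x ≠ 10 → x ≠ 11 → b.v x = a.v x := fun x hx h8 h10 h11 => by
    rw [hbv x hx h10 h11, hv₂ x h8]
  obtain ⟨h₃, f18, fD⟩ := hsame b hbm hv₃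
  have f8 : b.v 8 = v := by rw [hbv 8 (by omega) (by omega) (by omega), e8]
  have f5 : b.v 5 = a.v 5 := hv₃ _ (by omega) (by omega) (by omega) (by omega)
  have f9 : b.v 9 = a.v 9 := hv₃ _ (by omega) (by omega) (by omega) (by omega)
  have f16 : b.v 16 = a.v 16 := hv₃ _ (by omega) (by omega) (by omega) (by omega)
  have f17 : b.v 17 = a.v 17 := hv₃ _ (by omega) (by omega) (by omega) (by omega)
  have hht' : b.v 16 < b.v 17 := by rw [f16, f17]; exact hht
  refine Triple.ite hw _ (by simp [Exp.ok]) (by simp only [Exp.cost]; omega)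
    (fun h40 => ?_) (fun h40 => ?_)
  swap
  · simp only [Exp.eval] at h40
    rcases hfound with ⟨h1, -⟩ | ⟨-, hno⟩
    · omega
    have := h₃.sat_miss (O := O) hL hht' v (by rw [f16, hv]) (by rw [f5]; exact h5)
      (by rw [f5, f9]; exact hno)
    rw [f18, fD] at this
    refine Triple.sat hw (by simp only [Exp.cost, Blk.cost]; omega) ⟨this.1, hfin _ _ this.2 ?_⟩
    simp only [Exp.cost, Blk.cost]
    omega
  simp only [Exp.eval] at h40
  rcases hfound with ⟨-, u, hu, hadj, hvis⟩ | ⟨h0, -⟩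
  swap
  · exact (h40 h0).elim
  have hun := u.2
  have hTb := h₃.inv.lists.tab
  refine Triple.seq (by simp only [Exp.cost]; omega) (Triple.sat hw
    (by simp only [bfsVisit, cellE, Exp.cost, Blk.cost]; omega) ?_)
  refine .seq (.sto hTb (ρ := 3) (.const (by omega)) (.reg 41 hu) (.reg 9 f9) (by omega) (by omega) ?_)
  intro b₁ hb₁ hT₁
  refine .seq (.sto hT₁ (ρ := 8) (.const (by omega)) (.reg 41 (by rw [hb₁, hu])) (x := v + 1)
    ((Val.reg 8 (by rw [hb₁, f8])).add (.const (by omega)) (by omega)) (by omega) (by omega) ?_)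
  intro b₂ hb₂ hT₂
  have c41 := (Val.reg (M := 2 ^ w) (a := b₂) (x := u + 1) 41 (by rw [hb₂, hb₁, hu])).sub
    (.const (x := 1) (by omega)) (by omega)
  rw [Nat.add_sub_cancel] at c41
  have c14 := Val.cell hT₂ (.const (x := 0) (by omega)) c41 (by omega) (by omega)
  rw [upd_of_ne _ (by omega), upd_of_ne _ (by omega)] at c14
  refine .asg 14 c14 ?_
  set b₃ := b₂.set 14 (C 0 u) with hb₃
  have hT₃ : Tab (2 ^ w) (4 ^ s) (upd (upd C 3 (u + 1) (b.v 9)) 8 (u + 1) (v + 1)) b₃ := by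
    rw [f9]; exact hT₂.set _ _
  have hv₄ : ∀ x < 40, x ≠ 8 → x ≠ 14 → b₃.v x = b.v x := fun x _ _ h14 => by
    rw [hb₃, St.set_v, if_neg h14, hb₂, hb₁]
  have g14 : b₃.v 14 = C 0 u := by simp [hb₃]
  have g41 : b₃.v 41 = u + 1 := by rw [hb₃, St.set_v, if_neg (by omega), hb₂, hb₁, hu]
  refine Triple.ite hw _ (by simp [Exp.ok]) (by simp only [bfsVisit, cellE, Exp.cost, Blk.cost]; omega)
    (fun he => ?_) (fun he => ?_)
  · rw [Exp.eval, g14] at he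
    obtain ⟨k, hk, -⟩ := h.inv.mate u he
    have := h₃.sat_push (O := O) hL hht' v u (by rw [f16, hv]) hadj (by rw [f9]; exact hvis)
      hk hT₃ hv₄
      (by rw [g14, hk])
    rw [f18, fD] at this
    refine Triple.sat hw (by simp only [bfsVisit, bfsPush, cellE, Exp.cost, Blk.cost]; omega)
      ⟨this.1, hfin _ _ this.2 ?_⟩
    simp only [bfsVisit, bfsPush, cellE, Exp.cost, Blk.cost]
    omega
  · rw [Exp.eval, g14] at he
    refine h₃.triple_augment hL hht' v u (by rw [f16, hv]) hadj (by rw [f9]; exact hvis)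
      he hT₃ hv₄ g41
      (τe := τe + 20) (by simp only [bfsVisit, cellE, Exp.cost, Blk.cost]; omega) ?_
    intro τ'' _ c hτ'' hc hpost
    rw [f18] at hpost
    exact Or.inr ⟨hc, hpost, hτ''⟩

/-- As many rounds of breadth-first search as the matching may lack edges make it maximum. -/
lemma Triple.bfsRounds (hL : Large w n s R) {sd : ι}
    (hsd : ∀ v : Fin n, O.nat sd v 0 = if side v = true then 1 else 0) {δ : NNReal}
    (hδ : β → (3 / 4) ^ R ≤ (δ : ℝ)) (h : RoundInv w s R G side β d 0 (2 ^ s) C a)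
      (h18 : a.v 18 = 0)
    {τ τe : ℕ} (hτ : τe + (2 ^ d * listUnit R * (6 * n) + 30) * 2 ^ s + 10 ≤ τ) {Q : ℕ → St → Prop}
    (hQ : ∀ τ' ≤ τ, ∀ b C, τe ≤ τ' → RoundInv w s R G side β d (2 ^ s) 0 C b → Q τ' b) :
    Triple O δ (bfsRounds sd) Q τ a := by
  have hw := hL.pos
  have hM := hL.mem
  have hn := hL.lt
  have hZ : 4 ^ s ≤ 4 ^ s * 4 ^ s := Nat.le_mul_of_pos_left _ (by positivity)
  have h24 : 2 ^ s ≤ 4 ^ s := Nat.pow_le_pow_left (by norm_num) s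
  set U := 2 ^ d * listUnit R * (6 * n) with hU
  refine Triple.while_ hw _ (fun τ' b => ∃ C, RoundInv w s R G side β d (b.v 18)
    (2 ^ s - b.v 18) C b ∧
    b.v 18 ≤ 2 ^ s ∧ τe + (U + 30) * (2 ^ s - b.v 18) + 10 ≤ τ') ?_
    ⟨C, by rw [h18]; exact h, by rw [h18]; exact Nat.zero_le _, by rw [h18]; exact hτ⟩
  rintro τ' hτ' b ⟨C, h, hle, hcr⟩
  have hcond := (Val.reg (M := 2 ^ w) (a := b) 18 rfl).lt (Val.reg 2 h.lists.base.h2)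
  refine ⟨hcond.1, by simp only [Exp.cost]; omega, fun he => ?_, fun he => ?_⟩
  · rw [hcond.2] at he
    have h18 : b.v 18 = 2 ^ s := by by_contra h'; rw [if_pos (by omega)] at he; omega
    rw [h18, Nat.sub_self] at h
    exact hQ _ (by omega) b C (by simp only [Exp.cost]; omega) h
  · rw [hcond.2] at he
    have hlt : b.v 18 < 2 ^ s := by by_contra h'; rw [if_neg h'] at he; exact he rfl
    obtain ⟨k, hk⟩ : ∃ k, 2 ^ s - b.v 18 = k + 1 := ⟨2 ^ s - b.v 18 - 1, by omega⟩
    have hk' : 2 ^ s - (b.v 18 + 1) = k := by omega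
    rw [hk, mul_add, mul_one] at hcr
    refine Triple.seq (by simp only [Exp.cost]; omega) (Triple.bfs hL hsd hδ h hlt
      (τe := τe + (U + 30) * k + 20) (by simp only [Exp.cost]; omega) ?_)
    rintro τ'' hτ'' c hc ⟨hc18, C', h'⟩
    rw [hk'] at h'
    refine Triple.sat hw (by simp only [Exp.cost, Blk.cost]; omega) ?_
    refine .asg 18 (x := b.v 18 + 1) ((Val.reg 18 hc18).add (.const (by omega)) (by omega))
      ⟨C', ?_, by simpa using hlt, ?_⟩
    · simp only [St.set_v, if_true, hk']
      refine h'.congr rfl (fun x hx => ?_) (by simp)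
      rw [St.set_v, if_neg (by omega)]
    · simp only [St.set_v, if_true, hk', Exp.cost, Blk.cost]
      omega

end

/-! ### The two input models -/

lemma onVertex_ofNat {n w : ℕ} (hn : n < 2 ^ w) (f : Fin n → BitVec w) (v : Fin n) :
    onVertex f (BitVec.ofNat w v) = f v := by
  have e : (BitVec.ofNat w v).toNat = v := by
    rw [BitVec.toNat_ofNat, Nat.mod_eq_of_lt (v.2.trans hn)]
  unfold onVertex
  rw [dif_pos (by rw [e]; exact v.2)]
  congr 1
  exact Fin.ext e

lemma exists_of_onVertex_ne_zero {n w : ℕ} {f : Fin n → BitVec w} {x : BitVec w}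
    (h : onVertex f x ≠ 0) : ∃ v : Fin n, v = x.toNat ∧ onVertex f x = f v := by
  by_cases hx : x.toNat < n
  · exact ⟨⟨x.toNat, hx⟩, rfl, by rw [onVertex, dif_pos hx]⟩
  · rw [onVertex, dif_neg hx] at h
    exact (h rfl).elim

lemma toNat_onVertex_side {n w : ℕ} (hw : 0 < w) (hn : n < 2 ^ w) {G : SimpleGraph (Fin n)}
    (side : G.Coloring Bool) (v : Fin n) :
    (onVertex (fun v' => if side v' then (1 : BitVec w) else 0) (BitVec.ofNat w v)).toNat =
      if side v = true then 1 else 0 := by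
  rw [onVertex_ofNat hn]
  split_ifs
  · exact BitVec.toNat_one_of_pos hw
  · rfl

/-- The XOR instructions that compute an entry of a neighbor list. -/
def listEntryGates : List (Instr ListQuestion 14) :=
  [.qxor 8 8, .qxor 10 5, .qop .add 9 10 0 (by decide) (by decide),
    .qquery .entry 3 8 9 (by decide) (by decide)]

/-- The classical counterpart of `listEntryGates`. -/
def listEntryBlk : Blk ListQuestion := .qry 41 .entry (.v 8) (.v 5 +ₑ .v 42)

/-- The XOR instructions that compute `i + 1` if the vertex `i` is a neighbor, and `0` otherwise. -/
def adjEntryGates : List (Instr AdjQuestion 14) :=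
  [.qxor 8 8, .qxor 10 5, .qop .add 9 10 0 (by decide) (by decide),
    .qquery .edge 11 8 9 (by decide) (by decide), .qxor 12 12,
    .qop .add 13 9 12 (by decide) (by decide), .qop .mul 3 11 13 (by decide) (by decide)]

/-- The classical counterpart of `adjEntryGates`. -/
def adjEntryBlk : Blk AdjQuestion :=
  .seq (.qry 41 .edge (.v 8) (.v 5 +ₑ .v 42)) (.asg 41 (.v 41 *ₑ (.v 5 +ₑ .v 42 +ₑ .c 1)))

lemma listAccess {n w : ℕ} (hw : 0 < w) (hn : n < 2 ^ w) (G : SimpleGraph (Fin n))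
    (side : G.Coloring Bool) (N : NeighborLists G) :
    Access (listBlackBox w G side N) G side .side listEntryGates listEntryBlk
      (BlackBox.nat (listBlackBox w G side N) .entry) where
  side_eq v := toNat_onVertex_side hw hn side v
  isGate := by simp [listEntryGates, Instr.IsGate]
  adj_of_ent v i h := by
    simp only [BlackBox.nat, listBlackBox, onVertex_ofNat hn] at h ⊢
    split_ifs at h ⊢ with hi
    · cases hu : N.entry v ⟨_, hi⟩ with
      | none => rw [hu] at h; exact (h rfl).elim
      | some u =>
        refine ⟨u, ?_, (N.entry_spec v u).mp ⟨_, hu⟩⟩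
        simp only [BitVec.toNat_ofNat]
        exact Nat.mod_eq_of_lt (by omega)
    · exact (h rfl).elim
  ent_of_adj v u h := by
    obtain ⟨i, hi⟩ := (N.entry_spec v u).mpr h
    have hin := i.2.trans_le (N.len_le v)
    refine ⟨i, hin, ?_⟩
    have e : (BitVec.ofNat w i).toNat = i := by
      rw [BitVec.toNat_ofNat, Nat.mod_eq_of_lt (hin.trans hn)]
    simp only [BlackBox.nat, listBlackBox, onVertex_ofNat hn, e, i.2, dif_pos, Fin.eta, hi]
    rw [BitVec.toNat_ofNat]
    exact Nat.mod_eq_of_lt (by omega)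
  circuit s h8 h12 x hx := by
    have e : s.reg 5 + x = BitVec.ofNat w ((s.reg 5).toNat + x.toNat) := by
      rw [BitVec.ofNat_add, BitVec.ofNat_toNat, BitVec.ofNat_toNat, BitVec.setWidth_eq,
        BitVec.setWidth_eq]
    refine ⟨?_, ?_⟩
    · simp [listEntryGates, Instr.basisList, Instr.basis, QState.xorMap, basisWord, WordOp.eval,
        BlackBox.nat, e]
    · rintro i (rfl | rfl | rfl | rfl | rfl) <;>
        simp [listEntryGates, Instr.basisList, Instr.basis, QState.xorMap, basisWord]
  block b h8 h12 hx := by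
    have := Blk.Sat.qry (O := listBlackBox w G side N) (p := .entry) 41 (P := fun c => c = b.set 41
      (BlackBox.nat
      (listBlackBox w G side N) .entry (b.v 8) (b.v 5 + b.v 42))) (Val.reg (M := 2 ^ w)
        (a := b) 8 rfl)
      ((Val.reg 5 rfl).add (.reg 42 rfl) (by omega)) rfl
    exact this

/-- The neighbor lists that the adjacency matrix defines.  Positions `i ≥ 2 ^ w`, which do not fit
into a word, are no entries of the lists. -/
noncomputable def adjEntry {n : ℕ} (w : ℕ) (G : SimpleGraph (Fin n)) (side : G.Coloring Bool)
    (v i : ℕ) : ℕ :=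
  if i < 2 ^ w then BlackBox.nat (adjBlackBox w G side) .edge v i * (i + 1) else 0

lemma nat_edge_le_one {n w : ℕ} (hw : 0 < w) (G : SimpleGraph (Fin n)) (side : G.Coloring Bool)
    (v i : ℕ) : BlackBox.nat (adjBlackBox w G side) .edge v i ≤ 1 := by
  have h1 := BitVec.toNat_one_of_pos hw
  simp only [BlackBox.nat, adjBlackBox, onVertex]
  split_ifs <;> simp_all

lemma adjAccess {n w : ℕ} (hw : 0 < w) (hn : n < 2 ^ w) (G : SimpleGraph (Fin n))
    (side : G.Coloring Bool) :
    Access (adjBlackBox w G side) G side .side adjEntryGates adjEntryBlk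
      (adjEntry w G side) where
  side_eq v := toNat_onVertex_side hw hn side v
  isGate := by simp [adjEntryGates, Instr.IsGate]
  adj_of_ent v i h := by
    unfold adjEntry at h ⊢
    split_ifs at h ⊢ with hi
    · have h0 : BlackBox.nat (adjBlackBox w G side) .edge v i ≠ 0 := left_ne_zero_of_mul h
      have h1 := nat_edge_le_one hw G side v i
      rw [show BlackBox.nat (adjBlackBox w G side) .edge v i = 1 by omega, one_mul]
      simp only [BlackBox.nat, adjBlackBox, onVertex_ofNat hn] at h0
      obtain ⟨u, hu, hu'⟩ := exists_of_onVertex_ne_zero (fun h' => h0 (by rw [h']; rfl))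
      rw [BitVec.toNat_ofNat, Nat.mod_eq_of_lt hi] at hu
      refine ⟨u, by rw [hu], ?_⟩
      by_contra hadj
      rw [hu', if_neg hadj] at h0
      exact h0 rfl
    · exact (h rfl).elim
  ent_of_adj v u h := by
    refine ⟨u, u.2, ?_⟩
    rw [adjEntry, if_pos (u.2.trans hn)]
    simp only [BlackBox.nat, adjBlackBox, onVertex_ofNat hn, if_pos h]
    rw [BitVec.toNat_one_of_pos hw, one_mul]
  circuit s h8 h12 x hx := by
    have h1 := nat_edge_le_one hw G side (s.reg 8).toNat ((s.reg 5).toNat + x.toNat)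
    have e : (s.reg 5 + x).toNat = (s.reg 5).toNat + x.toNat := by
      rw [BitVec.toNat_add, Nat.mod_eq_of_lt (by omega)]
    have e1 : (s.reg 5 + x + s.reg 12).toNat = (s.reg 5).toNat + x.toNat + 1 := by
      rw [BitVec.toNat_add, e, h12, Nat.mod_eq_of_lt (by omega)]
    refine ⟨?_, ?_⟩
    · have : Instr.basisList (adjBlackBox w G side) s adjEntryGates (basisWord x) 3 =
          adjBlackBox w G side .edge (s.reg 8) (s.reg 5 + x) * (s.reg 5 + x + s.reg 12) := by
        simp [adjEntryGates, Instr.basisList, Instr.basis, QState.xorMap, basisWord, WordOp.eval]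
      rw [this, adjEntry, if_pos (by omega), BitVec.toNat_mul, e1]
      have e2 : BlackBox.nat (adjBlackBox w G side)
        .edge (s.reg 8).toNat ((s.reg 5).toNat + x.toNat) =
          (adjBlackBox w G side .edge (s.reg 8) (s.reg 5 + x)).toNat := by
        rw [← e, BlackBox.nat, BitVec.ofNat_toNat, BitVec.ofNat_toNat, BitVec.setWidth_eq,
          BitVec.setWidth_eq]
      rw [← e2, Nat.mod_eq_of_lt]
      refine lt_of_le_of_lt (Nat.mul_le_mul_right _ h1) ?_
      omega
    · rintro i (rfl | rfl | rfl | rfl | rfl) <;>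
        simp [adjEntryGates, Instr.basisList, Instr.basis, QState.xorMap, basisWord]
  block b h8 h12 hx := by
    have h1 := nat_edge_le_one hw G side (b.v 8) (b.v 5 + b.v 42)
    have h2 := Nat.mul_le_mul_right (b.v 5 + b.v 42 + 1) h1
    have : adjEntryBlk.Sat (adjBlackBox w G side) b
        fun c => c = b.set 41 (adjEntry w G side (b.v 8) (b.v 5 + b.v 42)) := by
      refine .seq (.qry 41 (.reg 8 rfl) ((Val.reg 5 rfl).add (.reg 42 rfl) (by omega)) ?_)
      set c := b.set 41 (BlackBox.nat (adjBlackBox w G side) .edge (b.v 8) (b.v 5 + b.v 42)) with hc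
      have c41 : c.v 41 = BlackBox.nat (adjBlackBox w G side) .edge (b.v 8) (b.v 5 + b.v 42) := by
        simp [hc]
      have c5 : c.v 5 = b.v 5 := by simp [hc]
      have c42 : c.v 42 = b.v 42 := by simp [hc]
      refine .asg 41 ((Val.reg 41 c41).mul (((Val.reg 5 c5).add (.reg 42 c42) (by omega)).add
        (.const (x := 1) (by omega)) (by omega)) (by omega)) ?_
      rw [adjEntry, if_pos (by omega)]
      ext x
      · simp only [hc, St.set_v]
        split_ifs <;> rfl
      · rfl
    exact this

/-! ### The algorithm -/

section
variable {ι : Type}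

/-- Compute the parameters: `4 ^ s`, `2 ^ s` and `R = 125 * s` for the least `s` with `n < 4 ^ s`,
and fill the sentinels of the rows `1`, `2`, `3` that are searched for small entries. -/
def setup : Prog ι 14 :=
  .seq (Blk.seq (.asg 12 (.c 1)) (.seq (.asg 1 (.c 1)) (.asg 2 (.c 1)))).prog
  (.seq (.while (.v 1 <ₑ .v 0 +ₑ .c 1)
    (Blk.seq (.asg 1 (.c 4 *ₑ .v 1)) (.seq (.asg 2 (.c 2 *ₑ .v 2)) (.asg 3 (.v 3 +ₑ .c 125)))).prog)
  (Blk.seq (.sto (cellE (.c 1) (.c 0)) (.v 1 *ₑ .v 1))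
    (.seq (.sto (cellE (.c 2) (.c 0)) (.v 1 *ₑ .v 1))
    (.seq (.sto (cellE (.c 3) (.c 0)) (.v 1 *ₑ .v 1))
    (.seq (.asg 4 (.v 2)) (.asg 7 (.v 1)))))).prog)

/-- The matching algorithm: read the graph, find an almost maximum matching by an auction, and
complete it by augmenting paths. -/
def maxMatching (sd : ι) (eg : List (Instr ι 14)) (eb : Blk ι) : Prog ι 14 :=
  .seq setup (.seq (learn sd eg eb) (.seq choose
    (.seq (Blk.seq (.asg 13 (.c 0)) (.asg 8 (.c 0))).prog
    (.seq (auction sd) (.seq (Blk.asg 18 (.c 0)).prog (bfsRounds sd))))))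

/-- The memory after the setup. -/
def initTable (s : ℕ) : ℕ → ℕ → ℕ :=
  upd (upd (upd (fun _ _ => 0) 1 0 (4 ^ s * 4 ^ s)) 2 0 (4 ^ s * 4 ^ s)) 3 0 (4 ^ s * 4 ^ s)

end

section
variable {ι : Type} {w n s R : ℕ} {O : BlackBox ι w} {G : SimpleGraph (Fin n)}
  {side : G.Coloring Bool} {β : Prop} {C C₀ : ℕ → ℕ → ℕ} {a b : St} {d : ℕ} {sd : ι}
  {eg : List (Instr ι 14)} {eb : Blk ι} {ent : ℕ → ℕ → ℕ} {δ : NNReal}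

lemma initTable_of_ne {r : ℕ} (h1 : r ≠ 1) (h2 : r ≠ 2) (h3 : r ≠ 3) :
    initTable s r = fun _ => 0 := by
  rw [initTable, upd_of_ne _ h3, upd_of_ne _ h2, upd_of_ne _ h1]

lemma initTable_apply {r x : ℕ} (hr : r = 1 ∨ r = 2 ∨ r = 3) :
    initTable s r x = if x = 0 then 4 ^ s * 4 ^ s else 0 := by
  rcases hr with rfl | rfl | rfl <;> simp [initTable, upd_apply]

lemma learnInv_init (hb : Base n s R a) (hT : Tab (2 ^ w) (4 ^ s) (initTable s) a)
    (h4 : a.v 4 = 2 ^ s)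
    (h7 : a.v 7 = 4 ^ s) (h5 : a.v 5 = 0) (h6 : a.v 6 = 0) (h8 : a.v 8 = 0) :
    LearnInv w s R G side ent β (initTable s) (initTable s) s 0 a := by
  have e6 : initTable s 6 = fun _ => 0 := initTable_of_ne (by omega) (by omega) (by omega)
  have e16 : ∀ v, initTable s (16 + v) = fun _ => 0 :=
    fun v => initTable_of_ne (by omega) (by omega) (by omega)
  have e1 : ∀ e, initTable s 1 e = if e = 0 then 4 ^ s * 4 ^ s else 0 := fun e => initTable_apply
    (Or.inl rfl)
  refine ⟨hb, hT, ?_, ?_, h4, le_rfl, ?_, ?_, ?_, ?_, Or.inl rfl, ⟨?_, ?_, ?_⟩, ?_, ?_, ?_, ?_, ?_, ?_, ?_⟩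
  · omega
  · rw [h5]; positivity
  · rw [h5, h8]; ring
  · rw [h7]
  · rw [h6, e6]; simp
  · rw [h6, h7]; positivity
  · intro v i hi; rw [e6] at hi; exact (Nat.not_lt_zero _ hi).elim
  · intro v i hi; rw [e6] at hi; exact (Nat.not_lt_zero _ hi).elim
  · intro v i _; rw [e16]
  · rw [e1, if_pos rfl]
  · intro e he _; rw [e1, if_neg he]; omega
  · intro e he _
    rw [e1, if_neg he, e6]
    simp
  · intro v _; rw [e6]
  · intro r _ _ _; rfl
  · intro _ v hv; omega
  · intro _ i hi; omega

lemma Triple.setup (hL : Large w n s (125 * s)) (hs : ∀ i, 4 ^ i ≤ n ↔ i < s) (h0 : a.v 0 = n)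
    (hz : ∀ x ≠ 0, a.v x = 0) (hm : a.m = fun _ => 0) {τ τe : ℕ} (hτ : τe + 100 * (s + 2) ≤ τ)
    {Q : ℕ → St → Prop} (hQ : ∀ τ' ≤ τ, ∀ b, τe ≤ τ' →
      LearnInv w s (125 * s) G side ent β (initTable s) (initTable s) s 0 b → Q τ' b) :
    Triple O δ setup Q τ a := by
  have hw := hL.pos
  have hM := hL.mem
  have hn := hL.lt
  have h4n := hL.le
  have h2n := hL.two_le
  have hrep := hL.rep
  have hZpos : 0 < 4 ^ s := by positivity
  have hZ : 4 ^ s ≤ 4 ^ s * 4 ^ s := Nat.le_mul_of_pos_left _ hZpos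
  refine Triple.seq (by omega) (Triple.sat hw (by simp only [Exp.cost, Blk.cost]; omega) ?_)
  refine .seq (.asg 12 (.const (x := 1) (by omega)) ?_)
  refine .seq (.asg 1 (.const (x := 1) (by omega)) ?_)
  refine .asg 2 (.const (x := 1) (by omega)) ?_
  refine Triple.seq (by simp only [Exp.cost, Blk.cost]; omega) ?_
  refine Triple.while_ hw _ (fun τ' b => b.m = (fun _ => 0) ∧ b.v 0 = n ∧ b.v 12 = 1 ∧ b.v 5 = 0 ∧
    b.v 6 = 0 ∧ b.v 8 = 0 ∧ ∃ i ≤ s, b.v 1 = 4 ^ i ∧ b.v 2 = 2 ^ i ∧ b.v 3 = 125 * i ∧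
    τe + 100 * (s + 1) + 50 ≤ τ' + 100 * i) ?_ ?_
  swap
  · refine ⟨hm, by simp [h0], by simp, by simp [hz], by simp [hz], by simp [hz], 0, Nat.zero_le _, by simp,
      by simp, by simp [hz], ?_⟩
    simp only [Exp.cost, Blk.cost]
    omega
  rintro τ' hτ' b ⟨hbm, b0, b12, b5, b6, b8, i, hi, b1, b2, b3, hcr⟩
  have h4i : 4 ^ i ≤ 4 ^ s := Nat.pow_le_pow_right (by norm_num) hi
  have h2i : 2 ^ i ≤ 4 ^ i := Nat.pow_le_pow_left (by norm_num) i
  have hcond := (Val.reg (M := 2 ^ w) 1 b1).lt ((Val.reg 0 b0).add (.const (x := 1) (by omega))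
    (by omega))
  refine ⟨hcond.1, by simp only [Exp.cost]; omega, fun he => ?_, fun he => ?_⟩
  · rw [hcond.2] at he
    have hni : ¬ 4 ^ i ≤ n := by intro h'; rw [if_pos (by omega)] at he; omega
    obtain rfl : i = s := by
      rw [hs] at hni
      omega
    have hT : Tab (2 ^ w) (4 ^ i) (fun _ _ => 0) b := ⟨hbm, b1, hZpos, hM⟩
    have c1 : ∀ c : St, c.v = b.v → Val (2 ^ w) c (.v 1 *ₑ .v 1) (4 ^ i * 4 ^ i) := fun c hc =>
      (Val.reg 1 (by rw [hc, b1])).mul (.reg 1 (by rw [hc, b1])) (by omega)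
    refine Triple.sat hw (by simp only [cellE, Exp.cost, Blk.cost]; omega) ?_
    refine .seq (.sto hT (ρ := 1) (i := 0) (.const (by omega)) (.const (by omega)) (c1 _ rfl)
      hZpos (by omega) ?_)
    intro b₁ hb₁ hT₁
    refine .seq (.sto hT₁ (ρ := 2) (i := 0) (.const (by omega)) (.const (by omega)) (c1 _ hb₁) hZpos (by omega) ?_)
    intro b₂ hb₂ hT₂
    rw [hb₁] at hb₂
    refine .seq (.sto hT₂ (ρ := 3) (i := 0) (.const (by omega)) (.const (by omega)) (c1 _ hb₂) hZpos (by omega) ?_)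
    intro b₃ hb₃ hT₃
    rw [hb₂] at hb₃
    refine .seq (.asg 4 (.reg 2 (by rw [hb₃, b2])) ?_)
    refine .asg 7 (.reg 1 (x := 4 ^ i) (by simp [hb₃, b1])) ?_
    refine hQ _ (by simp only [cellE, Exp.cost, Blk.cost]; omega) _ (by simp only [cellE, Exp.cost, Blk.cost]; omega)
      (learnInv_init ⟨?_, ?_, ?_, ?_, ?_⟩ ((hT₃.set _ _).set _ _) ?_ ?_ ?_ ?_ ?_) <;>
    simp [*]
  · rw [hcond.2] at he
    have hlt : i < s := by
      rw [← hs]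
      by_contra h'
      rw [if_neg (by omega)] at he
      exact he rfl
    have h4 : 4 * 4 ^ i ≤ 4 ^ s := by
      rw [← pow_succ']
      exact Nat.pow_le_pow_right (by norm_num) hlt
    refine Triple.sat hw (by simp only [Exp.cost, Blk.cost]; omega) ?_
    refine .seq (.asg 1 ((Val.const (x := 4) (by omega)).mul (.reg 1 b1) (by omega)) ?_)
    refine .seq (.asg 2 ((Val.const (x := 2) (by omega)).mul (.reg 2 (x := 2 ^ i) (by simp [b2]))
      (by omega)) ?_)
    refine .asg 3 ((Val.reg 3 (x := 125 * i) (by simp [b3])).add (.const (x := 125) (by omega))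
      (by omega))
      ⟨hbm, by simp [b0], by simp [b12], by simp [b5], by simp [b6], by simp [b8], i + 1, hlt,
        by simp [pow_succ'], by simp [pow_succ'], by simp; ring, ?_⟩
    simp only [Exp.cost, Blk.cost]
    omega

lemma auctionInv_init (h : NbrLists w s R G side β d C a) (hn : n < 4 ^ s) (h2 : 2 ≤ n)
    (hrow : ∀ r < 16, r ≠ 1 → r ≠ 6 → C r = initTable s r) (h8 : a.v 8 = 0) (h13 : a.v 13 = 0) :
    AuctionInv w s R G side β d C C a ∧ AuctionCur n s side C a := by
  have e0 : C 0 = fun _ =>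
    0 := by rw [hrow _ (by omega) (by omega) (by omega), initTable_of_ne] <;> omega
  have e4 : C 4 = fun _ =>
    0 := by rw [hrow _ (by omega) (by omega) (by omega), initTable_of_ne] <;> omega
  have e5 : C 5 = fun _ =>
    0 := by rw [hrow _ (by omega) (by omega) (by omega), initTable_of_ne] <;> omega
  have e2 : ∀ x, C 2 x = if x = 0 then 4 ^ s * 4 ^ s else 0 := fun x => by
    rw [hrow _ (by omega) (by omega) (by omega), initTable_apply (by omega)]
  have h24 : 2 ^ s ≤ 4 ^ s := Nat.pow_le_pow_left (by norm_num) s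
  have hZ : 4 ^ s * 2 ≤ 4 ^ s * 4 ^ s := Nat.mul_le_mul_left _ (by omega)
  refine ⟨⟨h, fun _ _ _ _ _ => rfl, ?_, ?_, ?_, ?_, ?_, ?_, ?_, ?_, ?_, ?_, ?_, ?_, ?_⟩, ?_, ?_⟩
  · intro v hv; rw [e0] at hv; exact (hv rfl).elim
  · omega
  · intro v _ hv; right; right; omega
  · intro v _ _; rw [e0, e4]; exact ⟨rfl, rfl⟩
  · rw [e2, if_pos rfl]; omega
  · intro u; rw [e2, if_neg (by omega)]; exact Nat.zero_le _
  · intro v; rw [e4]; exact Nat.zero_le _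
  · intro v; rw [e5]; exact dvd_zero _
  · intro v; rw [e5]; positivity
  · intro _ v i hi; rw [e5] at hi; exact (Nat.not_lt_zero _ hi).elim
  · intro _ v u _ _; rw [e4]; exact Nat.zero_le _
  · intro v u _ hv; rw [e0] at hv; simp at hv
  · intro u _ _; rw [e2, if_neg (by omega)]
  · intro _
    exact ⟨⟨0, by omega⟩, h8, Nat.zero_le _, fun _ => by rw [e0, e4]; exact ⟨rfl, by positivity⟩⟩
  · intro h'; omega

/-- The factor in the bound on the running time. -/
def timeFactor (eg : List (Instr ι 14)) (eb : Blk ι) : ℕ :=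
  48 * (750 * (4 * eg.length + eb.cost + 150) + 1700) +
    56 * (750 * (4 * 3 + (listBlk : Blk Empty).cost + 150) + 1700) + 1000

/-- The algorithm takes time `O(n * Y * s)`, where `Y ^ 2` bounds the size of the graph. -/
lemma Triple.maxMatching (hL : Large w n s (125 * s)) (hs : ∀ i, 4 ^ i ≤ n ↔ i < s)
    (acc : Access O G side sd eg eb ent) (hδ : β → (3 / 4) ^ (125 * s) ≤ (δ : ℝ)) (h0 : a.v 0 = n)
    (hz : ∀ x ≠ 0, a.v x = 0) (hm : a.m = fun _ => 0) {Y : ℕ} (hY : G.edgeSet.ncard + n ≤ Y * Y) :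
    Triple O δ (maxMatching sd eg eb) (fun _ b => ∃ C, Tab (2 ^ w) (4 ^ s) C b ∧ IsMate G (C 0) ∧
      (β → Deficiency side (C 0) 0)) (timeFactor eg eb * (s * (n * Y))) a := by
  have hw := hL.pos
  have hM := hL.mem
  have hn := hL.lt
  have h4n := hL.le
  have h2n := hL.two_le
  have hZpos : 0 < 4 ^ s := by positivity
  have hZ : 4 ^ s ≤ 4 ^ s * 4 ^ s := Nat.le_mul_of_pos_left _ hZpos
  have hs1 : 1 ≤ s := by have := (hs 0).mp (by omega); omega
  have hLL : 2 ^ s * 2 ^ s = 4 ^ s := by rw [← mul_pow]; norm_num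
  have hLY : 2 ^ s ≤ 2 * Y := by
    refine Nat.mul_self_le_mul_self_iff.mp ?_
    calc _ = 4 ^ s := hLL
      _ ≤ 4 * (Y * Y) := by omega
      _ = _ := by ring
  have hY1 : 1 ≤ Y := by
    rcases Nat.eq_zero_or_pos Y with rfl | h
    · omega
    · exact h
  have hnY : n ≤ n * Y := Nat.le_mul_of_pos_right _ hY1
  have hYn : 2 * Y ≤ n * Y := Nat.mul_le_mul_right _ h2n
  have hsP : n * Y ≤ s * (n * Y) := Nat.le_mul_of_pos_left _ hs1
  have hsY : 1 * s ≤ (n * Y) * s := Nat.mul_le_mul_right _ (by omega)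
  set P := s * (n * Y) with hP
  have hPs : s ≤ P := by rw [hP, mul_comm]; omega
  -- the cost of reading the graph
  set Ue := 750 * (4 * eg.length + eb.cost + 150) + 1700 with hUe
  set Ul := 750 * (4 * 3 + (listBlk : Blk Empty).cost + 150) + 1700 with hUl
  have hue : unit eg eb (125 * s) ≤ Ue * s := by
    have : 1700 * 1 ≤ 1700 * s := Nat.mul_le_mul_left _ hs1
    calc unit eg eb (125 * s) = 750 * (4 * eg.length + eb.cost + 150) * s + 1700 := by unfold unit; ring
      _ ≤ 750 * (4 * eg.length + eb.cost + 150) * s + 1700 * s := by omega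
      _ = _ := by rw [hUe]; ring
  have hul : listUnit (125 * s) ≤ Ul * s := by
    have : 1700 * 1 ≤ 1700 * s := Nat.mul_le_mul_left _ hs1
    calc listUnit (125 * s) = 750 * (4 * 3 + (listBlk : Blk Empty).cost + 150) * s + 1700 := by
          unfold listUnit unit; simp only [listGates, List.length_cons, List.length_nil]; ring
      _ ≤ 750 * (4 * 3 + (listBlk : Blk Empty).cost + 150) * s + 1700 * s := by omega
      _ = _ := by rw [hUl]; ring
  have hlearn : unit eg eb (125 * s) * (3 * (4 ^ s * 2 ^ s + 2 * 4 ^ s * Y)) ≤ 48 * Ue * P := by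
    calc _ ≤ (Ue * s) * (3 * (4 * n * (2 * Y) + 2 * (4 * n) * Y)) := by gcongr
      _ = _ := by rw [hP]; ring
  have htotal : timeFactor eg eb * P = 48 * Ue * P + 32 * Ul * P + 24 * Ul * P + 1000 * P := by
    unfold timeFactor; rw [← hUe, ← hUl]; ring
  clear_value P Ue Ul
  rw [htotal]
  refine Triple.seq (by omega) (Triple.setup (G := G) (side := side) (ent := ent) (β := β)
    hL hs h0 hz hm
    (τe := 48 * Ue * P + 32 * Ul * P + 24 * Ul * P + 600 * P) (by omega) ?_)
  intro τ₁ hτ₁ b₁ hc₁ hlearnInv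
  refine Triple.seq (by omega) (Triple.learn hL acc hδ hlearnInv (Y := Y) (by omega)
    (τe := 32 * Ul * P + 24 * Ul * P + 500 * P) (by omega) ?_)
  intro τ₂ hτ₂ b₂ C d q hc₂ h₂ hv8
  refine Triple.seq (by omega) (Triple.choose hL h₂.base h₂.tab h₂.sound (fun hβ v hv =>
    h₂.done hβ v (by omega) hv)
    h₂.cnt (τe := 32 * Ul * P + 24 * Ul * P + 300 * P) (by omega) ?_)
  intro τ₃ hτ₃ b₃ d' hc₃ h₃ hd'
  -- the blocks have length `4 ^ d' = O((m + n) / n)`, and `4 ^ s = O(n)`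
  have hdd : (2 : ℕ) ^ d' * 2 ^ d' = 4 ^ d' := by rw [← mul_pow]; norm_num
  have hdL : 2 ^ d' * 2 ^ s ≤ 4 * Y := by
    refine Nat.mul_self_le_mul_self_iff.mp ?_
    have := h₃.sound.sum_deg_le
    calc _ = 4 ^ d' * 4 ^ s := by rw [← hdd, ← hLL]; ring
      _ ≤ 4 ^ d' * (4 * n) := Nat.mul_le_mul_left _ h4n
      _ = 4 * (4 ^ d' * n) := by ring
      _ ≤ 4 * (4 * (Y * Y)) := Nat.mul_le_mul_left _ (by omega)
      _ = _ := by ring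
  have hd1 : 2 ^ d' * (2 ^ s + 1) ≤ 8 * Y := by
    have : 2 ^ d' * 1 ≤ 2 ^ d' * 2 ^ s := Nat.mul_le_mul_left _ Nat.one_le_two_pow
    rw [mul_add]
    omega
  have hauction : 2 ^ d' * listUnit (125 * s) * (4 * n * (2 ^ s + 1)) ≤ 32 * Ul * P := by
    calc _ = listUnit (125 * s) * (4 * n) * (2 ^ d' * (2 ^ s + 1)) := by ring
      _ ≤ (Ul * s) * (4 * n) * (8 * Y) := by gcongr
      _ = _ := by rw [hP]; ring
  have hbfs : (2 ^ d' * listUnit (125 * s) * (6 * n) + 30) * 2 ^ s ≤ 24 * Ul * P + 30 * P := by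
    calc _ = listUnit (125 * s) * (6 * n) * (2 ^ d' * 2 ^ s) + 30 * 2 ^ s := by ring
      _ ≤ (Ul * s) * (6 * n) * (4 * Y) + 30 * P := by gcongr; omega
      _ = _ := by rw [hP]; ring
  refine Triple.seq (by omega) (Triple.sat hw (by simp only [Exp.cost, Blk.cost]; omega) ?_)
  refine .seq (.asg 13 (.const (x := 0) (by omega)) ?_)
  refine .asg 8 (.const (x := 0) (by omega)) ?_
  set b₄ := (b₃.set 13 0).set 8 0 with hb₄
  have h₄ : NbrLists w s (125 * s) G side β d' C b₄ := h₃.congr ((h₃.tab.set _ _).set _ _) rfl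
    (fun _ => rfl) (fun x
      hx => by rw [hb₄, St.set_v, if_neg (by omega), St.set_v, if_neg (by omega)])
    (by simp [hb₄])
  obtain ⟨ha₄, hcur₄⟩ := auctionInv_init h₄ hn h2n h₂.rows (by simp [hb₄]) (by simp [hb₄])
  refine Triple.seq (by simp only [Exp.cost, Blk.cost]; omega)
    (Triple.auction hL acc.side_eq hδ ha₄ hcur₄
    (τe := 24 * Ul * P + 100 * P) (by simp only [Exp.cost, Blk.cost]; omega) ?_)
  intro τ₅ hτ₅ b₅ C₅ hc₅ h₅ hdef
  refine Triple.seq (by omega) (Triple.sat hw (by simp only [Exp.cost, Blk.cost]; omega) ?_)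
  refine .asg 18 (.const (x := 0) (by omega)) ?_
  have e3 : ∀ x, C₅ 3 x = if x = 0 then 4 ^ s * 4 ^ s else 0 := fun x => by
    rw [h₅.rows _ (by omega) (by omega) (by omega) (by omega), h₂.rows _ (by omega) (by omega)
      (by omega),
      initTable_apply (by omega)]
  have h₆ : RoundInv w s (125 * s) G side β d' 0 (2 ^ s) C₅ (b₅.set 18 0) := by
    refine ⟨h₅.lists.congr (h₅.lists.tab.set _ _) rfl (fun _ => rfl) (fun x hx => by
      rw [St.set_v, if_neg (by omega)]) (by simp), h₅.mate, ?_, fun u => ?_, hdef⟩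
    · rw [e3, if_pos rfl]
      exact (Nat.pow_le_pow_left (by norm_num) s).trans hZ
    · rw [e3, if_neg (by omega)]
  refine Triple.bfsRounds hL acc.side_eq hδ h₆ (by simp) (τe := 0)
    (by simp only [Exp.cost, Blk.cost]; omega) ?_
  intro τ₆ _ b₆ C₆ _ h₆
  exact ⟨C₆, h₆.lists.tab, h₆.mate, h₆.deficiency⟩

end

/-! ### Word length, error probability and running time -/

section
variable {ι : Type} {w n s : ℕ} {O : BlackBox ι w} {G : SimpleGraph (Fin n)}
  {side : G.Coloring Bool} {sd : ι} {eg : List (Instr ι 14)} {eb : Blk ι} {ent : ℕ → ℕ → ℕ}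

lemma two_le_of_one_le_ncard_edgeSet (hm : 1 ≤ G.edgeSet.ncard) : 2 ≤ n := by
  obtain ⟨e, he⟩ := Set.nonempty_of_ncard_ne_zero (show G.edgeSet.ncard ≠ 0 by omega)
  induction e with
  | h v u =>
    have hne : v.val ≠ u.val := fun h => (G.ne_of_adj he) (Fin.ext h)
    omega

/-- The number `s` that the setup computes. -/
def digits (n : ℕ) : ℕ := Nat.clog 4 (n + 1)

lemma pow_le_iff_lt_digits (i : ℕ) : 4 ^ i ≤ n ↔ i < digits n := by
  rw [digits, Nat.lt_clog_iff_pow_lt (by norm_num), Nat.lt_succ_iff]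

lemma four_pow_digits_le (hn : 1 ≤ n) : 4 ^ digits n ≤ 4 * n := by
  have h : 0 < digits n := (pow_le_iff_lt_digits 0).mp (by simpa using hn)
  obtain ⟨i, hi⟩ := Nat.exists_eq_succ_of_ne_zero h.ne'
  have := (pow_le_iff_lt_digits (n := n) i).mpr (by omega)
  rw [hi, pow_succ]
  omega

lemma lt_four_pow_digits : n < 4 ^ digits n := by
  by_contra h
  exact lt_irrefl _ ((pow_le_iff_lt_digits (n := n) _).mp (by omega))

/-- Sixteen times the length of `n` is a sufficient word length. -/
lemma large_digits (hn : 2 ≤ n) : Large (16 * Nat.size n) n (digits n) (125 * digits n) := by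
  set s := digits n with hs
  have h4 : 4 ^ s ≤ 4 * n := four_pow_digits_le (by omega)
  set l := Nat.size n with hl
  have hnl : n < 2 ^ l := Nat.lt_size_self n
  have hl2 : 2 ≤ l := by
    by_contra h
    have : 2 ^ l ≤ 2 ^ 1 := Nat.pow_le_pow_right (by norm_num) (by omega)
    omega
  have h4l : 4 ≤ 2 ^ l := Nat.pow_le_pow_right (n := 2) (by norm_num) hl2
  have hZ : 4 ^ s ≤ 2 ^ (2 * l) := by
    rw [two_mul, pow_add]
    exact h4.trans (Nat.mul_le_mul h4l hnl.le)
  have h64 : 2 ^ 6 ≤ 2 ^ (3 * l) := Nat.pow_le_pow_right (by norm_num) (by omega)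
  have hmem : 64 * (4 ^ s * 4 ^ s) ≤ 2 ^ (3 * l + (2 * l + 2 * l)) := by
    rw [pow_add, pow_add]
    gcongr
    exact h64
  have hmem' : 64 * (4 ^ s * 4 ^ s) ≤ 2 ^ (16 * l) :=
    hmem.trans (Nat.pow_le_pow_right (by norm_num) (by omega))
  have hsZ : s < 4 ^ s := Nat.lt_pow_self (by norm_num)
  have h4s : 4 ≤ 4 ^ s := by
    have : 4 ^ 1 ≤ 4 ^ s := Nat.pow_le_pow_right (by norm_num) (by
      have := (pow_le_iff_lt_digits (n := n) 0).mp (by omega); omega)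
    omega
  refine ⟨hn, lt_four_pow_digits, h4, hmem', ?_, ?_, by omega⟩
  · have : 4 * 4 ^ s ≤ 4 ^ s * 4 ^ s := Nat.mul_le_mul_right _ h4s
    omega
  · have h1 : 2 ^ (2 * s) ≤ 2 ^ (2 * l) := by rw [pow_mul]; exact hZ
    have := (Nat.pow_le_pow_iff_right (a := 2) (by norm_num)).mp h1
    omega

/-- The total error probability of the quantum searches.  The number `125 * s` of repetitions makes
the error of a single search at most `(4 ^ s) ^ (-25)`, a large power of `1 / n`, because
`(3 / 4) ^ 125 ≤ (1 / 4) ^ 25`. -/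
lemma error_le {K Y : ℕ} (hn : 2 ≤ n) (hK : K ≤ 4 ^ 20) (hY : Y ≤ 4 * n) :
    (3 / 4 : ℝ) ^ (125 * digits n) * (K * (digits n * (n * Y)) : ℕ) ≤ 1 / n := by
  set s := digits n with hs
  have hs1 : 1 ≤ s := by have := (pow_le_iff_lt_digits (n := n) 0).mp (by omega); omega
  have hnZ : n ≤ 4 ^ s := lt_four_pow_digits.le
  have h4s : 4 ≤ 4 ^ s := Nat.pow_le_pow_right (n := 4) (i := 1) (by norm_num) hs1
  have hsZ : s ≤ 4 ^ s := (Nat.lt_pow_self (by norm_num)).le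
  have hYZ : Y ≤ 4 ^ s * 4 ^ s := hY.trans (Nat.mul_le_mul h4s hnZ)
  have hKZ : K ≤ (4 ^ s) ^ 20 := hK.trans (Nat.pow_le_pow_left h4s 20)
  have hnat : K * (s * (n * Y)) * n ≤ (4 ^ s) ^ 25 := by
    calc _ ≤ (4 ^ s) ^ 20 * (4 ^ s * (4 ^ s * (4 ^ s * 4 ^ s))) * 4 ^ s := by gcongr
      _ = _ := by ring
  have h34 : (3 / 4 : ℝ) ^ 125 ≤ (1 / 4) ^ 25 := by norm_num
  have hpow : (3 / 4 : ℝ) ^ (125 * s) ≤ 1 / (4 ^ s) ^ 25 := by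
    calc (3 / 4 : ℝ) ^ (125 * s) = ((3 / 4) ^ 125) ^ s := pow_mul _ _ _
      _ ≤ ((1 / 4) ^ 25) ^ s := pow_le_pow_left₀ (by positivity) h34 s
      _ = 1 / (4 ^ s) ^ 25 := by rw [← pow_mul, ← pow_mul, one_div_pow, mul_comm]
  have hn0 : (0 : ℝ) < n := by positivity
  rw [le_div_iff₀ hn0]
  have hnat' : ((K * (s * (n * Y)) : ℕ) : ℝ) * n ≤ (4 ^ s) ^ 25 := by exact_mod_cast hnat
  calc _ = (3 / 4 : ℝ) ^ (125 * s) * (((K * (s * (n * Y)) : ℕ) : ℝ) * n) := by ring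
    _ ≤ 1 / (4 ^ s) ^ 25 * (4 ^ s) ^ 25 := by gcongr
    _ = 1 := by rw [one_div, inv_mul_cancel₀ (by positivity)]

/-- The algorithm works in each model in which it has access to neighbor lists.  Halting with
certainty and the success probability come from two instances of the same triple. -/
lemma solvesInTime_maxMatching (hw : w = 16 * Nat.size n) (acc : Access O G side sd eg eb ent)
    (hm : 1 ≤ G.edgeSet.ncard) {Y : ℕ} (hY : G.edgeSet.ncard + n ≤ Y * Y) (hYn : Y ≤ 4 * n)
    (hK : timeFactor eg eb ≤ 4 ^ 20) {T : ℕ}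
    (hT : timeFactor eg eb * (digits n * (n * Y)) ≤ T) :
    SolvesInTime (maxMatching sd eg eb) O n T (1 - 1 / (n : ℝ)) (HoldsMaximumMatching G) := by
  have hn := two_le_of_one_le_ncard_edgeSet hm
  have hL : Large w n (digits n) (125 * digits n) := by rw [hw]; exact large_digits hn
  have hn4 := hL.lt
  have hZZ := hL.mem
  have hZ : 4 ^ digits n ≤ 4 ^ digits n * 4 ^ digits n := Nat.le_mul_of_pos_left _ (by positivity)
  have hnw : n < 2 ^ w := by omega
  let a : St := ⟨fun x => if x = 0 then n else 0, fun _ => 0⟩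
  have hrel : Rel a ⟨Function.update 0 0 (BitVec.ofNat w n), 0⟩ := by
    refine ⟨fun x _ => ?_, fun b => rfl⟩
    by_cases hx : x = 0
    · subst hx
      simp [a, Nat.mod_eq_of_lt hnw]
    · simp [a, hx]
  have key := fun (β : Prop) (δ : NNReal) (hδ : β → (3 / 4) ^ (125 * digits n) ≤ (δ : ℝ)) =>
    Triple.maxMatching (β := β) (a := a) hL pow_le_iff_lt_digits acc hδ (by simp [a])
      (fun x hx => by simp [a, hx]) rfl hY _ hrel []
  -- the run has ended when no program is left, so the triples bound the halting probability
  have hnil : ∀ (S : CState w → Prop) (τ' : ℕ) (s : CState w), S s →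
      clHaltProb (k := 14) O S τ' [] s = 1 := fun S τ' s hS => by
    rw [clHaltProb, Conf.haltProb_nil, if_pos hS, QState.normSq_zero]
  refine ⟨le_antisymm ((Conf.haltProb_le_normSq O _ _ _ _ _).trans_eq QState.normSq_zero) ?_, ?_⟩
  · refine le_trans ?_ (Conf.haltProb_mono O _ _ hT)
    have := key False 0 (fun h => h.elim) (fun _ => True) 1 le_rfl (fun τ' _ b s' _ _ => by
      rw [hnil _ _ _ trivial]; simp)
    rw [NNReal.coe_zero, zero_mul, sub_zero] at this
    exact this
  · refine le_trans ?_ (Conf.haltProb_mono O _ _ hT)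
    have := key True ((3 / 4) ^ (125 * digits n)) (fun _ => by simp) (HoldsMaximumMatching G)
      1 le_rfl ?_
    · refine le_trans ?_ this
      have := error_le hn hK hYn
      push_cast at this ⊢
      linarith
    · rintro τ' _ b s' ⟨C, hT, hmate, hdef⟩ hr
      rw [hnil]
      · exact sub_le_self _ (by positivity)
      · refine holdsMaximumMatching_of_isMate (mate := C 0) (fun v => ?_) hmate (hdef trivial)
        have hv := v.2
        have := flat_read C 0 (show v.val < 4 ^ digits n by omega)
        rw [zero_mul, zero_add] at this
        rw [hr.2, BitVec.toNat_ofNat, Nat.mod_eq_of_lt (by omega), hT.mem, this]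

lemma digits_le_log (hn : 2 ≤ n) : (digits n : ℝ) ≤ 3 * Real.log n := by
  have h4 := four_pow_digits_le (n := n) (by omega)
  have hn2 : (2 : ℝ) ≤ n := by exact_mod_cast hn
  have h : (4 : ℝ) ^ digits n ≤ (n : ℝ) ^ 3 := by
    have h1 : (4 : ℝ) ^ digits n ≤ 4 * n := by exact_mod_cast h4
    nlinarith [mul_nonneg (sub_nonneg.mpr hn2) (show (0 : ℝ) ≤ n * (n + 2) by positivity)]
  have h2 := Real.log_le_log (by positivity) h
  rw [Real.log_pow, Real.log_pow] at h2
  have h3 : (1 : ℝ) ≤ Real.log 4 := by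
    rw [Real.le_log_iff_exp_le (by norm_num)]
    exact Real.exp_one_lt_d9.le.trans (by norm_num)
  have h4 : (digits n : ℝ) * 1 ≤ digits n * Real.log 4 := by gcongr
  push_cast at h2
  linarith

lemma ncard_edgeSet_add_le (G : SimpleGraph (Fin n)) (hn : 2 ≤ n) :
    G.edgeSet.ncard + n ≤ (2 * n) * (2 * n) := by
  have h : G.edgeSet.ncard ≤ (n + 1).choose 2 := by
    have := Set.ncard_le_card (s := G.edgeSet)
    rwa [Nat.card_eq_fintype_card, Sym2.card, Fintype.card_fin] at this
  have h2 : (n + 1).choose 2 ≤ (n + 1) * n := by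
    rw [Nat.choose_two_right]
    exact Nat.div_le_self _ _
  nlinarith

end

theorem mainTheorem2 :
    (∃ (k : ℕ) (P : Prog AdjQuestion k) (κ : ℕ) (C : ℝ),
      ∀ (n : ℕ) (G : SimpleGraph (Fin n)) (side : G.Coloring Bool), 1 ≤ G.edgeSet.ncard →
        SolvesInTime P (adjBlackBox (κ * Nat.size n) G side) n
          ⌊C * ((n : ℝ) ^ 2 * Real.log n)⌋₊ (1 - 1 / (n : ℝ)) (HoldsMaximumMatching G)) ∧
    (∃ (k : ℕ) (P : Prog ListQuestion k) (κ : ℕ) (C : ℝ),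
      ∀ (n : ℕ) (G : SimpleGraph (Fin n)) (side : G.Coloring Bool) (N : NeighborLists G),
        1 ≤ G.edgeSet.ncard →
          SolvesInTime P (listBlackBox (κ * Nat.size n) G side N) n
            ⌊C * ((n : ℝ) * Real.sqrt ((G.edgeSet.ncard : ℝ) + n) * Real.log n)⌋₊
            (1 - 1 / (n : ℝ)) (HoldsMaximumMatching G)) := by
  constructor
  · refine ⟨14, maxMatching .side adjEntryGates adjEntryBlk, 16,
      6 * timeFactor adjEntryGates adjEntryBlk, ?_⟩
    intro n G side hm
    have hn := two_le_of_one_le_ncard_edgeSet hm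
    have hL := large_digits hn
    have hn4 := hL.lt
    have hZZ := hL.mem
    have hZ : 4 ^ digits n ≤ 4 ^ digits n * 4 ^ digits n := Nat.le_mul_of_pos_left _ (by positivity)
    refine solvesInTime_maxMatching rfl (adjAccess hL.pos (by omega) G side) hm
      (ncard_edgeSet_add_le G hn) (by omega)
      (by simp [timeFactor, adjEntryGates, adjEntryBlk, listBlk, Blk.cost, Exp.cost])
        (Nat.le_floor ?_)
    have := digits_le_log hn
    push_cast
    calc _ = timeFactor adjEntryGates adjEntryBlk * (n * (2 * n)) * (digits n : ℝ) := by ring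
      _ ≤ timeFactor adjEntryGates adjEntryBlk * (n * (2 * n)) * (3 * Real.log n) := by gcongr
      _ = _ := by ring
  · refine ⟨14, maxMatching .side listEntryGates listEntryBlk, 16,
      6 * timeFactor listEntryGates listEntryBlk, ?_⟩
    intro n G side N hm
    have hn := two_le_of_one_le_ncard_edgeSet hm
    have hL := large_digits hn
    have hn4 := hL.lt
    have hZZ := hL.mem
    have hZ : 4 ^ digits n ≤ 4 ^ digits n * 4 ^ digits n := Nat.le_mul_of_pos_left _ (by positivity)
    have hmn := ncard_edgeSet_add_le G hn
    have hsq := (Nat.sqrt_le_sqrt hmn).trans_eq (Nat.sqrt_eq (2 * n))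
    refine solvesInTime_maxMatching rfl (listAccess hL.pos (by omega) G side N) hm
      (Nat.lt_succ_sqrt _).le (by omega)
      (by simp [timeFactor, listEntryGates, listEntryBlk, listBlk, Blk.cost, Exp.cost])
        (Nat.le_floor ?_)
    have := digits_le_log hn
    have hY : (((G.edgeSet.ncard + n).sqrt + 1 : ℕ) : ℝ) ≤ 2 * Real.sqrt
      ((G.edgeSet.ncard : ℝ) + n) := by
      have h1 : (((G.edgeSet.ncard + n).sqrt : ℕ) : ℝ) ≤ Real.sqrt ((G.edgeSet.ncard : ℝ) + n) := by
        exact_mod_cast Real.nat_sqrt_le_real_sqrt (a := G.edgeSet.ncard + n)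
      have h2 : (1 : ℝ) ≤ Real.sqrt ((G.edgeSet.ncard : ℝ) + n) := by
        rw [Real.one_le_sqrt]
        exact_mod_cast (by omega : 1 ≤ G.edgeSet.ncard + n)
      push_cast
      linarith
    rw [Nat.cast_mul, Nat.cast_mul, Nat.cast_mul]
    calc _ ≤ (timeFactor listEntryGates listEntryBlk : ℝ) * (3 * Real.log n *
          (n * (2 * Real.sqrt ((G.edgeSet.ncard : ℝ) + n)))) := by gcongr
      _ = _ := by ring
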